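/- Let $n\ge 0$ and let $S$ be an oriented $(n+3)$-gon with set of chords $\chi_S$. Let $\mathcal M_{0,S}$ be the moduli space of genus $0$ curves with points $z_e$ marked by the edges $e$ of $S$, with dihedral coordinates $u_c$, $c\in\chi_S$ (the chord $c=\{i,j\}$ gives $u_c=\frac{(z_{i^-}-z_{j^+})(z_{i^+}-z_{j^-})}{(z_{i^-}-z_{j^-})(z_{i^+}-z_{j^+})}$, where $i^-,i^+$ are the edges of $S$ ending and starting at the vertex $i$, and likewise $j^\pm$). Let $X=\{0<t_1<\dots<t_n<1\}$ be the cell $\{u_c>0\ \forall c\}$ of $\mathcal M_{0,S}(\mathbb R)$ in simplicial coordinates. For a set $J$ of non-crossing chords, which cuts $S$ into polygons $S_0,\dots,S_k$, put $X_J=\prod_i X_{S_i}$, the open cell of the stratum $D_J=\bigcap_{c\in J}\{u_c=0\}\cong\prod_i\mathcal M^{\delta_i}_{0,S_i}$; let $\chi_J=\bigsqcup_i\chi_{S_i}$ be the set of chords not in $J$ which cross no element of $J$, and $s_J=\prod_{c\in J}s_c$. For a set $K\subset\chi_J$ of non-crossing chords let $f_K:X_J\to(0,1)^K\times X_{J\cup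 K}$ be the following trivialisation map. Its component in $X_P$, for a polygon $P$ cut out by $J\cup K$ inside the polygon $S_i$, is the forgetful map for the edges of $S_i$ which start at the vertices of $P$ (the edge of $P$ starting at $v$ being identified with the edge of $S_i$ starting at $v$). Its component for $c\in K$ is the forgetful map, defined in the same way, to the polygon cut out by $J\cup K\setminus\{c\}$ which contains $c$, followed by the dihedral coordinate $u_c$ of that polygon. In particular $f_{\{c\}}$ has first component $u_c$. Formal integrands on $X_J$ are linear combinations of $\prod_{c}u_c^{m_c}\,\omega$, with $\omega$ a logarithmic top-degree form and $m_c$ in the free commutative monoid on the symbols $s_c$. The map $f_K^*$ pulls back forms after multiplication with $\bigwedge_{c\in K}d\log u_c$, and symbols by expressing the pull-back of a dihedral coordinate as a product of dihedral coordinates. For $c\in\chi_J$ the map $R_c$ sends $\prod_d u_d^{m_d}\,\omega$ to $\prod_d u_d^{m_d}|_{u_d=1\text{ if }d\text{ crosses }c}\;d\log u_c\otimes\mathrm{Res}_{D_c}\omega$, and $R_K$ is the composite of the $R_c$, $c\in K$. Put $$\Omega^{\mathrm{ren}}=\sum_{K}(-1)^{|K|}f_K^*R_K\Omega ,$$ the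 sum being over all sets $K\subset\chi_J$ of non-crossing chords. The $X_J$ are oriented so that all maps $f_K$ are orientation preserving. Let $\omega$ be a top-degree element of the $\mathbb Q$-algebra generated by the forms $d\log u_c$, and set $$I(s)=\int_X\Big(\prod_{c\in\chi_S}u_c^{s_c}\Big)\omega,\qquad \Omega_J=\Big(\prod_{c\in\chi_J}u_c^{s_c}\Big)\mathrm{Res}_{D_J}\omega .$$ Let $C$ be the set of all $s\in\mathbb C^{\chi_S}$ with $\mathrm{Re}\,s_c>0$ if $\mathrm{Res}_{D_c}\omega\ne0$ and $\mathrm{Re}\,s_c>-1$ if $\mathrm{Res}_{D_c}\omega=0$. Then: 1. For all $s\in C$ the integrals $I(s)$ and $\int_{X_J}\Omega_J^{\mathrm{ren}}$ converge absolutely, and $$I(s)=\sum_J\frac1{s_J}\int_{X_J}\Omega_J^{\mathrm{ren}},$$ the sum being over all sets $J\subset\chi_S$ of non-crossing chords, including $\emptyset$. The term for $J$ is zero if $\mathrm{Res}_{D_c}\omega=0$ for some $c\in J$ (also when some such $s_c$ is $0$). 2. There is $\varepsilon>0$ such that all integrals $\int_{X_J}\Omega_J^{\mathrm{ren}}$ converge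 absolutely, and are holomorphic functions of $s$, for $\mathrm{Re}\,s_c>-\varepsilon$ ($c\in\chi_S$). 3. $I$ has a unique Laurent expansion $\sum_k L_k\prod_c s_c^{k_c}$, $k\in\mathbb Z^{\chi_S}$, converging absolutely to $I(s)$ for $s\in C$ near $0$, with at most simple poles: if $L_k\neq0$, then all $k_c\ge-1$, and the set of all $c$ with $k_c=-1$ is non-crossing and consists of chords with $\mathrm{Res}_{D_c}\omega\ne0$. 4. With $\varepsilon$ as in 2, let $c\in\chi_S$ and fix $s_d$ for $d\ne c$, with $\mathrm{Re}\,s_d>-\varepsilon$, and $\mathrm{Re}\,s_d>0$ if $\mathrm{Res}_{D_d}\omega\neq0$. Then $\int_{X_{\{c\}}}\Omega_c$ converges absolutely, and $I(s)-\frac1{s_c}\int_{X_{\{c\}}}\Omega_c$, for $\mathrm{Re}\,s_c>0$ small, extends to a holomorphic function of $s_c$ near $0$; that is, the residue of $I$ at $s_c=0$ is $\int_{X_{\{c\}}}\Omega_c$, an integral over the cell $X_{\{c\}}$ of the boundary divisor $D_c$. -/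

import Mathlib

open MeasureTheory Filter Topology

noncomputable section

namespace OpenString

/-! ### Combinatorics of the polygon

The vertices of the oriented `(n+3)`-gon are `0, 1, …, n+2` in cyclic order.  A (sub)polygon is given
by its set `P` of vertices; every vertex `v` of `P` also labels the edge of `P` which starts at `v`
(it ends at the next element of `P` in the cyclic order), hence also the marked point attached to
that edge. -/

/-- Vertices of the polygon `S` (and labels of its edges, i.e. of the marked points). -/
abbrev Vert (n : ℕ) : Type := Fin (n + 3)

/-- Chords of `S`: pairs of non-adjacent vertices, written in increasing order. -/
abbrev Chord (n : ℕ) : Type :=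
  {p : Vert n × Vert n // p.1.val + 2 ≤ p.2.val ∧ ¬ (p.1.val = 0 ∧ p.2.val = n + 2)}

variable {n : ℕ}

/-- The two endpoints of a chord. -/
def ends (c : Chord n) : Finset (Vert n) := {c.1.1, c.1.2}

/-- Two chords cross if their endpoints are strictly interlaced. -/
abbrev Crosses (c d : Chord n) : Prop :=
  (c.1.1 < d.1.1 ∧ d.1.1 < c.1.2 ∧ c.1.2 < d.1.2) ∨
  (d.1.1 < c.1.1 ∧ c.1.1 < d.1.2 ∧ d.1.2 < c.1.2)

/-- Sets of non-crossing chords. -/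
abbrev NonCrossing (J : Finset (Chord n)) : Prop := ∀ c ∈ J, ∀ d ∈ J, ¬ Crosses c d

/-- The finite set of all sets `J` of non-crossing chords of `S` (the empty set included). -/
def dissections (n : ℕ) : Finset (Finset (Chord n)) := Finset.univ.filter fun J => NonCrossing J

/-- Cutting the polygon `P` along `c`: two polygons if both ends of `c` are vertices of `P`;
otherwise `P` is left as it is. -/
def cut (c : Chord n) (P : Finset (Vert n)) : Finset (Finset (Vert n)) :=
  if ends c ⊆ P then
    {P.filter fun v => c.1.1 ≤ v ∧ v ≤ c.1.2, P.filter fun v => v ≤ c.1.1 ∨ c.1.2 ≤ v}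
  else {P}

/-- The polygons obtained by cutting `S` along the chords of the list `l`. -/
def cells : List (Chord n) → Finset (Finset (Vert n))
  | [] => {Finset.univ}
  | c :: l => (cells l).biUnion (cut c)

/-- The cell, among the polygons cut out by `l`, which contains the set of vertices `A`.  It is used
only when there is exactly one, i.e. when `A` is the set of ends of a chord of one of these polygons,
or is itself (the vertex set of) a polygon obtained by cutting one of them further. -/
def cellOf (l : List (Chord n)) (A : Finset (Vert n)) : Finset (Vert n) :=
  ((cells l).filter fun Q => A ⊆ Q).sup id

/-- `χ_J`: the chords which are not in `J` and do not cross any chord of `J`; these are the chords of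
the polygons cut out by `J`. -/
def chi (l : List (Chord n)) : Finset (Chord n) :=
  Finset.univ.filter fun d => d ∉ l ∧ ∀ c ∈ l, ¬ Crosses c d

/-- First vertex, last vertex, and cyclic predecessor of `v`, in the polygon `P`. -/
def lo (P : Finset (Vert n)) : Vert n := P.inf id

def hi (P : Finset (Vert n)) : Vert n := P.sup id

def pred (P : Finset (Vert n)) (v : Vert n) : Vert n :=
  if (P.filter fun w => w < v).Nonempty then (P.filter fun w => w < v).sup id else hi P

/-! ### Moduli spaces, simplicial coordinates and dihedral coordinates

Points of the projective line are given by homogeneous coordinates.  In the polygon `P` with vertices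
`p_0 < p_1 < ⋯ < p_m` the marked points `p_0, p_{m-1}, p_m` are placed at `0, 1, ∞`, and the remaining
ones are the simplicial coordinates. -/

/-- `x₁ y₂ - y₁ x₂`; equal to the difference `x - y` for two points of the affine line. -/
def bracket (x y : ℝ × ℝ) : ℝ := x.1 * y.2 - y.1 * x.2

/-- The dihedral coordinate `u_c`, for a chord `c = {i, j}` of the polygon `P`, of a configuration
`z` of points labelled by the edges of `P`: the cross-ratio of the four edges of `P` which meet the
ends of `c`. -/
def crossRatio (P : Finset (Vert n)) (z : Vert n → ℝ × ℝ) (c : Chord n) : ℝ :=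
  (bracket (z (pred P c.1.1)) (z c.1.2) * bracket (z c.1.1) (z (pred P c.1.2))) /
    (bracket (z (pred P c.1.1)) (z (pred P c.1.2)) * bracket (z c.1.1) (z c.1.2))

/-- The simplicial coordinate of the point labelled `v` of a configuration `z` of points labelled by
the edges of `P`. -/
def simplicial (P : Finset (Vert n)) (z : Vert n → ℝ × ℝ) (v : Vert n) : ℝ :=
  (bracket (z v) (z (lo P)) * bracket (z (pred P (hi P))) (z (hi P))) /
    (bracket (z v) (z (hi P)) * bracket (z (pred P (hi P))) (z (lo P)))

/-- The simplicial coordinates on `M_{0,S/J} = ∏ M_{0,S_i}`: the pairs consisting of a cell and of one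
of its marked points, other than the three which are fixed. -/
abbrev Coord (l : List (Chord n)) : Type :=
  {q : Finset (Vert n) × Vert n // q.1 ∈ cells l ∧ q.2 ∈ q.1 ∧
    q.2 ≠ lo q.1 ∧ q.2 ≠ hi q.1 ∧ q.2 ≠ pred q.1 (hi q.1)}

/-- Coordinate space of `M_{0,S/J}(ℝ)`. -/
abbrev Space (l : List (Chord n)) : Type := Coord l → ℝ

/-- The configuration of points, labelled by the edges of the cell `P`, with coordinates `t`. -/
def config (l : List (Chord n)) (t : Space l) (P : Finset (Vert n)) (v : Vert n) : ℝ × ℝ :=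
  if v = hi P then (1, 0)
  else if v = lo P then (0, 1)
  else if v = pred P (hi P) then (1, 1)
  else if h : P ∈ cells l ∧ v ∈ P ∧ v ≠ lo P ∧ v ≠ hi P ∧ v ≠ pred P (hi P) then (t ⟨(P, v), h⟩, 1)
  else (0, 1)

/-- The domain `X_J = ∏ X^{δ_i}`, a product of open simplices `0 < t_1 < ⋯ < t_m < 1`. -/
def X (l : List (Chord n)) : Set (Space l) :=
  {t | (∀ q, 0 < t q ∧ t q < 1) ∧
    ∀ q q' : Coord l, q.1.1 = q'.1.1 → q.1.2 < q'.1.2 → t q < t q'}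

/-- The dihedral coordinate `u_c` on `M_{0,S/J}`, for a chord `c ∈ χ_J`. -/
def u (l : List (Chord n)) (c : Chord n) (t : Space l) : ℝ :=
  crossRatio (cellOf l (ends c)) (config l t (cellOf l (ends c))) c

/-! ### Trivialisation maps

Let `K` be a set of non-crossing chords of the polygons cut out by `J`.  The trivialisation map
`f_K : X_J → (0,1)^K × X_{J ∪ K}` is defined as follows.  The edges of a polygon `P`, which is cut out
of a cell `Q` of `J` by `K`, are identified with edges of `Q`: an edge of `Q` with itself, and a chord
in `K` with the next edge of `Q` in the cyclic order.  In terms of initial vertices of edges this is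
the inclusion `P ⊆ Q`: the edge of `P` starting at `v` corresponds to the edge of `Q` starting at `v`.
The component `X_J → X_P` of `f_K` forgets the marked points which are not labelled by `P`.  For
`c ∈ K` the component of `f_K` in `(0,1)` is obtained by cutting along `c` last: it is the composite of
the forgetful map to the polygon `P` which is cut out by `K \ {c}` and contains `c`, and of the
dihedral coordinate `u_c` of `P`.  For `K = {c}` it is `u_c` itself. -/

/-- The components `X_J → X_P` of `f_K`. -/
def forget (l K : List (Chord n)) (t : Space l) : Space (K ++ l) :=
  fun q => simplicial q.1.1 (config l t (cellOf l q.1.1)) q.1.2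

/-- The component of `f_K` indexed by `c ∈ K`. -/
def normalCoord (l K : List (Chord n)) (c : Chord n) (t : Space l) : ℝ :=
  crossRatio (cellOf (K.erase c ++ l) (ends c)) (config l t (cellOf l (ends c))) c

/-- The trivialisation map `f_K` in coordinates. -/
def triv (l K : List (Chord n)) (t : Space l) : {c // c ∈ K} ⊕ Coord (K ++ l) → ℝ
  | Sum.inl c => normalCoord l K c t
  | Sum.inr q => forget l K t q

/-- Partial derivatives. -/
def partialD {ι : Type} [Fintype ι] [DecidableEq ι] (f : (ι → ℝ) → ℝ) (j : ι) (t : ι → ℝ) : ℝ :=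
  fderiv ℝ f t (Pi.single j 1)

open Classical in
/-- Absolute value of the Jacobian determinant of `f_K`.  (Source and target have the same dimension;
the absolute value does not depend on the bijection of the coordinates which is used.) -/
def jac (l K : List (Chord n)) (t : Space l) : ℝ :=
  if h : Fintype.card (Coord l) = Fintype.card ({c // c ∈ K} ⊕ Coord (K ++ l)) then
    |(Matrix.of fun i j : Coord l =>
      partialD (fun t' => triv l K t' (Fintype.equivOfCardEq h i)) j t).det|
  else 0

/-! ### Logarithmic forms and residues

`X_J` is oriented in such a way that all trivialisation maps `X_J → (0,1)^K × X_{J ∪ K}` are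
orientation preserving (an order on `K` entering in the same way in forms on `(0,1)^K`, in iterated
residues along `K`, and in the orientation), where `X = X_∅` carries the orientation `dt_1 ∧ ⋯ ∧ dt_n`.  A top-degree form
on `X_J` is represented by its coefficient with respect to the positive unit volume form of the
coordinates, so that its integral over the oriented manifold `X_J` is the Lebesgue integral of this
coefficient. -/

/-- Top-degree differential forms on `X_J`. -/
abbrev Form (l : List (Chord n)) : Type := Space l → ℝ

/-- `d log u_{a_1} ∧ ⋯ ∧ d log u_{a_n}`, a top-degree form on `M_{0,S}`. -/
def dlogWedge (a : Coord ([] : List (Chord n)) → Chord n) : Form ([] : List (Chord n)) :=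
  fun t => (Matrix.of fun i j => partialD (u [] (a i)) j t / u [] (a i) t).det

/-- `Ω_S^{|S|-3}`: the top-degree part of the `ℚ`-algebra generated by the `d log u_c`. -/
def logForms (n : ℕ) : Submodule ℚ (Form ([] : List (Chord n))) :=
  Submodule.span ℚ (Set.range dlogWedge)

/-- The residue along `D_c ≅ M_{0,S/(J ∪ {c})}` of a form `ω` on `M_{0,S/J}`: writing
`ω = h(x, y) dx ∧ dy` in the coordinates `(x, y)` given by `f_{c}`, where `x = u_c`, it is the form with
coefficient `lim_{x → 0} x h(x, y)`. -/
def res (l : List (Chord n)) (c : Chord n) (ω : Form l) : Form (c :: l) := fun y =>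
  limUnder (comap (fun t => (u l c t, forget l [c] t)) (𝓝[>] (0 : ℝ) ×ˢ pure y) ⊓ 𝓟 (X l))
    fun t => u l c t * (ω t / jac l [c] t)

/-- The iterated residue `Res_{D_J}`. -/
def resIter : (l : List (Chord n)) → Form ([] : List (Chord n)) → Form l
  | [], ω => ω
  | c :: l, ω => res l c (resIter l ω)

/-- The pull-back of `⋀_{c ∈ K} (dx_c / x_c) ∧ η` by `f_K`. -/
def pull (l K : List (Chord n)) (η : Form (K ++ l)) : Form l := fun t =>
  η (forget l K t) * jac l K t / (K.map fun c => normalCoord l K c t).prod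

/-- `Res_{D_c} ω ≠ 0`. -/
def HasPole (ω : Form ([] : List (Chord n))) (c : Chord n) : Prop :=
  ∃ y ∈ X [c], res [] c ω y ≠ 0

/-! ### Formal integrands

`Mon n` is the free commutative monoid on the symbols `s_c`.  A family `m` of exponents stands for the
formal symbol `∏_c u_c^{m_c}`.  An element of `Integrand l` is a finite sum of terms
`(∏_c u_c^{m_c}) (⋀_{c ∈ J} d log u_c) ⊗ ω`, with `ω` a form on `M_{0,S/J}`, and `c` running through
`J ∪ χ_J`; this is `A_J(M) ⊗ A_{S/J}(M)`.  The elements in which no `u_c` with `c ∈ J` occurs are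
identified with those of `A_{S/J}(M)`, by leaving out the `d log u_c`. -/

abbrev Mon (n : ℕ) : Type := Chord n → ℕ

abbrev Expo (n : ℕ) : Type := Chord n → Mon n

abbrev Integrand (l : List (Chord n)) : Type := Expo n →₀ Form l

/-- The evaluation map: `u_d ↦ 1` for `d` crossing `c`. -/
def evExpo (c : Chord n) (m : Expo n) : Expo n := fun d => if Crosses c d then 0 else m d

/-- `R_c : A_{S/J}(M) → A_c(M) ⊗ A_{S/(J ∪ {c})}(M)`. -/
def R (l : List (Chord n)) (c : Chord n) (Ω : Integrand l) : Integrand (c :: l) :=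
  Ω.sum fun m ω => Finsupp.single (evExpo c m) (res l c ω)

/-- Edges (labels) on one side of a chord. -/
def side (d : Chord n) : Finset (Vert n) := Finset.univ.filter fun v => d.1.1 ≤ v ∧ v < d.1.2

/-- The chord `d` becomes the chord `e` of `P` when all edges not labelled by `P` are contracted:
they induce the same partition of the edges of `P`. -/
abbrev ContractsTo (P : Finset (Vert n)) (d e : Chord n) : Prop :=
  ends e ⊆ P ∧ (P ∩ side d = P ∩ side e ∨ P ∩ side d = P \ side e)

/-- Exponents of the pull-back of a formal symbol by `f_K`: under each component `u_e` is mapped to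
`∏ u_d` over the preimages `d` of `e` by contraction. -/
def pullExpo (l K : List (Chord n)) (m : Expo n) : Expo n := fun d =>
  if d ∈ l then m d
  else if d ∈ chi l then
    (∑ c ∈ K.toFinset.filter fun c =>
        cellOf (K.erase c ++ l) (ends c) ⊆ cellOf l (ends d) ∧
          ContractsTo (cellOf (K.erase c ++ l) (ends c)) d c, m c) +
      ∑ P ∈ (cells (K ++ l)).filter fun P => P ⊆ cellOf l (ends d),
        ∑ e ∈ (chi (K ++ l)).filter fun e => ContractsTo P d e, m e
  else 0

/-- `f_K^* : A_K(M) ⊗ A_{S/(J ∪ K)}(M) → A_{S/J}(M)`. -/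
def fStar (l K : List (Chord n)) (Ω : Integrand (K ++ l)) : Integrand l :=
  Ω.sum fun m ω => Finsupp.single (pullExpo l K m) (pull l K ω)

/-- `R_K`, the composite of the `R_c`, `c ∈ K`. -/
def RIter (l : List (Chord n)) : (K : List (Chord n)) → Integrand l → Integrand (K ++ l)
  | [], Ω => Ω
  | c :: K, Ω => R (K ++ l) c (RIter l K Ω)

/-- The renormalisation map `Ω ↦ Ω^ren = ∑_K (-1)^{|K|} f_K^* R_K Ω` on `A_{S/J}(M)`; `K` ranges over
the sets of non-crossing chords of the polygons cut out by `J`.  (Nothing depends on the order in which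
the elements of `J` and `K` are listed.) -/
def ren (l : List (Chord n)) (Ω : Integrand l) : Integrand l :=
  ∑ K ∈ (chi l).powerset.filter fun K => NonCrossing K,
    (-1 : ℤ) ^ K.card • fStar l K.toList (RIter l K.toList Ω)

/-- The realisation of the elements of `A_{S/J}(M)` as forms on `X_J`, for `s_c ∈ ℂ`. -/
def realise (l : List (Chord n)) (s : Chord n → ℂ) (Ω : Integrand l) (t : Space l) : ℂ :=
  Ω.sum fun m ω => (∏ c ∈ chi l, ((u l c t : ℝ) : ℂ) ^ (∑ e, (m c e : ℂ) * s e)) * ((ω t : ℝ) : ℂ)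

/-- `Ω_J = (∏_{c ∈ χ_J} u_c^{s_c}) Res_{D_J} ω`. -/
def OmegaJ (l : List (Chord n)) (ω : Form ([] : List (Chord n))) : Integrand l :=
  Finsupp.single (fun c => if c ∈ chi l then Pi.single c 1 else 0) (resIter l ω)

/-! ### Amplitudes -/

/-- The integrand `(∏_c u_c^{s_c}) ω` of the open string amplitude. -/
def openIntegrand (ω : Form ([] : List (Chord n))) (s : Chord n → ℂ)
    (t : Space ([] : List (Chord n))) : ℂ :=
  (∏ c, ((u [] c t : ℝ) : ℂ) ^ s c) * ((ω t : ℝ) : ℂ)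

/-- The open string amplitude. -/
def openAmplitude (ω : Form ([] : List (Chord n))) (s : Chord n → ℂ) : ℂ :=
  ∫ t in X [], openIntegrand ω s t

/-- The realisation of `Ω_J^ren` on `X_J`. -/
def renIntegrand (ω : Form ([] : List (Chord n))) (J : Finset (Chord n))
    (s : Chord n → ℂ) : Space (J.toList) → ℂ :=
  realise J.toList s (ren J.toList (OmegaJ J.toList ω))

/-- `∫_{X_J} Ω_J^ren`. -/
def renIntegral (ω : Form ([] : List (Chord n))) (J : Finset (Chord n))
    (s : Chord n → ℂ) : ℂ :=
  ∫ t in X (J.toList), renIntegrand ω J s t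

/-- `Ω_c`, realised on `X_{\{c\}} = X ∩ D_c`. -/
def stratumIntegrand (ω : Form ([] : List (Chord n))) (c : Chord n) (s : Chord n → ℂ) :
    Space [c] → ℂ :=
  realise [c] s (OmegaJ [c] ω)

/-- The region of convergence of the open string amplitude. -/
def convRegion (ω : Form ([] : List (Chord n))) : Set (Chord n → ℂ) :=
  {s | ∀ c, -1 < (s c).re ∧ (HasPole ω c → 0 < (s c).re)}

end OpenString

end

open OpenString

/-! The poles come from the directions normal to the divisors: in the coordinate x_c of a
trivialisation the integrand behaves like x_c^{s_c} dx_c/x_c, and ∫_0^1 x^{s-1} dx = 1/s. Everything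
is measured against the canonical form of a cell, with coefficient `dens`, that is dt_1⋯dt_m / (t_1
(t_2 - t_1)⋯(1 - t_m)) for each polygon. By `hasJac_triv` it is the pull-back under f_K of the
canonical form of X_{J ∪ K} times ∏ dx_c / (x_c (1 - x_c)), and by `triv_bijOn` f_K is a bijection
onto (0,1)^K × X_{J ∪ K}. Both are proved by adding one chord c at a time. By `triv_cons`, f_{K ∪
{c}} is f_K, followed by a rescaling of the odds x_d / (1 - x_d) by functions of the point of X_{J ∪
K} (`xr_twist`), followed by the cut along c. One cut is a bijection because two half-configurations
and a value of u_c glue uniquely (`equi_glue`, `step_surjOn`), and its Jacobian matrix is triangular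
after one more rescaling of odds.

Evaluating d log forms on the vector fields `dil` shows that a logarithmic form is a polynomial P in
the dihedral coordinates times `dens` (`dlogWedge_eq`). Its residue along D_c is then the
restriction of P to u_c = 0 times the canonical form of the divisor (`res_eq`), and P is divisible
by the u_c for which this residue vanishes (`exists_numerator`). Thus the integrals over the strata
are integrals of ∏ u_d^{s_d} P(u) `dens`. They converge by comparison with (∏ u_d)^δ `dens`, whose
integrability is shown by induction on the number of chords, with Beta integrals in the normal
direction (`integrableOn_uprod`).

By `integral_term` the integral of f_K^* R_K Ω_J is ∏_{c ∈ K} 1/s_c times the integral of Ω_{J ∪ K}.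
In the sum over J and K one collects the pairs with given M = J ∪ K; the signs (-1)^{|K|} cancel
unless there is only one choice of K (`integral_strat_eq_sum`). Taken over all J this gives the
formula for the amplitude; taken over the J containing c it identifies the residue at s_c = 0.

For the convergence of the renormalised integrals near s = 0, fix a chord c. The terms of K and K ∪
{c} differ by O(u_c), up to logarithms, and if K crosses c its term contains a factor 1 - x_d which
is a multiple of u_c. Hence the alternating sum is O(u_c) for every c at once (`exists_dren_le_u`).
With c the chord of smallest coordinate this gives a positive power of ∏ u_d, which beats logarithms
and slightly negative exponents. The same bound holds for all derivatives in s, with constants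
growing geometrically after division by k! (`exists_dren_le`), so each renormalised integral is the
sum of a convergent power series. Dividing by ∏_{c ∈ J} s_c and adding up gives the Laurent
expansion; its uniqueness is the identity theorem, one variable at a time. -/

noncomputable section

namespace OpenString

variable {n : ℕ}

/-! ### Cells of a dissection -/

/-- Lists of distinct, pairwise non-crossing chords. -/
def Good : List (Chord n) → Prop
  | [] => True
  | c :: l => c ∈ chi l ∧ Good l

/-- The part of `P` on the inner side of `c`. -/
def inner (c : Chord n) (P : Finset (Vert n)) : Finset (Vert n) :=
  P.filter fun v => c.1.1 ≤ v ∧ v ≤ c.1.2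

/-- The part of `P` on the outer side of `c`. -/
def outer (c : Chord n) (P : Finset (Vert n)) : Finset (Vert n) :=
  P.filter fun v => v ≤ c.1.1 ∨ c.1.2 ≤ v

/-- `c` is a chord of the polygon `P`. -/
structure Proper (c : Chord n) (P : Finset (Vert n)) : Prop where
  fst_mem : c.1.1 ∈ P
  snd_mem : c.1.2 ∈ P
  inside : ∃ v ∈ P, c.1.1 < v ∧ v < c.1.2
  outside : ∃ v ∈ P, v < c.1.1 ∨ c.1.2 < v

lemma ends_subset {c : Chord n} {P : Finset (Vert n)} : ends c ⊆ P ↔ c.1.1 ∈ P ∧ c.1.2 ∈ P := by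
  simp [ends, Finset.insert_subset_iff]

lemma chord_lt (c : Chord n) : c.1.1 < c.1.2 := by
  have := c.2.1
  rw [Fin.lt_def]; omega

lemma chord_ext {c d : Chord n} (h1 : c.1.1 = d.1.1) (h2 : c.1.2 = d.1.2) : c = d :=
  Subtype.ext (Prod.ext h1 h2)

lemma not_crosses_self (c : Chord n) : ¬ Crosses c c := by
  simp [Crosses]

lemma crosses_comm {c d : Chord n} : Crosses c d ↔ Crosses d c := by
  unfold Crosses; tauto

lemma mem_chi {l : List (Chord n)} {d : Chord n} :
    d ∈ chi l ↔ d ∉ l ∧ ∀ c ∈ l, ¬ Crosses c d := by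
  simp [chi]

lemma mem_inner {c : Chord n} {P : Finset (Vert n)} {v : Vert n} :
    v ∈ inner c P ↔ v ∈ P ∧ c.1.1 ≤ v ∧ v ≤ c.1.2 := by simp [inner]

lemma mem_outer {c : Chord n} {P : Finset (Vert n)} {v : Vert n} :
    v ∈ outer c P ↔ v ∈ P ∧ (v ≤ c.1.1 ∨ c.1.2 ≤ v) := by simp [outer]

lemma inner_subset (c : Chord n) (P : Finset (Vert n)) : inner c P ⊆ P := Finset.filter_subset _ _

lemma outer_subset (c : Chord n) (P : Finset (Vert n)) : outer c P ⊆ P := Finset.filter_subset _ _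

lemma cut_of_subset {c : Chord n} {P : Finset (Vert n)} (h : ends c ⊆ P) :
    cut c P = {inner c P, outer c P} := by
  simp [cut, h, inner, outer]

lemma cut_of_not_subset {c : Chord n} {P : Finset (Vert n)} (h : ¬ ends c ⊆ P) :
    cut c P = {P} := by
  simp [cut, h]

lemma proper_univ (d : Chord n) : Proper d Finset.univ := by
  have h1 := d.2.1
  have h2 := d.2.2
  have h3 := d.1.2.isLt
  refine ⟨Finset.mem_univ _, Finset.mem_univ _,
    ⟨⟨d.1.1.val + 1, by omega⟩, Finset.mem_univ _, ?_, ?_⟩, ?_⟩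
  · rw [Fin.lt_def]; simp
  · rw [Fin.lt_def]; simp; omega
  · by_cases h : d.1.1.val = 0
    · refine ⟨⟨n + 2, by omega⟩, Finset.mem_univ _, Or.inr ?_⟩
      rw [Fin.lt_def]; simp; omega
    · refine ⟨⟨0, by omega⟩, Finset.mem_univ _, Or.inl ?_⟩
      change 0 < d.1.1.val
      omega

/-- An end of `c` which is not an end of `d` serves as the vertex outside `d`; it exists because `c
≠ d`. -/
lemma proper_inner {c d : Chord n} {Q : Finset (Vert n)} (hc : Proper c Q) (hd : Proper d Q)
    (h1 : c.1.1 ≤ d.1.1) (h2 : d.1.2 ≤ c.1.2) (hne : c ≠ d) : Proper d (inner c Q) := by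
  obtain ⟨v, hv, hv1, hv2⟩ := hd.inside
  have hlt := chord_lt d
  refine ⟨mem_inner.2 ⟨hd.1, h1, by order⟩, mem_inner.2 ⟨hd.2, by order, h2⟩,
    ⟨v, mem_inner.2 ⟨hv, by order, by order⟩, hv1, hv2⟩, ?_⟩
  by_cases h : c.1.1 = d.1.1
  · have : d.1.2 ≠ c.1.2 := fun h' => hne (chord_ext h h'.symm)
    exact ⟨c.1.2, mem_inner.2 ⟨hc.2, by order, le_rfl⟩, Or.inr (by order)⟩
  · exact ⟨c.1.1, mem_inner.2 ⟨hc.1, le_rfl, by order⟩, Or.inl (by order)⟩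

lemma proper_outer {c d : Chord n} {Q : Finset (Vert n)} (hc : Proper c Q) (hd : Proper d Q)
    (h1 : d.1.1 ≤ c.1.1 ∨ c.1.2 ≤ d.1.1) (h2 : d.1.2 ≤ c.1.1 ∨ c.1.2 ≤ d.1.2) (hne : c ≠ d) :
    Proper d (outer c Q) := by
  obtain ⟨v, hv, hv1, hv2⟩ := hd.inside
  obtain ⟨w, hw, hw'⟩ := hd.outside
  have hlt := chord_lt d
  have hlt' := chord_lt c
  have hne' : ¬ (c.1.1 = d.1.1 ∧ c.1.2 = d.1.2) := fun h => hne (chord_ext h.1 h.2)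
  refine ⟨mem_outer.2 ⟨hd.1, h1⟩, mem_outer.2 ⟨hd.2, h2⟩, ?_, ?_⟩
  · rcases h2 with h2 | h2
    · exact ⟨v, mem_outer.2 ⟨hv, Or.inl (by order)⟩, hv1, hv2⟩
    · rcases h1 with h1 | h1
      · by_cases h : c.1.1 = d.1.1
        · exact ⟨c.1.2, mem_outer.2 ⟨hc.2, Or.inr le_rfl⟩, by order,
            lt_of_le_of_ne h2 fun h' => hne' ⟨h, h'⟩⟩
        · exact ⟨c.1.1, mem_outer.2 ⟨hc.1, Or.inl le_rfl⟩, by order, by order⟩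
      · exact ⟨v, mem_outer.2 ⟨hv, Or.inr (by order)⟩, hv1, hv2⟩
  · rcases h2 with h2 | h2
    · exact ⟨c.1.2, mem_outer.2 ⟨hc.2, Or.inr le_rfl⟩, Or.inr (by order)⟩
    · rcases h1 with h1 | h1
      · refine ⟨w, mem_outer.2 ⟨hw, ?_⟩, hw'⟩
        rcases hw' with h | h
        · exact Or.inl (by order)
        · exact Or.inr (by order)
      · exact ⟨c.1.1, mem_outer.2 ⟨hc.1, Or.inl le_rfl⟩, Or.inl (by order)⟩

lemma side_of_not_crosses {c d : Chord n} (h : ¬ Crosses c d) :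
    (c.1.1 ≤ d.1.1 ∧ d.1.2 ≤ c.1.2) ∨
      ((d.1.1 ≤ c.1.1 ∨ c.1.2 ≤ d.1.1) ∧ (d.1.2 ≤ c.1.1 ∨ c.1.2 ≤ d.1.2)) := by
  have := chord_lt c
  have := chord_lt d
  unfold Crosses at h
  grind

/-- By uniqueness of `Q`, `cut c` does nothing to the other cells. -/
lemma mem_cells_cons {c : Chord n} {l : List (Chord n)} {Q P : Finset (Vert n)}
    (hQ : Q ∈ cells l) (hc : ends c ⊆ Q) (hu : ∀ Q' ∈ cells l, ends c ⊆ Q' → Q' = Q) :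
    P ∈ cells (c :: l) ↔ (P ∈ cells l ∧ P ≠ Q) ∨ P = inner c Q ∨ P = outer c Q := by
  simp only [cells, Finset.mem_biUnion]
  constructor
  · rintro ⟨P0, hP0, hP⟩
    by_cases h : ends c ⊆ P0
    · obtain rfl := hu P0 hP0 h
      rw [cut_of_subset h] at hP
      simpa using Or.inr hP
    · rw [cut_of_not_subset h, Finset.mem_singleton] at hP
      subst hP
      exact Or.inl ⟨hP0, fun h' => h (h' ▸ hc)⟩
  · rintro (⟨hP, hne⟩ | h)
    · refine ⟨P, hP, ?_⟩
      rw [cut_of_not_subset fun h => hne (hu P hP h)]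
      simp
    · refine ⟨Q, hQ, ?_⟩
      rw [cut_of_subset hc]
      simpa using h

lemma inter_inner_outer (c : Chord n) (Q : Finset (Vert n)) : inner c Q ∩ outer c Q ⊆ ends c := by
  intro v hv
  rw [Finset.mem_inter, mem_inner, mem_outer] at hv
  simp only [ends, Finset.mem_insert, Finset.mem_singleton]
  grind

lemma card_ends_le (c : Chord n) : (ends c).card ≤ 2 := Finset.card_le_two

lemma Proper.card_inner {c : Chord n} {Q : Finset (Vert n)} (h : Proper c Q) :
    3 ≤ (inner c Q).card := by
  obtain ⟨v, hv, h1, h2⟩ := h.inside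
  have : ({c.1.1, v, c.1.2} : Finset (Vert n)) ⊆ inner c Q := by
    intro w hw
    simp only [Finset.mem_insert, Finset.mem_singleton] at hw
    rw [mem_inner]
    rcases hw with rfl | rfl | rfl
    · exact ⟨h.1, le_rfl, by order⟩
    · exact ⟨hv, by order, by order⟩
    · exact ⟨h.2, by order, le_rfl⟩
  refine le_trans (le_of_eq ?_) (Finset.card_le_card this)
  rw [Finset.card_insert_of_notMem, Finset.card_insert_of_notMem, Finset.card_singleton]
  · simp; order
  · simp; constructor <;> order

lemma Proper.card_outer {c : Chord n} {Q : Finset (Vert n)} (h : Proper c Q) :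
    3 ≤ (outer c Q).card := by
  obtain ⟨v, hv, h1⟩ := h.outside
  have hlt := chord_lt c
  have : ({c.1.1, c.1.2, v} : Finset (Vert n)) ⊆ outer c Q := by
    intro w hw
    simp only [Finset.mem_insert, Finset.mem_singleton] at hw
    rw [mem_outer]
    rcases hw with rfl | rfl | rfl
    · exact ⟨h.1, Or.inl le_rfl⟩
    · exact ⟨h.2, Or.inr le_rfl⟩
    · exact ⟨hv, h1.imp le_of_lt le_of_lt⟩
  refine le_trans (le_of_eq ?_) (Finset.card_le_card this)
  rw [Finset.card_insert_of_notMem, Finset.card_insert_of_notMem, Finset.card_singleton]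
  · simp; rcases h1 with h | h <;> order
  · simp; constructor
    · order
    · rcases h1 with h | h <;> order

/-- The invariant of successive cuts. Two cells share at most an edge, so three common vertices
identify a cell; this is what makes `cellOf` well defined on polygons, and the last field does the
same for chords. -/
structure CellSpec (l : List (Chord n)) : Prop where
  card : ∀ P ∈ cells l, 3 ≤ P.card
  inter : ∀ P ∈ cells l, ∀ P' ∈ cells l, 3 ≤ (P ∩ P').card → P = P'
  chord : ∀ d ∈ chi l, ∃ Q ∈ cells l, Proper d Q ∧ ∀ Q' ∈ cells l, ends d ⊆ Q' → Q' = Q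

lemma mem_chi_cons {c d : Chord n} {l : List (Chord n)} :
    d ∈ chi (c :: l) ↔ d ∈ chi l ∧ d ≠ c ∧ ¬ Crosses c d := by
  simp only [mem_chi, List.mem_cons, not_or]
  constructor
  · rintro ⟨⟨h1, h2⟩, h3⟩
    exact ⟨⟨h2, fun e he => h3 e (Or.inr he)⟩, h1, h3 c (Or.inl rfl)⟩
  · rintro ⟨⟨h1, h2⟩, h3, h4⟩
    refine ⟨⟨h3, h1⟩, ?_⟩
    rintro e (rfl | he)
    · exact h4
    · exact h2 e he

/-- The two halves of a cell have only the ends of the new chord `c` in common. A chord which does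
not cross `c` lies in one of them, and only `c` itself would lie in both. -/
lemma cellSpec {l : List (Chord n)} (hl : Good l) : CellSpec l := by
  induction l with
  | nil =>
    refine ⟨?_, ?_, ?_⟩
    · intro P hP
      simp only [cells, Finset.mem_singleton] at hP
      subst hP
      simp
    · intro P hP P' hP' _
      simp only [cells, Finset.mem_singleton] at hP hP'
      rw [hP, hP']
    · intro d _
      refine ⟨Finset.univ, by simp [cells], proper_univ d, ?_⟩
      intro Q' hQ' _
      simpa [cells] using hQ'
  | cons c l ih =>
    obtain ⟨hc, hl⟩ := hl
    have IH := ih hl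
    obtain ⟨Q, hQ, hpc, hu⟩ := IH.chord c hc
    have hcQ : ends c ⊆ Q := ends_subset.2 ⟨hpc.1, hpc.2⟩
    have hmem : ∀ {P}, P ∈ cells (c :: l) ↔ _ := fun {P} => mem_cells_cons (P := P) hQ hcQ hu
    have key : ∀ P ∈ cells (c :: l), ∀ P' ∈ cells (c :: l), P ∈ cells l → P ≠ Q →
        3 ≤ (P ∩ P').card → P = P' := by
      intro P _ P' hP' hP hPQ h3
      rcases hmem.1 hP' with ⟨h', _⟩ | h' | h'
      · exact IH.inter P hP P' h' h3
      · subst h'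
        exact absurd (IH.inter P hP Q hQ (h3.trans (Finset.card_le_card
          (Finset.inter_subset_inter_left (inner_subset c Q))))) hPQ
      · subst h'
        exact absurd (IH.inter P hP Q hQ (h3.trans (Finset.card_le_card
          (Finset.inter_subset_inter_left (outer_subset c Q))))) hPQ
    have hio : ¬ 3 ≤ (inner c Q ∩ outer c Q).card := by
      have := (Finset.card_le_card (inter_inner_outer c Q)).trans (card_ends_le c)
      omega
    refine ⟨?_, ?_, ?_⟩
    · intro P hP
      rcases hmem.1 hP with ⟨h, _⟩ | rfl | rfl
      · exact IH.card P h
      · exact hpc.card_inner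
      · exact hpc.card_outer
    · intro P hP P' hP' h3
      rcases hmem.1 hP with ⟨h, hne⟩ | h | h
      · exact key P hP P' hP' h hne h3
      · rcases hmem.1 hP' with ⟨h', hne'⟩ | h' | h'
        · exact (key P' hP' P hP h' hne' (by rwa [Finset.inter_comm])).symm
        · rw [h, h']
        · rw [h, h'] at h3; exact absurd h3 hio
      · rcases hmem.1 hP' with ⟨h', hne'⟩ | h' | h'
        · exact (key P' hP' P hP h' hne' (by rwa [Finset.inter_comm])).symm
        · rw [h, h', Finset.inter_comm] at h3; exact absurd h3 hio
        · rw [h, h']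
    · intro d hd
      obtain ⟨hd, hdc, hcr⟩ := mem_chi_cons.1 hd
      obtain ⟨Q', hQ', hpd, hu'⟩ := IH.chord d hd
      by_cases hQQ : Q' = Q
      · subst hQQ
        have hlt := chord_lt d
        have hltc := chord_lt c
        have hnot : ¬ (ends d ⊆ inner c Q' ∧ ends d ⊆ outer c Q') := by
          rintro ⟨h1, h2⟩
          rw [ends_subset] at h1 h2
          have e1 := inter_inner_outer c Q' (Finset.mem_inter.2 ⟨h1.1, h2.1⟩)
          have e2 := inter_inner_outer c Q' (Finset.mem_inter.2 ⟨h1.2, h2.2⟩)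
          simp only [ends, Finset.mem_insert, Finset.mem_singleton] at e1 e2
          apply hdc
          rcases e1 with e1 | e1 <;> rcases e2 with e2 | e2
          · order
          · exact chord_ext e1 e2
          · order
          · order
        have huniq : ∀ P ∈ cells (c :: l), ends d ⊆ P → P = inner c Q' ∨ P = outer c Q' := by
          intro P hP hdP
          rcases hmem.1 hP with ⟨h, hne⟩ | h | h
          · exact absurd (hu' P h hdP) hne
          · exact Or.inl h
          · exact Or.inr h
        rcases side_of_not_crosses hcr with ⟨h1, h2⟩ | ⟨h1, h2⟩
        · have hp := proper_inner hpc hpd h1 h2 hdc.symm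
          refine ⟨_, hmem.2 (Or.inr (Or.inl rfl)), hp, ?_⟩
          intro P hP hdP
          rcases huniq P hP hdP with h | h
          · exact h
          · exact absurd ⟨ends_subset.2 ⟨hp.1, hp.2⟩, h ▸ hdP⟩ hnot
        · have hp := proper_outer hpc hpd h1 h2 hdc.symm
          refine ⟨_, hmem.2 (Or.inr (Or.inr rfl)), hp, ?_⟩
          intro P hP hdP
          rcases huniq P hP hdP with h | h
          · exact absurd ⟨h ▸ hdP, ends_subset.2 ⟨hp.1, hp.2⟩⟩ hnot
          · exact h
      · refine ⟨Q', hmem.2 (Or.inl ⟨hQ', hQQ⟩), hpd, ?_⟩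
        intro P hP hdP
        rcases hmem.1 hP with ⟨h, hne⟩ | h | h
        · exact hu' P h hdP
        · exact absurd (hu' Q hQ (hdP.trans (h ▸ inner_subset c Q))).symm hQQ
        · exact absurd (hu' Q hQ (hdP.trans (h ▸ outer_subset c Q))).symm hQQ

lemma cellOf_eq {l : List (Chord n)} {A Q : Finset (Vert n)} (hQ : Q ∈ cells l) (hA : A ⊆ Q)
    (hu : ∀ Q' ∈ cells l, A ⊆ Q' → Q' = Q) : cellOf l A = Q := by
  have : (cells l).filter (fun Q => A ⊆ Q) = {Q} := by
    ext Q'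
    simp only [Finset.mem_filter, Finset.mem_singleton]
    exact ⟨fun h => hu Q' h.1 h.2, fun h => h ▸ ⟨hQ, hA⟩⟩
  rw [cellOf, this, Finset.sup_singleton, id]

section
variable {l : List (Chord n)} (hl : Good l)
include hl

lemma cellOf_eq_of_subset {A Q : Finset (Vert n)} (hQ : Q ∈ cells l) (hA : A ⊆ Q)
    (h3 : 3 ≤ A.card) : cellOf l A = Q :=
  cellOf_eq hQ hA fun Q' hQ' hA' => (cellSpec hl).inter Q' hQ' Q hQ
    (h3.trans (Finset.card_le_card (Finset.subset_inter hA' hA)))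

lemma cellOf_self {Q : Finset (Vert n)} (hQ : Q ∈ cells l) : cellOf l Q = Q :=
  cellOf_eq_of_subset hl hQ subset_rfl ((cellSpec hl).card Q hQ)

lemma cellOf_ends_mem {d : Chord n} (hd : d ∈ chi l) : cellOf l (ends d) ∈ cells l := by
  obtain ⟨Q, hQ, hp, hu⟩ := (cellSpec hl).chord d hd
  rwa [cellOf_eq hQ (ends_subset.2 ⟨hp.1, hp.2⟩) hu]

lemma proper_cellOf {d : Chord n} (hd : d ∈ chi l) : Proper d (cellOf l (ends d)) := by
  obtain ⟨Q, hQ, hp, hu⟩ := (cellSpec hl).chord d hd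
  rwa [cellOf_eq hQ (ends_subset.2 ⟨hp.1, hp.2⟩) hu]

lemma eq_cellOf_ends {d : Chord n} (hd : d ∈ chi l) {Q : Finset (Vert n)} (hQ : Q ∈ cells l)
    (h : ends d ⊆ Q) : Q = cellOf l (ends d) := by
  obtain ⟨Q', hQ', hp, hu⟩ := (cellSpec hl).chord d hd
  rw [cellOf_eq hQ' (ends_subset.2 ⟨hp.1, hp.2⟩) hu]
  exact hu Q hQ h

lemma mem_cells_cons_iff {c : Chord n} (hc : c ∈ chi l) {P : Finset (Vert n)} :
    P ∈ cells (c :: l) ↔ (P ∈ cells l ∧ P ≠ cellOf l (ends c)) ∨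
      P = inner c (cellOf l (ends c)) ∨ P = outer c (cellOf l (ends c)) := by
  have hp := proper_cellOf hl hc
  exact mem_cells_cons (cellOf_ends_mem hl hc) (ends_subset.2 ⟨hp.1, hp.2⟩)
    fun Q' hQ' h => eq_cellOf_ends hl hc hQ' h

end

lemma Good.tail {K l : List (Chord n)} (h : Good (K ++ l)) : Good l := by
  induction K with
  | nil => exact h
  | cons c K ih => exact ih h.2

lemma exists_cell_superset (K : List (Chord n)) {l : List (Chord n)} {P : Finset (Vert n)}
    (hP : P ∈ cells (K ++ l)) : ∃ Q ∈ cells l, P ⊆ Q := by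
  induction K generalizing P with
  | nil => exact ⟨P, hP, subset_rfl⟩
  | cons c K ih =>
    simp only [List.cons_append, cells, Finset.mem_biUnion] at hP
    obtain ⟨P0, hP0, hP⟩ := hP
    obtain ⟨Q, hQ, h⟩ := ih hP0
    refine ⟨Q, hQ, subset_trans ?_ h⟩
    by_cases hc : ends c ⊆ P0
    · rw [cut_of_subset hc] at hP
      simp only [Finset.mem_insert, Finset.mem_singleton] at hP
      rcases hP with rfl | rfl
      · exact inner_subset _ _
      · exact outer_subset _ _
    · rw [cut_of_not_subset hc, Finset.mem_singleton] at hP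
      rw [hP]

lemma cellOf_cell {K l : List (Chord n)} (h : Good (K ++ l)) {P : Finset (Vert n)}
    (hP : P ∈ cells (K ++ l)) : cellOf l P ∈ cells l ∧ P ⊆ cellOf l P := by
  obtain ⟨Q, hQ, hPQ⟩ := exists_cell_superset K hP
  rw [cellOf_eq_of_subset h.tail hQ hPQ ((cellSpec h).card P hP)]
  exact ⟨hQ, hPQ⟩

/-- `P` lies on one side of the chord `c`. -/
def OneSided (c : Chord n) (P : Finset (Vert n)) : Prop :=
  (∀ v ∈ P, c.1.1 ≤ v ∧ v ≤ c.1.2) ∨ (∀ v ∈ P, v ≤ c.1.1 ∨ c.1.2 ≤ v)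

lemma OneSided.mono {c : Chord n} {P P' : Finset (Vert n)} (h : OneSided c P) (hP : P' ⊆ P) :
    OneSided c P' :=
  h.imp (fun h v hv => h v (hP hv)) fun h v hv => h v (hP hv)

/-- Either the two cells lie in different older cells, which are already separated, or they are the
two halves made by the last cut. -/
lemma cells_separated {l : List (Chord n)} (hl : Good l) {P P' : Finset (Vert n)}
    (hP : P ∈ cells l) (hP' : P' ∈ cells l) (hne : P ≠ P') :
    ∃ e ∈ l, ((∀ v ∈ P, e.1.1 ≤ v ∧ v ≤ e.1.2) ∧ ∀ v ∈ P', v ≤ e.1.1 ∨ e.1.2 ≤ v) ∨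
      ((∀ v ∈ P', e.1.1 ≤ v ∧ v ≤ e.1.2) ∧ ∀ v ∈ P, v ≤ e.1.1 ∨ e.1.2 ≤ v) := by
  induction l generalizing P P' with
  | nil =>
    simp only [cells, Finset.mem_singleton] at hP hP'
    exact absurd (hP.trans hP'.symm) hne
  | cons c l ih =>
    obtain ⟨hc, hl⟩ := hl
    set Q := cellOf l (ends c)
    have hQ := cellOf_ends_mem hl hc
    have sub : ∀ {R R' : Finset (Vert n)}, R ∈ cells l → R' ∈ cells l → R ≠ R' → P ⊆ R → P' ⊆ R' →
        ∃ e ∈ c :: l, ((∀ v ∈ P, e.1.1 ≤ v ∧ v ≤ e.1.2) ∧ ∀ v ∈ P', v ≤ e.1.1 ∨ e.1.2 ≤ v) ∨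
          ((∀ v ∈ P', e.1.1 ≤ v ∧ v ≤ e.1.2) ∧ ∀ v ∈ P, v ≤ e.1.1 ∨ e.1.2 ≤ v) := by
      intro R R' hR hR' hRR h h'
      obtain ⟨e, he, H⟩ := ih hl hR hR' hRR
      exact ⟨e, List.mem_cons_of_mem _ he, H.imp
        (fun H => ⟨fun v hv => H.1 v (h hv), fun v hv => H.2 v (h' hv)⟩)
        (fun H => ⟨fun v hv => H.1 v (h' hv), fun v hv => H.2 v (h hv)⟩)⟩
    have hi := fun v (hv : v ∈ inner c Q) => (mem_inner.1 hv).2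
    have ho := fun v (hv : v ∈ outer c Q) => (mem_outer.1 hv).2
    rcases (mem_cells_cons_iff hl hc).1 hP with ⟨h, hn⟩ | h | h <;>
      rcases (mem_cells_cons_iff hl hc).1 hP' with ⟨h', hn'⟩ | h' | h'
    · exact sub h h' hne subset_rfl subset_rfl
    · exact sub h hQ hn subset_rfl (h' ▸ inner_subset _ _)
    · exact sub h hQ hn subset_rfl (h' ▸ outer_subset _ _)
    · exact sub hQ h' hn'.symm (h ▸ inner_subset _ _) subset_rfl
    · exact absurd (h.trans h'.symm) hne
    · exact ⟨c, by simp, Or.inl ⟨h ▸ hi, h' ▸ ho⟩⟩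
    · exact sub hQ h' hn'.symm (h ▸ outer_subset _ _) subset_rfl
    · exact ⟨c, by simp, Or.inr ⟨h' ▸ hi, h ▸ ho⟩⟩
    · exact absurd (h.trans h'.symm) hne

lemma oneSided_of_mem_cells {l : List (Chord n)} (hl : Good l) {P : Finset (Vert n)}
    (hP : P ∈ cells l) {c : Chord n} (hc : c ∈ l) : OneSided c P := by
  induction l generalizing P with
  | nil => simp at hc
  | cons d l ih =>
    obtain ⟨hd, hl⟩ := hl
    rcases (mem_cells_cons_iff hl hd).1 hP with ⟨h, hne⟩ | h | h
    · rcases List.mem_cons.1 hc with rfl | hc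
      -- Here `P` is not one of the halves made by `c`. An older chord `e` separates it from the
      -- cell containing `c`; as both ends of `c` lie beyond `e`, `P` cannot have vertices strictly
      -- on both sides of `c`.
      · obtain ⟨e, he, H⟩ := cells_separated hl h (cellOf_ends_mem hl hd) hne
        have hp := proper_cellOf hl hd
        have hlt := chord_lt c
        have hlt' := chord_lt e
        by_contra hcon
        simp only [OneSided, not_or, not_forall] at hcon
        obtain ⟨⟨w, hw, hw'⟩, ⟨v, hv, hv'⟩⟩ := hcon
        rcases H with ⟨H1, H2⟩ | ⟨H1, H2⟩
        · have a1 := H2 _ hp.1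
          have a2 := H2 _ hp.2
          have a3 := H1 _ hv
          have a4 := H1 _ hw
          grind
        · have a1 := H1 _ hp.1
          have a2 := H1 _ hp.2
          have a3 := H2 _ hv
          grind
      · exact ih hl h hc
    · rcases List.mem_cons.1 hc with rfl | hc
      · exact Or.inl fun v hv => (mem_inner.1 (h ▸ hv)).2
      · exact (ih hl (cellOf_ends_mem hl hd) hc).mono (h ▸ inner_subset _ _)
    · rcases List.mem_cons.1 hc with rfl | hc
      · exact Or.inr fun v hv => (mem_outer.1 (h ▸ hv)).2
      · exact (ih hl (cellOf_ends_mem hl hd) hc).mono (h ▸ outer_subset _ _)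

lemma mem_chi_of_proper {l : List (Chord n)} (hl : Good l) {P : Finset (Vert n)}
    (hP : P ∈ cells l) {d : Chord n} (hd : Proper d P) : d ∈ chi l := by
  obtain ⟨v, hv, hv'⟩ := hd.inside
  obtain ⟨w, hw, hw'⟩ := hd.outside
  have h1 := hd.1
  have h2 := hd.2
  rw [mem_chi]
  refine ⟨fun h => ?_, fun c hc hcr => ?_⟩
  · rcases oneSided_of_mem_cells hl hP h with h | h
    · have := h w hw; grind
    · have := h v hv; grind
  · have := chord_lt c
    have := chord_lt d
    rcases oneSided_of_mem_cells hl hP hc with h | h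
    · have := h _ h1; have := h _ h2; unfold Crosses at hcr; grind
    · have := h _ h1; have := h _ h2; unfold Crosses at hcr; grind

lemma cellOf_of_proper {l : List (Chord n)} (hl : Good l) {P : Finset (Vert n)}
    (hP : P ∈ cells l) {d : Chord n} (hd : Proper d P) : cellOf l (ends d) = P :=
  (eq_cellOf_ends hl (mem_chi_of_proper hl hP hd) hP (ends_subset.2 ⟨hd.1, hd.2⟩)).symm

lemma exists_cell_of_oneSided {l : List (Chord n)} (hl : Good l) {A : Finset (Vert n)}
    (hA : ∀ c ∈ l, OneSided c A) : ∃ Q ∈ cells l, A ⊆ Q := by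
  induction l with
  | nil => exact ⟨Finset.univ, by simp [cells], Finset.subset_univ _⟩
  | cons c l ih =>
    obtain ⟨hc, hl⟩ := hl
    obtain ⟨Q, hQ, hAQ⟩ := ih hl fun e he => hA e (List.mem_cons_of_mem _ he)
    by_cases h : Q = cellOf l (ends c)
    · rcases hA c (by simp) with h' | h'
      · exact ⟨_, (mem_cells_cons_iff hl hc).2 (Or.inr (Or.inl rfl)),
          fun v hv => mem_inner.2 ⟨h ▸ hAQ hv, h' v hv⟩⟩
      · exact ⟨_, (mem_cells_cons_iff hl hc).2 (Or.inr (Or.inr rfl)),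
          fun v hv => mem_outer.2 ⟨h ▸ hAQ hv, h' v hv⟩⟩
    · exact ⟨Q, (mem_cells_cons_iff hl hc).2 (Or.inl ⟨hQ, h⟩), hAQ⟩

/-- Cells are the maximal sets of at least three vertices which lie on one side of every chord. This
description involves only the set of chords, whence the independence of the order of cutting. -/
lemma mem_cells_iff {l : List (Chord n)} (hl : Good l) {P : Finset (Vert n)} :
    P ∈ cells l ↔ 3 ≤ P.card ∧ (∀ c ∈ l, OneSided c P) ∧
      ∀ P', P ⊆ P' → (∀ c ∈ l, OneSided c P') → P' ⊆ P := by
  constructor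
  · intro hP
    refine ⟨(cellSpec hl).card P hP, fun c hc => oneSided_of_mem_cells hl hP hc, ?_⟩
    intro P' h h'
    obtain ⟨Q, hQ, hPQ⟩ := exists_cell_of_oneSided hl h'
    have : P = Q := (cellSpec hl).inter P hP Q hQ
      (((cellSpec hl).card P hP).trans (Finset.card_le_card
        (Finset.subset_inter subset_rfl (h.trans hPQ))))
    rwa [this]
  · rintro ⟨h3, h1, h2⟩
    obtain ⟨Q, hQ, hPQ⟩ := exists_cell_of_oneSided hl h1
    have : P = Q := subset_antisymm hPQ (h2 Q hPQ fun c hc => oneSided_of_mem_cells hl hQ hc)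
    rwa [this]

lemma cells_congr {l l' : List (Chord n)} (hl : Good l) (hl' : Good l')
    (h : ∀ c, c ∈ l ↔ c ∈ l') : cells l = cells l' := by
  ext P
  simp only [mem_cells_iff hl, mem_cells_iff hl', h]

lemma chi_congr {l l' : List (Chord n)} (h : ∀ c, c ∈ l ↔ c ∈ l') : chi l = chi l' := by
  ext d
  simp only [mem_chi, h]

lemma good_append {K l : List (Chord n)} (hl : Good l) (hK : K.Nodup) (h1 : ∀ c ∈ K, c ∈ chi l)
    (h2 : ∀ c ∈ K, ∀ d ∈ K, ¬ Crosses c d) : Good (K ++ l) := by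
  induction K with
  | nil => exact hl
  | cons c K ih =>
    rw [List.nodup_cons] at hK
    refine ⟨?_, ih hK.2 (fun d hd => h1 d (by simp [hd]))
      fun d hd e he => h2 d (by simp [hd]) e (by simp [he])⟩
    have := mem_chi.1 (h1 c (by simp))
    rw [mem_chi]
    refine ⟨by simp [hK.1, this.1], fun d hd => ?_⟩
    rcases List.mem_append.1 hd with hd | hd
    · exact h2 d (by simp [hd]) c (by simp)
    · exact this.2 d hd

lemma good_iff {l : List (Chord n)} :
    Good l ↔ l.Nodup ∧ ∀ c ∈ l, ∀ d ∈ l, ¬ Crosses c d := by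
  constructor
  · intro h
    induction l with
    | nil => simp
    | cons c l ih =>
      obtain ⟨hc, hl⟩ := h
      have IH := ih hl
      rw [mem_chi] at hc
      refine ⟨List.nodup_cons.2 ⟨hc.1, IH.1⟩, ?_⟩
      intro d hd e he
      rcases List.mem_cons.1 hd with h1 | h1 <;> rcases List.mem_cons.1 he with h2 | h2
      · rw [h1, h2]; exact not_crosses_self _
      · rw [h1]; exact fun h => hc.2 e h2 (crosses_comm.1 h)
      · rw [h2]; exact hc.2 d h1
      · exact IH.2 d h1 e h2
  · rintro ⟨h1, h2⟩
    have := good_append (l := []) trivial h1 (by simp [mem_chi]) h2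
    rwa [List.append_nil] at this

lemma good_congr {l l' : List (Chord n)} (hl : Good l) (hn : l'.Nodup)
    (h : ∀ c, c ∈ l' ↔ c ∈ l) : Good l' := by
  rw [good_iff] at hl ⊢
  exact ⟨hn, fun c hc d hd => hl.2 c ((h c).1 hc) d ((h d).1 hd)⟩

/-! ### Predecessors -/

section
variable {P : Finset (Vert n)}

lemma lo_mem (hP : P.Nonempty) : lo P ∈ P := by
  obtain ⟨v, hv, h⟩ := Finset.exists_mem_eq_inf' hP (id : Vert n → Vert n)
  rw [lo, ← Finset.inf'_eq_inf hP, h]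
  exact hv

lemma hi_mem (hP : P.Nonempty) : hi P ∈ P := by
  obtain ⟨v, hv, h⟩ := Finset.exists_mem_eq_sup' hP (id : Vert n → Vert n)
  rw [hi, ← Finset.sup'_eq_sup hP, h]
  exact hv

lemma lo_le {v : Vert n} (hv : v ∈ P) : lo P ≤ v := Finset.inf_le (f := id) hv

lemma le_hi {v : Vert n} (hv : v ∈ P) : v ≤ hi P := Finset.le_sup (f := id) hv

lemma lo_eq {v : Vert n} (hv : v ∈ P) (h : ∀ w ∈ P, v ≤ w) : lo P = v :=
  le_antisymm (lo_le hv) (h _ (lo_mem ⟨v, hv⟩))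

lemma hi_eq {v : Vert n} (hv : v ∈ P) (h : ∀ w ∈ P, w ≤ v) : hi P = v :=
  le_antisymm (h _ (hi_mem ⟨v, hv⟩)) (le_hi hv)

lemma pred_spec {v : Vert n} (h : ∃ w ∈ P, w < v) :
    pred P v ∈ P ∧ pred P v < v ∧ ∀ w ∈ P, w < v → w ≤ pred P v := by
  obtain ⟨w, hw, hwv⟩ := h
  have hne : (P.filter fun w => w < v).Nonempty := ⟨w, by simp [hw, hwv]⟩
  obtain ⟨x, hx, hx'⟩ := Finset.exists_mem_eq_sup' hne (id : Vert n → Vert n)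
  have hp : pred P v = x := by
    rw [pred, if_pos hne, ← Finset.sup'_eq_sup hne, hx']; rfl
  rw [Finset.mem_filter] at hx
  rw [hp]
  refine ⟨hx.1, hx.2, fun y hy hyv => ?_⟩
  rw [← hp, pred, if_pos hne]
  exact Finset.le_sup (f := id) (by simp [hy, hyv])

lemma pred_eq {v x : Vert n} (hx : x ∈ P) (hxv : x < v) (h : ∀ w ∈ P, w < v → w ≤ x) :
    pred P v = x := by
  obtain ⟨h1, h2, h3⟩ := pred_spec ⟨x, hx, hxv⟩
  exact le_antisymm (h _ h1 h2) (h3 x hx hxv)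

lemma pred_of_forall_le {v : Vert n} (h : ∀ w ∈ P, v ≤ w) : pred P v = hi P := by
  rw [pred, if_neg]
  rintro ⟨w, hw⟩
  rw [Finset.mem_filter] at hw
  exact absurd (h w hw.1) (not_le.2 hw.2)

lemma pred_lo : pred P (lo P) = hi P := pred_of_forall_le fun _ hw => lo_le hw

lemma pred_spec' {v : Vert n} (hv : v ∈ P) (h : v ≠ lo P) :
    pred P v ∈ P ∧ pred P v < v ∧ ∀ w ∈ P, w < v → w ≤ pred P v :=
  pred_spec ⟨lo P, lo_mem ⟨v, hv⟩, lt_of_le_of_ne (lo_le hv) (Ne.symm h)⟩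

lemma pred_mem {v : Vert n} (hv : v ∈ P) : pred P v ∈ P := by
  by_cases h : v = lo P
  · rw [h, pred_lo]; exact hi_mem ⟨v, hv⟩
  · exact (pred_spec' hv h).1

lemma nonempty_of_three (h : 3 ≤ P.card) : P.Nonempty := Finset.card_pos.1 (by omega)

lemma lo_lt_pred_hi (h : 3 ≤ P.card) : lo P < pred P (hi P) ∧ pred P (hi P) < hi P := by
  have hne := nonempty_of_three h
  have : ∃ v ∈ P, v ≠ lo P ∧ v ≠ hi P := by
    by_contra hcon
    push Not at hcon
    have : P ⊆ {lo P, hi P} := fun v hv => by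
      simp only [Finset.mem_insert, Finset.mem_singleton]
      by_cases h' : v = lo P
      · exact Or.inl h'
      · exact Or.inr (hcon v hv h')
    have := (Finset.card_le_card this).trans Finset.card_le_two
    omega
  obtain ⟨v, hv, h1, h2⟩ := this
  have hv1 := lt_of_le_of_ne (lo_le hv) (Ne.symm h1)
  have hv2 := lt_of_le_of_ne (le_hi hv) h2
  obtain ⟨a, b, c⟩ := pred_spec ⟨v, hv, hv2⟩
  exact ⟨hv1.trans_le (c v hv hv2), b⟩

lemma lo_lt_hi (h : 3 ≤ P.card) : lo P < hi P := (lo_lt_pred_hi h).1.trans (lo_lt_pred_hi h).2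

end

/-- Consecutive vertices of a cell are adjacent, or joined by a chord of the dissection. -/
lemma edge_of_cell {l : List (Chord n)} (hl : Good l) {P : Finset (Vert n)} (hP : P ∈ cells l) :
    (∀ v ∈ P, v ≠ lo P → (pred P v).val + 1 = v.val ∨ ∃ c ∈ l, c.1 = (pred P v, v)) ∧
      (((lo P).val = 0 ∧ (hi P).val = n + 2) ∨ ∃ c ∈ l, c.1 = (lo P, hi P)) := by
  induction l generalizing P with
  | nil =>
    simp only [cells, Finset.mem_singleton] at hP
    subst hP
    have h0 : lo (Finset.univ : Finset (Vert n)) = ⟨0, by omega⟩ :=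
      lo_eq (Finset.mem_univ _) fun w _ => Nat.zero_le w.val
    refine ⟨fun v _ hv => Or.inl ?_, Or.inl ⟨by rw [h0], ?_⟩⟩
    · have hv0 : 0 < v.val := Nat.pos_of_ne_zero fun h => hv (by rw [h0]; exact Fin.ext h)
      rw [pred_eq (x := ⟨v.val - 1, by omega⟩) (Finset.mem_univ _)]
      · simp only; omega
      · rw [Fin.lt_def]; simp only; omega
      · intro w _ hw
        rw [Fin.lt_def] at hw
        rw [Fin.le_def]; simp; omega
    · rw [hi_eq (v := ⟨n + 2, by omega⟩) (Finset.mem_univ _)]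
      intro w _
      rw [Fin.le_def]; simp; omega
  | cons c l ih =>
    obtain ⟨hc, hl⟩ := hl
    have hpr := proper_cellOf hl hc
    obtain ⟨I1, I2⟩ := ih hl (cellOf_ends_mem hl hc)
    have hlt := chord_lt c
    set Q := cellOf l (ends c)
    rcases (mem_cells_cons_iff hl hc).1 hP with ⟨h, _⟩ | h | h
    · obtain ⟨I1, I2⟩ := ih hl h
      exact ⟨fun v hv hv' => (I1 v hv hv').imp_right fun ⟨e, he, h⟩ => ⟨e, by simp [he], h⟩,
        I2.imp_right fun ⟨e, he, h⟩ => ⟨e, by simp [he], h⟩⟩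
    · have hlo : lo P = c.1.1 := lo_eq (h ▸ mem_inner.2 ⟨hpr.1, le_rfl, hlt.le⟩) fun w hw => by
        rw [h, mem_inner] at hw; exact hw.2.1
      have hhi : hi P = c.1.2 := hi_eq (h ▸ mem_inner.2 ⟨hpr.2, hlt.le, le_rfl⟩) fun w hw => by
        rw [h, mem_inner] at hw; exact hw.2.2
      refine ⟨fun v hv hv' => ?_, Or.inr ⟨c, by simp, by rw [hlo, hhi]⟩⟩
      have hv2 := hv
      rw [h, mem_inner] at hv
      have hv1 : c.1.1 < v := lt_of_le_of_ne hv.2.1 (hlo ▸ Ne.symm hv')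
      obtain ⟨a1, a2, a3⟩ := pred_spec ⟨c.1.1, hpr.1, hv1⟩
      have hpe : pred P v = pred Q v := by
        apply pred_eq _ a2
        · intro w hw hwv
          rw [h, mem_inner] at hw
          exact a3 w hw.1 hwv
        · rw [h, mem_inner]
          exact ⟨a1, a3 _ hpr.1 hv1, by order⟩
      rw [hpe]
      refine (I1 v hv.1 fun hlo' => ?_).imp_right fun ⟨e, he, h⟩ => ⟨e, by simp [he], h⟩
      exact absurd (lo_le hpr.1) (by rw [← hlo']; exact not_le.2 hv1)
    · have hlo : lo P = lo Q := by
        have := lo_mem (P := Q) ⟨_, hpr.1⟩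
        refine lo_eq (h ▸ mem_outer.2 ⟨this, Or.inl (lo_le hpr.1)⟩) fun w hw => ?_
        rw [h] at hw
        exact lo_le (outer_subset _ _ hw)
      have hhi : hi P = hi Q := by
        have := hi_mem (P := Q) ⟨_, hpr.1⟩
        refine hi_eq (h ▸ mem_outer.2 ⟨this, Or.inr (le_hi hpr.2)⟩) fun w hw => ?_
        rw [h] at hw
        exact le_hi (outer_subset _ _ hw)
      refine ⟨fun v hv hv' => ?_, ?_⟩
      · have hv2 := hv
        rw [h, mem_outer] at hv
        by_cases hvj : v = c.1.2
        · subst hvj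
          refine Or.inr ⟨c, by simp, ?_⟩
          rw [pred_eq (x := c.1.1)]
          · rw [h, mem_outer]; exact ⟨hpr.1, Or.inl le_rfl⟩
          · exact hlt
          · intro w hw hwv
            rw [h, mem_outer] at hw
            rcases hw.2 with h | h <;> order
        · obtain ⟨a1, a2, a3⟩ := pred_spec' hv.1 (hlo ▸ hv')
          have hpe : pred P v = pred Q v := by
            apply pred_eq _ a2
            · intro w hw hwv
              rw [h, mem_outer] at hw
              exact a3 w hw.1 hwv
            · rw [h, mem_outer]
              refine ⟨a1, ?_⟩
              rcases hv.2 with h | h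
              · exact Or.inl (by order)
              · exact Or.inr (a3 _ hpr.2 (lt_of_le_of_ne h (Ne.symm hvj)))
          rw [hpe]
          exact (I1 v hv.1 (hlo ▸ hv')).imp_right fun ⟨e, he, h⟩ => ⟨e, by simp [he], h⟩
      · rw [hlo, hhi]
        exact I2.imp_right fun ⟨e, he, h⟩ => ⟨e, by simp [he], h⟩

/-! ### Cyclic arcs and rectangles of chords -/

/-- `a` lies on the cyclic arc `(x, y]`. -/
abbrev Arc (x y a : Vert n) : Prop := if x < y then x < a ∧ a ≤ y else x < a ∨ a ≤ y

/-- The part of `Q` on the cyclic arc `(x, y]`. -/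
def arc (Q : Finset (Vert n)) (x y : Vert n) : Finset (Vert n) := Q.filter fun a => Arc x y a

lemma mem_arc {Q : Finset (Vert n)} {x y a : Vert n} : a ∈ arc Q x y ↔ a ∈ Q ∧ Arc x y a := by
  simp only [arc, Finset.mem_filter]

/-- Going back one step from a point of (x, y] one cannot jump over `x`, since `x` is a vertex of
`Q`. -/
lemma arc_pred {Q : Finset (Vert n)} {x y a : Vert n} (hx : x ∈ Q)
    (ha : a ∈ Q) (h : Arc x y a) : pred Q a = x ∨ Arc x y (pred Q a) := by
  by_cases hlo : a = lo Q
  · have hp : pred Q a = hi Q := by rw [hlo, pred_lo]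
    have h1 := le_hi hx
    have h2 := lo_le hx
    rw [hp]
    unfold Arc at *
    grind
  · obtain ⟨h1, h2, h3⟩ := pred_spec' ha hlo
    have h4 := h3 x hx
    unfold Arc at *
    grind

lemma prod_Ioc_div {Q : Finset (Vert n)} {x y : Vert n} (hx : x ∈ Q) (hy : y ∈ Q) (hxy : x ≤ y)
    (g : Vert n → ℝ) (hg : ∀ a ∈ Q, x ≤ a → a ≤ y → g a ≠ 0) :
    ∏ a ∈ Q.filter (fun a => x < a ∧ a ≤ y), g a / g (pred Q a) = g y / g x := by
  induction y using WellFoundedLT.induction with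
  | ind y ih =>
    rcases eq_or_lt_of_le hxy with rfl | hlt
    · rw [Finset.filter_eq_empty_iff.2, Finset.prod_empty, div_self (hg x hx le_rfl le_rfl)]
      intro a _ h
      exact absurd (h.1.trans_le h.2) (lt_irrefl _)
    · obtain ⟨h1, h2, h3⟩ := pred_spec ⟨x, hx, hlt⟩
      have hxp := h3 x hx hlt
      have IH := ih (pred Q y) h2 h1 hxp fun a ha hxa hap => hg a ha hxa (hap.trans h2.le)
      have : Q.filter (fun a => x < a ∧ a ≤ y) =
          insert y (Q.filter fun a => x < a ∧ a ≤ pred Q y) := by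
        ext a
        simp only [Finset.mem_filter, Finset.mem_insert]
        have := h3 a
        grind
      rw [this, Finset.prod_insert, IH]
      · have := hg _ h1 hxp h2.le
        field_simp
      · simp only [Finset.mem_filter, not_and, not_le]
        exact fun _ _ => h2

lemma prod_arc_div {Q : Finset (Vert n)} {x y : Vert n} (hx : x ∈ Q) (hy : y ∈ Q) (hxy : x ≠ y)
    (g : Vert n → ℝ) (hg : ∀ a ∈ Q, a = x ∨ Arc x y a → g a ≠ 0) :
    ∏ a ∈ arc Q x y, g a / g (pred Q a) = g y / g x := by
  rcases lt_or_gt_of_ne hxy with h | h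
  · have : arc Q x y = Q.filter fun a => x < a ∧ a ≤ y := by
      ext a; simp [mem_arc, Arc, h]
    rw [this]
    refine prod_Ioc_div hx hy h.le g fun a ha h1 h2 => hg a ha ?_
    simp only [Arc, h, if_true]
    grind
  -- The arc wraps around: it is (x, hi] followed by [lo, y]. The factor at `lo` links the two
  -- telescoping products, its predecessor being `hi`.
  · have hn : ¬ x < y := not_lt.2 h.le
    have hlo := lo_mem ⟨x, hx⟩
    have hhi := hi_mem ⟨x, hx⟩
    have e1 : arc Q x y = Q.filter (fun a => x < a ∧ a ≤ hi Q) ∪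
        insert (lo Q) (Q.filter fun a => lo Q < a ∧ a ≤ y) := by
      ext a
      simp only [mem_arc, Arc, hn, if_false, Finset.mem_union, Finset.mem_filter, Finset.mem_insert]
      have := @le_hi n Q a
      have := @lo_le n Q a
      have := lo_le hy
      grind
    have hgl : g (lo Q) ≠ 0 := hg _ hlo (Or.inr (by simp only [Arc, hn, if_false]; right; exact lo_le hy))
    have hgh : g (hi Q) ≠ 0 := by
      refine hg _ hhi ?_
      have := le_hi hx
      simp only [Arc, hn, if_false]; grind
    rw [e1, Finset.prod_union, Finset.prod_insert, pred_lo, prod_Ioc_div hx hhi (le_hi hx),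
      prod_Ioc_div hlo hy (lo_le hy)]
    · field_simp
    · intro a ha _ h2
      exact hg a ha (Or.inr (by simp only [Arc, hn, if_false]; exact Or.inr h2))
    · intro a ha h1 _
      refine hg a ha ?_
      simp only [Arc, hn, if_false]; grind
    · simp
    · rw [Finset.disjoint_left]
      intro a
      simp only [Finset.mem_filter, Finset.mem_insert]
      have := lo_le hx
      grind

/-- The cross-ratio of four points. -/
def xr (z : Vert n → ℝ × ℝ) (a b c d : Vert n) : ℝ :=
  (bracket (z a) (z d) * bracket (z b) (z c)) / (bracket (z a) (z c) * bracket (z b) (z d))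

lemma bracket_swap (x y : ℝ × ℝ) : bracket x y = - bracket y x := by
  simp only [bracket]; ring

lemma bracket_plucker (a b c d : ℝ × ℝ) :
    bracket a b * bracket c d - bracket a c * bracket b d + bracket a d * bracket b c = 0 := by
  simp only [bracket]; ring

lemma crossRatio_eq_xr (P : Finset (Vert n)) (z : Vert n → ℝ × ℝ) (c : Chord n) :
    crossRatio P z c = xr z (pred P c.1.1) c.1.1 (pred P c.1.2) c.1.2 := rfl

lemma simplicial_eq_xr (P : Finset (Vert n)) (z : Vert n → ℝ × ℝ) (v : Vert n) :
    simplicial P z v = xr z v (pred P (hi P)) (hi P) (lo P) := rfl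

lemma xr_swap (z : Vert n → ℝ × ℝ) (a b c d : Vert n) : xr z c d a b = xr z a b c d := by
  unfold xr
  rw [bracket_swap (z c) (z b), bracket_swap (z d) (z a), bracket_swap (z c) (z a),
    bracket_swap (z d) (z b)]
  ring

/-- Distinct labels in `Q` have distinct points. -/
def Sep (Q : Finset (Vert n)) (z : Vert n → ℝ × ℝ) : Prop :=
  ∀ v ∈ Q, ∀ w ∈ Q, v ≠ w → bracket (z v) (z w) ≠ 0

/-- The arcs `[x, y]` and `[x', y']` of `Q` are disjoint. -/
structure Rect (Q : Finset (Vert n)) (x y x' y' : Vert n) : Prop where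
  h1 : x ∈ Q
  h2 : y ∈ Q
  h3 : x' ∈ Q
  h4 : y' ∈ Q
  ne : x ≠ y
  ne' : x' ≠ y'
  disj : ∀ a ∈ Q, ∀ b ∈ Q, a = x ∨ Arc x y a → b = x' ∨ Arc x' y' b → a ≠ b

lemma arc_right (x y : Vert n) : Arc x y y := by unfold Arc; grind

/-- For fixed `a` the factor is a quotient g(b) / g(pred b), so the product over `b` telescopes;
what remains has the same shape in `a` and telescopes again. Disjointness of the closed arcs keeps
all brackets nonzero. -/
lemma prod_rect {Q : Finset (Vert n)} {z : Vert n → ℝ × ℝ} (hz : Sep Q z) {x y x' y' : Vert n}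
    (h : Rect Q x y x' y') :
    ∏ a ∈ arc Q x y, ∏ b ∈ arc Q x' y', xr z (pred Q a) a (pred Q b) b = xr z x y x' y' := by
  have hA : ∀ a ∈ arc Q x y, pred Q a = x ∨ Arc x y (pred Q a) := fun a ha =>
    arc_pred h.h1 (mem_arc.1 ha).1 (mem_arc.1 ha).2
  have hne : ∀ a ∈ Q, (a = x ∨ Arc x y a) → ∀ b ∈ Q, (b = x' ∨ Arc x' y' b) →
      bracket (z a) (z b) ≠ 0 := fun a ha h1 b hb h2 => hz a ha b hb (h.disj a ha b hb h1 h2)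
  have inner : ∀ a ∈ arc Q x y, ∏ b ∈ arc Q x' y', xr z (pred Q a) a (pred Q b) b =
      (bracket (z a) (z x') / bracket (z a) (z y')) /
        (bracket (z (pred Q a)) (z x') / bracket (z (pred Q a)) (z y')) := by
    intro a ha
    have ha' := mem_arc.1 ha
    have hp := pred_mem ha'.1
    rw [Finset.prod_congr rfl (g := fun b =>
      (bracket (z (pred Q a)) (z b) / bracket (z a) (z b)) /
        (bracket (z (pred Q a)) (z (pred Q b)) / bracket (z a) (z (pred Q b))))]
    · rw [prod_arc_div h.h3 h.h4 h.ne'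
        (fun b => bracket (z (pred Q a)) (z b) / bracket (z a) (z b))]
      · have b1 := hne a ha'.1 (Or.inr ha'.2) x' h.h3 (Or.inl rfl)
        have b2 := hne a ha'.1 (Or.inr ha'.2) y' h.h4 (Or.inr (arc_right _ _))
        have b3 := hne _ hp (hA a ha) x' h.h3 (Or.inl rfl)
        have b4 := hne _ hp (hA a ha) y' h.h4 (Or.inr (arc_right _ _))
        field_simp
      · intro b hb hb'
        exact div_ne_zero (hne _ hp (hA a ha) b hb hb') (hne _ ha'.1 (Or.inr ha'.2) b hb hb')
    · intro b hb
      have hb' := mem_arc.1 hb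
      have hpb := arc_pred h.h3 hb'.1 hb'.2
      have hpb' := pred_mem hb'.1
      have b1 := hne a ha'.1 (Or.inr ha'.2) b hb'.1 (Or.inr hb'.2)
      have b2 := hne a ha'.1 (Or.inr ha'.2) _ hpb' hpb
      have b3 := hne _ hp (hA a ha) b hb'.1 (Or.inr hb'.2)
      have b4 := hne _ hp (hA a ha) _ hpb' hpb
      unfold xr
      field_simp
  rw [Finset.prod_congr rfl inner,
    prod_arc_div h.h1 h.h2 h.ne (fun a => bracket (z a) (z x') / bracket (z a) (z y'))]
  · have b1 := hne y h.h2 (Or.inr (arc_right _ _)) y' h.h4 (Or.inr (arc_right _ _))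
    have b2 := hne x h.h1 (Or.inl rfl) y' h.h4 (Or.inr (arc_right _ _))
    have b3 := hne x h.h1 (Or.inl rfl) x' h.h3 (Or.inl rfl)
    have b4 := hne y h.h2 (Or.inr (arc_right _ _)) x' h.h3 (Or.inl rfl)
    unfold xr
    field_simp
  · intro a ha ha'
    exact div_ne_zero (hne a ha ha' x' h.h3 (Or.inl rfl))
      (hne a ha ha' y' h.h4 (Or.inr (arc_right _ _)))

/-- The chord `d` has one end on the arc `(x, y]` and the other one on `(x', y']`. -/
abbrev InRect (x y x' y' : Vert n) (d : Chord n) : Prop :=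
  (Arc x y d.1.1 ∧ Arc x' y' d.1.2) ∨ (Arc x' y' d.1.1 ∧ Arc x y d.1.2)

lemma exists_lt_of_two {Q : Finset (Vert n)} {a b : Vert n} (ha : a ∈ Q) (hb : b ∈ Q)
    (hab : a < b) (h1 : pred Q b ≠ a) (h2 : pred Q a ≠ b) :
    (∃ v ∈ Q, a < v ∧ v < b) ∧ ∃ v ∈ Q, v < a ∨ b < v := by
  obtain ⟨p1, p2, p3⟩ := pred_spec ⟨a, ha, hab⟩
  refine ⟨⟨_, p1, lt_of_le_of_ne (p3 a ha hab) (Ne.symm h1), p2⟩, pred Q a, pred_mem ha, ?_⟩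
  by_cases hlo : a = lo Q
  · right
    rw [hlo, pred_lo] at h2 ⊢
    exact lt_of_le_of_ne (le_hi hb) (Ne.symm h2)
  · exact Or.inl (pred_spec' ha hlo).2.1

/-- The predecessors of `a` and `b` stay on the two disjoint closed arcs, so `a` and `b` are not
adjacent in `Q` and span a chord. -/
lemma proper_of_rect {Q : Finset (Vert n)} {x y x' y' : Vert n} (h : Rect Q x y x' y')
    {a b : Vert n} (ha : a ∈ arc Q x y) (hb : b ∈ arc Q x' y') (hab : a < b) :
    (∃ v ∈ Q, a < v ∧ v < b) ∧ ∃ v ∈ Q, v < a ∨ b < v := by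
  rw [mem_arc] at ha hb
  have h1 := arc_pred h.h1 ha.1 ha.2
  have h2 := arc_pred h.h3 hb.1 hb.2
  exact exists_lt_of_two ha.1 hb.1 hab
    (Ne.symm (h.disj a ha.1 _ (pred_mem hb.1) (Or.inr ha.2) h2))
    (h.disj _ (pred_mem ha.1) b hb.1 h1 (Or.inr hb.2))

lemma Rect.symm {Q : Finset (Vert n)} {x y x' y' : Vert n} (h : Rect Q x y x' y') :
    Rect Q x' y' x y :=
  ⟨h.h3, h.h4, h.h1, h.h2, h.ne', h.ne, fun a ha b hb h1 h2 => (h.disj b hb a ha h2 h1).symm⟩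

lemma fst_ne {p : Vert n × Vert n} (h : ∃ v, p.1 < v ∧ v < p.2) : p.1.val + 2 ≤ p.2.val := by
  obtain ⟨v, h1, h2⟩ := h
  rw [Fin.lt_def] at h1 h2
  omega

/-- The pair `(a, b)` as a chord of `Q`. -/
lemma exists_chord {Q : Finset (Vert n)} {a b : Vert n} (ha : a ∈ Q) (hb : b ∈ Q)
    (h1 : ∃ v ∈ Q, a < v ∧ v < b) (h2 : ∃ v ∈ Q, v < a ∨ b < v) :
    ∃ d : Chord n, d.1 = (a, b) ∧ Proper d Q := by
  obtain ⟨v, hv, hv'⟩ := h1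
  obtain ⟨w, hw, hw'⟩ := h2
  refine ⟨⟨(a, b), fst_ne (p := (a, b)) ⟨v, hv'⟩, ?_⟩, rfl, ha, hb, ⟨v, hv, hv'⟩, w, hw, hw'⟩
  rintro ⟨e1, e2⟩
  have := w.isLt
  rcases hw' with h | h <;> rw [Fin.lt_def] at h <;> simp only at e1 e2 <;> omega

/-- A cross-ratio as a product of dihedral coordinates. -/
theorem prod_chords_rect {l : List (Chord n)} (hl : Good l) {Q : Finset (Vert n)}
    (hQ : Q ∈ cells l) {z : Vert n → ℝ × ℝ} (hz : Sep Q z) {x y x' y' : Vert n}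
    (h : Rect Q x y x' y') :
    ∏ d ∈ (chi l).filter (fun d => cellOf l (ends d) = Q ∧ InRect x y x' y' d),
      crossRatio Q z d = xr z x y x' y' := by
  classical
  rw [← prod_rect hz h, ← Finset.prod_product']
  have hdisj : ∀ v : Vert n, v ∈ Q → Arc x y v → ¬ Arc x' y' v := fun v hv h1 h2 =>
    h.disj v hv v hv (Or.inr h1) (Or.inr h2) rfl
  have hmem : ∀ d ∈ (chi l).filter (fun d => cellOf l (ends d) = Q ∧ InRect x y x' y' d),
      d.1.1 ∈ Q ∧ d.1.2 ∈ Q ∧ InRect x y x' y' d := by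
    intro d hd
    rw [Finset.mem_filter] at hd
    obtain ⟨hd, rfl, hr⟩ := hd
    have := proper_cellOf hl hd
    exact ⟨this.1, this.2, hr⟩
  -- The factor of `prod_rect` at (a, b) is the dihedral coordinate of the chord {a, b}. A chord is
  -- sent to its two ends, the one on the first arc being listed first.
  refine Finset.prod_nbij
    (fun d => if Arc x y d.1.1 then (d.1.1, d.1.2) else (d.1.2, d.1.1)) ?_ ?_ ?_ ?_
  · intro d hd
    obtain ⟨h1, h2, hr⟩ := hmem d hd
    rw [Finset.mem_product]
    by_cases ha : Arc x y d.1.1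
    · simp only [ha, if_true, mem_arc]
      rcases hr with hr | hr
      · exact ⟨⟨h1, trivial⟩, h2, hr.2⟩
      · exact absurd hr.1 (hdisj _ h1 ha)
    · simp only [ha, if_false, mem_arc]
      rcases hr with hr | hr
      · exact absurd hr.1 ha
      · exact ⟨⟨h2, hr.2⟩, h1, hr.1⟩
  · intro d hd d' hd' heq
    have l1 := chord_lt d
    have l2 := chord_lt d'
    dsimp only at heq
    by_cases ha : Arc x y d.1.1
    · by_cases ha' : Arc x y d'.1.1
      · rw [if_pos ha, if_pos ha', Prod.mk.injEq] at heq
        exact chord_ext heq.1 heq.2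
      · rw [if_pos ha, if_neg ha', Prod.mk.injEq] at heq
        exact absurd l1 (by rw [heq.1, heq.2]; exact not_lt.2 l2.le)
    · by_cases ha' : Arc x y d'.1.1
      · rw [if_neg ha, if_pos ha', Prod.mk.injEq] at heq
        exact absurd l1 (by rw [heq.1, heq.2]; exact not_lt.2 l2.le)
      · rw [if_neg ha, if_neg ha', Prod.mk.injEq] at heq
        exact chord_ext heq.2 heq.1
  · rintro ⟨a, b⟩ hab
    rw [Finset.mem_coe, Finset.mem_product] at hab
    obtain ⟨ha, hb⟩ := hab
    have ha' := mem_arc.1 ha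
    have hb' := mem_arc.1 hb
    have hne := h.disj a ha'.1 b hb'.1 (Or.inr ha'.2) (Or.inr hb'.2)
    rcases lt_or_gt_of_ne hne with hlt | hlt
    · obtain ⟨p1, p2⟩ := proper_of_rect h ha hb hlt
      obtain ⟨d, hd, hp⟩ := exists_chord ha'.1 hb'.1 p1 p2
      refine ⟨d, ?_, ?_⟩
      · simp only [Finset.coe_filter, Set.mem_ofPred_eq]
        refine ⟨mem_chi_of_proper hl hQ hp, cellOf_of_proper hl hQ hp, Or.inl ?_⟩
        rw [hd]; exact ⟨ha'.2, hb'.2⟩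
      · have e1 : d.1.1 = a := by rw [hd]
        have e2 : d.1.2 = b := by rw [hd]
        simp only [e1, e2]
        rw [if_pos ha'.2]
    · obtain ⟨p1, p2⟩ := proper_of_rect h.symm hb ha hlt
      obtain ⟨d, hd, hp⟩ := exists_chord hb'.1 ha'.1 p1 p2
      refine ⟨d, ?_, ?_⟩
      · simp only [Finset.coe_filter, Set.mem_ofPred_eq]
        refine ⟨mem_chi_of_proper hl hQ hp, cellOf_of_proper hl hQ hp, Or.inr ?_⟩
        rw [hd]; exact ⟨hb'.2, ha'.2⟩
      · have e1 : d.1.1 = b := by rw [hd]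
        have e2 : d.1.2 = a := by rw [hd]
        simp only [e1, e2]
        rw [if_neg fun h' => hdisj _ hb'.1 h' hb'.2]
  · intro d hd
    by_cases ha : Arc x y d.1.1
    · simp only [if_pos ha]; rfl
    · simp only [if_neg ha]; rw [crossRatio_eq_xr, xr_swap]

/-! ### The cross-ratios of a chord of a sub-polygon -/

section
variable {P : Finset (Vert n)} {e : Chord n} (he : Proper e P)
include he

lemma Proper.pred_snd : pred P e.1.2 ∈ P ∧ e.1.1 < pred P e.1.2 ∧ pred P e.1.2 < e.1.2 ∧
    ∀ w ∈ P, w < e.1.2 → w ≤ pred P e.1.2 := by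
  obtain ⟨v, hv, h1, h2⟩ := he.inside
  obtain ⟨a, b, c⟩ := pred_spec ⟨v, hv, h2⟩
  exact ⟨a, h1.trans_le (c v hv h2), b, c⟩

lemma Proper.pred_fst : pred P e.1.1 ∈ P ∧
    ((pred P e.1.1 < e.1.1 ∧ ∀ w ∈ P, w < e.1.1 → w ≤ pred P e.1.1) ∨
      (e.1.1 = lo P ∧ pred P e.1.1 = hi P ∧ e.1.2 < hi P)) := by
  refine ⟨pred_mem he.1, ?_⟩
  by_cases h : e.1.1 = lo P
  · right
    refine ⟨h, by rw [h, pred_lo], ?_⟩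
    obtain ⟨v, hv, h1⟩ := he.outside
    rcases h1 with h1 | h1
    · rw [h] at h1; exact absurd (lo_le hv) (not_le.2 h1)
    · exact h1.trans_le (le_hi hv)
  · obtain ⟨a, b, c⟩ := pred_spec' he.1 h
    exact Or.inl ⟨b, c⟩

/-- The rectangle of the cross-ratio u_e of `P`, read inside a larger polygon `Q`. -/
lemma Proper.rect {Q : Finset (Vert n)} (hPQ : P ⊆ Q) :
    Rect Q (pred P e.1.1) e.1.1 (pred P e.1.2) e.1.2 := by
  obtain ⟨a1, a2, a3, a4⟩ := he.pred_snd
  obtain ⟨b1, b2⟩ := he.pred_fst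
  have := chord_lt e
  refine ⟨hPQ b1, hPQ he.1, hPQ a1, hPQ he.2, ?_, a3.ne, ?_⟩
  · grind
  · intro a _ b _
    unfold Arc
    grind

/-- The rectangle belonging to 1 - u_e: the two arcs complementary to those of `Proper.rect`. -/
lemma Proper.rect' {Q : Finset (Vert n)} (hPQ : P ⊆ Q) :
    Rect Q e.1.1 (pred P e.1.2) e.1.2 (pred P e.1.1) := by
  obtain ⟨a1, a2, a3, a4⟩ := he.pred_snd
  obtain ⟨b1, b2⟩ := he.pred_fst
  have := chord_lt e
  refine ⟨hPQ he.1, hPQ a1, hPQ he.2, hPQ b1, a2.ne, ?_, ?_⟩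
  · grind
  · intro a _ b _
    unfold Arc
    grind

/-- The three-term Plücker relation, divided by one of its terms. -/
lemma one_sub_crossRatio {z : Vert n → ℝ × ℝ} (hz : Sep P z) :
    1 - crossRatio P z e = xr z e.1.1 (pred P e.1.2) e.1.2 (pred P e.1.1) := by
  obtain ⟨a1, a2, a3, a4⟩ := he.pred_snd
  obtain ⟨b1, b2⟩ := he.pred_fst
  have hlt := chord_lt e
  have n1 : pred P e.1.1 ≠ pred P e.1.2 := by grind
  have h1 := hz _ b1 _ a1 n1
  have h2 := hz _ he.1 _ he.2 hlt.ne
  rw [crossRatio_eq_xr]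
  unfold xr
  have hp := bracket_plucker (z (pred P e.1.1)) (z e.1.1) (z (pred P e.1.2)) (z e.1.2)
  rw [bracket_swap (z e.1.1) (z (pred P e.1.1)), bracket_swap (z (pred P e.1.2)) (z (pred P e.1.1))]
  field_simp
  linarith

/-- Contraction of chords in terms of arcs. -/
lemma contractsTo_iff {d : Chord n} : ContractsTo P d e ↔
    InRect (pred P e.1.1) e.1.1 (pred P e.1.2) e.1.2 d := by
  obtain ⟨a1, a2, a3, a4⟩ := he.pred_snd
  obtain ⟨b1, b2⟩ := he.pred_fst
  have hlt := chord_lt e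
  have hlt' := chord_lt d
  have i1 := he.1
  have i2 := he.2
  unfold ContractsTo
  simp only [ends_subset, i1, i2, true_and, and_self, Finset.ext_iff, Finset.mem_inter,
    Finset.mem_sdiff, side, Finset.mem_filter, Finset.mem_univ]
  constructor
  · rintro (h | h)
    · have c1 := h e.1.1
      have c2 := h e.1.2
      have c3 := h (pred P e.1.1)
      have c4 := h (pred P e.1.2)
      left
      unfold Arc
      grind
    · have c1 := h e.1.1
      have c2 := h e.1.2
      have c3 := h (pred P e.1.1)
      have c4 := h (pred P e.1.2)
      right
      unfold Arc
      grind
  · rintro (⟨h1, h2⟩ | ⟨h1, h2⟩)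
    · left
      intro v
      have c1 := @lo_le n P v
      have c2 := @le_hi n P v
      have c3 := a4 v
      unfold Arc at h1 h2
      grind
    · right
      intro v
      have c1 := @lo_le n P v
      have c2 := @le_hi n P v
      have c3 := a4 v
      unfold Arc at h1 h2
      grind

end

/-! ### Configurations of points -/

/-- The points labelled by `P` are distinct, and in the cyclic order of `P`. -/
def Pos (P : Finset (Vert n)) (z : Vert n → ℝ × ℝ) : Prop :=
  ∀ v ∈ P, ∀ w ∈ P, v < w → bracket (z v) (z w) < 0

lemma Pos.sep {P : Finset (Vert n)} {z : Vert n → ℝ × ℝ} (h : Pos P z) : Sep P z := by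
  intro v hv w hw hne
  rcases lt_or_gt_of_ne hne with h' | h'
  · exact (h v hv w hw h').ne
  · rw [bracket_swap]
    exact neg_ne_zero.2 (h w hw v hv h').ne

lemma Pos.mono {P P' : Finset (Vert n)} {z : Vert n → ℝ × ℝ} (h : Pos P z) (hP : P' ⊆ P) :
    Pos P' z := fun v hv w hw => h v (hP hv) w (hP hw)

lemma Pos.gt {P : Finset (Vert n)} {z : Vert n → ℝ × ℝ} (h : Pos P z) {v w : Vert n}
    (hv : v ∈ P) (hw : w ∈ P) (hvw : w < v) : 0 < bracket (z v) (z w) := by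
  rw [bracket_swap]; exact neg_pos.2 (h w hw v hv hvw)

lemma Sep.mono {P P' : Finset (Vert n)} {z : Vert n → ℝ × ℝ} (h : Sep P z) (hP : P' ⊆ P) :
    Sep P' z := fun v hv w hw => h v (hP hv) w (hP hw)

/-- Both u_e and 1 - u_e are cross-ratios, so only signs of brackets matter. When the predecessor of
the first end wraps around to the last vertex, the brackets with it change sign in pairs. -/
lemma crossRatio_mem {P : Finset (Vert n)} {z : Vert n → ℝ × ℝ} (h : Pos P z) {e : Chord n}
    (he : Proper e P) : 0 < crossRatio P z e ∧ crossRatio P z e < 1 := by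
  have key := one_sub_crossRatio he h.sep
  obtain ⟨a1, a2, a3, a4⟩ := he.pred_snd
  obtain ⟨b1, b2⟩ := he.pred_fst
  have hlt := chord_lt e
  have s1 := h _ he.1 _ he.2 hlt
  have s2 := h _ he.1 _ a1 a2
  have s3 := h _ a1 _ he.2 a3
  suffices H : 0 < crossRatio P z e ∧ 0 < xr z e.1.1 (pred P e.1.2) e.1.2 (pred P e.1.1) by
    exact ⟨H.1, by linarith [H.2]⟩
  rw [crossRatio_eq_xr]
  unfold xr
  rcases b2 with ⟨b2, _⟩ | ⟨b2, b3, b4⟩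
  · have s4 := h _ b1 _ he.1 b2
    have s5 := h _ b1 _ he.2 (b2.trans hlt)
    have s6 := h _ b1 _ a1 (b2.trans a2)
    rw [bracket_swap (z (pred P e.1.2)) (z (pred P e.1.1)), bracket_swap (z e.1.1) (z (pred P e.1.1))]
    refine ⟨div_pos (mul_pos_of_neg_of_neg s5 s2) (mul_pos_of_neg_of_neg s6 s1),
      div_pos_of_neg_of_neg ?_ ?_⟩ <;> nlinarith
  · rw [← b3] at b4
    have s4 := h.gt b1 he.1 (hlt.trans b4)
    have s5 := h.gt b1 he.2 b4
    have s6 := h.gt b1 a1 (a3.trans b4)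
    rw [bracket_swap (z (pred P e.1.2)) (z (pred P e.1.1)), bracket_swap (z e.1.1) (z (pred P e.1.1))]
    refine ⟨div_pos_of_neg_of_neg ?_ ?_, div_pos ?_ ?_⟩ <;> nlinarith

/-- Projective equivalence of configurations labelled by `P`. -/
def Equi (P : Finset (Vert n)) (z z' : Vert n → ℝ × ℝ) : Prop :=
  ∃ (k : ℝ) (m : Vert n → ℝ), k ≠ 0 ∧ (∀ v ∈ P, m v ≠ 0) ∧
    ∀ v ∈ P, ∀ w ∈ P, bracket (z' v) (z' w) = k * m v * m w * bracket (z v) (z w)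

lemma Equi.mono {P P' : Finset (Vert n)} {z z' : Vert n → ℝ × ℝ} (h : Equi P z z') (hP : P' ⊆ P) :
    Equi P' z z' := by
  obtain ⟨k, m, h1, h2, h3⟩ := h
  exact ⟨k, m, h1, fun v hv => h2 v (hP hv), fun v hv w hw => h3 v (hP hv) w (hP hw)⟩

lemma Equi.xr_eq {P : Finset (Vert n)} {z z' : Vert n → ℝ × ℝ} (h : Equi P z z') {a b c d : Vert n}
    (ha : a ∈ P) (hb : b ∈ P) (hc : c ∈ P) (hd : d ∈ P) : xr z' a b c d = xr z a b c d := by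
  obtain ⟨k, m, h1, h2, h3⟩ := h
  unfold xr
  rw [h3 a ha d hd, h3 b hb c hc, h3 a ha c hc, h3 b hb d hd]
  have e1 : k * m a * m d * bracket (z a) (z d) * (k * m b * m c * bracket (z b) (z c)) =
    (k * k * m a * m b * m c * m d) * (bracket (z a) (z d) * bracket (z b) (z c)) := by ring
  have e2 : k * m a * m c * bracket (z a) (z c) * (k * m b * m d * bracket (z b) (z d)) =
    (k * k * m a * m b * m c * m d) * (bracket (z a) (z c) * bracket (z b) (z d)) := by ring
  rw [e1, e2, mul_div_mul_left]
  simp [h1, h2 a ha, h2 b hb, h2 c hc, h2 d hd]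

lemma Equi.crossRatio_eq {P : Finset (Vert n)} {z z' : Vert n → ℝ × ℝ} (h : Equi P z z')
    {e : Chord n} (h1 : e.1.1 ∈ P) (h2 : e.1.2 ∈ P) : crossRatio P z' e = crossRatio P z e :=
  h.xr_eq (pred_mem h1) h1 (pred_mem h2) h2

lemma Equi.simplicial_eq {P : Finset (Vert n)} {z z' : Vert n → ℝ × ℝ} (h : Equi P z z')
    {v : Vert n} (hv : v ∈ P) : simplicial P z' v = simplicial P z v :=
  h.xr_eq hv (pred_mem (hi_mem ⟨v, hv⟩)) (hi_mem ⟨v, hv⟩) (lo_mem ⟨v, hv⟩)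

/-- Affine coordinate of a point of a normalised configuration. -/
def pos (l : List (Chord n)) (t : Space l) (P : Finset (Vert n)) (v : Vert n) : ℝ :=
  (config l t P v).1

lemma config_hi (l : List (Chord n)) (t : Space l) (P : Finset (Vert n)) :
    config l t P (hi P) = (1, 0) := by simp [config]

lemma config_of_ne {l : List (Chord n)} {t : Space l} {P : Finset (Vert n)} {v : Vert n}
    (hv : v ≠ hi P) : config l t P v = (pos l t P v, 1) := by
  refine Prod.ext rfl ?_
  unfold config
  rw [if_neg hv]
  split_ifs <;> rfl

section
variable {l : List (Chord n)} {t : Space l} {P : Finset (Vert n)}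

lemma pos_lo (h3 : 3 ≤ P.card) : pos l t P (lo P) = 0 := by
  have := lo_lt_hi h3
  simp [pos, config, this.ne]

lemma pos_pred_hi (h3 : 3 ≤ P.card) : pos l t P (pred P (hi P)) = 1 := by
  have := lo_lt_pred_hi h3
  simp [pos, config, this.1.ne', this.2.ne]

lemma pos_coord (t : Space l) (q : Coord l) : pos l t q.1.1 q.1.2 = t q := by
  obtain ⟨⟨P, v⟩, h1, h2, h3, h4, h5⟩ := q
  have : P ∈ cells l ∧ v ∈ P ∧ v ≠ lo P ∧ v ≠ hi P ∧ v ≠ pred P (hi P) := ⟨h1, h2, h3, h4, h5⟩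
  simp only at h3 h4 h5
  simp only [pos, config, if_neg h3, if_neg h4, if_neg h5, dif_pos this]

lemma bracket_config_hi {v : Vert n} (hv : v ≠ hi P) :
    bracket (config l t P v) (config l t P (hi P)) = -1 := by
  rw [config_hi, config_of_ne hv]; simp [bracket]

lemma bracket_config {v w : Vert n} (hv : v ≠ hi P) (hw : w ≠ hi P) :
    bracket (config l t P v) (config l t P w) = pos l t P v - pos l t P w := by
  rw [config_of_ne hv, config_of_ne hw]; simp [bracket]

lemma eq_coord {v : Vert n} (hv : v ∈ P) (hP : P ∈ cells l) (h : v ≠ hi P) :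
    v = lo P ∨ v = pred P (hi P) ∨ ∃ q : Coord l, q.1 = (P, v) := by
  by_cases h1 : v = lo P
  · exact Or.inl h1
  by_cases h2 : v = pred P (hi P)
  · exact Or.inr (Or.inl h2)
  · exact Or.inr (Or.inr ⟨⟨(P, v), hP, hv, h1, h, h2⟩, rfl⟩)

variable (hl : Good l)
include hl

lemma pos_lt (ht : t ∈ X l) (hP : P ∈ cells l) {v w : Vert n} (hv : v ∈ P) (hw : w ∈ P)
    (hvw : v < w) (hwh : w ≠ hi P) : pos l t P v < pos l t P w := by
  have h3 := (cellSpec hl).card P hP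
  have hvh : v ≠ hi P := fun h => absurd (le_hi hw) (not_le.2 (h ▸ hvw))
  have hph := lo_lt_pred_hi h3
  have hwp : w ≤ pred P (hi P) := (pred_spec ⟨w, hw, lt_of_le_of_ne (le_hi hw) hwh⟩).2.2 w hw
    (lt_of_le_of_ne (le_hi hw) hwh)
  rcases eq_coord hv hP hvh with h1 | h1 | ⟨q, hq⟩
  · rw [h1, pos_lo h3]
    rcases eq_coord hw hP hwh with h2 | h2 | ⟨q', hq'⟩
    · exact absurd hvw (by rw [h1, h2]; exact lt_irrefl _)
    · rw [h2, pos_pred_hi h3]; exact one_pos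
    · have : pos l t P w = t q' := by rw [← pos_coord t q', hq']
      rw [this]; exact (ht.1 q').1
  · exact absurd hwp (not_le.2 (h1 ▸ hvw))
  · have e1 : pos l t P v = t q := by rw [← pos_coord t q, hq]
    rw [e1]
    rcases eq_coord hw hP hwh with h2 | h2 | ⟨q', hq'⟩
    · exact absurd (lo_le hv) (not_le.2 (h2 ▸ hvw))
    · rw [h2, pos_pred_hi h3]; exact (ht.1 q).2
    · have : pos l t P w = t q' := by rw [← pos_coord t q', hq']
      rw [this]
      exact ht.2 q q' (by rw [hq, hq']) (by rw [hq, hq']; exact hvw)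

lemma pos_config (ht : t ∈ X l) (hP : P ∈ cells l) : Pos P (config l t P) := by
  intro v hv w hw hvw
  have hvh : v ≠ hi P := fun h => absurd (le_hi hw) (not_le.2 (h ▸ hvw))
  by_cases hwh : w = hi P
  · rw [hwh, bracket_config_hi hvh]; norm_num
  · rw [bracket_config hvh hwh]
    linarith [pos_lt hl ht hP hv hw hvw hwh]

lemma mem_X_of_pos (h : ∀ P ∈ cells l, ∀ v ∈ P, ∀ w ∈ P, v < w → w ≠ hi P →
    pos l t P v < pos l t P w) : t ∈ X l := by
  refine ⟨fun q => ?_, fun q q' hqq hlt => ?_⟩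
  · obtain ⟨h1, h2, h3, h4, h5⟩ := q.2
    have hc := (cellSpec hl).card _ h1
    have hph := lo_lt_pred_hi hc
    rw [← pos_coord t q]
    constructor
    · rw [← pos_lo (l := l) (t := t) hc]
      exact h _ h1 _ (lo_mem ⟨_, h2⟩) _ h2 (lt_of_le_of_ne (lo_le h2) (Ne.symm h3)) h4
    · rw [← pos_pred_hi (l := l) (t := t) hc]
      have hlt := lt_of_le_of_ne (le_hi h2) h4
      obtain ⟨p1, p2, p3⟩ := pred_spec ⟨_, h2, hlt⟩
      exact h _ h1 _ h2 _ p1 (lt_of_le_of_ne (p3 _ h2 hlt) h5) p2.ne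
  · rw [← pos_coord t q, ← pos_coord t q', hqq]
    exact h _ q'.2.1 _ (hqq ▸ q.2.2.1) _ q'.2.2.1 hlt q'.2.2.2.2.1

/-- The simplicial coordinate also takes the right values 0 and 1 at the two finite normalised
labels. -/
lemma pos_of_simplicial {z : Vert n → ℝ × ℝ} (hP : P ∈ cells l) (hz : Pos P z)
    (h : ∀ q : Coord l, q.1.1 = P → t q = simplicial P z q.1.2) {v : Vert n} (hv : v ∈ P)
    (hvh : v ≠ hi P) : pos l t P v = simplicial P z v := by
  have h3 := (cellSpec hl).card P hP
  have hph := lo_lt_pred_hi h3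
  have hm := hi_mem (nonempty_of_three h3)
  have hm' := lo_mem (nonempty_of_three h3)
  rcases eq_coord hv hP hvh with h1 | h1 | ⟨q, hq⟩
  · rw [h1, pos_lo h3, simplicial]
    simp [bracket, mul_comm]
  · rw [h1, pos_pred_hi h3, simplicial]
    have b1 := hz.sep _ (pred_mem hm) _ hm hph.2.ne
    have b2 := hz.sep _ (pred_mem hm) _ hm' hph.1.ne'
    field_simp
  · have e1 : pos l t P v = t q := by rw [← pos_coord t q, hq]
    rw [e1, h q (by rw [hq]), hq]

/-- Normalising a configuration is a projective transformation followed by a rescaling of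
homogeneous coordinates: `k` plays the role of its determinant and `m` of the rescaling. -/
lemma equi_of_simplicial {z : Vert n → ℝ × ℝ} (hP : P ∈ cells l) (hz : Pos P z)
    (h : ∀ q : Coord l, q.1.1 = P → t q = simplicial P z q.1.2) : Equi P z (config l t P) := by
  have h3 := (cellSpec hl).card P hP
  obtain ⟨hp1, hp2⟩ := lo_lt_pred_hi h3
  have hm := hi_mem (nonempty_of_three h3)
  have hm' := lo_mem (nonempty_of_three h3)
  have hmp := pred_mem hm
  have hps := fun v hv hvh => pos_of_simplicial (v := v) hl hP hz h hv hvh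
  set b := pred P (hi P)
  have b1 := hz.sep _ hmp _ hm hp2.ne
  have b2 := hz.sep _ hmp _ hm' hp1.ne'
  have b3 := hz.sep _ hm' _ hm (hp1.trans hp2).ne
  -- Forced by the bracket of the points 1 and 0 being 1. The point at infinity is (1, 0), whose
  -- bracket with every finite point is ±1, whence its scaling factor -1/k.
  set k := bracket (z b) (z (hi P)) * bracket (z (lo P)) (z (hi P)) / bracket (z b) (z (lo P)) with hk
  have hk0 : k ≠ 0 := div_ne_zero (mul_ne_zero b1 b3) b2
  refine ⟨k, fun v => if v = hi P then -k⁻¹ else (bracket (z v) (z (hi P)))⁻¹, hk0, ?_, ?_⟩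
  · intro v hv
    dsimp only
    split_ifs with h'
    · exact neg_ne_zero.2 (inv_ne_zero hk0)
    · exact inv_ne_zero (hz.sep _ hv _ hm h')
  · have self : ∀ x : ℝ × ℝ, bracket x x = 0 := fun x => by simp only [bracket]; ring
    intro v hv w hw
    beta_reduce
    by_cases hvh : v = hi P
    · by_cases hwh : w = hi P
      · rw [hvh, hwh, self, self, mul_zero]
      · have b4 := hz.sep _ hw _ hm hwh
        rw [hvh, if_pos rfl, if_neg hwh, bracket_swap, bracket_config_hi hwh,
          bracket_swap (z (hi P))]
        field_simp
    · by_cases hwh : w = hi P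
      · have b4 := hz.sep _ hv _ hm hvh
        rw [hwh, if_pos rfl, if_neg hvh, bracket_config_hi hvh]
        field_simp
      · rw [bracket_config hvh hwh, hps v hv hvh, hps w hw hwh, if_neg hvh, if_neg hwh]
        have b4 := hz.sep _ hv _ hm hvh
        have b5 := hz.sep _ hw _ hm hwh
        have hpl := bracket_plucker (z v) (z w) (z (lo P)) (z (hi P))
        have e : bracket (z v) (z w) * bracket (z (lo P)) (z (hi P)) =
          bracket (z v) (z (lo P)) * bracket (z w) (z (hi P)) -
            bracket (z v) (z (hi P)) * bracket (z w) (z (lo P)) := by linarith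
        have e2 : k * (bracket (z v) (z (hi P)))⁻¹ * (bracket (z w) (z (hi P)))⁻¹ *
            bracket (z v) (z w) = (bracket (z b) (z (hi P)) / bracket (z b) (z (lo P)) *
              (bracket (z v) (z (hi P)))⁻¹ * (bracket (z w) (z (hi P)))⁻¹ *
              (bracket (z v) (z w) * bracket (z (lo P)) (z (hi P)))) := by
          rw [hk]; ring
        rw [e2, e]
        unfold simplicial
        rw [show pred P (hi P) = b from rfl]
        field_simp
        try ring

end

/-! ### Jacobians -/

section Jacobian
variable {ι κ μ : Type} [Fintype ι] [DecidableEq ι] [Fintype κ] [DecidableEq κ] [Fintype μ]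
  [DecidableEq μ]

/-- `f` is differentiable at `t`, and the absolute value of its Jacobian determinant is `J`. -/
def HasJac (f : (ι → ℝ) → (κ → ℝ)) (t : ι → ℝ) (J : ℝ) : Prop :=
  ∃ f' : (ι → ℝ) →L[ℝ] (κ → ℝ), HasFDerivAt f f' t ∧ ∃ e : ι ≃ κ,
    |((LinearMap.toMatrix' (f' : (ι → ℝ) →ₗ[ℝ] (κ → ℝ))).submatrix e id).det| = J

omit [Fintype κ] [DecidableEq κ] in
lemma toMatrix_single (f : (ι → ℝ) →ₗ[ℝ] (κ → ℝ)) (k : κ) (j : ι) :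
    LinearMap.toMatrix' f k j = f (Pi.single j 1) k := by
  rw [LinearMap.toMatrix'_apply]

omit [Fintype κ] [DecidableEq κ] in
-- Another identification of the index sets permutes the rows, which affects only the sign.
lemma abs_det_submatrix (A : Matrix κ ι ℝ) (e e' : ι ≃ κ) :
    |(A.submatrix e id).det| = |(A.submatrix e' id).det| := by
  have : A.submatrix e id = (A.submatrix e' id).submatrix (e.trans e'.symm) id := by
    ext i j; simp
  rw [this, Matrix.det_permute, abs_mul]
  rcases Int.units_eq_one_or (Equiv.Perm.sign (e.trans e'.symm)) with h | h <;> rw [h] <;> simp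

omit [DecidableEq μ] in
lemma HasJac.comp {f : (ι → ℝ) → (κ → ℝ)} {g : (κ → ℝ) → (μ → ℝ)} {t : ι → ℝ} {J J' : ℝ}
    (hg : HasJac g (f t) J') (hf : HasJac f t J) : HasJac (g ∘ f) t (J' * J) := by
  obtain ⟨f', hf', e, he⟩ := hf
  obtain ⟨g', hg', e', he'⟩ := hg
  refine ⟨g'.comp f', hg'.comp t hf', e.trans e', ?_⟩
  have : (LinearMap.toMatrix' ((g'.comp f' : (ι → ℝ) →L[ℝ] (μ → ℝ)) : (ι → ℝ) →ₗ[ℝ] (μ → ℝ))) =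
      LinearMap.toMatrix' (g' : (κ → ℝ) →ₗ[ℝ] (μ → ℝ)) *
        LinearMap.toMatrix' (f' : (ι → ℝ) →ₗ[ℝ] (κ → ℝ)) := by
    rw [← LinearMap.toMatrix'_comp]; rfl
  rw [this, ← he, ← he', ← abs_mul, ← Matrix.det_submatrix_equiv_self e
    ((LinearMap.toMatrix' (g' : (κ → ℝ) →ₗ[ℝ] (μ → ℝ))).submatrix e' id), ← Matrix.det_mul]
  congr 2
  rw [Matrix.submatrix_submatrix]
  exact (Matrix.submatrix_mul_equiv _ _ _ e _).symm

omit [Fintype κ] [DecidableEq κ] in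
lemma HasJac.congr {f g : (ι → ℝ) → (κ → ℝ)} {t : ι → ℝ} {J : ℝ} (hf : HasJac f t J)
    (h : g =ᶠ[𝓝 t] f) : HasJac g t J := by
  obtain ⟨f', hf', e, he⟩ := hf
  exact ⟨f', hf'.congr_of_eventuallyEq h, e, he⟩

/-- A permutation contributing a nonzero product satisfies r i ≤ r (σ i) for all i. The sums over i
agree, so these are equalities, and entries between different indices of equal rank vanish; hence σ
= 1. Ties in the rank are therefore harmless, and no linear order of the coordinates is needed. -/
lemma det_of_rank (A : Matrix ι ι ℝ) (r : ι → ℕ) (h : ∀ i j, i ≠ j → r i ≤ r j → A i j = 0) :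
    A.det = ∏ i, A i i := by
  rw [Matrix.det_apply, Finset.sum_eq_single 1]
  · simp
  · intro σ _ hσ
    suffices ∏ i, A (σ i) i = 0 by rw [this, smul_zero]
    by_contra hne
    replace hne := Finset.prod_ne_zero_iff.1 hne
    have h1 : ∀ i, r i ≤ r (σ i) := by
      intro i
      by_contra hlt
      push Not at hlt
      exact hne i (Finset.mem_univ i) (h _ _ (fun h' => by rw [h'] at hlt; exact lt_irrefl _ hlt) hlt.le)
    have h2 : ∑ i, r i = ∑ i, r (σ i) := (Equiv.sum_comp σ r).symm
    have h3 := (Finset.sum_eq_sum_iff_of_le fun i _ => h1 i).1 h2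
    apply hσ
    ext i
    by_contra hi
    exact hne i (Finset.mem_univ i) (h _ _ hi (h3 i (Finset.mem_univ i)).ge)
  · simp

omit [DecidableEq κ] in
-- Triangularity and the diagonal entries are checked on one-variable restrictions of `f`.
lemma hasJac_of_triangular {f : (ι → ℝ) → (κ → ℝ)} {t : ι → ℝ} (e : ι ≃ κ) (r : ι → ℕ)
    (D : ι → ℝ) (hf : DifferentiableAt ℝ f t)
    (h0 : ∀ i j, i ≠ j → r i ≤ r j → ∀ z, f (Function.update t j z) (e i) = f t (e i))
    (hD : ∀ i, HasDerivAt (fun z => f (Function.update t i z) (e i)) (D i) (t i)) :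
    HasJac f t |∏ i, D i| := by
  refine ⟨fderiv ℝ f t, hf.hasFDerivAt, e, ?_⟩
  have key : ∀ i j, HasDerivAt (fun z => f (Function.update t j z) (e i))
      (fderiv ℝ f t (Pi.single j 1) (e i)) (t j) := by
    intro i j
    have h1 : HasFDerivAt f (fderiv ℝ f t) (Function.update t j (t j)) := by
      rw [Function.update_eq_self]; exact hf.hasFDerivAt
    have h2 := h1.comp_hasDerivAt (t j) (hasDerivAt_update t j (t j))
    exact hasDerivAt_pi.1 h2 (e i)
  have hent : ∀ i j, ((LinearMap.toMatrix' ((fderiv ℝ f t : (ι → ℝ) →L[ℝ] (κ → ℝ)) :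
      (ι → ℝ) →ₗ[ℝ] (κ → ℝ))).submatrix e id) i j = fderiv ℝ f t (Pi.single j 1) (e i) := by
    intro i j
    rw [Matrix.submatrix_apply, toMatrix_single]
    rfl
  rw [det_of_rank _ r]
  · congr 1
    refine Finset.prod_congr rfl fun i _ => ?_
    rw [hent]
    exact (key i i).unique (hD i)
  · intro i j hij hr
    rw [hent]
    refine (key i j).unique ?_
    have : (fun z => f (Function.update t j z) (e i)) = fun _ => f t (e i) :=
      funext fun z => h0 i j hij hr z
    rw [this]
    exact hasDerivAt_const _ _

omit [DecidableEq κ] in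
lemma hasJac_reindex (σ : κ ≃ ι) (t : ι → ℝ) : HasJac (fun x k => x (σ k)) t 1 := by
  have := hasJac_of_triangular (f := fun (x : ι → ℝ) k => x (σ k)) (t := t) σ.symm (fun _ => 0)
    (fun _ => 1) (by fun_prop) ?_ ?_
  · simpa using this
  · intro i j hij _ z
    simp [Function.update_of_ne hij]
  · intro i
    simp only [Equiv.apply_symm_apply, Function.update_self]
    exact hasDerivAt_id' (t i)

/-- The map which applies `f` to the second group of variables. -/
def rightMap (μ : Type) (f : (ι → ℝ) → (κ → ℝ)) (w : μ ⊕ ι → ℝ) : μ ⊕ κ → ℝ :=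
  Sum.elim (fun m => w (Sum.inl m)) (f fun i => w (Sum.inr i))

omit [DecidableEq κ] in
lemma HasJac.rightMap {f : (ι → ℝ) → (κ → ℝ)} {w : μ ⊕ ι → ℝ} {J : ℝ}
    (h : HasJac f (fun i => w (Sum.inr i)) J) : HasJac (rightMap μ f) w J := by
  obtain ⟨f', hf', e, he⟩ := h
  set L : (μ ⊕ ι → ℝ) →L[ℝ] (ι → ℝ) := ContinuousLinearMap.pi fun i => ContinuousLinearMap.proj (Sum.inr i)
  set F : (μ ⊕ ι → ℝ) →L[ℝ] (μ ⊕ κ → ℝ) := ContinuousLinearMap.pi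
    (Sum.elim (fun m => ContinuousLinearMap.proj (Sum.inl m))
      fun k => (ContinuousLinearMap.proj k).comp (f'.comp L)) with hF
  refine ⟨F, ?_, Equiv.sumCongr (Equiv.refl μ) e, ?_⟩
  · rw [hasFDerivAt_pi']
    rintro (m | k)
    · exact (ContinuousLinearMap.proj (R := ℝ) (φ := fun _ : μ ⊕ ι => ℝ) (Sum.inl m)).hasFDerivAt
    · have h1 : HasFDerivAt f f' (L w) := hf'
      have h2 := h1.comp w L.hasFDerivAt
      exact (ContinuousLinearMap.proj (R := ℝ) (φ := fun _ : κ => ℝ) k).hasFDerivAt.comp w h2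
  · have : (LinearMap.toMatrix' (F : (μ ⊕ ι → ℝ) →ₗ[ℝ] (μ ⊕ κ → ℝ))).submatrix
        (Equiv.sumCongr (Equiv.refl μ) e) id =
        Matrix.fromBlocks 1 0 0
          ((LinearMap.toMatrix' (f' : (ι → ℝ) →ₗ[ℝ] (κ → ℝ))).submatrix e id) := by
      ext (i | i) (j | j)
      · simp [hF, Matrix.one_apply, Pi.single_apply]
      · simp [hF]
      · simp only [Matrix.submatrix_apply, toMatrix_single, hF]
        simp only [Equiv.sumCongr_apply, Sum.map_inr, id, Matrix.fromBlocks_apply₂₁, Matrix.zero_apply]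
        have : L (Pi.single (Sum.inl j) 1) = 0 := by
          ext x; simp [L]
        change f' (L (Pi.single (Sum.inl j) 1)) (e i) = 0
        rw [this]; simp
      · simp only [Matrix.submatrix_apply, toMatrix_single, hF]
        simp only [Equiv.sumCongr_apply, Sum.map_inr, id, Matrix.fromBlocks_apply₂₂,
          Matrix.submatrix_apply, toMatrix_single]
        have : L (Pi.single (Sum.inr j) 1) = Pi.single j 1 := by
          ext x; simp [L, Pi.single_apply]
        change f' (L (Pi.single (Sum.inr j) 1)) (e i) = f' (Pi.single j 1) (e i)
        rw [this]
    rw [this, Matrix.det_fromBlocks_zero₂₁, Matrix.det_one, one_mul, he]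

/-- Rescaling of the odds `x / (1 - x)` of the variables of the first group by functions of the
variables of the second group. -/
def twist (G : κ → (ι → ℝ) → ℝ) (w : κ ⊕ ι → ℝ) : κ ⊕ ι → ℝ :=
  Sum.elim (fun k => w (Sum.inl k) * G k (fun i => w (Sum.inr i)) /
    (w (Sum.inl k) * G k (fun i => w (Sum.inr i)) + (1 - w (Sum.inl k)))) fun i => w (Sum.inr i)

/-- If y / (1 - y) = G x / (1 - x) with G fixed, then dy / (y (1 - y)) = dx / (x (1 - x)). The
variables on which G depends are unchanged, so the matrix is triangular with these derivatives and
ones on the diagonal. -/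
lemma hasJac_twist {G : κ → (ι → ℝ) → ℝ} {w : κ ⊕ ι → ℝ}
    (hw : ∀ k, 0 < w (Sum.inl k) ∧ w (Sum.inl k) < 1)
    (hG : ∀ k, 0 < G k fun i => w (Sum.inr i))
    (hd : ∀ k, DifferentiableAt ℝ (G k) fun i => w (Sum.inr i)) :
    HasJac (twist G) w
      (∏ k, (twist G w (Sum.inl k) * (1 - twist G w (Sum.inl k))) /
        (w (Sum.inl k) * (1 - w (Sum.inl k)))) := by
  have hpos : ∀ k, 0 < w (Sum.inl k) * G k (fun i => w (Sum.inr i)) + (1 - w (Sum.inl k)) :=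
    fun k => by nlinarith [hw k, mul_pos (hw k).1 (hG k)]
  have := hasJac_of_triangular (f := twist G) (t := w) (Equiv.refl _)
    (Sum.elim (fun _ => 1) fun _ => 0)
    (Sum.elim (fun k => (twist G w (Sum.inl k) * (1 - twist G w (Sum.inl k))) /
        (w (Sum.inl k) * (1 - w (Sum.inl k)))) fun _ => 1) ?_ ?_ ?_
  · rw [Fintype.prod_sum_type] at this
    simp only [Sum.elim_inl, Sum.elim_inr, Finset.prod_const_one, mul_one] at this
    rwa [abs_of_nonneg] at this
    refine Finset.prod_nonneg fun k _ => ?_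
    have h1 := hw k
    have h2 := hpos k
    have h3 : 1 - twist G w (Sum.inl k) = (1 - w (Sum.inl k)) /
        (w (Sum.inl k) * G k (fun i => w (Sum.inr i)) + (1 - w (Sum.inl k))) := by
      simp only [twist, Sum.elim_inl]
      field_simp
      ring
    rw [h3]
    simp only [twist, Sum.elim_inl]
    have := mul_pos (hw k).1 (hG k)
    have h4 : 0 < 1 - w (Sum.inl k) := by linarith
    have := h1.1
    positivity
  · rw [differentiableAt_pi]
    rintro (k | i)
    · simp only [twist, Sum.elim_inl]
      have h1 : DifferentiableAt ℝ (fun w : κ ⊕ ι → ℝ => G k fun i => w (Sum.inr i)) w :=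
        (hd k).comp (f := fun (w : κ ⊕ ι → ℝ) i => w (Sum.inr i)) w (by fun_prop)
      have h2 : DifferentiableAt ℝ (fun w : κ ⊕ ι → ℝ => w (Sum.inl k)) w := by fun_prop
      have h3 := (h2.fun_mul h1).fun_add ((differentiableAt_const (1 : ℝ)).fun_sub h2)
      simp only [div_eq_mul_inv]
      exact (h2.fun_mul h1).fun_mul (h3.fun_inv (hpos k).ne')
    · simp only [twist, Sum.elim_inr]
      fun_prop
  · rintro (k | i) (k' | j) hij hr z
    · have hne : k ≠ k' := fun h => hij (by rw [h])
      simp [twist, hne]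
    · simp at hr
    · simp [twist]
    · have hne : i ≠ j := fun h => hij (by rw [h])
      simp [twist, hne]
  · rintro (k | i)
    · simp only [twist, Equiv.refl_apply, Sum.elim_inl, Function.update_self, ne_eq, reduceCtorEq,
        not_false_eq_true, Function.update_of_ne]
      set g := G k fun i => w (Sum.inr i)
      have h2 := hpos k
      have h1 := hw k
      have hx := (hasDerivAt_id (w (Sum.inl k)))
      have hn : HasDerivAt (fun z : ℝ => z * g) (1 * g) (w (Sum.inl k)) := hx.mul_const g
      have hdn : HasDerivAt (fun z : ℝ => z * g + (1 - z)) (1 * g + (0 - 1)) (w (Sum.inl k)) :=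
        hn.add ((hasDerivAt_const _ _).sub hx)
      refine (hn.fun_div hdn h2.ne').congr_deriv ?_
      have h3 := h1.1.ne'
      have h4 : 1 - w (Sum.inl k) ≠ 0 := by linarith
      have h5 := h2.ne'
      change w (Sum.inl k) * g + (1 - w (Sum.inl k)) ≠ 0 at h5
      clear hx hn hdn h2 hpos
      generalize w (Sum.inl k) = x at *
      obtain ⟨D, hD⟩ : ∃ D, D = x * g + (1 - x) := ⟨_, rfl⟩
      rw [← hD] at h5 ⊢
      have h6 : 1 - x * g / D = (1 - x) / D := by
        rw [eq_div_iff h5, sub_mul, div_mul_cancel₀ _ h5, hD]; ring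
      rw [h6]
      field_simp
      rw [hD]
      ring
    · simp only [twist, Equiv.refl_apply, Sum.elim_inr, Function.update_self]
      exact hasDerivAt_id _

end Jacobian

lemma jac_eq {l K : List (Chord n)} {t : Space l} {J : ℝ} (h : HasJac (triv l K) t J) :
    jac l K t = J := by
  obtain ⟨f', hf', e, he⟩ := h
  have hcard : Fintype.card (Coord l) = Fintype.card ({c // c ∈ K} ⊕ Coord (K ++ l)) :=
    Fintype.card_congr e
  rw [jac, dif_pos hcard, ← he, abs_det_submatrix _ e (Fintype.equivOfCardEq hcard)]
  congr 2
  ext i j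
  rw [Matrix.submatrix_apply, toMatrix_single, Matrix.of_apply, partialD,
    (hasFDerivAt_pi'.1 hf' _).fderiv]
  rfl

/-! ### Cutting along one chord -/

section
variable {c : Chord n} {Q : Finset (Vert n)} (hp : Proper c Q)
include hp

lemma Proper.lo_inner : lo (inner c Q) = c.1.1 :=
  lo_eq (mem_inner.2 ⟨hp.1, le_rfl, (chord_lt c).le⟩) fun _ hw => (mem_inner.1 hw).2.1

lemma Proper.hi_inner : hi (inner c Q) = c.1.2 :=
  hi_eq (mem_inner.2 ⟨hp.2, (chord_lt c).le, le_rfl⟩) fun _ hw => (mem_inner.1 hw).2.2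

lemma Proper.lo_outer : lo (outer c Q) = lo Q :=
  lo_eq (mem_outer.2 ⟨lo_mem ⟨_, hp.1⟩, Or.inl (lo_le hp.1)⟩)
    fun _ hw => lo_le (outer_subset _ _ hw)

lemma Proper.hi_outer : hi (outer c Q) = hi Q :=
  hi_eq (mem_outer.2 ⟨hi_mem ⟨_, hp.1⟩, Or.inr (le_hi hp.2)⟩)
    fun _ hw => le_hi (outer_subset _ _ hw)

lemma Proper.pred_inner {v : Vert n} (hv : v ∈ inner c Q) (hvi : v ≠ c.1.1) :
    pred (inner c Q) v = pred Q v := by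
  rw [mem_inner] at hv
  have h1 := lt_of_le_of_ne hv.2.1 (Ne.symm hvi)
  obtain ⟨a1, a2, a3⟩ := pred_spec ⟨_, hp.1, h1⟩
  refine pred_eq (mem_inner.2 ⟨a1, a3 _ hp.1 h1, by order⟩) a2 fun w hw hwv => ?_
  exact a3 w (inner_subset _ _ hw) hwv

lemma Proper.pred_outer_snd : pred (outer c Q) c.1.2 = c.1.1 := by
  refine pred_eq (mem_outer.2 ⟨hp.1, Or.inl le_rfl⟩) (chord_lt c) fun w hw hwv => ?_
  rcases (mem_outer.1 hw).2 with h | h <;> order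

lemma Proper.pred_outer {v : Vert n} (hv : v ∈ outer c Q) (hvj : v ≠ c.1.2) :
    pred (outer c Q) v = pred Q v := by
  by_cases hlo : v = lo Q
  · rw [hlo, pred_lo, ← hp.lo_outer, pred_lo, hp.hi_outer]
  · rw [mem_outer] at hv
    obtain ⟨a1, a2, a3⟩ := pred_spec' hv.1 hlo
    refine pred_eq (mem_outer.2 ⟨a1, ?_⟩) a2 fun w hw hwv => a3 w (outer_subset _ _ hw) hwv
    rcases hv.2 with h | h
    · exact Or.inl (by order)
    · exact Or.inr (a3 _ hp.2 (lt_of_le_of_ne h (Ne.symm hvj)))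

lemma Proper.fst_mem_inner : c.1.1 ∈ inner c Q := mem_inner.2 ⟨hp.1, le_rfl, (chord_lt c).le⟩
lemma Proper.snd_mem_inner : c.1.2 ∈ inner c Q := mem_inner.2 ⟨hp.2, (chord_lt c).le, le_rfl⟩
lemma Proper.fst_mem_outer : c.1.1 ∈ outer c Q := mem_outer.2 ⟨hp.1, Or.inl le_rfl⟩
lemma Proper.snd_mem_outer : c.1.2 ∈ outer c Q := mem_outer.2 ⟨hp.2, Or.inr le_rfl⟩

lemma Proper.pred_snd_mem_inner : pred Q c.1.2 ∈ inner c Q :=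
  mem_inner.2 ⟨hp.pred_snd.1, hp.pred_snd.2.1.le, hp.pred_snd.2.2.1.le⟩

lemma Proper.pred_fst_mem_outer : pred Q c.1.1 ∈ outer c Q := by
  refine mem_outer.2 ⟨hp.pred_fst.1, ?_⟩
  rcases hp.pred_fst.2 with h | h
  · exact Or.inl h.1.le
  · exact Or.inr (by rw [h.2.1]; exact h.2.2.le)

omit hp in
lemma mem_inner_or_outer {v : Vert n} (hv : v ∈ Q) : v ∈ inner c Q ∨ v ∈ outer c Q := by
  rw [mem_inner, mem_outer]
  have := chord_lt c
  grind

end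

/-! ### Gluing two configurations along a chord -/

lemma Equi.symm {P : Finset (Vert n)} {z z' : Vert n → ℝ × ℝ} (h : Equi P z z') : Equi P z' z := by
  obtain ⟨k, m, h1, h2, h3⟩ := h
  refine ⟨k⁻¹, fun v => (m v)⁻¹, inv_ne_zero h1, fun v hv => inv_ne_zero (h2 v hv), ?_⟩
  intro v hv w hw
  rw [h3 v hv w hw]
  have := h2 v hv
  have := h2 w hw
  field_simp

lemma Equi.trans {P : Finset (Vert n)} {z z' z'' : Vert n → ℝ × ℝ} (h : Equi P z z')
    (h' : Equi P z' z'') : Equi P z z'' := by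
  obtain ⟨k, m, h1, h2, h3⟩ := h
  obtain ⟨k', m', h1', h2', h3'⟩ := h'
  refine ⟨k' * k, fun v => m' v * m v, mul_ne_zero h1' h1,
    fun v hv => mul_ne_zero (h2' v hv) (h2 v hv), ?_⟩
  intro v hv w hw
  rw [h3' v hv w hw, h3 v hv w hw]
  ring

/-- A configuration on `Q` is determined up to equivalence by its restrictions to the two halves and
by u_c. The two equivalences need not use the same factors on the common ends i, j; the cross-ratio
makes the ratios of the factors at j and i agree, and the Plücker relation then expresses all
brackets through those with i and j. -/
lemma equi_glue {c : Chord n} {Q : Finset (Vert n)} (hp : Proper c Q) {z z' : Vert n → ℝ × ℝ}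
    (hz : Pos Q z) (hz' : Pos Q z') (h1 : Equi (inner c Q) z z') (h2 : Equi (outer c Q) z z')
    (hx : crossRatio Q z' c = crossRatio Q z c) : Equi Q z z' := by
  obtain ⟨k1, m1, hk1, hm1, H1⟩ := h1
  obtain ⟨k2, m2, hk2, hm2, H2⟩ := h2
  have hlt := chord_lt c
  set i := c.1.1
  set j := c.1.2
  have ii := hp.fst_mem_inner
  have ji := hp.snd_mem_inner
  have io := hp.fst_mem_outer
  have jo := hp.snd_mem_outer
  have pi := hp.pred_snd_mem_inner
  have ao := hp.pred_fst_mem_outer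
  have iQ := hp.1
  have jQ := hp.2
  have pQ := hp.pred_snd.1
  have aQ := hp.pred_fst.1
  have hip : i < pred Q j := hp.pred_snd.2.1
  have hpj : pred Q j < j := hp.pred_snd.2.2.1
  have haa : pred Q i < i ∨ j < pred Q i := by
    rcases hp.pred_fst.2 with h | h
    · exact Or.inl h.1
    · exact Or.inr (by rw [h.2.1]; exact h.2.2)
  have hcr : bracket (z' (pred Q i)) (z' j) * bracket (z' i) (z' (pred Q j)) /
      (bracket (z' (pred Q i)) (z' (pred Q j)) * bracket (z' i) (z' j)) =
      bracket (z (pred Q i)) (z j) * bracket (z i) (z (pred Q j)) /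
      (bracket (z (pred Q i)) (z (pred Q j)) * bracket (z i) (z j)) := hx
  generalize pred Q j = p at *
  generalize pred Q i = a at *
  have hij := hz.sep _ iQ _ jQ hlt.ne
  have hij' := hz'.sep _ iQ _ jQ hlt.ne
  have e0 : k1 * m1 i * m1 j = k2 * m2 i * m2 j := by
    have := (H1 i ii j ji).symm.trans (H2 i io j jo)
    exact mul_right_cancel₀ hij this
  have hai : a ≠ i := by rcases haa with h | h <;> order
  have haj : a ≠ j := by rcases haa with h | h <;> order
  have hap : a ≠ p := by rcases haa with h | h <;> order
  have nap := hz.sep _ aQ _ pQ hap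
  have nap' := hz'.sep _ aQ _ pQ hap
  have naj := hz.sep _ aQ _ jQ haj
  have nai := hz.sep _ aQ _ iQ hai
  have nip := hz.sep _ iQ _ pQ hip.ne
  have npj := hz.sep _ pQ _ jQ hpj.ne
  -- Only this step uses u_c: clearing denominators and replacing the products of crossing brackets
  -- by means of Plücker leaves a common nonzero factor times the claim.
  have e1 : m2 j * m1 i = m2 i * m1 j := by
    rw [div_eq_div_iff (mul_ne_zero nap' hij') (mul_ne_zero nap hij)] at hcr
    have pl := bracket_plucker (z a) (z i) (z p) (z j)
    have pl' := bracket_plucker (z' a) (z' i) (z' p) (z' j)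
    have d1 : bracket (z a) (z p) * bracket (z i) (z j) =
      bracket (z a) (z i) * bracket (z p) (z j) + bracket (z a) (z j) * bracket (z i) (z p) := by
      linarith
    have d2 : bracket (z' a) (z' p) * bracket (z' i) (z' j) =
      bracket (z' a) (z' i) * bracket (z' p) (z' j) +
        bracket (z' a) (z' j) * bracket (z' i) (z' p) := by
      linarith
    rw [d1, d2, H2 a ao j jo, H1 i ii p pi, H2 a ao i io, H1 p pi j ji] at hcr
    have hne : k1 * k2 * m2 a * m1 p * (bracket (z a) (z j) * bracket (z i) (z p) *
        (bracket (z a) (z i) * bracket (z p) (z j))) ≠ 0 := by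
      exact mul_ne_zero (mul_ne_zero (mul_ne_zero (mul_ne_zero hk1 hk2) (hm2 a ao)) (hm1 p pi))
        (mul_ne_zero (mul_ne_zero naj nip) (mul_ne_zero nai npj))
    apply mul_left_cancel₀ hne
    linarith
  have r0 : m1 j / m1 i = m2 j / m2 i := by
    rw [div_eq_div_iff (hm1 i ii) (hm2 i io)]; linarith
  set r := m1 j / m1 i with hr
  have hr0 : r ≠ 0 := div_ne_zero (hm1 j ji) (hm1 i ii)
  have hr1 : m1 j = r * m1 i := by rw [hr, div_mul_cancel₀ _ (hm1 i ii)]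
  have hr2 : m2 j = r * m2 i := by rw [r0, div_mul_cancel₀ _ (hm2 i io)]
  -- Brackets with i are multiplied by `b v` and brackets with j by `r * b v`, with the same `r` on
  -- both halves; these are the hypotheses for the last Plücker relation.
  obtain ⟨b, hb⟩ : ∃ b : Vert n → ℝ, ∀ v ∈ Q, b v ≠ 0 ∧
      bracket (z' i) (z' v) = b v * bracket (z i) (z v) ∧
      bracket (z' v) (z' j) = r * b v * bracket (z v) (z j) := by
    refine ⟨fun v => if v ∈ inner c Q then k1 * m1 i * m1 v else k2 * m2 i * m2 v, fun v hv => ?_⟩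
    by_cases hvi : v ∈ inner c Q
    · simp only [hvi, if_true]
      refine ⟨by simp [hk1, hm1 i ii, hm1 v hvi], H1 i ii v hvi, ?_⟩
      rw [H1 v hvi j ji, hr1]; ring
    · have hvo := (mem_inner_or_outer hv).resolve_left hvi
      simp only [hvi, if_false]
      refine ⟨by simp [hk2, hm2 i io, hm2 v hvo], H2 i io v hvo, ?_⟩
      rw [H2 v hvo j jo, hr2]; ring
  refine ⟨r * bracket (z i) (z j) / bracket (z' i) (z' j), b, div_ne_zero (mul_ne_zero hr0 hij) hij',
    fun v hv => (hb v hv).1, fun v hv w hw => ?_⟩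
  have pl := bracket_plucker (z v) (z w) (z i) (z j)
  have pl' := bracket_plucker (z' v) (z' w) (z' i) (z' j)
  obtain ⟨-, v1, v2⟩ := hb v hv
  obtain ⟨-, w1, w2⟩ := hb w hw
  rw [bracket_swap (z' v) (z' i), bracket_swap (z' w) (z' i), v1, w1, v2, w2] at pl'
  rw [bracket_swap (z v) (z i), bracket_swap (z w) (z i)] at pl
  have e2 : r * bracket (z i) (z j) / bracket (z' i) (z' j) * b v * b w * bracket (z v) (z w) =
      r * b v * b w * (bracket (z v) (z w) * bracket (z i) (z j)) / bracket (z' i) (z' j) := by ring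
  rw [e2, eq_div_iff hij']
  linear_combination pl' - r * b v * b w * pl

lemma simplicial_lt {P : Finset (Vert n)} {z : Vert n → ℝ × ℝ} (h3 : 3 ≤ P.card) (hz : Pos P z)
    {v w : Vert n} (hv : v ∈ P) (hw : w ∈ P) (hvw : v < w) (hwh : w ≠ hi P) :
    simplicial P z v < simplicial P z w := by
  obtain ⟨hp1, hp2⟩ := lo_lt_pred_hi h3
  have hm := hi_mem (nonempty_of_three h3)
  have hm' := lo_mem (nonempty_of_three h3)
  have hmp := pred_mem hm
  have hw1 := lt_of_le_of_ne (le_hi hw) hwh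
  have s1 := hz _ hv _ hm (hvw.trans hw1)
  have s2 := hz _ hw _ hm hw1
  have s3 := hz _ hv _ hw hvw
  have s4 := hz _ hmp _ hm hp2
  have s5 := hz.gt hmp hm' hp1
  have s6 := hz _ hm' _ hm (hp1.trans hp2)
  have hpl := bracket_plucker (z v) (z w) (z (lo P)) (z (hi P))
  unfold simplicial
  generalize pred P (hi P) = b at *
  have d1 := mul_neg_of_neg_of_pos s1 s5
  have d2 := mul_neg_of_neg_of_pos s2 s5
  rw [← sub_neg, div_sub_div _ _ d1.ne d2.ne]
  refine div_neg_of_neg_of_pos ?_ (mul_pos_of_neg_of_neg d1 d2)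
  have : bracket (z b) (z (hi P)) * bracket (z b) (z (lo P)) *
      (bracket (z v) (z w) * bracket (z (lo P)) (z (hi P))) < 0 :=
    mul_neg_of_neg_of_pos (mul_neg_of_neg_of_pos s4 s5) (mul_pos_of_neg_of_neg s3 s6)
  linear_combination (exp := 1) this - bracket (z b) (z (hi P)) * bracket (z b) (z (lo P)) * hpl

lemma mem_X_of_simplicial {l : List (Chord n)} (hl : Good l) {t : Space l}
    (h : ∀ P ∈ cells l, ∃ z, Pos P z ∧ ∀ q : Coord l, q.1.1 = P → t q = simplicial P z q.1.2) :
    t ∈ X l := by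
  refine mem_X_of_pos hl fun P hP v hv w hw hvw hwh => ?_
  obtain ⟨z, hz, hs⟩ := h P hP
  have hvh : v ≠ hi P := fun h' => absurd (le_hi hw) (not_le.2 (h' ▸ hvw))
  rw [pos_of_simplicial hl hP hz hs hv hvh, pos_of_simplicial hl hP hz hs hw hwh]
  exact simplicial_lt ((cellSpec hl).card P hP) hz hv hw hvw hwh

lemma simplicial_config {l : List (Chord n)} {t : Space l} {P : Finset (Vert n)}
    (h3 : 3 ≤ P.card) {v : Vert n} (hv : v ≠ hi P) :
    simplicial P (config l t P) v = pos l t P v := by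
  have h := lo_lt_pred_hi h3
  rw [simplicial, bracket_config_hi hv, bracket_config_hi h.2.ne,
    bracket_config hv (h.1.trans h.2).ne, bracket_config h.2.ne (h.1.trans h.2).ne,
    pos_lo h3, pos_pred_hi h3]
  ring

/-! ### The forgetful components of the trivialisation maps -/

section
variable {K l : List (Chord n)} (h : Good (K ++ l)) {t : Space l} (ht : t ∈ X l)
include h ht

lemma pos_config_cellOf {P : Finset (Vert n)} (hP : P ∈ cells (K ++ l)) :
    Pos P (config l t (cellOf l P)) :=
  (pos_config h.tail ht (cellOf_cell h hP).1).mono (cellOf_cell h hP).2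

/-- Forgetting and renormalising does not change cross-ratios of labels of `P`; they may be computed
in the configuration on the big cell. -/
lemma equi_forget {P : Finset (Vert n)} (hP : P ∈ cells (K ++ l)) :
    Equi P (config l t (cellOf l P)) (config (K ++ l) (forget l K t) P) :=
  equi_of_simplicial h hP (pos_config_cellOf h ht hP) fun q hq => by subst hq; rfl

lemma forget_mem_X : forget l K t ∈ X (K ++ l) :=
  mem_X_of_simplicial h fun P hP => ⟨_, pos_config_cellOf h ht hP, fun q hq => by subst hq; rfl⟩

end

/-- The target `(0,1)^K × X_{J ∪ K}` of the trivialisation map. -/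
def Box (l K : List (Chord n)) : Set ({c // c ∈ K} ⊕ Coord (K ++ l) → ℝ) :=
  {y | (∀ c, 0 < y (Sum.inl c) ∧ y (Sum.inl c) < 1) ∧ (fun q => y (Sum.inr q)) ∈ X (K ++ l)}

lemma normalCoord_singleton (l : List (Chord n)) (c : Chord n) (t : Space l) :
    normalCoord l [c] c t = u l c t := by
  simp [normalCoord, u]

lemma u_mem {l : List (Chord n)} (hl : Good l) {t : Space l} (ht : t ∈ X l) {c : Chord n}
    (hc : c ∈ chi l) : 0 < u l c t ∧ u l c t < 1 :=
  crossRatio_mem (pos_config hl ht (cellOf_ends_mem hl hc)) (proper_cellOf hl hc)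

section
variable {l : List (Chord n)} {c : Chord n} (hl : Good l) (hc : c ∈ chi l)
include hl hc

lemma inner_mem_cells : inner c (cellOf l (ends c)) ∈ cells (c :: l) :=
  (mem_cells_cons_iff hl hc).2 (Or.inr (Or.inl rfl))

lemma outer_mem_cells : outer c (cellOf l (ends c)) ∈ cells (c :: l) :=
  (mem_cells_cons_iff hl hc).2 (Or.inr (Or.inr rfl))

lemma cellOf_inner : cellOf l (inner c (cellOf l (ends c))) = cellOf l (ends c) :=
  cellOf_eq_of_subset hl (cellOf_ends_mem hl hc) (inner_subset _ _)
    (proper_cellOf hl hc).card_inner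

lemma cellOf_outer : cellOf l (outer c (cellOf l (ends c))) = cellOf l (ends c) :=
  cellOf_eq_of_subset hl (cellOf_ends_mem hl hc) (outer_subset _ _)
    (proper_cellOf hl hc).card_outer

/-- The image determines the configuration on both halves up to equivalence, and u_c; on the cell of
`c` one applies `equi_glue`, and the other cells are unchanged. -/
lemma step_injOn : Set.InjOn (triv l [c]) (X l) := by
  intro t ht t' ht' heq
  have hgood : Good ([c] ++ l) := ⟨hc, hl⟩
  set Q := cellOf l (ends c) with hQ
  have hQm := cellOf_ends_mem hl hc
  have hp := proper_cellOf hl hc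
  have hf : forget l [c] t = forget l [c] t' := funext fun q => congrFun heq (Sum.inr q)
  have hx : u l c t = u l c t' := by
    have := congrFun heq (Sum.inl ⟨c, by simp⟩)
    simpa only [triv, normalCoord_singleton] using this
  have key : ∀ P ∈ cells (c :: l), Equi P (config l t (cellOf l P)) (config l t' (cellOf l P)) := by
    intro P hP
    have e1 := equi_forget hgood ht hP
    have e2 := equi_forget hgood ht' hP
    rw [hf] at e1
    exact e1.trans e2.symm
  have hEq : ∀ P ∈ cells l, Equi P (config l t P) (config l t' P) := by
    intro P hP
    by_cases hPQ : P = Q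
    · subst hPQ
      have k1 := key _ (inner_mem_cells hl hc)
      have k2 := key _ (outer_mem_cells hl hc)
      rw [cellOf_inner hl hc] at k1
      rw [cellOf_outer hl hc] at k2
      exact equi_glue hp (pos_config hl ht hQm) (pos_config hl ht' hQm) k1 k2 hx.symm
    · have := key P ((mem_cells_cons_iff hl hc).2 (Or.inl ⟨hP, hPQ⟩))
      rwa [cellOf_self hl hP] at this
  funext q
  have h3 := (cellSpec hl).card _ q.2.1
  rw [← pos_coord t q, ← pos_coord t' q, ← simplicial_config h3 q.2.2.2.2.1,
    ← simplicial_config h3 q.2.2.2.2.1]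
  exact ((hEq _ q.2.1).simplicial_eq q.2.2.1).symm

lemma step_mapsTo : Set.MapsTo (triv l [c]) (X l) (Box l [c]) := by
  intro t ht
  have hgood : Good ([c] ++ l) := ⟨hc, hl⟩
  refine ⟨?_, forget_mem_X hgood ht⟩
  rintro ⟨d, hd⟩
  obtain rfl := List.mem_singleton.1 hd
  simp only [triv, normalCoord_singleton]
  exact u_mem hl ht hc

/-- The preimage is written down: the inner configuration is inserted between the points of the ends
of `c` in the outer one by a linear map, whose one free parameter adjusts u_c. -/
lemma step_surjOn : Set.SurjOn (triv l [c]) (X l) (Box l [c]) := by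
  intro w hw
  obtain ⟨hw1, hw2⟩ := hw
  have hgood : Good (c :: l) := ⟨hc, hl⟩
  obtain ⟨hx0, hx1⟩ := hw1 ⟨c, by simp⟩
  set x := w (Sum.inl ⟨c, by simp⟩) with hx
  set y : Space (c :: l) := fun q => w (Sum.inr q) with hy
  have hyX : y ∈ X (c :: l) := hw2
  set Q := cellOf l (ends c) with hQ
  have hQm := cellOf_ends_mem hl hc
  have hp := proper_cellOf hl hc
  have hlt := chord_lt c
  set o := config (c :: l) y (outer c Q) with ho
  set η := config (c :: l) y (inner c Q) with hη
  have hom := outer_mem_cells hl hc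
  have him := inner_mem_cells hl hc
  have po : Pos (outer c Q) o := pos_config hgood hyX hom
  have pη : Pos (inner c Q) η := pos_config hgood hyX him
  have io := hp.fst_mem_outer
  have jo := hp.snd_mem_outer
  have ao := hp.pred_fst_mem_outer
  have ii := hp.fst_mem_inner
  have ji := hp.snd_mem_inner
  have pi := hp.pred_snd_mem_inner
  set i := c.1.1
  set j := c.1.2
  have haa : pred Q i < i ∨ j < pred Q i := by
    rcases hp.pred_fst.2 with h | h
    · exact Or.inl h.1
    · exact Or.inr (by rw [h.2.1]; exact h.2.2)
  have hip : i < pred Q j := hp.pred_snd.2.1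
  have hpj : pred Q j < j := hp.pred_snd.2.2.1
  have hpo : pred Q j ∉ outer c Q := by
    rw [mem_outer]; grind
  have ci := (cellSpec hgood).card _ him
  have η_hi : η j = (1, 0) := by
    have := config_hi (c :: l) y (inner c Q)
    rwa [hp.hi_inner] at this
  have η_ne : ∀ v, v ≠ j → η v = (pos (c :: l) y (inner c Q) v, 1) := fun v hv =>
    config_of_ne (by rw [hp.hi_inner]; exact hv)
  have η_lo : η i = (0, 1) := by
    rw [η_ne i hlt.ne]
    have := pos_lo (l := c :: l) (t := y) ci
    rw [hp.lo_inner] at this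
    rw [this]
  have η_p : η (pred Q j) = (1, 1) := by
    rw [η_ne _ hpj.ne]
    have := pos_pred_hi (l := c :: l) (t := y) ci
    rw [hp.hi_inner, hp.pred_inner ji hlt.ne'] at this
    rw [this]
  have η_pos : ∀ v ∈ Q, v ∉ outer c Q → η v = ((η v).1, 1) ∧ 0 < (η v).1 ∧ i < v ∧ v < j := by
    intro v hv hvo
    have hv' : i < v ∧ v < j := by
      rw [mem_outer] at hvo; grind
    have hvi : v ∈ inner c Q := mem_inner.2 ⟨hv, hv'.1.le, hv'.2.le⟩
    have e := η_ne v hv'.2.ne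
    refine ⟨by rw [e], ?_, hv'⟩
    have := pη i ii v hvi hv'.1
    rw [η_lo, e] at this
    rw [e]
    simp only [bracket] at this
    simp only
    linarith
  set B := |bracket (o (pred Q i)) (o i)| with hB
  set A := |bracket (o (pred Q i)) (o j)| with hA
  have hai : pred Q i ≠ i := by rcases haa with h | h <;> order
  have haj : pred Q i ≠ j := by rcases haa with h | h <;> order
  have hB0 : 0 < B := abs_pos.2 (po.sep _ ao _ io hai)
  have hA0 : 0 < A := abs_pos.2 (po.sep _ ao _ jo haj)
  -- If the inner point (1, 1) goes to β o_j + α o_i, then u_c = β A / (β A + α B); this choice of α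
  -- and β makes it x.
  set α := (1 - x) * A with hα
  set β := x * B with hβ
  have hα0 : 0 < α := mul_pos (by linarith) hA0
  have hβ0 : 0 < β := mul_pos hx0 hB0
  have oij := po _ io _ jo hlt
  -- The linear map sends (0, 1), the inner point i, to α o_i and (1, 0), the inner point j, to β
  -- o_j. The inner points have positive first coordinate and land between o_i and o_j.
  set ζ : Vert n → ℝ × ℝ := fun v => if v ∈ outer c Q then o v else
    ((η v).1 * β * (o j).1 + (η v).2 * α * (o i).1, (η v).1 * β * (o j).2 + (η v).2 * α * (o i).2)
    with hζ
  have ζo : ∀ v ∈ outer c Q, ζ v = o v := fun v hv => if_pos hv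
  have ζi : ∀ v, v ∉ outer c Q → ζ v = ((η v).1 * β * (o j).1 + (η v).2 * α * (o i).1,
    (η v).1 * β * (o j).2 + (η v).2 * α * (o i).2) := fun v hv => if_neg hv
  have br_o : ∀ v w, v ∉ outer c Q → w ∈ outer c Q → bracket (ζ v) (ζ w) =
      (η v).1 * β * bracket (o j) (o w) + (η v).2 * α * bracket (o i) (o w) := by
    intro v w hv hw
    rw [ζi v hv, ζo w hw]; simp only [bracket]; ring
  have br_i : ∀ v w, v ∉ outer c Q → w ∉ outer c Q → bracket (ζ v) (ζ w) =
      α * β * bracket (o j) (o i) * bracket (η v) (η w) := by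
    intro v w hv hw
    rw [ζi v hv, ζi w hw]; simp only [bracket]; ring
  have mixed : ∀ v ∈ Q, v ∉ outer c Q → ∀ w ∈ outer c Q,
      (v < w → bracket (ζ v) (ζ w) < 0) ∧ (w < v → 0 < bracket (ζ v) (ζ w)) := by
    intro v hv hvo w hw
    obtain ⟨e1, e2, e3, e4⟩ := η_pos v hv hvo
    have e5 : (η v).2 = 1 := by rw [e1]
    rw [br_o v w hvo hw, e5]
    have hw' := (mem_outer.1 hw).2
    constructor
    · intro hvw
      have hjw : j ≤ w := by rcases hw' with h | h <;> order
      have s1 := po _ io _ hw (hlt.trans_le hjw)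
      have s2 : bracket (o j) (o w) ≤ 0 := by
        rcases eq_or_lt_of_le hjw with h | h
        · rw [h]; simp only [bracket]; nlinarith
        · exact (po _ jo _ hw h).le
      nlinarith [mul_pos e2 hβ0]
    · intro hwv
      have hwi : w ≤ i := by rcases hw' with h | h <;> order
      have s1 := po.gt jo hw (hwi.trans_lt hlt)
      have s2 : 0 ≤ bracket (o i) (o w) := by
        rcases eq_or_lt_of_le hwi with h | h
        · rw [h]; simp only [bracket]; nlinarith
        · exact (po.gt io hw h).le
      have := mul_pos (mul_pos e2 hβ0) s1
      nlinarith
  have pζ : Pos Q ζ := by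
    intro v hv w hw hvw
    by_cases hvo : v ∈ outer c Q
    · by_cases hwo : w ∈ outer c Q
      · rw [ζo v hvo, ζo w hwo]; exact po v hvo w hwo hvw
      · rw [bracket_swap]
        have := (mixed w hw hwo v hvo).2 hvw
        linarith
    · by_cases hwo : w ∈ outer c Q
      · exact (mixed v hv hvo w hwo).1 hvw
      · rw [br_i v w hvo hwo]
        have e1 := (η_pos v hv hvo).2.2
        have e2 := (η_pos w hw hwo).2.2
        have := pη v (mem_inner.2 ⟨hv, e1.1.le, e1.2.le⟩) w (mem_inner.2 ⟨hw, e2.1.le, e2.2.le⟩) hvw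
        have s := po.gt jo io hlt
        exact mul_neg_of_pos_of_neg (mul_pos (mul_pos hα0 hβ0) s) this
  have eqi : Equi (inner c Q) ζ η := by
    have s := po.gt jo io hlt
    set m : Vert n → ℝ := fun v => if v = i then α else if v = j then β else 1 with hm
    have hmv : ∀ v ∈ inner c Q, m v * (ζ v).1 = (η v).1 * β * (o j).1 + (η v).2 * α * (o i).1 ∧
        m v * (ζ v).2 = (η v).1 * β * (o j).2 + (η v).2 * α * (o i).2 := by
      intro v hv
      by_cases h1 : v = i
      · subst h1
        rw [ζo _ io, η_lo]; simp [hm]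
      · by_cases h2 : v = j
        · subst h2
          rw [ζo _ jo, η_hi]; simp [hm, hlt.ne']
        · have : v ∉ outer c Q := by
            rw [mem_inner] at hv; rw [mem_outer]; grind
          rw [ζi v this]; simp [hm, h1, h2]
    have hk : α * β * bracket (o j) (o i) ≠ 0 := (mul_pos (mul_pos hα0 hβ0) s).ne'
    refine ⟨(α * β * bracket (o j) (o i))⁻¹, m, inv_ne_zero hk, ?_, ?_⟩
    · intro v _
      simp only [hm]; split_ifs
      · exact hα0.ne'
      · exact hβ0.ne'
      · exact one_ne_zero
    · intro v hv w hw
      have : m v * m w * bracket (ζ v) (ζ w) =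
          (m v * (ζ v).1) * (m w * (ζ w).2) - (m v * (ζ v).2) * (m w * (ζ w).1) := by
        simp only [bracket]; ring
      rw [mul_assoc, mul_assoc, ← mul_assoc (m v), this, (hmv v hv).1, (hmv v hv).2, (hmv w hw).1,
        (hmv w hw).2, eq_inv_mul_iff_mul_eq₀ hk]
      simp only [bracket]; ring
  have hcr : crossRatio Q ζ c = x := by
    have e1 : ζ (pred Q j) = (β * (o j).1 + α * (o i).1, β * (o j).2 + α * (o i).2) := by
      rw [ζi _ hpo, η_p]; simp
    change bracket (ζ (pred Q i)) (ζ j) * bracket (ζ i) (ζ (pred Q j)) /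
      (bracket (ζ (pred Q i)) (ζ (pred Q j)) * bracket (ζ i) (ζ j)) = x
    rw [e1, ζo _ ao, ζo _ io, ζo _ jo]
    have e2 : bracket (o i) (β * (o j).1 + α * (o i).1, β * (o j).2 + α * (o i).2) =
      β * bracket (o i) (o j) := by simp only [bracket]; ring
    have e3 : bracket (o (pred Q i)) (β * (o j).1 + α * (o i).1, β * (o j).2 + α * (o i).2) =
      β * bracket (o (pred Q i)) (o j) + α * bracket (o (pred Q i)) (o i) := by
      simp only [bracket]; ring
    rw [e2, e3, hα, hβ]
    have hn := oij.ne
    rcases haa with h | h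
    · have s1 := po _ ao _ io h
      have s2 := po _ ao _ jo (h.trans hlt)
      rw [hA, hB, abs_of_neg s1, abs_of_neg s2]
      have n1 := s1.ne
      have n2 := s2.ne
      rw [div_eq_iff]
      · ring
      · refine mul_ne_zero ?_ hn
        have : x * -bracket (o (pred Q i)) (o i) * bracket (o (pred Q i)) (o j) +
          (1 - x) * -bracket (o (pred Q i)) (o j) * bracket (o (pred Q i)) (o i) =
          - (bracket (o (pred Q i)) (o i) * bracket (o (pred Q i)) (o j)) := by ring
        rw [this]
        exact neg_ne_zero.2 (mul_ne_zero n1 n2)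
    · have s1 := po.gt ao io (hlt.trans h)
      have s2 := po.gt ao jo h
      rw [hA, hB, abs_of_pos s1, abs_of_pos s2]
      have n1 := s1.ne'
      have n2 := s2.ne'
      rw [div_eq_iff]
      · ring
      · refine mul_ne_zero ?_ hn
        have : x * bracket (o (pred Q i)) (o i) * bracket (o (pred Q i)) (o j) +
          (1 - x) * bracket (o (pred Q i)) (o j) * bracket (o (pred Q i)) (o i) =
          bracket (o (pred Q i)) (o i) * bracket (o (pred Q i)) (o j) := by ring
        rw [this]
        exact mul_ne_zero n1 n2
  -- The cell of `c` receives the glued configuration, the other cells keep their coordinates.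
  set t : Space l := fun q => if q.1.1 = Q then simplicial Q ζ q.1.2 else pos (c :: l) y q.1.1 q.1.2
    with ht
  have hother : ∀ P ∈ cells l, P ≠ Q → P ∈ cells (c :: l) := fun P hP h =>
    (mem_cells_cons_iff hl hc).2 (Or.inl ⟨hP, h⟩)
  have sQ : ∀ q : Coord l, q.1.1 = Q → t q = simplicial Q ζ q.1.2 := fun q hq => if_pos hq
  have sP : ∀ P ∈ cells l, P ≠ Q → ∀ q : Coord l, q.1.1 = P →
      t q = simplicial P (config (c :: l) y P) q.1.2 := by
    intro P hP hPQ q hq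
    subst hq
    rw [simplicial_config ((cellSpec hl).card _ hP) q.2.2.2.2.1]
    exact if_neg hPQ
  have htX : t ∈ X l := by
    refine mem_X_of_simplicial hl fun P hP => ?_
    by_cases hPQ : P = Q
    · exact ⟨ζ, hPQ ▸ pζ, fun q hq => hPQ ▸ sQ q (hq.trans hPQ)⟩
    · exact ⟨_, pos_config hgood hyX (hother P hP hPQ), sP P hP hPQ⟩
  have eQ : Equi Q ζ (config l t Q) := equi_of_simplicial hl hQm pζ sQ
  refine ⟨t, htX, funext ?_⟩
  rintro (⟨d, hd⟩ | q)
  · obtain rfl := List.mem_singleton.1 hd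
    simp only [triv, normalCoord_singleton]
    rw [← hx, ← hcr]
    exact eQ.crossRatio_eq hp.1 hp.2
  · change simplicial q.1.1 (config l t (cellOf l q.1.1)) q.1.2 = y q
    have h3 := (cellSpec hgood).card _ q.2.1
    rw [← pos_coord y q, ← simplicial_config h3 q.2.2.2.2.1]
    rcases (mem_cells_cons_iff hl hc).1 q.2.1 with ⟨h, hne⟩ | h | h
    · rw [cellOf_self hl h]
      exact (equi_of_simplicial hl h (pos_config hgood hyX (hother _ h hne))
        (sP _ h hne)).simplicial_eq q.2.2.1
    · have hv := q.2.2.1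
      rw [h] at hv ⊢
      rw [cellOf_inner hl hc, (eQ.mono (inner_subset _ _)).simplicial_eq hv]
      exact (eqi.simplicial_eq hv).symm
    · have hv := q.2.2.1
      rw [h] at hv ⊢
      rw [cellOf_outer hl hc, (eQ.mono (outer_subset _ _)).simplicial_eq hv]
      unfold simplicial
      have m1 := hi_mem ⟨_, hv⟩
      have m2 := lo_mem ⟨_, hv⟩
      rw [ζo _ hv, ζo _ m1, ζo _ m2, ζo _ (pred_mem m1)]

lemma step_bijOn : Set.BijOn (triv l [c]) (X l) (Box l [c]) :=
  ⟨step_mapsTo hl hc, step_injOn hl hc, step_surjOn hl hc⟩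

end

/-! ### The canonical density and the Jacobian of one cut -/

/-- The interior vertices of `P`, other than the first and the last one. -/
def mid (P : Finset (Vert n)) : Finset (Vert n) := (P.erase (lo P)).erase (hi P)

/-- The vertices of `P` which carry a simplicial coordinate. -/
def free (P : Finset (Vert n)) : Finset (Vert n) := (mid P).erase (pred P (hi P))

/-- The product of the consecutive differences of a configuration. -/
def gap (z : Vert n → ℝ × ℝ) (P : Finset (Vert n)) : ℝ :=
  ∏ v ∈ mid P, bracket (z v) (z (pred P v))

/-- The coefficient of the canonical form of the cell `X_J`. -/
def dens (l : List (Chord n)) (t : Space l) : ℝ := ∏ P ∈ cells l, (gap (config l t P) P)⁻¹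

lemma mem_mid {P : Finset (Vert n)} {v : Vert n} : v ∈ mid P ↔ v ∈ P ∧ v ≠ lo P ∧ v ≠ hi P := by
  simp only [mid, Finset.mem_erase]; tauto

lemma mem_free {P : Finset (Vert n)} {v : Vert n} :
    v ∈ free P ↔ v ∈ P ∧ v ≠ lo P ∧ v ≠ hi P ∧ v ≠ pred P (hi P) := by
  simp only [free, Finset.mem_erase, mem_mid]; tauto

lemma gap_pos {z : Vert n → ℝ × ℝ} {P : Finset (Vert n)} (hz : Pos P z) : 0 < gap z P := by
  refine Finset.prod_pos fun v hv => ?_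
  rw [mem_mid] at hv
  obtain ⟨a, b, -⟩ := pred_spec' hv.1 hv.2.1
  exact hz.gt hv.1 a b

lemma dens_pos {l : List (Chord n)} (hl : Good l) {t : Space l} (ht : t ∈ X l) : 0 < dens l t :=
  Finset.prod_pos fun _ hP => inv_pos.2 (gap_pos (pos_config hl ht hP))

lemma prod_coord (l : List (Chord n)) (F : Finset (Vert n) → Vert n → ℝ) :
    ∏ q : Coord l, F q.1.1 q.1.2 = ∏ P ∈ cells l, ∏ v ∈ free P, F P v := by
  classical
  refine Eq.trans ?_ (Finset.prod_finset_product
    (Finset.univ.filter fun q : Finset (Vert n) × Vert n =>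
      q.1 ∈ cells l ∧ q.2 ∈ q.1 ∧ q.2 ≠ lo q.1 ∧ q.2 ≠ hi q.1 ∧ q.2 ≠ pred q.1 (hi q.1))
    (cells l) free (by simp [mem_free]) (f := fun q => F q.1 q.2))
  exact (Finset.prod_subtype _ (by simp) (fun q : Finset (Vert n) × Vert n => F q.1 q.2)).symm

/-- Derivative of the normalised coordinate of the point labelled `v`, when it moves. -/
def slope (z : Vert n → ℝ × ℝ) (P : Finset (Vert n)) (v : Vert n) : ℝ :=
  bracket (z (pred P (hi P))) (z (hi P)) * bracket (z (lo P)) (z (hi P)) /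
    (bracket (z (pred P (hi P))) (z (lo P)) * bracket (z v) (z (hi P)) ^ 2)

lemma slope_pos {z : Vert n → ℝ × ℝ} {P : Finset (Vert n)} (h3 : 3 ≤ P.card) (hz : Pos P z)
    {v : Vert n} (hv : v ∈ free P) : 0 < slope z P v := by
  obtain ⟨hp1, hp2⟩ := lo_lt_pred_hi h3
  have hm := hi_mem (nonempty_of_three h3)
  have hm' := lo_mem (nonempty_of_three h3)
  have hmp := pred_mem hm
  rw [mem_free] at hv
  refine div_pos (mul_pos_of_neg_of_neg (hz _ hmp _ hm hp2) (hz _ hm' _ hm (hp1.trans hp2)))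
    (mul_pos (hz.gt hmp hm' hp1) ?_)
  exact sq_pos_of_neg (hz _ hv.1 _ hm (lt_of_le_of_ne (le_hi hv.1) hv.2.2.1))

/-- A difference of consecutive normalised coordinates is the slope times the bracket of the two
points times a quotient of brackets with the point `hi P`. The quotients telescope over `P`. -/
lemma prod_slope {l : List (Chord n)} (hl : Good l) {y : Space l} {P : Finset (Vert n)}
    (hP : P ∈ cells l) {z : Vert n → ℝ × ℝ} (hz : Pos P z)
    (h : ∀ q : Coord l, q.1.1 = P → y q = simplicial P z q.1.2) :
    (∏ v ∈ free P, slope z P v) * gap z P =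
      bracket (z (pred P (hi P))) (z (lo P)) * gap (config l y P) P := by
  have h3 := (cellSpec hl).card P hP
  obtain ⟨hp1, hp2⟩ := lo_lt_pred_hi h3
  have hm := hi_mem (nonempty_of_three h3)
  have hm' := lo_mem (nonempty_of_three h3)
  have hmp := pred_mem hm
  have hps := fun v hv hvh => pos_of_simplicial (v := v) hl hP hz h hv hvh
  have hmid : mid P = P.filter fun a => lo P < a ∧ a ≤ pred P (hi P) := by
    ext a
    rw [mem_mid, Finset.mem_filter]
    constructor
    · rintro ⟨h1, h2, h3⟩
      have := lt_of_le_of_ne (le_hi h1) h3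
      exact ⟨h1, lt_of_le_of_ne (lo_le h1) (Ne.symm h2), (pred_spec ⟨a, h1, this⟩).2.2 a h1 this⟩
    · rintro ⟨h1, h2, h3⟩
      exact ⟨h1, h2.ne', (h3.trans_lt hp2).ne⟩
  have hpm : pred P (hi P) ∈ mid P := mem_mid.2 ⟨hmp, hp1.ne', hp2.ne⟩
  have b1 := hz.sep _ hmp _ hm hp2.ne
  have b2 := hz.sep _ hmp _ hm' hp1.ne'
  have b3 := hz.sep _ hm' _ hm (hp1.trans hp2).ne
  have e1 : gap (config l y P) P = ∏ v ∈ mid P, slope z P v * bracket (z v) (z (pred P v)) *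
      (bracket (z v) (z (hi P)) / bracket (z (pred P v)) (z (hi P))) := by
    refine Finset.prod_congr rfl fun v hv => ?_
    rw [mem_mid] at hv
    obtain ⟨a1, a2, -⟩ := pred_spec' hv.1 hv.2.1
    have hne : pred P v ≠ hi P := (a2.trans_le (le_hi hv.1)).ne
    rw [bracket_config hv.2.2 hne, hps v hv.1 hv.2.2, hps _ a1 hne]
    have b4 := hz.sep _ hv.1 _ hm hv.2.2
    have b5 := hz.sep _ a1 _ hm hne
    have hpl := bracket_plucker (z v) (z (pred P v)) (z (lo P)) (z (hi P))
    unfold simplicial slope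
    generalize pred P (hi P) = b at *
    field_simp
    linear_combination -hpl
  rw [e1, Finset.prod_mul_distrib, Finset.prod_mul_distrib]
  have e2 : ∏ v ∈ mid P, bracket (z v) (z (hi P)) / bracket (z (pred P v)) (z (hi P)) =
      bracket (z (pred P (hi P))) (z (hi P)) / bracket (z (lo P)) (z (hi P)) := by
    rw [hmid]
    exact prod_Ioc_div hm' hmp hp1.le (fun v => bracket (z v) (z (hi P))) fun a ha _ hap =>
      hz.sep _ ha _ hm (hap.trans_lt hp2).ne
  -- The label `pred P (hi P)` contributes to the gaps but carries no coordinate; its slope is split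
  -- off and produces the bracket on the right.
  rw [e2, ← Finset.mul_prod_erase _ _ hpm]
  change _ = _ * (_ * (∏ v ∈ free P, slope z P v) * gap z P * _)
  unfold slope
  field_simp

/-! ### Derivatives of configurations with respect to the coordinates -/

section
variable {l : List (Chord n)}

lemma config_update_ne {t : Space l} {q : Coord l} {P : Finset (Vert n)} {v : Vert n}
    (h : q.1 ≠ (P, v)) (x : ℝ) : config l (Function.update t q x) P v = config l t P v := by
  unfold config
  split_ifs with h1 h2 h3 h4
  · rfl
  · rfl
  · rfl
  · rw [Function.update_of_ne]
    exact fun h' => h (by rw [← h'])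
  · rfl

lemma config_update_self {t : Space l} (q : Coord l) (x : ℝ) :
    config l (Function.update t q x) q.1.1 q.1.2 = (x, 1) := by
  rw [config_of_ne q.2.2.2.2.1, pos_coord, Function.update_self]

lemma differentiable_config (P : Finset (Vert n)) (v : Vert n) :
    Differentiable ℝ fun t : Space l => (config l t P v).1 := by
  unfold config
  split_ifs
  · exact differentiable_const _
  · exact differentiable_const _
  · exact differentiable_const _
  · exact differentiable_apply _
  · exact differentiable_const _

lemma config_snd (t t' : Space l) (P : Finset (Vert n)) (v : Vert n) :
    (config l t P v).2 = (config l t' P v).2 := by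
  unfold config
  split_ifs <;> rfl

lemma differentiable_bracket (P : Finset (Vert n)) (v w : Vert n) :
    Differentiable ℝ fun t : Space l => bracket (config l t P v) (config l t P w) := by
  unfold bracket
  have h1 := differentiable_config (l := l) P v
  have h2 := differentiable_config (l := l) P w
  have h3 : ∀ x, (fun t : Space l => (config l t P x).2) = fun _ => (config l 0 P x).2 :=
    fun x => funext fun t => config_snd t 0 P x
  have h4 : Differentiable ℝ fun t : Space l => (config l t P v).2 := by
    rw [h3]; exact differentiable_const _
  have h5 : Differentiable ℝ fun t : Space l => (config l t P w).2 := by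
    rw [h3]; exact differentiable_const _
  exact (h1.fun_mul h5).fun_sub (h2.fun_mul h4)

lemma differentiableAt_xr {t : Space l} {P : Finset (Vert n)} {a b c d : Vert n}
    (h1 : bracket (config l t P a) (config l t P c) ≠ 0)
    (h2 : bracket (config l t P b) (config l t P d) ≠ 0) :
    DifferentiableAt ℝ (fun t : Space l => xr (config l t P) a b c d) t := by
  unfold xr
  simp only [div_eq_mul_inv]
  have k := fun v w => (differentiable_bracket (l := l) P v w) t
  exact ((k a d).fun_mul (k b c)).fun_mul (((k a c).fun_mul (k b d)).fun_inv (mul_ne_zero h1 h2))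

lemma hasDerivAt_simplicial {t : Space l} (q : Coord l) {P : Finset (Vert n)}
    (h : q.1.2 ∈ free P) (hne : bracket (config l t q.1.1 q.1.2) (config l t q.1.1 (hi P)) ≠ 0) :
    HasDerivAt (fun x => simplicial P (config l (Function.update t q x) q.1.1) q.1.2)
      (slope (config l t q.1.1) P q.1.2) (t q) := by
  rw [mem_free] at h
  have e : ∀ (w : Vert n) (x : ℝ), q.1.2 ≠ w →
      config l (Function.update t q x) q.1.1 w = config l t q.1.1 w := fun w x hw =>
    config_update_ne (fun h' => hw (by rw [h'])) x
  have hz : config l t q.1.1 q.1.2 = (t q, 1) := by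
    rw [config_of_ne q.2.2.2.2.1, pos_coord]
  unfold slope
  rw [hz] at hne ⊢
  have : (fun x => simplicial P (config l (Function.update t q x) q.1.1) q.1.2) = fun x =>
      bracket (x, 1) (config l t q.1.1 (lo P)) *
        bracket (config l t q.1.1 (pred P (hi P))) (config l t q.1.1 (hi P)) /
      (bracket (x, 1) (config l t q.1.1 (hi P)) *
        bracket (config l t q.1.1 (pred P (hi P))) (config l t q.1.1 (lo P))) := by
    funext x
    unfold simplicial
    rw [config_update_self, e _ x h.2.1, e _ x h.2.2.1, e _ x h.2.2.2]
  rw [this]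
  generalize config l t q.1.1 (lo P) = b at *
  generalize config l t q.1.1 (hi P) = d at *
  generalize config l t q.1.1 (pred P (hi P)) = a at *
  generalize t q = x0 at *
  have lin : ∀ b : ℝ × ℝ, HasDerivAt (fun x : ℝ => bracket (x, 1) b) b.2 x0 := by
    intro b
    simp only [bracket]
    exact (((hasDerivAt_id' x0).mul_const b.2).sub_const (b.1 * 1)).congr_deriv (by ring)
  have h1 := ((lin b).fun_div (lin d) hne).mul_const (bracket a d / bracket a b)
  have e2 : (fun x : ℝ => bracket (x, 1) b * bracket a d / (bracket (x, 1) d * bracket a b)) =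
      fun x => bracket (x, 1) b / bracket (x, 1) d * (bracket a d / bracket a b) := by
    funext x; rw [mul_div_mul_comm]
  rw [e2]
  refine h1.congr_deriv ?_
  have e3 : b.2 * bracket (x0, 1) d - bracket (x0, 1) b * d.2 = bracket b d := by
    simp only [bracket]; ring
  rw [e3, div_mul_div_comm]
  congr 1 <;> ring

end

/-! ### Coordinates before and after a cut -/

section
variable {l : List (Chord n)} {c : Chord n} (hl : Good l) (hc : c ∈ chi l)

/-- The label of the coordinate which is not a coordinate of one of the two halves. -/
def extra (l : List (Chord n)) (c : Chord n) : Vert n :=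
  if c.1.2 = hi (cellOf l (ends c)) then c.1.1 else pred (cellOf l (ends c)) c.1.2

/-- A label on the outer side of `c`. -/
def refLabel (l : List (Chord n)) (c : Chord n) : Vert n :=
  if c.1.2 = hi (cellOf l (ends c)) then lo (cellOf l (ends c)) else hi (cellOf l (ends c))

include hl hc

lemma extra_mem_free : extra l c ∈ free (cellOf l (ends c)) := by
  have hp := proper_cellOf hl hc
  set Q := cellOf l (ends c) with hQ
  have h3 := (cellSpec hl).card _ (cellOf_ends_mem hl hc)
  obtain ⟨a1, a2, a3, a4⟩ := hp.pred_snd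
  have h1 := lo_le hp.1
  have h2 := le_hi hp.2
  rw [mem_free, extra, ← hQ]
  split_ifs with h
  · obtain ⟨v, hv, hv'⟩ := hp.outside
    have := le_hi hv
    have := lo_le hv
    rw [← h]
    refine ⟨hp.1, ?_, ?_, ?_⟩ <;> grind
  · have h5 := lt_of_le_of_ne h2 h
    have h6 := (pred_spec ⟨_, hp.2, h5⟩).2.2 _ hp.2 h5
    refine ⟨a1, ?_, ?_, ?_⟩ <;> order

lemma lo_lt_fst_of_hi (h : c.1.2 = hi (cellOf l (ends c))) : lo (cellOf l (ends c)) < c.1.1 := by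
  have hp := proper_cellOf hl hc
  obtain ⟨v, hv, hv'⟩ := hp.outside
  have := le_hi hv
  have := lo_le hv
  grind

lemma refLabel_spec : refLabel l c ∈ cellOf l (ends c) ∧
    (refLabel l c < c.1.1 ∨ c.1.2 < refLabel l c) := by
  have hp := proper_cellOf hl hc
  rw [refLabel]
  split_ifs with h
  · exact ⟨lo_mem ⟨_, hp.1⟩, Or.inl (lo_lt_fst_of_hi hl hc h)⟩
  · exact ⟨hi_mem ⟨_, hp.1⟩, Or.inr (lt_of_le_of_ne (le_hi hp.2) h)⟩

lemma pred_hi_outer : pred (outer c (cellOf l (ends c))) (hi (cellOf l (ends c))) =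
    if c.1.2 = hi (cellOf l (ends c)) then c.1.1
    else pred (cellOf l (ends c)) (hi (cellOf l (ends c))) := by
  have hp := proper_cellOf hl hc
  split_ifs with h
  · rw [← h, hp.pred_outer_snd]
  · exact hp.pred_outer (by rw [← hp.hi_outer]; exact hi_mem ⟨_, hp.fst_mem_outer⟩) (Ne.symm h)

lemma free_inner_iff {v : Vert n} : v ∈ free (inner c (cellOf l (ends c))) ↔
    v ∈ cellOf l (ends c) ∧ c.1.1 < v ∧ v < c.1.2 ∧ v ≠ pred (cellOf l (ends c)) c.1.2 := by
  have hp := proper_cellOf hl hc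
  rw [mem_free, hp.lo_inner, hp.hi_inner, hp.pred_inner hp.snd_mem_inner (chord_lt c).ne', mem_inner]
  grind

lemma free_outer_iff {v : Vert n} : v ∈ free (outer c (cellOf l (ends c))) ↔
    v ∈ free (cellOf l (ends c)) ∧ (v ≤ c.1.1 ∨ c.1.2 ≤ v) ∧
      (c.1.2 = hi (cellOf l (ends c)) → v ≠ c.1.1) := by
  have hp := proper_cellOf hl hc
  rw [mem_free, hp.lo_outer, hp.hi_outer, pred_hi_outer hl hc, mem_outer, mem_free]
  obtain ⟨a1, a2, a3, a4⟩ := hp.pred_snd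
  split_ifs with h
  · rw [← h]; grind
  · grind

lemma free_subset_of_cell {P : Finset (Vert n)} (hP : P ∈ cells (c :: l)) {v : Vert n}
    (hv : v ∈ free P) : v ∈ free (cellOf l P) ∧ (cellOf l P, v) ≠ (cellOf l (ends c), extra l c) := by
  have hp := proper_cellOf hl hc
  have hex := extra_mem_free hl hc
  obtain ⟨a1, a2, a3, a4⟩ := hp.pred_snd
  rcases (mem_cells_cons_iff hl hc).1 hP with ⟨h, hne⟩ | h | h
  · rw [cellOf_self hl h]
    exact ⟨hv, fun h' => hne (Prod.mk.inj h').1⟩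
  · rw [h] at hv ⊢
    rw [cellOf_inner hl hc]
    rw [free_inner_iff hl hc] at hv
    have h1 := lo_le hp.1
    have h2 := le_hi hp.2
    refine ⟨mem_free.2 ⟨hv.1, by order, by order, ?_⟩, fun h' => ?_⟩
    · by_cases h : c.1.2 = hi (cellOf l (ends c))
      · rw [← h]; exact hv.2.2.2
      · have h5 := lt_of_le_of_ne h2 h
        have h6 := (pred_spec ⟨_, hp.2, h5⟩).2.2 _ hp.2 h5
        order
    · have := (Prod.mk.inj h').2
      rw [extra] at this
      split_ifs at this
      · order
      · exact hv.2.2.2 this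
  · rw [h] at hv ⊢
    rw [cellOf_outer hl hc]
    rw [free_outer_iff hl hc] at hv
    refine ⟨hv.1, fun h' => ?_⟩
    have := (Prod.mk.inj h').2
    rw [extra] at this
    split_ifs at this with h
    · exact hv.2.2 h this
    · rcases hv.2.1 with h | h <;> order

/-- Labels of the coordinates before and after a cut. -/
def coordUp : {d // d ∈ [c]} ⊕ Coord (c :: l) → Coord l
  | Sum.inl _ => ⟨(cellOf l (ends c), extra l c), cellOf_ends_mem hl hc,
      mem_free.1 (extra_mem_free hl hc)⟩
  | Sum.inr q => ⟨(cellOf l q.1.1, q.1.2), (cellOf_cell (K := [c]) ⟨hc, hl⟩ q.2.1).1,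
      mem_free.1 (free_subset_of_cell hl hc q.2.1 (mem_free.2 q.2.2)).1⟩

/-- Each half has three normalised labels, and exactly one coordinate of the cell becomes a
normalised label: the predecessor of the second end j of `c`, or the first end if j is the last
vertex (then the predecessor of j was already normalised). It is replaced by u_c. -/
lemma coordUp_bijective : Function.Bijective (coordUp hl hc) := by
  have hp := proper_cellOf hl hc
  have hgood : Good (c :: l) := ⟨hc, hl⟩
  constructor
  · rintro (⟨d, hd⟩ | q) (⟨d', hd'⟩ | q') h
    · obtain rfl := List.mem_singleton.1 hd
      obtain rfl := List.mem_singleton.1 hd'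
      rfl
    · have := congrArg Subtype.val h
      exact absurd this.symm (free_subset_of_cell hl hc q'.2.1 (mem_free.2 q'.2.2)).2
    · have := congrArg Subtype.val h
      exact absurd this (free_subset_of_cell hl hc q.2.1 (mem_free.2 q.2.2)).2
    · have := congrArg Subtype.val h
      obtain ⟨e1, e2⟩ := Prod.mk.inj this
      congr 1
      refine Subtype.ext (Prod.ext ?_ e2)
      have f1 := mem_free.2 q.2.2
      have f2 := mem_free.2 q'.2.2
      rw [e2] at f1
      generalize q'.1.2 = v at *
      rcases (mem_cells_cons_iff hl hc).1 q.2.1 with ⟨h, hne⟩ | h | h <;>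
        rcases (mem_cells_cons_iff hl hc).1 q'.2.1 with ⟨h', hne'⟩ | h' | h'
      · rwa [cellOf_self hl h, cellOf_self hl h'] at e1
      · rw [cellOf_self hl h, h', cellOf_inner hl hc] at e1; exact absurd e1 hne
      · rw [cellOf_self hl h, h', cellOf_outer hl hc] at e1; exact absurd e1 hne
      · rw [cellOf_self hl h', h, cellOf_inner hl hc] at e1; exact absurd e1.symm hne'
      · rw [h, h']
      · rw [h, free_inner_iff hl hc] at f1
        rw [h', free_outer_iff hl hc] at f2
        rcases f2.2.1 with h | h <;> order
      · rw [cellOf_self hl h', h, cellOf_outer hl hc] at e1; exact absurd e1.symm hne'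
      · rw [h, free_outer_iff hl hc] at f1
        rw [h', free_inner_iff hl hc] at f2
        rcases f1.2.1 with h | h <;> order
      · rw [h, h']
  · intro q
    by_cases hQ : q.1.1 = cellOf l (ends c)
    · by_cases he : q.1.2 = extra l c
      · exact ⟨Sum.inl ⟨c, by simp⟩, Subtype.ext (Prod.ext hQ.symm he.symm)⟩
      · have hf := mem_free.2 q.2.2
        rw [hQ] at hf
        by_cases hin : c.1.1 < q.1.2 ∧ q.1.2 < c.1.2
        · have : q.1.2 ∈ free (inner c (cellOf l (ends c))) := by
            rw [free_inner_iff hl hc]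
            refine ⟨(mem_free.1 hf).1, hin.1, hin.2, fun h' => ?_⟩
            rw [extra] at he
            split_ifs at he with h
            · exact (mem_free.1 hf).2.2.2 (by rw [← h]; exact h')
            · exact he h'
          refine ⟨Sum.inr ⟨(_, q.1.2), inner_mem_cells hl hc, mem_free.1 this⟩, ?_⟩
          refine Subtype.ext (Prod.ext ?_ rfl)
          exact (cellOf_inner hl hc).trans hQ.symm
        · have : q.1.2 ∈ free (outer c (cellOf l (ends c))) := by
            rw [free_outer_iff hl hc]
            refine ⟨hf, by grind, fun h h' => ?_⟩
            rw [extra, if_pos h] at he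
            exact he h'
          refine ⟨Sum.inr ⟨(_, q.1.2), outer_mem_cells hl hc, mem_free.1 this⟩, ?_⟩
          refine Subtype.ext (Prod.ext ?_ rfl)
          exact (cellOf_outer hl hc).trans hQ.symm
    · refine ⟨Sum.inr ⟨q.1, (mem_cells_cons_iff hl hc).2 (Or.inl ⟨q.2.1, hQ⟩), q.2.2⟩, ?_⟩
      refine Subtype.ext (Prod.ext ?_ rfl)
      exact cellOf_self hl q.2.1

/-- The two halves are distinct from each other and from the old cells, as each has three vertices.
-/
lemma prod_cells_cons (F : Finset (Vert n) → ℝ) :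
    ∏ P ∈ cells (c :: l), F P = F (inner c (cellOf l (ends c))) * F (outer c (cellOf l (ends c))) *
      ∏ P ∈ (cells l).erase (cellOf l (ends c)), F P := by
  have hp := proper_cellOf hl hc
  set Q := cellOf l (ends c) with hQ
  have hQm := cellOf_ends_mem hl hc
  have e : cells (c :: l) = insert (inner c Q) (insert (outer c Q) ((cells l).erase Q)) := by
    ext P
    rw [mem_cells_cons_iff hl hc]
    simp only [Finset.mem_insert, Finset.mem_erase]
    tauto
  have hsub : ∀ P ∈ (cells l).erase Q, P ⊆ Q → ¬ 3 ≤ P.card := by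
    intro P hP hPQ h3
    rw [Finset.mem_erase] at hP
    refine hP.1 ((cellSpec hl).inter P hP.2 Q hQm ?_)
    rwa [Finset.inter_eq_left.2 hPQ]
  have hio : inner c Q ≠ outer c Q := by
    intro h
    have h1 := inter_inner_outer c Q
    rw [← h, Finset.inter_self] at h1
    have h2 := (Finset.card_le_card h1).trans (card_ends_le c)
    have h4 : 3 ≤ (inner c Q).card := hp.card_inner
    omega
  rw [e, Finset.prod_insert, Finset.prod_insert, mul_assoc]
  · exact fun h => hsub _ h (outer_subset _ _) hp.card_outer
  · rw [Finset.mem_insert, not_or]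
    exact ⟨hio, fun h => hsub _ h (inner_subset _ _) hp.card_inner⟩

end

/-! ### The Jacobian of one cut -/

lemma isOpen_X (l : List (Chord n)) : IsOpen (X l) := by
  have : X l = (⋂ q, {t : Space l | 0 < t q ∧ t q < 1}) ∩
      ⋂ q : Coord l, ⋂ q' : Coord l, {t : Space l | q.1.1 = q'.1.1 → q.1.2 < q'.1.2 → t q < t q'} := by
    ext t; simp [X]
  rw [this]
  refine (isOpen_iInter_of_finite fun q => ?_).inter
    (isOpen_iInter_of_finite fun q => isOpen_iInter_of_finite fun q' => ?_)
  · exact (isOpen_lt continuous_const (continuous_apply q)).inter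
      (isOpen_lt (continuous_apply q) continuous_const)
  · by_cases h : q.1.1 = q'.1.1 ∧ q.1.2 < q'.1.2
    · have : {t : Space l | q.1.1 = q'.1.1 → q.1.2 < q'.1.2 → t q < t q'} =
          {t | t q < t q'} := by ext t; simp [h.1, h.2]
      rw [this]
      exact isOpen_lt (continuous_apply q) (continuous_apply q')
    · have : {t : Space l | q.1.1 = q'.1.1 → q.1.2 < q'.1.2 → t q < t q'} = Set.univ := by
        ext t
        simp only [Set.mem_ofPred_eq, Set.mem_univ, iff_true]
        exact fun h1 h2 => absurd ⟨h1, h2⟩ h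
      rw [this]
      exact isOpen_univ

lemma one_sub_xr {z : Vert n → ℝ × ℝ} {a i b j : Vert n} (h1 : bracket (z a) (z b) ≠ 0)
    (h2 : bracket (z i) (z j) ≠ 0) : 1 - xr z a i b j =
      bracket (z a) (z i) * bracket (z b) (z j) / (bracket (z a) (z b) * bracket (z i) (z j)) := by
  have hp := bracket_plucker (z a) (z i) (z b) (z j)
  unfold xr
  field_simp
  linarith

/-- The odds of the cross-ratio are ⟨a,j⟩⟨i,b⟩ / (⟨a,i⟩⟨b,j⟩), a function of a times a function of
b. Replacing (a, b) by (a', b') therefore multiplies the odds by two cross-ratios, one involving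
only a, a' and the other only b, b', together with i, j. When a, a' lie on one side of the chord {i,
j} and b, b' on the other, these are functions on the two halves. -/
lemma xr_twist {z : Vert n → ℝ × ℝ} {a i b j a' b' : Vert n} (h1 : bracket (z a) (z b) ≠ 0)
    (h2 : bracket (z i) (z j) ≠ 0) (h3 : bracket (z a) (z i) ≠ 0) (h4 : bracket (z b) (z j) ≠ 0)
    (h5 : bracket (z a) (z j) ≠ 0) (h6 : bracket (z i) (z b) ≠ 0)
    (h7 : bracket (z a') (z i) ≠ 0) (h8 : bracket (z b') (z j) ≠ 0)
    (h9 : bracket (z a') (z b') ≠ 0) :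
    xr z a i b j * (xr z a' a i j * xr z b b' i j) /
      (xr z a i b j * (xr z a' a i j * xr z b b' i j) + (1 - xr z a i b j)) = xr z a' i b' j := by
  have hp := bracket_plucker (z a') (z i) (z b') (z j)
  have e1 : xr z a i b j * (xr z a' a i j * xr z b b' i j) = (1 - xr z a i b j) *
      (bracket (z a') (z j) * bracket (z i) (z b') / (bracket (z a') (z i) * bracket (z b') (z j))) := by
    rw [one_sub_xr h1 h2]
    unfold xr
    rw [bracket_swap (z b') (z i), bracket_swap (z b) (z i)]
    field_simp
  have e2 : 1 - xr z a i b j ≠ 0 := by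
    rw [one_sub_xr h1 h2]
    exact div_ne_zero (mul_ne_zero h3 h4) (mul_ne_zero h1 h2)
  have e3 : (1 - xr z a i b j) *
      (bracket (z a') (z j) * bracket (z i) (z b') / (bracket (z a') (z i) * bracket (z b') (z j))) +
      (1 - xr z a i b j) = (1 - xr z a i b j) * ((bracket (z a') (z b') * bracket (z i) (z j)) /
        (bracket (z a') (z i) * bracket (z b') (z j))) := by
    have : bracket (z a') (z b') * bracket (z i) (z j) =
        bracket (z a') (z j) * bracket (z i) (z b') + bracket (z a') (z i) * bracket (z b') (z j) := by
      linarith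
    rw [this]
    field_simp
  rw [e1, e3]
  generalize 1 - xr z a i b j = w at *
  unfold xr
  field_simp

section
variable {l : List (Chord n)} {c : Chord n} (hl : Good l) (hc : c ∈ chi l)

/-- The cut along `c`, with a simplified first component. -/
def preCut (l : List (Chord n)) (c : Chord n) (t : Space l) : {d // d ∈ [c]} ⊕ Coord (c :: l) → ℝ :=
  Sum.elim (fun _ => xr (config l t (cellOf l (ends c))) (refLabel l c) c.1.1
    (pred (cellOf l (ends c)) c.1.2) c.1.2) (forget l [c] t)

/-- The order in which the coordinates are eliminated. -/
def cutRank (l : List (Chord n)) (c : Chord n) (q : Finset (Vert n) × Vert n) : ℕ :=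
  if q.1 = cellOf l (ends c) then
    if c.1.2 = hi (cellOf l (ends c)) then (if q.2 = c.1.1 then 0 else 1)
    else if q.2 = pred (cellOf l (ends c)) c.1.2 then 1
    else if c.1.1 < q.2 ∧ q.2 < c.1.2 then 2 else 0
  else 0

/-- Diagonal entries of the Jacobian matrix of `preCut`. -/
def cutDiag (l : List (Chord n)) (c : Chord n) (t : Space l) : {d // d ∈ [c]} ⊕ Coord (c :: l) → ℝ :=
  Sum.elim (fun _ => if c.1.2 = hi (cellOf l (ends c)) then -1 else
      (pos l t (cellOf l (ends c)) c.1.2 - pos l t (cellOf l (ends c)) c.1.1)⁻¹)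
    fun q => slope (config l t (cellOf l q.1.1)) q.1.1 q.1.2

include hl hc

/-- A component of `preCut` depends, besides its own coordinate, only on coordinates of strictly
smaller rank. The normalised labels of the inner half are the possible dependencies across the cut,
and the ranks are chosen accordingly. -/
lemma preCut_update {t : Space l} {k k' : {d // d ∈ [c]} ⊕ Coord (c :: l)} (hne : k ≠ k')
    (hr : cutRank l c (coordUp hl hc k).1 ≤ cutRank l c (coordUp hl hc k').1) (x : ℝ) :
    preCut l c (Function.update t (coordUp hl hc k') x) k = preCut l c t k := by
  have hp := proper_cellOf hl hc
  have hne' : coordUp hl hc k ≠ coordUp hl hc k' := fun h => hne ((coordUp_bijective hl hc).1 h)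
  have hlt := chord_lt c
  obtain ⟨a1, a2, a3, a4⟩ := hp.pred_snd
  have hlo := lo_le hp.1
  have hhi := le_hi hp.2
  have hph : c.1.2 ≠ hi (cellOf l (ends c)) →
      c.1.2 ≤ pred (cellOf l (ends c)) (hi (cellOf l (ends c))) := fun h =>
    (pred_spec ⟨_, hp.2, lt_of_le_of_ne hhi h⟩).2.2 _ hp.2 (lt_of_le_of_ne hhi h)
  rcases k with ⟨d, hd⟩ | q
  · obtain rfl := List.mem_singleton.1 hd
    have key : ∀ w, (coordUp hl hc k').1 = (cellOf l (ends d), w) → w = refLabel l d ∨ w = d.1.1 ∨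
        w = pred (cellOf l (ends d)) d.1.2 ∨ w = d.1.2 → False := by
      intro w hw hw'
      have hf := mem_free.2 (coordUp hl hc k').2.2
      have hne2 : (cellOf l (ends d), extra l d) ≠ (cellOf l (ends d), w) := fun h =>
        hne' (Subtype.ext (h.trans hw.symm))
      have hne3 : extra l d ≠ w := fun h => hne2 (by rw [h])
      change cutRank l d (cellOf l (ends d), extra l d) ≤ _ at hr
      rw [hw] at hr hf
      simp only [mem_free] at hf
      simp only [cutRank, if_true] at hr
      rw [extra] at hr hne3
      rw [refLabel] at hw'
      split_ifs at hr hw' hne3 with h1 <;> grind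
    simp only [preCut, Sum.elim_inl, xr]
    rw [config_update_ne fun h => key _ h (Or.inl rfl),
      config_update_ne fun h => key _ h (Or.inr (Or.inl rfl)),
      config_update_ne fun h => key _ h (Or.inr (Or.inr (Or.inl rfl))),
      config_update_ne fun h => key _ h (Or.inr (Or.inr (Or.inr rfl)))]
  · have key : ∀ w, (coordUp hl hc k').1 = (cellOf l q.1.1, w) → w = q.1.2 ∨ w = lo q.1.1 ∨
        w = hi q.1.1 ∨ w = pred q.1.1 (hi q.1.1) → False := by
      intro w hw hw'
      have hf := mem_free.2 (coordUp hl hc k').2.2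
      have hfq := mem_free.2 q.2.2
      have hne2 : (cellOf l q.1.1, q.1.2) ≠ (cellOf l q.1.1, w) := fun h =>
        hne' (Subtype.ext (h.trans hw.symm))
      have hne3 : q.1.2 ≠ w := fun h => hne2 (by rw [h])
      change cutRank l c (cellOf l q.1.1, q.1.2) ≤ _ at hr
      rw [hw] at hr hf
      simp only [mem_free] at hf
      rcases (mem_cells_cons_iff hl hc).1 q.2.1 with ⟨h, hneQ⟩ | h | h
      · rw [cellOf_self hl h] at hf
        grind
      · rw [h, hp.lo_inner, hp.hi_inner, hp.pred_inner hp.snd_mem_inner hlt.ne'] at hw'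
        rw [h, free_inner_iff hl hc] at hfq
        rw [h, cellOf_inner hl hc] at hf hr
        simp only [cutRank, if_true] at hr
        split_ifs at hr <;> grind
      · rw [h, hp.lo_outer, hp.hi_outer, pred_hi_outer hl hc] at hw'
        rw [h, free_outer_iff hl hc, mem_free] at hfq
        rw [h, cellOf_outer hl hc] at hf hr
        simp only [cutRank, if_true] at hr
        split_ifs at hr hw' <;> grind
    simp only [preCut, Sum.elim_inr, forget, simplicial]
    rw [config_update_ne fun h => key _ h (Or.inl rfl),
      config_update_ne fun h => key _ h (Or.inr (Or.inl rfl)),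
      config_update_ne fun h => key _ h (Or.inr (Or.inr (Or.inl rfl))),
      config_update_ne fun h => key _ h (Or.inr (Or.inr (Or.inr rfl)))]

/-- With the reference label the first component is affine in the lost coordinate: 1 - t_i if j is
the last vertex, (t_p - t_i) / (t_j - t_i) with p the predecessor of j otherwise. The other
components are simplicial coordinates. -/
lemma hasDerivAt_preCut {t : Space l} (ht : t ∈ X l) (k : {d // d ∈ [c]} ⊕ Coord (c :: l)) :
    HasDerivAt (fun x => preCut l c (Function.update t (coordUp hl hc k) x) k) (cutDiag l c t k)
      (t (coordUp hl hc k)) := by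
  have hp := proper_cellOf hl hc
  have hgood : Good ([c] ++ l) := ⟨hc, hl⟩
  rcases k with ⟨d, hd⟩ | q
  · obtain rfl := List.mem_singleton.1 hd
    set Q := cellOf l (ends d) with hQ
    have hQm : Q ∈ cells l := cellOf_ends_mem hl hc
    have h3 := (cellSpec hl).card _ hQm
    have hlt := chord_lt d
    obtain ⟨a1, a2, a3, a4⟩ := hp.pred_snd
    have hhi := le_hi hp.2
    simp only [preCut, Sum.elim_inl, cutDiag, ← hQ]
    have e : ∀ (w : Vert n) (x : ℝ), extra l d ≠ w →
        config l (Function.update t (coordUp hl hc (Sum.inl ⟨d, hd⟩)) x) Q w = config l t Q w :=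
      fun w x hw => config_update_ne (fun h' => hw (Prod.mk.inj h').2) x
    have e' : ∀ x : ℝ, config l (Function.update t (coordUp hl hc (Sum.inl ⟨d, hd⟩)) x) Q
        (extra l d) = (x, 1) := fun x => config_update_self (coordUp hl hc (Sum.inl ⟨d, hd⟩)) x
    split_ifs with hj
    · have e1 : extra l d = d.1.1 := by rw [extra, if_pos hj]
      have e2 : refLabel l d = lo Q := by rw [refLabel, if_pos hj]
      have hlo := lo_lt_fst_of_hi hl hc hj
      have hph := lo_lt_pred_hi h3
      rw [← hQ] at hlo
      have : (fun x => xr (config l (Function.update t (coordUp hl hc (Sum.inl ⟨d, hd⟩)) x) Q)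
          (refLabel l d) d.1.1 (pred Q d.1.2) d.1.2) = fun x => 1 - x := by
        funext x
        unfold xr
        rw [e2, e (lo Q) x (by rw [e1]; exact hlo.ne'), e (pred Q d.1.2) x (by rw [e1]; exact a2.ne),
          e d.1.2 x (by rw [e1]; exact hlt.ne), ← e1, e', hj, bracket_config_hi (lo_lt_hi h3).ne,
          bracket_config (lo_lt_hi h3).ne hph.2.ne, pos_lo h3, pos_pred_hi h3, config_hi,
          config_of_ne hph.2.ne, pos_pred_hi h3]
        simp [bracket]
      rw [this]
      exact ((hasDerivAt_id' _).const_sub 1).congr_deriv (by ring)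
    · have e1 : extra l d = pred Q d.1.2 := by rw [extra, if_neg hj]
      have e2 : refLabel l d = hi Q := by rw [refLabel, if_neg hj]
      have hjh := lt_of_le_of_ne hhi hj
      have hpos := pos_lt hl ht hQm hp.1 hp.2 hlt hj
      have : (fun x => xr (config l (Function.update t (coordUp hl hc (Sum.inl ⟨d, hd⟩)) x) Q)
          (refLabel l d) d.1.1 (pred Q d.1.2) d.1.2) =
          fun x => (x - pos l t Q d.1.1) * (pos l t Q d.1.2 - pos l t Q d.1.1)⁻¹ := by
        funext x
        unfold xr
        rw [e2, e (hi Q) x (by rw [e1]; exact (a3.trans hjh).ne),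
          e d.1.1 x (by rw [e1]; exact a2.ne'),
          e d.1.2 x (by rw [e1]; exact a3.ne), ← e1, e', config_hi, config_of_ne hj,
          config_of_ne (hlt.trans hjh).ne]
        simp only [bracket]
        have : pos l t Q d.1.2 - pos l t Q d.1.1 ≠ 0 := by linarith
        have h' : pos l t Q d.1.1 - pos l t Q d.1.2 ≠ 0 := by
          intro h; apply this; linarith
        field_simp
        ring
      rw [this]
      exact (((hasDerivAt_id' _).sub_const _).mul_const _).congr_deriv (one_mul _)
  · have hz := pos_config_cellOf hgood ht q.2.1
    exact hasDerivAt_simplicial (coordUp hl hc (Sum.inr q)) (mem_free.2 q.2.2)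
      (hz.sep _ q.2.2.1 _ (hi_mem ⟨_, q.2.2.1⟩) q.2.2.2.2.1)

lemma differentiableAt_preCut {t : Space l} (ht : t ∈ X l) : DifferentiableAt ℝ (preCut l c) t := by
  have hp := proper_cellOf hl hc
  have hgood : Good ([c] ++ l) := ⟨hc, hl⟩
  obtain ⟨a1, a2, a3, a4⟩ := hp.pred_snd
  obtain ⟨r1, r2⟩ := refLabel_spec hl hc
  have hlt := chord_lt c
  rw [differentiableAt_pi]
  rintro (d | q)
  · have hz := (pos_config hl ht (cellOf_ends_mem hl hc)).sep
    simp only [preCut, Sum.elim_inl]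
    exact differentiableAt_xr (hz _ r1 _ a1 (by grind)) (hz _ hp.1 _ hp.2 hlt.ne)
  · have hz := (pos_config_cellOf hgood ht q.2.1).sep
    have h3 := (cellSpec hgood).card _ q.2.1
    have hm := hi_mem ⟨_, q.2.2.1⟩
    simp only [preCut, Sum.elim_inr, forget, simplicial_eq_xr]
    exact differentiableAt_xr (hz _ q.2.2.1 _ hm q.2.2.2.2.1)
      (hz _ (pred_mem hm) _ (lo_mem ⟨_, q.2.2.1⟩) (lo_lt_pred_hi h3).1.ne')

/-- The interior vertices of the cell are those of the two halves. Predecessors change only at the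
second end j of `c`, whose predecessor in the outer half is the first end; no correction is needed
when j is the last vertex. -/
lemma gap_cut (z : Vert n → ℝ × ℝ) :
    gap z (cellOf l (ends c)) * (if c.1.2 = hi (cellOf l (ends c)) then 1 else
      bracket (z c.1.2) (z c.1.1)) =
    gap z (inner c (cellOf l (ends c))) * gap z (outer c (cellOf l (ends c))) *
      (if c.1.2 = hi (cellOf l (ends c)) then 1 else
        bracket (z c.1.2) (z (pred (cellOf l (ends c)) c.1.2))) := by
  have hp := proper_cellOf hl hc
  have hloQ := fun h => lo_lt_fst_of_hi hl hc h
  set Q := cellOf l (ends c) with hQ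
  have hlt := chord_lt c
  have hlo := lo_le hp.1
  have hhi := le_hi hp.2
  have hdis : Disjoint (mid (inner c Q)) (mid (outer c Q)) := by
    rw [Finset.disjoint_left]
    intro v h1 h2
    rw [mem_mid, hp.lo_inner, hp.hi_inner, mem_inner] at h1
    rw [mem_mid, mem_outer] at h2
    grind
  have hin : gap z (inner c Q) = ∏ v ∈ mid (inner c Q), bracket (z v) (z (pred Q v)) := by
    refine Finset.prod_congr rfl fun v hv => ?_
    rw [mem_mid, hp.lo_inner] at hv
    rw [hp.pred_inner hv.1 hv.2.1]
  by_cases hj : c.1.2 = hi Q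
  · have hmid : mid Q = mid (inner c Q) ∪ (mid (outer c Q)) := by
      ext v
      rw [Finset.mem_union, mem_mid, mem_mid, mem_mid, hp.lo_inner, hp.hi_inner, hp.lo_outer,
        hp.hi_outer, mem_inner, mem_outer]
      have := hloQ hj
      constructor
      · rintro ⟨h1, h2, h3⟩
        have := le_hi h1
        grind
      · grind
    have hout : gap z (outer c Q) = ∏ v ∈ mid (outer c Q), bracket (z v) (z (pred Q v)) := by
      refine Finset.prod_congr rfl fun v hv => ?_
      rw [mem_mid, hp.hi_outer, ← hj] at hv
      rw [hp.pred_outer hv.1 hv.2.2]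
    rw [if_pos hj, if_pos hj, hin, hout, mul_one, mul_one, ← Finset.prod_union hdis, ← hmid]
    rfl
  · have hjm : c.1.2 ∈ mid (outer c Q) := by
      rw [mem_mid, hp.lo_outer, hp.hi_outer]
      exact ⟨hp.snd_mem_outer, (hlo.trans_lt hlt).ne', hj⟩
    have hmid : mid Q = mid (inner c Q) ∪ (mid (outer c Q)) := by
      ext v
      rw [Finset.mem_union, mem_mid, mem_mid, mem_mid, hp.lo_inner, hp.hi_inner, hp.lo_outer,
        hp.hi_outer, mem_inner, mem_outer]
      grind
    have hout : gap z (outer c Q) = bracket (z c.1.2) (z c.1.1) *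
        ∏ v ∈ (mid (outer c Q)).erase c.1.2, bracket (z v) (z (pred Q v)) := by
      rw [gap, ← Finset.mul_prod_erase _ _ hjm, hp.pred_outer_snd]
      congr 1
      refine Finset.prod_congr rfl fun v hv => ?_
      rw [Finset.mem_erase, mem_mid] at hv
      rw [hp.pred_outer hv.2.1 hv.1]
    have hQ' : gap z Q = (∏ v ∈ mid (inner c Q), bracket (z v) (z (pred Q v))) *
        (bracket (z c.1.2) (z (pred Q c.1.2)) *
        ∏ v ∈ (mid (outer c Q)).erase c.1.2, bracket (z v) (z (pred Q v))) := by
      rw [gap, hmid, Finset.prod_union hdis, ← Finset.mul_prod_erase _ _ hjm]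
    rw [if_neg hj, if_neg hj, hin, hout, hQ']
    ring

lemma prod_slope_cells {t : Space l} (ht : t ∈ X l) :
    ∏ P ∈ (cells l).erase (cellOf l (ends c)), ∏ v ∈ free P, slope (config l t (cellOf l P)) P v =
      ∏ P ∈ (cells l).erase (cellOf l (ends c)),
        gap (config (c :: l) (forget l [c] t) P) P * (gap (config l t P) P)⁻¹ := by
  have hgood : Good ([c] ++ l) := ⟨hc, hl⟩
  refine Finset.prod_congr rfl fun P hP => ?_
  rw [Finset.mem_erase] at hP
  have hP' : P ∈ cells (c :: l) := (mem_cells_cons_iff hl hc).2 (Or.inl ⟨hP.2, hP.1⟩)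
  have hz := pos_config_cellOf hgood ht hP'
  have h3 := (cellSpec hl).card P hP.2
  obtain ⟨hp1, hp2⟩ := lo_lt_pred_hi h3
  have := prod_slope (l := c :: l) (y := forget l [c] t) hgood hP' hz fun q hq => by subst hq; rfl
  rw [cellOf_self hl hP.2] at this hz ⊢
  rw [bracket_config hp2.ne (hp1.trans hp2).ne, pos_pred_hi h3, pos_lo h3] at this
  rw [eq_mul_inv_iff_mul_eq₀ (gap_pos hz).ne', this]
  ring

/-- The product of the diagonal entries: `prod_slope` turns the slopes of every cell into quotients
of gaps, `gap_cut` compares the gaps before and after the cut, and the derivative of the first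
component supplies what is missing for x (1 - x). -/
lemma hasJac_preCut {t : Space l} (ht : t ∈ X l) (d : {d // d ∈ [c]}) : HasJac (preCut l c) t
    (dens l t * (preCut l c t (Sum.inl d) * (1 - preCut l c t (Sum.inl d))) /
      dens (c :: l) (forget l [c] t)) := by
  have hgood : Good ([c] ++ l) := ⟨hc, hl⟩
  have hp := proper_cellOf hl hc
  have hQm := cellOf_ends_mem hl hc
  have hz := pos_config hl ht hQm
  have hbij := coordUp_bijective hl hc
  set e : Coord l ≃ {d // d ∈ [c]} ⊕ Coord (c :: l) := (Equiv.ofBijective _ hbij).symm with he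
  have he' : ∀ k, e (coordUp hl hc k) = k := fun k => (Equiv.ofBijective _ hbij).symm_apply_apply k
  have main := hasJac_of_triangular (f := preCut l c) (t := t) e (fun i => cutRank l c i.1)
    (fun i => cutDiag l c t (e i)) (differentiableAt_preCut hl hc ht)
    (fun i j hij hr x => by
      obtain ⟨k, rfl⟩ := hbij.2 i
      obtain ⟨k', rfl⟩ := hbij.2 j
      rw [he']
      exact preCut_update hl hc (fun h => hij (by rw [h])) hr x)
    (fun i => by
      obtain ⟨k, rfl⟩ := hbij.2 i
      rw [he']
      exact hasDerivAt_preCut hl hc ht k)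
  convert main using 1
  rw [Equiv.prod_comp e (cutDiag l c t), Fintype.prod_sum_type, abs_mul]
  have hin := inner_mem_cells hl hc
  have hout := outer_mem_cells hl hc
  have e1 : ∏ q : Coord (c :: l), cutDiag l c t (Sum.inr q) =
      (∏ v ∈ free (inner c (cellOf l (ends c))),
        slope (config l t (cellOf l (ends c))) (inner c (cellOf l (ends c))) v) *
      (∏ v ∈ free (outer c (cellOf l (ends c))),
        slope (config l t (cellOf l (ends c))) (outer c (cellOf l (ends c))) v) *
      ∏ P ∈ (cells l).erase (cellOf l (ends c)),
        gap (config (c :: l) (forget l [c] t) P) P * (gap (config l t P) P)⁻¹ := by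
    refine (prod_coord (c :: l) fun P v => slope (config l t (cellOf l P)) P v).trans ?_
    rw [prod_cells_cons hl hc, prod_slope_cells hl hc ht, cellOf_inner hl hc, cellOf_outer hl hc]
  have hzi := hz.mono (inner_subset c _)
  have hzo := hz.mono (outer_subset c _)
  have s1 := prod_slope (l := c :: l) (y := forget l [c] t) hgood hin hzi fun q hq => by
    change simplicial q.1.1 (config l t (cellOf l q.1.1)) q.1.2 = _
    rw [hq, cellOf_inner hl hc]
  have s2 := prod_slope (l := c :: l) (y := forget l [c] t) hgood hout hzo fun q hq => by
    change simplicial q.1.1 (config l t (cellOf l q.1.1)) q.1.2 = _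
    rw [hq, cellOf_outer hl hc]
  have hpos : 0 < ∏ q : Coord (c :: l), cutDiag l c t (Sum.inr q) := by
    refine Finset.prod_pos fun q _ => ?_
    exact slope_pos ((cellSpec hgood).card _ q.2.1) (pos_config_cellOf hgood ht q.2.1)
      (mem_free.2 q.2.2)
  rw [abs_of_pos hpos, e1]
  have hy := forget_mem_X hgood ht
  have gi := gap_pos (pos_config hgood hy hin)
  have go := gap_pos (pos_config hgood hy hout)
  have gQ := gap_pos hz
  have gzi := gap_pos hzi
  have gzo := gap_pos hzo
  have hcut := gap_cut hl hc (config l t (cellOf l (ends c)))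
  rw [hp.lo_inner, hp.hi_inner, hp.pred_inner hp.snd_mem_inner (chord_lt c).ne'] at s1
  rw [hp.lo_outer, hp.hi_outer, pred_hi_outer hl hc] at s2
  have d1 : dens l t = (gap (config l t (cellOf l (ends c))) (cellOf l (ends c)))⁻¹ *
      ∏ P ∈ (cells l).erase (cellOf l (ends c)), (gap (config l t P) P)⁻¹ :=
    (Finset.mul_prod_erase _ _ hQm).symm
  have d2 : (dens (c :: l) (forget l [c] t))⁻¹ =
      gap (config (c :: l) (forget l [c] t) (inner c (cellOf l (ends c)))) (inner c (cellOf l (ends c))) *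
      gap (config (c :: l) (forget l [c] t) (outer c (cellOf l (ends c)))) (outer c (cellOf l (ends c))) *
      ∏ P ∈ (cells l).erase (cellOf l (ends c)), gap (config (c :: l) (forget l [c] t) P) P := by
    rw [dens, prod_cells_cons hl hc, mul_inv, mul_inv, inv_inv, inv_inv, ← Finset.prod_inv_distrib]
    simp only [inv_inv]
  rw [div_eq_mul_inv, d1, d2, Finset.prod_mul_distrib]
  have hu : ∀ f : {d // d ∈ [c]} → ℝ, ∏ d, f d = f d := by
    intro f
    have : Subsingleton {d // d ∈ [c]} :=
      ⟨fun a b => Subtype.ext ((List.mem_singleton.1 a.2).trans (List.mem_singleton.1 b.2).symm)⟩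
    rw [Fintype.prod_eq_single d fun x hx => absurd (Subsingleton.elim _ _) hx]
  rw [hu]
  have h3 := (cellSpec hl).card _ hQm
  obtain ⟨hp1, hp2⟩ := lo_lt_pred_hi h3
  have hlt := chord_lt c
  obtain ⟨a1, a2, a3, a4⟩ := hp.pred_snd
  have hhi := le_hi hp.2
  simp only [preCut, Sum.elim_inl, cutDiag]
  clear d1 d2 hu hpos e1 main he he' e hbij
  generalize ∏ P ∈ (cells l).erase (cellOf l (ends c)),
    gap (config (c :: l) (forget l [c] t) P) P = Y at *
  generalize ∏ P ∈ (cells l).erase (cellOf l (ends c)), (gap (config l t P) P)⁻¹ = Z at *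
  generalize (∏ v ∈ free (inner c (cellOf l (ends c))),
        slope (config l t (cellOf l (ends c))) (inner c (cellOf l (ends c))) v) = S1 at *
  generalize (∏ v ∈ free (outer c (cellOf l (ends c))),
        slope (config l t (cellOf l (ends c))) (outer c (cellOf l (ends c))) v) = S2 at *
  generalize gap (config (c :: l) (forget l [c] t) (inner c (cellOf l (ends c))))
    (inner c (cellOf l (ends c))) = A at *
  generalize gap (config (c :: l) (forget l [c] t) (outer c (cellOf l (ends c))))
    (outer c (cellOf l (ends c))) = B at *
  set z := config l t (cellOf l (ends c)) with hzd
  have hS1 : S1 = bracket (z (pred (cellOf l (ends c)) c.1.2)) (z c.1.1) * A /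
      gap z (inner c (cellOf l (ends c))) := by rw [eq_div_iff gzi.ne', s1]
  have f1 : z (hi (cellOf l (ends c))) = (1, 0) := config_hi _ _ _
  have f4 : z c.1.1 = (pos l t (cellOf l (ends c)) c.1.1, 1) :=
    config_of_ne (hlt.trans_le hhi).ne
  by_cases hj : c.1.2 = hi (cellOf l (ends c))
  · have f2 : z (lo (cellOf l (ends c))) = (0, 1) := by
      rw [hzd, config_of_ne (hp1.trans hp2).ne, pos_lo h3]
    have f3 : z (pred (cellOf l (ends c)) c.1.2) = (1, 1) := by
      rw [hj, hzd, config_of_ne hp2.ne, pos_pred_hi h3]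
    rw [if_pos hj, if_pos hj, mul_one, mul_one] at hcut
    rw [if_pos hj] at s2 ⊢
    rw [refLabel, if_pos hj]
    have hS2 : S2 = bracket (z c.1.1) (z (lo (cellOf l (ends c)))) * B /
      gap z (outer c (cellOf l (ends c))) := by rw [eq_div_iff gzo.ne', s2]
    rw [hS1, hS2, hcut]
    unfold xr
    have f5 : z c.1.2 = (1, 0) := by rw [hj, f1]
    rw [f2, f3, f4, f5]
    simp only [bracket, abs_neg, abs_one, one_mul]
    field_simp
    ring
  · have hjh := lt_of_le_of_ne hhi hj
    have f3 : z (pred (cellOf l (ends c)) c.1.2) =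
        (pos l t (cellOf l (ends c)) (pred (cellOf l (ends c)) c.1.2), 1) :=
      config_of_ne (a3.trans hjh).ne
    have f5 : z c.1.2 = (pos l t (cellOf l (ends c)) c.1.2, 1) := config_of_ne hj
    have hpos := pos_lt hl ht hQm hp.1 hp.2 hlt hj
    have hpos' := pos_lt hl ht hQm a1 hp.2 a3 hj
    rw [if_neg hj, if_neg hj] at hcut
    rw [if_neg hj, bracket_config hp2.ne (hp1.trans hp2).ne, pos_pred_hi h3, pos_lo h3] at s2
    rw [if_neg hj, abs_of_pos (inv_pos.2 (sub_pos.2 hpos))]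
    rw [refLabel, if_neg hj]
    have hS2 : S2 = B / gap z (outer c (cellOf l (ends c))) := by
      rw [eq_div_iff gzo.ne', s2]; ring
    have hG : (gap z (cellOf l (ends c)))⁻¹ = bracket (z c.1.2) (z c.1.1) /
        (gap z (inner c (cellOf l (ends c))) * gap z (outer c (cellOf l (ends c))) *
          bracket (z c.1.2) (z (pred (cellOf l (ends c)) c.1.2))) := by
      have : bracket (z c.1.2) (z c.1.1) ≠ 0 := by
        rw [f4, f5]; simp only [bracket]; intro h; linarith
      rw [← hcut]
      field_simp
    rw [hS1, hS2, hG]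
    unfold xr
    rw [f1, f3, f4, f5]
    simp only [bracket]
    generalize pos l t (cellOf l (ends c)) c.1.1 = x at *
    generalize pos l t (cellOf l (ends c)) c.1.2 = x' at *
    generalize pos l t (cellOf l (ends c)) (pred (cellOf l (ends c)) c.1.2) = x'' at *
    have n1 : x' - x ≠ 0 := by linarith
    have n2 : x' - x'' ≠ 0 := by linarith
    have n3 : x - x' ≠ 0 := by intro h; linarith
    simp only [mul_one, one_mul, mul_zero, sub_zero]
    have : (1:ℝ) - (x - x'') / (x - x') = (x'' - x') / (x - x') := by field_simp; ring
    rw [this]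
    field_simp
    ring

end

/-! ### The trivialisation maps -/

lemma xr_pos {z : Vert n → ℝ × ℝ} {a b i j : Vert n}
    (h : 0 < bracket (z a) (z i) * bracket (z a) (z j) * (bracket (z b) (z i) * bracket (z b) (z j))) :
    0 < xr z a b i j := by
  unfold xr
  have h1 : bracket (z a) (z i) * bracket (z b) (z j) ≠ 0 := by
    intro h'
    rw [show bracket (z a) (z i) * bracket (z a) (z j) * (bracket (z b) (z i) * bracket (z b) (z j)) =
      bracket (z a) (z i) * bracket (z b) (z j) * (bracket (z a) (z j) * bracket (z b) (z i)) by ring,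
      h', zero_mul] at h
    exact lt_irrefl _ h
  rw [← mul_div_mul_right _ _ h1]
  refine div_pos ?_ (mul_self_pos.2 h1)
  linarith

lemma Pos.mul_pos_of_outside {P : Finset (Vert n)} {z : Vert n → ℝ × ℝ} (hz : Pos P z) {c : Chord n}
    {a : Vert n} (ha : a ∈ P) (h1 : c.1.1 ∈ P) (h2 : c.1.2 ∈ P) (h : a < c.1.1 ∨ c.1.2 < a) :
    0 < bracket (z a) (z c.1.1) * bracket (z a) (z c.1.2) := by
  have hlt := chord_lt c
  rcases h with h | h
  · exact mul_pos_of_neg_of_neg (hz _ ha _ h1 h) (hz _ ha _ h2 (h.trans hlt))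
  · exact mul_pos (hz.gt ha h1 (hlt.trans h)) (hz.gt ha h2 h)

lemma Pos.mul_neg_of_inside {P : Finset (Vert n)} {z : Vert n → ℝ × ℝ} (hz : Pos P z) {c : Chord n}
    {a : Vert n} (ha : a ∈ P) (h1 : c.1.1 ∈ P) (h2 : c.1.2 ∈ P) (h : c.1.1 < a ∧ a < c.1.2) :
    bracket (z a) (z c.1.1) * bracket (z a) (z c.1.2) < 0 :=
  mul_neg_of_pos_of_neg (hz.gt ha h1 h.1) (hz _ ha _ h2 h.2)

lemma Proper.pred_fst_outside {P : Finset (Vert n)} {c : Chord n} (hp : Proper c P) :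
    pred P c.1.1 < c.1.1 ∨ c.1.2 < pred P c.1.1 := by
  rcases hp.pred_fst.2 with h | h
  · exact Or.inl h.1
  · exact Or.inr (by rw [h.2.1]; exact h.2.2)

/-! ### The Jacobian of a cut in terms of u_c -/

section
variable {l : List (Chord n)} {c : Chord n} (hl : Good l) (hc : c ∈ chi l)

/-- The factor which turns the odds of the first component of `preCut` into those of `u_c`. -/
def cutShear (l : List (Chord n)) (c : Chord n) (_ : {d // d ∈ [c]}) (y : Space (c :: l)) : ℝ :=
  xr (config (c :: l) y (outer c (cellOf l (ends c)))) (pred (cellOf l (ends c)) c.1.1)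
    (refLabel l c) c.1.1 c.1.2

include hl hc

lemma refLabel_mem_outer : refLabel l c ∈ outer c (cellOf l (ends c)) := by
  obtain ⟨r1, r2⟩ := refLabel_spec hl hc
  exact mem_outer.2 ⟨r1, r2.imp le_of_lt le_of_lt⟩

lemma cutShear_pos {y : Space (c :: l)} (hy : y ∈ X (c :: l)) (d : {d // d ∈ [c]}) :
    0 < cutShear l c d y := by
  have hp := proper_cellOf hl hc
  have hgood : Good (c :: l) := ⟨hc, hl⟩
  have hz := pos_config hgood hy (outer_mem_cells hl hc)
  exact xr_pos (mul_pos (hz.mul_pos_of_outside hp.pred_fst_mem_outer hp.fst_mem_outer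
    hp.snd_mem_outer hp.pred_fst_outside) (hz.mul_pos_of_outside (refLabel_mem_outer hl hc)
    hp.fst_mem_outer hp.snd_mem_outer (refLabel_spec hl hc).2))

/-- `xr_twist` with b = b': only the outer label changes, from `refLabel` to the predecessor of the
first end, so the odds are multiplied by a function on the outer half. -/
lemma triv_eq_twist {t : Space l} (ht : t ∈ X l) :
    triv l [c] t = twist (cutShear l c) (preCut l c t) := by
  have hp := proper_cellOf hl hc
  have hgood : Good ([c] ++ l) := ⟨hc, hl⟩
  have hz := (pos_config hl ht (cellOf_ends_mem hl hc)).sep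
  obtain ⟨a1, a2, a3, a4⟩ := hp.pred_snd
  obtain ⟨r1, r2⟩ := refLabel_spec hl hc
  have hlt := chord_lt c
  have hao := hp.pred_fst_outside
  have ha := hp.pred_fst.1
  funext k
  rcases k with ⟨d, hd⟩ | q
  · obtain rfl := List.mem_singleton.1 hd
    have hout := outer_mem_cells hl hc
    have e := equi_forget hgood ht hout
    rw [cellOf_outer hl hc] at e
    have e' : cutShear l d ⟨d, hd⟩ (forget l [d] t) = _ := e.xr_eq hp.pred_fst_mem_outer
      (refLabel_mem_outer hl hc) hp.fst_mem_outer hp.snd_mem_outer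
    have e1 := hz _ a1 _ hp.1 a2.ne'
    have e2 := hz _ a1 _ hp.2 a3.ne
    have e3 : xr (config l t (cellOf l (ends d))) (pred (cellOf l (ends d)) d.1.2)
        (pred (cellOf l (ends d)) d.1.2) d.1.1 d.1.2 = 1 := by
      unfold xr
      rw [mul_comm, div_self (mul_ne_zero e1 e2)]
    change normalCoord l [d] d t = _
    rw [normalCoord_singleton]
    have e4 := xr_twist (z := config l t (cellOf l (ends d))) (a := refLabel l d) (i := d.1.1)
      (b := pred (cellOf l (ends d)) d.1.2) (j := d.1.2) (a' := pred (cellOf l (ends d)) d.1.1)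
      (b' := pred (cellOf l (ends d)) d.1.2) (hz _ r1 _ a1 (by grind)) (hz _ hp.1 _ hp.2 hlt.ne)
      (hz _ r1 _ hp.1 (by grind)) e2 (hz _ r1 _ hp.2 (by grind)) (hz _ hp.1 _ a1 a2.ne)
      (hz _ ha _ hp.1 (by grind)) e2 (hz _ ha _ a1 (by grind))
    rw [e3, mul_one, ← e'] at e4
    exact e4.symm
  · rfl

/-- The twist replaces x (1 - x) for the simplified component by u_c (1 - u_c), so the formula keeps
its form. -/
lemma hasJac_cut {t : Space l} (ht : t ∈ X l) : HasJac (triv l [c]) t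
    (dens l t * (u l c t * (1 - u l c t)) / dens (c :: l) (forget l [c] t)) := by
  have hgood : Good ([c] ++ l) := ⟨hc, hl⟩
  have hp := proper_cellOf hl hc
  have hy := forget_mem_X hgood ht
  set d : {d // d ∈ [c]} := ⟨c, by simp⟩ with hd
  have hsub : ∀ d' : {d // d ∈ [c]}, d' = d := fun d' => Subtype.ext (List.mem_singleton.1 d'.2)
  have hz := pos_config hl ht (cellOf_ends_mem hl hc)
  have htw := triv_eq_twist hl hc ht
  have hx : twist (cutShear l c) (preCut l c t) (Sum.inl d) = u l c t := by
    rw [← htw]; exact normalCoord_singleton l c t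
  have hpos := cutShear_pos hl hc hy d
  have hu := u_mem hl ht hc
  have hpre : 0 < preCut l c t (Sum.inl d) ∧ preCut l c t (Sum.inl d) < 1 := by
    obtain ⟨a1, a2, a3, a4⟩ := hp.pred_snd
    obtain ⟨r1, r2⟩ := refLabel_spec hl hc
    have hlt := chord_lt c
    have h1 : (1 : ℝ) - preCut l c t (Sum.inl d) = _ :=
      one_sub_xr (hz.sep _ r1 _ a1 (by grind)) (hz.sep _ hp.1 _ hp.2 hlt.ne)
    have s1 := hz _ hp.1 _ hp.2 hlt
    have s2 := hz _ hp.1 _ a1 a2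
    have s3 := hz _ a1 _ hp.2 a3
    suffices H : 0 < preCut l c t (Sum.inl d) ∧ 0 < 1 - preCut l c t (Sum.inl d) from
      ⟨H.1, by linarith [H.2]⟩
    rw [h1]
    simp only [preCut, Sum.elim_inl]
    unfold xr
    rcases r2 with r2 | r2
    · have s4 := hz _ r1 _ hp.1 r2
      have s5 := hz _ r1 _ a1 (r2.trans a2)
      have s6 := hz _ r1 _ hp.2 (r2.trans hlt)
      exact ⟨div_pos (mul_pos_of_neg_of_neg s6 s2) (mul_pos_of_neg_of_neg s5 s1),
        div_pos (mul_pos_of_neg_of_neg s4 s3) (mul_pos_of_neg_of_neg s5 s1)⟩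
    · have s4 := hz.gt r1 hp.1 (hlt.trans r2)
      have s5 := hz.gt r1 a1 (a3.trans r2)
      have s6 := hz.gt r1 hp.2 r2
      exact ⟨div_pos_of_neg_of_neg (mul_neg_of_pos_of_neg s6 s2) (mul_neg_of_pos_of_neg s5 s1),
        div_pos_of_neg_of_neg (mul_neg_of_pos_of_neg s4 s3) (mul_neg_of_pos_of_neg s5 s1)⟩
  have j1 := hasJac_preCut hl hc ht d
  have hdiff : DifferentiableAt ℝ (cutShear l c d) (forget l [c] t) := by
    have hout := outer_mem_cells hl hc
    have hzo := (pos_config hgood hy hout).sep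
    have hlt := chord_lt c
    have := hp.pred_fst_outside
    have := (refLabel_spec hl hc).2
    exact differentiableAt_xr (hzo _ hp.pred_fst_mem_outer _ hp.fst_mem_outer (by grind))
      (hzo _ (refLabel_mem_outer hl hc) _ hp.snd_mem_outer (by grind))
  have j2 := hasJac_twist (G := cutShear l c) (w := preCut l c t)
    (fun k => by rw [hsub k]; exact hpre) (fun k => by rw [hsub k]; exact hpos)
    (fun k => by rw [hsub k]; exact hdiff)
  have j3 := (j2.comp j1).congr (g := triv l [c])
    (Filter.eventually_of_mem ((isOpen_X l).mem_nhds ht) fun t' ht' => triv_eq_twist hl hc ht')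
  convert j3 using 1
  have : Subsingleton {d // d ∈ [c]} := ⟨fun a b => (hsub a).trans (hsub b).symm⟩
  rw [Fintype.prod_eq_single d fun x hx' => absurd (hsub x) hx', hx]
  have h1 := hpre.1.ne'
  have h2 : 1 - preCut l c t (Sum.inl d) ≠ 0 := by linarith [hpre.2]
  field_simp

end

/-! ### Adding one chord to a trivialisation map -/

section
variable {l K : List (Chord n)} {c : Chord n}

/-- The factor which compares the odds of the component of index `d` before and after a further
cut along `c`. -/
def shear (l K : List (Chord n)) (c : Chord n) (d : {d // d ∈ K}) (y : Space (K ++ l)) : ℝ :=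
  xr (config (K ++ l) y (outer d.1 (cellOf (K.erase d.1 ++ l) (ends d.1))))
    (pred (cellOf (c :: (K.erase d.1 ++ l)) (ends d.1)) d.1.1.1)
    (pred (cellOf (K.erase d.1 ++ l) (ends d.1)) d.1.1.1) d.1.1.1 d.1.1.2 *
  xr (config (K ++ l) y (inner d.1 (cellOf (K.erase d.1 ++ l) (ends d.1))))
    (pred (cellOf (K.erase d.1 ++ l) (ends d.1)) d.1.1.2)
    (pred (cellOf (c :: (K.erase d.1 ++ l)) (ends d.1)) d.1.1.2) d.1.1.1 d.1.1.2

lemma good_erase (h : Good (K ++ l)) {d : Chord n} (hd : d ∈ K) : Good (d :: (K.erase d ++ l)) :=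
  good_congr h (((List.perm_cons_erase hd).append_right l).nodup_iff.1 (good_iff.1 h).1)
    fun _ => ((List.perm_cons_erase hd).append_right l).mem_iff.symm

lemma cells_erase (h : Good (K ++ l)) {d : Chord n} (hd : d ∈ K) :
    cells (d :: (K.erase d ++ l)) = cells (K ++ l) :=
  cells_congr (good_erase h hd) h fun _ => ((List.perm_cons_erase hd).append_right l).mem_iff.symm

/-- The data of a chord in a dissection, before and after a further cut. -/
structure CutData (l K : List (Chord n)) (c d : Chord n) : Prop where
  ne : d ≠ c
  proper : Proper d (cellOf (K.erase d ++ l) (ends d))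
  proper' : Proper d (cellOf (c :: (K.erase d ++ l)) (ends d))
  sub : cellOf (c :: (K.erase d ++ l)) (ends d) ⊆ cellOf (K.erase d ++ l) (ends d)
  inner_mem : inner d (cellOf (K.erase d ++ l) (ends d)) ∈ cells (K ++ l)
  outer_mem : outer d (cellOf (K.erase d ++ l) (ends d)) ∈ cells (K ++ l)
  cell_inner : cellOf l (inner d (cellOf (K.erase d ++ l) (ends d))) = cellOf l (ends d)
  cell_outer : cellOf l (outer d (cellOf (K.erase d ++ l) (ends d))) = cellOf l (ends d)

lemma cellOf_cellOf_ends (h : Good (K ++ l)) {d : Chord n} (hd : d ∈ chi (K ++ l)) :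
    cellOf l (cellOf (K ++ l) (ends d)) = cellOf l (ends d) := by
  have hm := cellOf_ends_mem h hd
  obtain ⟨h1, h2⟩ := cellOf_cell h hm
  have hp := proper_cellOf h hd
  symm
  refine cellOf_of_proper h.tail h1 ⟨h2 hp.1, h2 hp.2, ?_, ?_⟩
  · obtain ⟨v, hv, hv'⟩ := hp.inside
    exact ⟨v, h2 hv, hv'⟩
  · obtain ⟨v, hv, hv'⟩ := hp.outside
    exact ⟨v, h2 hv, hv'⟩

lemma cutData (h : Good (c :: (K ++ l))) {d : Chord n} (hd : d ∈ K) : CutData l K c d := by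
  have hne : d ≠ c := fun h' => (mem_chi.1 h.1).1 (List.mem_append_left _ (h' ▸ hd))
  have g1 := good_erase h.2 hd
  have g2 : Good (d :: c :: (K.erase d ++ l)) := by
    refine good_congr (l := c :: d :: (K.erase d ++ l)) (good_congr h ?_ ?_) ?_ ?_
    · have := (good_iff.1 h).1
      exact (((List.perm_cons_erase hd).append_right l).cons c).nodup_iff.1 this
    · exact fun c' => (((List.perm_cons_erase hd).append_right l).cons c).mem_iff.symm
    · have := (good_iff.1 h).1
      exact ((((List.perm_cons_erase hd).append_right l).cons c).trans (List.Perm.swap _ _ _)).nodup_iff.1 this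
    · exact fun c' => (List.Perm.swap _ _ _).mem_iff.symm
  have hm := cellOf_ends_mem g1.2 g1.1
  have hm' := cellOf_ends_mem g2.2 g2.1
  have hi := inner_mem_cells g1.2 g1.1
  have ho := outer_mem_cells g1.2 g1.1
  rw [cells_erase h.2 hd] at hi ho
  have hsub := (cellOf_cell (K := [c]) (l := K.erase d ++ l) g2.2 hm').2
  have hsub' := cellOf_cellOf_ends (K := [c]) (l := K.erase d ++ l) g2.2 g2.1
  change cellOf (K.erase d ++ l) (cellOf (c :: (K.erase d ++ l)) (ends d)) = _ at hsub'
  rw [hsub'] at hsub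
  have hcc := cellOf_cellOf_ends g1.2 g1.1
  have hsup := (cellOf_cell g1.2 hm)
  rw [hcc] at hsup
  refine ⟨hne, proper_cellOf g1.2 g1.1, proper_cellOf g2.2 g2.1, hsub, hi, ho, ?_, ?_⟩
  · exact cellOf_eq_of_subset h.2.tail hsup.1 ((inner_subset _ _).trans hsup.2)
      (proper_cellOf g1.2 g1.1).card_inner
  · exact cellOf_eq_of_subset h.2.tail hsup.1 ((outer_subset _ _).trans hsup.2)
      (proper_cellOf g1.2 g1.1).card_outer

section
variable {d : Chord n} (D : CutData l K c d)
include D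

lemma CutData.mem_outer' : pred (cellOf (c :: (K.erase d ++ l)) (ends d)) d.1.1 ∈
    outer d (cellOf (K.erase d ++ l) (ends d)) := by
  have := mem_outer.1 D.proper'.pred_fst_mem_outer
  exact mem_outer.2 ⟨D.sub this.1, this.2⟩

lemma CutData.mem_inner' : pred (cellOf (c :: (K.erase d ++ l)) (ends d)) d.1.2 ∈
    inner d (cellOf (K.erase d ++ l) (ends d)) := by
  have := mem_inner.1 D.proper'.pred_snd_mem_inner
  exact mem_inner.2 ⟨D.sub this.1, this.2⟩

end

variable (h : Good (c :: (K ++ l)))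
include h

lemma shear_pos {y : Space (K ++ l)} (hy : y ∈ X (K ++ l)) (d : {d // d ∈ K}) :
    0 < shear l K c d y := by
  have D := cutData h d.2
  have hp := D.proper
  have hp' := D.proper'
  have zo := pos_config h.2 hy D.outer_mem
  have zi := pos_config h.2 hy D.inner_mem
  refine mul_pos (xr_pos (mul_pos ?_ ?_)) (xr_pos (mul_pos_of_neg_of_neg ?_ ?_))
  · exact zo.mul_pos_of_outside D.mem_outer' hp.fst_mem_outer hp.snd_mem_outer hp'.pred_fst_outside
  · exact zo.mul_pos_of_outside hp.pred_fst_mem_outer hp.fst_mem_outer hp.snd_mem_outer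
      hp.pred_fst_outside
  · exact zi.mul_neg_of_inside hp.pred_snd_mem_inner hp.fst_mem_inner hp.snd_mem_inner
      ⟨hp.pred_snd.2.1, hp.pred_snd.2.2.1⟩
  · exact zi.mul_neg_of_inside D.mem_inner' hp.fst_mem_inner hp.snd_mem_inner
      ⟨hp'.pred_snd.2.1, hp'.pred_snd.2.2.1⟩

lemma differentiableAt_shear {y : Space (K ++ l)} (hy : y ∈ X (K ++ l)) (d : {d // d ∈ K}) :
    DifferentiableAt ℝ (shear l K c d) y := by
  have D := cutData h d.2
  have hp := D.proper
  have hp' := D.proper'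
  have zo := (pos_config h.2 hy D.outer_mem).sep
  have zi := (pos_config h.2 hy D.inner_mem).sep
  have hlt := chord_lt d.1
  have n1 := hp.pred_fst_outside
  have n2 := hp'.pred_fst_outside
  have n3 := hp.pred_snd
  have n4 := hp'.pred_snd
  refine DifferentiableAt.fun_mul (differentiableAt_xr ?_ ?_) (differentiableAt_xr ?_ ?_)
  · exact zo _ D.mem_outer' _ hp.fst_mem_outer (by grind)
  · exact zo _ hp.pred_fst_mem_outer _ hp.snd_mem_outer (by grind)
  · exact zi _ hp.pred_snd_mem_inner _ hp.fst_mem_inner (by grind)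
  · exact zi _ D.mem_inner' _ hp.snd_mem_inner (by grind)

/-- The further cut along `c` shrinks the polygon in which the component of `d` is a dihedral
coordinate. This can only move the predecessors of the two ends of `d`, one on each side of `d`, and
`xr_twist` applies. -/
lemma normalCoord_cons {t : Space l} (ht : t ∈ X l) (d : {d // d ∈ K}) :
    normalCoord l (c :: K) d.1 t =
      twist (shear l K c) (triv l K t) (Sum.inl d) := by
  have D := cutData h d.2
  have hp := D.proper
  have hp' := D.proper'
  have hgl := h.2.tail
  have e1 := equi_forget h.2 ht D.outer_mem
  have e2 := equi_forget h.2 ht D.inner_mem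
  rw [D.cell_outer] at e1
  rw [D.cell_inner] at e2
  have zo := pos_config_cellOf h.2 ht D.outer_mem
  have zi := pos_config_cellOf h.2 ht D.inner_mem
  have hsubQ : cellOf (K.erase d.1 ++ l) (ends d.1) ⊆ cellOf l (ends d.1) := by
    have g1 := good_erase h.2 d.2
    have := (cellOf_cell g1.2 (cellOf_ends_mem g1.2 g1.1)).2
    rwa [cellOf_cellOf_ends g1.2 g1.1] at this
  have hzs : Sep (cellOf (K.erase d.1 ++ l) (ends d.1)) (config l t (cellOf l (ends d.1))) := by
    have hQ : cellOf l (ends d.1) ∈ cells l := by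
      rw [← D.cell_outer]; exact (cellOf_cell h.2 D.outer_mem).1
    exact ((pos_config hgl ht hQ).mono hsubQ).sep
  have hlt := chord_lt d.1
  have n1 := hp.pred_fst_outside
  have n2 := hp'.pred_fst_outside
  have n3 := hp.pred_snd
  have n4 := hp'.pred_snd
  have m1 := hp.pred_fst.1
  have m2 := D.sub hp'.pred_fst.1
  have m3 := D.sub n4.1
  have m4 := n3.1
  simp only [twist, Sum.elim_inl, triv, shear]
  change crossRatio (cellOf ((c :: K).erase d.1 ++ l) (ends d.1)) _ _ =
    normalCoord l K d.1 t * (xr _ _ _ _ _ * xr _ _ _ _ _) / _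
  rw [e1.xr_eq D.mem_outer' hp.pred_fst_mem_outer hp.fst_mem_outer hp.snd_mem_outer,
    e2.xr_eq hp.pred_snd_mem_inner D.mem_inner' hp.fst_mem_inner hp.snd_mem_inner,
    List.erase_cons_tail (by rw [beq_iff_eq]; exact Ne.symm D.ne)]
  refine (xr_twist (hzs _ m1 _ m4 (by grind)) (hzs _ hp.1 _ hp.2 hlt.ne) (hzs _ m1 _ hp.1 (by grind))
    (hzs _ m4 _ hp.2 (by grind)) (hzs _ m1 _ hp.2 (by grind)) (hzs _ hp.1 _ m4 (by grind))
    (hzs _ m2 _ hp.1 (by grind)) (hzs _ m3 _ hp.2 (by grind)) (hzs _ m2 _ m3 (by grind))).symm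

/-- For the chord cut last the polygon is a cell of the dissection by `K ++ l`, so its component
factors through the forgetful map to that stratum. -/
lemma normalCoord_self {t : Space l} (ht : t ∈ X l) :
    normalCoord l (c :: K) c t = u (K ++ l) c (forget l K t) := by
  have hm := cellOf_ends_mem h.2 h.1
  have hp := proper_cellOf h.2 h.1
  have e := equi_forget h.2 ht hm
  rw [cellOf_cellOf_ends h.2 h.1] at e
  unfold normalCoord u
  rw [List.erase_cons_head]
  exact (e.crossRatio_eq hp.1 hp.2).symm

lemma forget_cons {t : Space l} (ht : t ∈ X l) :
    forget l (c :: K) t = forget (K ++ l) [c] (forget l K t) := by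
  funext q
  have hm := cellOf_cell (K := [c]) (l := K ++ l) h q.2.1
  have e := equi_forget h.2 ht hm.1
  have h3 := (cellSpec h).card _ q.2.1
  have : cellOf l (cellOf (K ++ l) q.1.1) = cellOf l q.1.1 := by
    symm
    have := cellOf_cell h.2 hm.1
    exact cellOf_eq_of_subset h.2.tail this.1 (hm.2.trans this.2) h3
  rw [this] at e
  exact ((e.mono hm.2).simplicial_eq q.2.2.1).symm

/-- Sorting of the coordinates. -/
def consEquiv : {d // d ∈ c :: K} ⊕ Coord (c :: (K ++ l)) ≃
    {d // d ∈ K} ⊕ ({d // d ∈ [c]} ⊕ Coord (c :: (K ++ l))) := by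
  classical
  have hcK : c ∉ K := fun h' => (mem_chi.1 h.1).1 (List.mem_append_left _ h')
  refine ⟨Sum.elim (fun d => if hd : d.1 ∈ K then Sum.inl ⟨d.1, hd⟩ else
      Sum.inr (Sum.inl ⟨c, by simp⟩)) fun q => Sum.inr (Sum.inr q),
    Sum.elim (fun d => Sum.inl ⟨d.1, by simp [d.2]⟩)
      (Sum.elim (fun d => Sum.inl ⟨c, by simp⟩) Sum.inr), ?_, ?_⟩
  · rintro (⟨d, hd⟩ | q)
    · by_cases h' : d ∈ K
      · simp [h']
      · have : d = c := by simpa [h'] using hd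
        subst this
        simp [h']
    · rfl
  · rintro (⟨d, hd⟩ | ⟨d, hd⟩ | q)
    · simp [hd]
    · obtain rfl := List.mem_singleton.1 hd
      simp [hcK]
    · rfl

/-- f_{K ∪ {c}} is f_K, then the rescaling of the odds of the old normal coordinates, then f_c on
the factor X_{J ∪ K}. This reduces all trivialisation maps to single cuts. -/
lemma triv_cons {t : Space l} (ht : t ∈ X l) : triv l (c :: K) t = fun k =>
    rightMap {d // d ∈ K} (triv (K ++ l) [c]) (twist (shear l K c) (triv l K t)) (consEquiv h k) := by
  funext k
  rcases k with ⟨d, hd⟩ | q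
  · by_cases h' : d ∈ K
    · simp only [consEquiv, Equiv.coe_fn_mk, Sum.elim_inl, dif_pos h', rightMap]
      exact normalCoord_cons h ht ⟨d, h'⟩
    · have : d = c := by simpa [h'] using hd
      subst this
      simp only [consEquiv, Equiv.coe_fn_mk, Sum.elim_inl, dif_neg h', rightMap, Sum.elim_inr]
      refine (normalCoord_self h ht).trans ?_
      exact (normalCoord_singleton _ _ _).symm
  · exact congrFun (forget_cons h ht) q

end

lemma prod_mem_list {β : Type*} [CommMonoid β] (K : List (Chord n)) (F : Chord n → β) :
    ∏ d : {d // d ∈ K}, F d.1 = ∏ d ∈ K.toFinset, F d :=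
  (Finset.prod_subtype K.toFinset (p := fun d => d ∈ K) (by simp) F).symm

/-! ### Bijectivity and Jacobians of all trivialisation maps -/

section
variable {l : List (Chord n)} (hl : Good l)
include hl

lemma forget_nil {t : Space l} : forget l [] t = t := by
  funext q
  change simplicial q.1.1 (config l t (cellOf l q.1.1)) q.1.2 = t q
  have h3 := (cellSpec hl).card _ q.2.1
  rw [cellOf_self hl q.2.1, simplicial_config h3 q.2.2.2.2.1, pos_coord]

omit hl in
lemma twist_unit {x G : ℝ} (hx : 0 < x ∧ x < 1) (hG : 0 < G) :
    0 < x * G / (x * G + (1 - x)) ∧ x * G / (x * G + (1 - x)) < 1 := by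
  have h1 := mul_pos hx.1 hG
  have h2 : 0 < x * G + (1 - x) := by linarith
  exact ⟨div_pos h1 h2, (div_lt_one h2).2 (by linarith)⟩

theorem triv_bijOn : ∀ K : List (Chord n), Good (K ++ l) → Set.BijOn (triv l K) (X l) (Box l K)
  | [], _ => by
    refine ⟨fun t ht => ⟨fun c => absurd c.2 (by simp), ?_⟩, fun t _ t' _ h => ?_, fun w hw => ?_⟩
    · change forget l [] t ∈ _
      rwa [forget_nil hl]
    · rw [← forget_nil hl (t := t), ← forget_nil hl (t := t')]
      exact funext fun q => congrFun h (Sum.inr q)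
    · refine ⟨fun q => w (Sum.inr q), hw.2, ?_⟩
      funext k
      rcases k with ⟨d, hd⟩ | q
      · exact absurd hd (by simp)
      · exact congrFun (forget_nil hl) q
  | c :: K, h => by
    replace h : Good (c :: (K ++ l)) := h
    have ih := triv_bijOn K h.2
    have step := step_bijOn h.2 h.1
    have hcK : c ∉ K := fun h' => (mem_chi.1 h.1).1 (List.mem_append_left _ h')
    have hbox : ∀ {t}, t ∈ X l → ∀ d : {d // d ∈ K}, 0 < normalCoord l K d.1 t ∧
        normalCoord l K d.1 t < 1 := fun ht d => (ih.1 ht).1 d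
    have hforget : ∀ {t}, t ∈ X l → forget l K t ∈ X (K ++ l) := fun ht => forget_mem_X h.2 ht
    refine ⟨fun t ht => ⟨?_, forget_mem_X h ht⟩, fun t ht t' ht' heq => ?_, fun w hw => ?_⟩
    · rintro ⟨d, hd⟩
      change 0 < normalCoord l (c :: K) d t ∧ normalCoord l (c :: K) d t < 1
      by_cases hdK : d ∈ K
      · rw [normalCoord_cons h ht ⟨d, hdK⟩]
        exact twist_unit (hbox ht ⟨d, hdK⟩) (shear_pos h (hforget ht) _)
      · obtain rfl : d = c := by simpa [hdK] using hd
        rw [normalCoord_self h ht]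
        exact u_mem h.2 (hforget ht) h.1
    -- First the point of X_{J ∪ K} is recovered by injectivity of the single cut. Then the scaling
    -- factors agree and can be removed from the odds.
    · have hy : forget l K t = forget l K t' := by
        refine step.2.1 (hforget ht) (hforget ht') ?_
        funext k
        rcases k with ⟨d, hd⟩ | q
        · obtain rfl := List.mem_singleton.1 hd
          change normalCoord _ _ _ _ = normalCoord _ _ _ _
          rw [normalCoord_singleton, normalCoord_singleton, ← normalCoord_self h ht,
            ← normalCoord_self h ht']
          exact congrFun heq (Sum.inl ⟨d, by simp⟩)
        · change forget _ _ _ _ = forget _ _ _ _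
          rw [← forget_cons h ht, ← forget_cons h ht']
          exact congrFun heq (Sum.inr q)
      refine ih.2.1 ht ht' ?_
      funext k
      rcases k with d | q
      · have e1 : normalCoord l (c :: K) d.1 t = normalCoord l (c :: K) d.1 t' :=
          congrFun heq (Sum.inl ⟨d.1, by simp [d.2]⟩)
        rw [normalCoord_cons h ht d, normalCoord_cons h ht' d] at e1
        have hG := shear_pos h (hforget ht) d
        simp only [twist, Sum.elim_inl] at e1
        change triv l K t (Sum.inl d) * shear l K c d (forget l K t) / _ =
          triv l K t' (Sum.inl d) * shear l K c d (forget l K t') / _ at e1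
        change normalCoord l K d.1 t * shear l K c d (forget l K t) /
          (normalCoord l K d.1 t * shear l K c d (forget l K t) + (1 - normalCoord l K d.1 t)) =
          normalCoord l K d.1 t' * shear l K c d (forget l K t') /
          (normalCoord l K d.1 t' * shear l K c d (forget l K t') + (1 - normalCoord l K d.1 t')) at e1
        rw [← hy] at e1
        have b1 := hbox ht d
        have b2 := hbox ht' d
        change normalCoord l K d.1 t = normalCoord l K d.1 t'
        generalize shear l K c d (forget l K t) = G at *
        generalize normalCoord l K d.1 t = x at *
        generalize normalCoord l K d.1 t' = x' at *
        have n1 := mul_pos b1.1 hG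
        have n2 := mul_pos b2.1 hG
        have n3 : x * G + (1 - x) ≠ 0 := by linarith
        have n4 : x' * G + (1 - x') ≠ 0 := by linarith
        rw [div_eq_div_iff n3 n4] at e1
        have : G * (x - x') = 0 := by linear_combination e1
        rcases mul_eq_zero.1 this with h | h
        · exact absurd h hG.ne'
        · linarith
      · exact congrFun hy q
    · obtain ⟨y, hy, hyw⟩ := step.2.2 (show Sum.elim (fun _ => w (Sum.inl ⟨c, by simp⟩))
        (fun q => w (Sum.inr q)) ∈ Box (K ++ l) [c] from ⟨fun _ => hw.1 _, hw.2⟩)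
      have hG := fun d => shear_pos h hy d
      -- The prescribed normal coordinates are rescaled by the inverse factors, evaluated at the
      -- point `y` found for the single cut.
      obtain ⟨t, ht, htw⟩ := ih.2.2 (show Sum.elim (fun d : {d // d ∈ K} =>
          w (Sum.inl ⟨d.1, by simp [d.2]⟩) * (shear l K c d y)⁻¹ /
          (w (Sum.inl ⟨d.1, by simp [d.2]⟩) * (shear l K c d y)⁻¹ +
            (1 - w (Sum.inl ⟨d.1, by simp [d.2]⟩)))) y ∈ Box l K from
          ⟨fun d => twist_unit (hw.1 _) (inv_pos.2 (hG d)), hy⟩)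
      have hfy : forget l K t = y := funext fun q => congrFun htw (Sum.inr q)
      refine ⟨t, ht, ?_⟩
      funext k
      rcases k with ⟨d, hd⟩ | q
      · change normalCoord l (c :: K) d t = _
        by_cases hdK : d ∈ K
        · rw [normalCoord_cons h ht ⟨d, hdK⟩, htw]
          simp only [twist, Sum.elim_inl, Sum.elim_inr]
          change _ / (_ + (1 - _)) * shear l K c ⟨d, hdK⟩ y / (_ / (_ + (1 - _)) * shear l K c ⟨d, hdK⟩ y + (1 - _ / (_ + (1 - _)))) = _
          have b := hw.1 ⟨d, hd⟩
          have hG := hG ⟨d, hdK⟩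
          generalize shear l K c ⟨d, hdK⟩ y = G at *
          generalize w (Sum.inl ⟨d, hd⟩) = x at *
          have n1 := mul_pos b.1 (inv_pos.2 hG)
          have n2 : x * G⁻¹ + (1 - x) ≠ 0 := by linarith
          have e1 : 1 - x * G⁻¹ / (x * G⁻¹ + (1 - x)) = (1 - x) / (x * G⁻¹ + (1 - x)) := by
            rw [eq_div_iff n2, sub_mul, div_mul_cancel₀ _ n2]; ring
          have e2 : x * G⁻¹ / (x * G⁻¹ + (1 - x)) * G = x / (x * G⁻¹ + (1 - x)) := by
            field_simp
          rw [e1, e2, ← add_div, add_sub_cancel, div_div_div_cancel_right₀ n2, div_one]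
        · obtain rfl : d = c := by simpa [hdK] using hd
          rw [normalCoord_self h ht, hfy, ← normalCoord_singleton]
          exact congrFun hyw (Sum.inl ⟨d, by simp⟩)
      · change forget l (c :: K) t q = _
        rw [forget_cons h ht, hfy]
        exact congrFun hyw (Sum.inr q)

/-- The Jacobian determinant of the trivialisation maps. -/
theorem hasJac_triv : ∀ K : List (Chord n), Good (K ++ l) → ∀ t ∈ X l, HasJac (triv l K) t
    (dens l t * (∏ c : {c // c ∈ K}, normalCoord l K c.1 t * (1 - normalCoord l K c.1 t)) /
      dens (K ++ l) (forget l K t))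
  | [], _, t, ht => by
    have : IsEmpty {c // c ∈ ([] : List (Chord n))} := ⟨fun c => absurd c.2 (by simp)⟩
    have : triv l [] = fun (t : Space l) k => t (Equiv.emptySum {c // c ∈ ([] : List (Chord n))} (Coord l) k) := by
      funext t k
      rcases k with ⟨d, hd⟩ | q
      · exact absurd hd (by simp)
      · exact congrFun (forget_nil hl) q
    rw [this]
    have e := hasJac_reindex (Equiv.emptySum {c // c ∈ ([] : List (Chord n))} (Coord l)) t
    rw [forget_nil hl, Finset.univ_eq_empty, Finset.prod_empty, mul_one]
    refine Eq.mp ?_ e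
    congr 1
    exact (div_self (dens_pos hl ht).ne').symm
  | c :: K, h, t, ht => by
    replace h : Good (c :: (K ++ l)) := h
    have ih := hasJac_triv K h.2 t ht
    have hb := (triv_bijOn hl K h.2).1 ht
    have hy := forget_mem_X h.2 ht
    have j2 := hasJac_twist (G := shear l K c) (w := triv l K t) hb.1
      (fun k => shear_pos h hy k) (fun k => differentiableAt_shear h hy k)
    have j3 : HasJac (rightMap {d // d ∈ K} (triv (K ++ l) [c])) (twist (shear l K c) (triv l K t)) _ :=
      HasJac.rightMap (hasJac_cut h.2 h.1 hy)
    have j4 := (hasJac_reindex (consEquiv h) _).comp ((j3.comp j2).comp ih)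
    have j5 := j4.congr (g := triv l (c :: K))
      (Filter.eventually_of_mem ((isOpen_X l).mem_nhds ht) fun t' ht' => triv_cons h ht')
    have e0 : (fun i => twist (shear l K c) (triv l K t) (Sum.inr i)) = forget l K t := rfl
    rw [e0] at j5
    convert j5 using 1
    -- The twist divides by the old product of x (1 - x) and multiplies by the new one, and the
    -- single cut exchanges the densities, so everything intermediate cancels.
    rw [one_mul, Finset.prod_div_distrib, ← forget_cons h ht, ← normalCoord_self h ht]
    have e1 : ∏ d : {d // d ∈ c :: K}, normalCoord l (c :: K) d.1 t * (1 - normalCoord l (c :: K) d.1 t) =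
        (∏ k : {d // d ∈ K}, twist (shear l K c) (triv l K t) (Sum.inl k) *
          (1 - twist (shear l K c) (triv l K t) (Sum.inl k))) *
        (normalCoord l (c :: K) c t * (1 - normalCoord l (c :: K) c t)) := by
      have hcK : c ∉ K := fun h' => (mem_chi.1 h.1).1 (List.mem_append_left _ h')
      rw [prod_mem_list (c :: K) fun d => normalCoord l (c :: K) d t * (1 - normalCoord l (c :: K) d t),
        List.toFinset_cons, Finset.prod_insert (by simpa using hcK), mul_comm,
        ← prod_mem_list K fun d => normalCoord l (c :: K) d t * (1 - normalCoord l (c :: K) d t)]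
      congr 1
      exact Finset.prod_congr rfl fun k _ => by rw [normalCoord_cons h ht k]
    rw [e1]
    have e2 : ∏ k : {d // d ∈ K}, triv l K t (Sum.inl k) * (1 - triv l K t (Sum.inl k)) =
      ∏ k : {d // d ∈ K}, normalCoord l K k.1 t * (1 - normalCoord l K k.1 t) := rfl
    rw [e2]
    have p1 : ∏ k : {d // d ∈ K}, normalCoord l K k.1 t * (1 - normalCoord l K k.1 t) ≠ 0 := by
      refine Finset.prod_ne_zero_iff.2 fun k _ => mul_ne_zero (hb.1 k).1.ne' ?_
      have := (hb.1 k).2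
      change normalCoord l K k.1 t < 1 at this
      linarith
    have p2 := (dens_pos h.2 hy).ne'
    have p3 := (dens_pos h (forget_mem_X (K := c :: K) h ht)).ne'
    change _ / dens (c :: (K ++ l)) _ = _
    change dens (c :: (K ++ l)) _ ≠ 0 at p3
    field_simp

end

/-! ### Pull-backs of dihedral coordinates -/

lemma mem_cellOf_of_crosses {l : List (Chord n)} (hl : Good l) {c d : Chord n} (hc : c ∈ chi l)
    (hd : d ∈ chi l) (h : Crosses c d) : cellOf l (ends c) = cellOf l (ends d) := by
  by_contra hne
  have hp := proper_cellOf hl hc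
  have hq := proper_cellOf hl hd
  obtain ⟨e, he, H⟩ := cells_separated hl (cellOf_ends_mem hl hc) (cellOf_ends_mem hl hd) hne
  have := chord_lt c
  have := chord_lt d
  rcases H with ⟨h1, h2⟩ | ⟨h1, h2⟩
  · have a1 := h1 _ hp.1
    have a2 := h1 _ hp.2
    have a3 := h2 _ hq.1
    have a4 := h2 _ hq.2
    unfold Crosses at h
    grind
  · have a1 := h2 _ hp.1
    have a2 := h2 _ hp.2
    have a3 := h1 _ hq.1
    have a4 := h1 _ hq.2
    unfold Crosses at h
    grind

lemma Proper.mono {P Q : Finset (Vert n)} {e : Chord n} (h : Proper e P) (hPQ : P ⊆ Q) :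
    Proper e Q := by
  obtain ⟨v, hv, hv'⟩ := h.inside
  obtain ⟨w, hw, hw'⟩ := h.outside
  exact ⟨hPQ h.1, hPQ h.2, ⟨v, hPQ hv, hv'⟩, w, hPQ hw, hw'⟩

/-- The chords which become `e` by contraction to `P`. -/
def contr (l : List (Chord n)) (P : Finset (Vert n)) (e : Chord n) : Finset (Chord n) :=
  (chi l).filter fun d => P ⊆ cellOf l (ends d) ∧ ContractsTo P d e

/-- The chords whose coordinates divide the pull-back of `1 - u_e`. -/
def cocontr (l : List (Chord n)) (P : Finset (Vert n)) (e : Chord n) : Finset (Chord n) :=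
  (chi l).filter fun d => P ⊆ cellOf l (ends d) ∧ InRect e.1.1 (pred P e.1.2) e.1.2 (pred P e.1.1) d

section
variable {l : List (Chord n)} (hl : Good l)
include hl

section
variable {P : Finset (Vert n)} {e : Chord n}

omit hl in
lemma Proper.three_le (he : Proper e P) : 3 ≤ P.card :=
  he.card_inner.trans (Finset.card_le_card (inner_subset _ _))

lemma prod_u_filter {Q : Finset (Vert n)} (hQ : Q ∈ cells l) (hPQ : P ⊆ Q) (he : Proper e P)
    (t : Space l) (R : Chord n → Prop) [DecidablePred R] :
    ∏ d ∈ (chi l).filter (fun d => P ⊆ cellOf l (ends d) ∧ R d), u l d t =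
      ∏ d ∈ (chi l).filter (fun d => cellOf l (ends d) = Q ∧ R d), crossRatio Q (config l t Q) d := by
  have : (chi l).filter (fun d => P ⊆ cellOf l (ends d) ∧ R d) =
      (chi l).filter (fun d => cellOf l (ends d) = Q ∧ R d) := by
    refine Finset.filter_congr fun d hd => and_congr_left fun _ => ⟨fun h => ?_, fun h => h ▸ hPQ⟩
    rw [← cellOf_eq_of_subset hl hQ hPQ (he.three_le),
      cellOf_eq_of_subset hl (cellOf_ends_mem hl hd) h (he.three_le)]
  rw [this]
  refine Finset.prod_congr rfl fun d hd => ?_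
  rw [← (Finset.mem_filter.1 hd).2.1, u]

/-- `prod_chords_rect` for the rectangle of u_e, which consists of the chords contracting to `e`. -/
lemma crossRatio_eq_prod {Q : Finset (Vert n)} (hQ : Q ∈ cells l) (hPQ : P ⊆ Q) (he : Proper e P)
    {t : Space l} (ht : t ∈ X l) :
    crossRatio P (config l t Q) e = ∏ d ∈ contr l P e, u l d t := by
  rw [contr, prod_u_filter hl hQ hPQ he t (fun d => ContractsTo P d e), crossRatio_eq_xr,
    ← prod_chords_rect hl hQ (pos_config hl ht hQ).sep (he.rect hPQ)]
  refine Finset.prod_congr (Finset.filter_congr fun d _ => ?_) fun _ _ => rfl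
  rw [contractsTo_iff he]

lemma one_sub_crossRatio_eq_prod {Q : Finset (Vert n)} (hQ : Q ∈ cells l) (hPQ : P ⊆ Q)
    (he : Proper e P) {t : Space l} (ht : t ∈ X l) :
    1 - crossRatio P (config l t Q) e = ∏ d ∈ cocontr l P e, u l d t := by
  have hz := (pos_config hl ht hQ).sep
  rw [one_sub_crossRatio he (hz.mono hPQ), ← prod_chords_rect hl hQ hz (he.rect' hPQ), cocontr,
    prod_u_filter hl hQ hPQ he t (fun d => InRect e.1.1 (pred P e.1.2) e.1.2 (pred P e.1.1) d)]

lemma self_mem_contr (he : Proper e P) {Q : Finset (Vert n)} (hQ : Q ∈ cells l) (hPQ : P ⊆ Q) :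
    e ∈ contr l P e := by
  have := he.mono hPQ
  rw [contr, Finset.mem_filter, cellOf_of_proper hl hQ this]
  exact ⟨mem_chi_of_proper hl hQ this, hPQ, ends_subset.2 ⟨he.1, he.2⟩, Or.inl rfl⟩

end

/-- Inside one cell, a chord crossing `d` joins the two arcs complementary to those of u_d. Thus u_c
divides 1 - u_d whenever c and d cross, the source of all estimates near D_c. -/
lemma mem_cocontr_of_crosses {c d : Chord n} (hc : c ∈ chi l) (hd : d ∈ chi l) (h : Crosses c d) :
    c ∈ cocontr l (cellOf l (ends d)) d := by
  have hp := proper_cellOf hl hd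
  have hq := proper_cellOf hl hc
  have hcell := mem_cellOf_of_crosses hl hc hd h
  rw [cocontr, Finset.mem_filter, hcell]
  rw [hcell] at hq
  refine ⟨hc, subset_rfl, ?_⟩
  obtain ⟨a1, a2, a3, a4⟩ := hp.pred_snd
  obtain ⟨b1, b2⟩ := hp.pred_fst
  have c1 := hq.1
  have c2 := hq.2
  have := chord_lt c
  have := chord_lt d
  have := le_hi c1
  have := le_hi c2
  have := lo_le c1
  have := lo_le c2
  unfold InRect Arc
  unfold Crosses at h
  grind

lemma contractsTo_cell_iff {d e : Chord n} (hd : d ∈ chi l) (he : e ∈ chi l)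
    (h : cellOf l (ends d) = cellOf l (ends e)) (hc : ContractsTo (cellOf l (ends e)) d e) : d = e := by
  have hp := proper_cellOf hl he
  have hq := proper_cellOf hl hd
  rw [h] at hq
  rw [contractsTo_iff hp] at hc
  obtain ⟨a1, a2, a3, a4⟩ := hp.pred_snd
  obtain ⟨b1, b2⟩ := hp.pred_fst
  have := hq.1
  have := hq.2
  have := chord_lt d
  have := chord_lt e
  have := le_hi hq.1
  have := le_hi hq.2
  have := lo_le hq.1
  have := lo_le hq.2
  unfold InRect Arc at hc
  refine chord_ext ?_ ?_ <;> grind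

/-- Cutting along `c` moves the predecessor of an end of `e` only where `e` meets `c`. The arc then
grows by labels beyond `c`, so the additional chords contracting to `e` cross `c`. -/
lemma contractsTo_cut {c e : Chord n} (hc : c ∈ chi l) (he : e ∈ chi (c :: l)) (d : Chord n) :
    (ContractsTo (cellOf l (ends e)) d e → ContractsTo (cellOf (c :: l) (ends e)) d e) ∧
      (ContractsTo (cellOf (c :: l) (ends e)) d e → ¬ ContractsTo (cellOf l (ends e)) d e →
        Crosses c d) := by
  have hgood : Good (c :: l) := ⟨hc, hl⟩
  have hm := cellOf_ends_mem hgood he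
  have hp := proper_cellOf hgood he
  have hq := proper_cellOf hl hc
  have hel : ∀ Q ∈ cells l, cellOf (c :: l) (ends e) ⊆ Q → cellOf l (ends e) = Q := fun Q hQ h =>
    cellOf_of_proper hl hQ (hp.mono h)
  rcases (mem_cells_cons_iff hl hc).1 hm with ⟨h, _⟩ | h | h
  · rw [hel _ h subset_rfl]
    exact ⟨id, fun h h' => absurd h h'⟩
  · have hQ := hel _ (cellOf_ends_mem hl hc) (h ▸ inner_subset _ _)
    rw [h] at hp ⊢
    rw [hQ]
    have hpQ := hp.mono (inner_subset _ _)
    rw [contractsTo_iff hp, contractsTo_iff hpQ]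
    have e1 := mem_inner.1 hp.1
    have e2 := mem_inner.1 hp.2
    obtain ⟨v, hv, hv'⟩ := hp.outside
    have hv := mem_inner.1 hv
    have hlt := chord_lt e
    have hlt' := chord_lt d
    have hlt'' := chord_lt c
    rw [hq.pred_inner hp.2 (by grind)]
    by_cases hi : e.1.1 = c.1.1
    · have : pred (inner c (cellOf l (ends c))) e.1.1 = c.1.2 := by
        rw [hi, ← hq.lo_inner, pred_lo, hq.hi_inner]
      rw [this, hi]
      obtain ⟨b1, b2⟩ := hq.pred_fst
      obtain ⟨a1, a2, a3, a4⟩ := hpQ.pred_snd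
      have := le_hi hq.2
      have := lo_le hq.1
      unfold InRect Arc Crosses
      constructor <;> grind
    · rw [hq.pred_inner hp.1 hi]
      exact ⟨id, fun h h' => absurd h h'⟩
  · have hQ := hel _ (cellOf_ends_mem hl hc) (h ▸ outer_subset _ _)
    rw [h] at hp ⊢
    rw [hQ]
    have hpQ := hp.mono (outer_subset _ _)
    rw [contractsTo_iff hp, contractsTo_iff hpQ]
    have e1 := mem_outer.1 hp.1
    have e2 := mem_outer.1 hp.2
    obtain ⟨v, hv, hv'⟩ := hp.outside
    have hv := mem_outer.1 hv
    obtain ⟨w, hw, hw'⟩ := hp.inside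
    have hw := mem_outer.1 hw
    have hlt := chord_lt e
    have hlt' := chord_lt d
    have hlt'' := chord_lt c
    obtain ⟨b1, b2⟩ := hpQ.pred_fst
    obtain ⟨a1, a2, a3, a4⟩ := hpQ.pred_snd
    obtain ⟨a1', a2', a3', a4'⟩ := hq.pred_snd
    have := le_hi hq.2
    have := lo_le hq.1
    by_cases hi : e.1.1 = c.1.2
    · rw [hi, hq.pred_outer_snd, hq.pred_outer hp.2 (by grind)]
      unfold InRect Arc Crosses
      constructor <;> grind
    · rw [hq.pred_outer hp.1 hi]
      by_cases hj : e.1.2 = c.1.2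
      · rw [hj, hq.pred_outer_snd]
        rw [hj] at a1 a2 a3 a4
        unfold InRect Arc Crosses
        constructor <;> grind
      · rw [hq.pred_outer hp.2 hj]
        exact ⟨id, fun h h' => absurd h h'⟩

lemma one_sub_u_eq {t : Space l} (ht : t ∈ X l) {d : Chord n} (hd : d ∈ chi l) :
    1 - u l d t = ∏ e ∈ cocontr l (cellOf l (ends d)) d, u l e t :=
  one_sub_crossRatio_eq_prod hl (cellOf_ends_mem hl hd) subset_rfl (proper_cellOf hl hd) ht

lemma prod_u_mem {t : Space l} (ht : t ∈ X l) {S : Finset (Chord n)} (hS : S ⊆ chi l) :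
    0 < ∏ d ∈ S, u l d t ∧ ∏ d ∈ S, u l d t ≤ 1 :=
  ⟨Finset.prod_pos fun _ hd => (u_mem hl ht (hS hd)).1,
    Finset.prod_le_one (fun _ hd => (u_mem hl ht (hS hd)).1.le) fun _ hd => (u_mem hl ht (hS hd)).2.le⟩

lemma prod_u_le {t : Space l} (ht : t ∈ X l) {S : Finset (Chord n)} (hS : S ⊆ chi l) {c : Chord n}
    (hc : c ∈ S) : ∏ d ∈ S, u l d t ≤ u l c t := by
  rw [← Finset.mul_prod_erase _ _ hc]
  exact mul_le_of_le_one_right (u_mem hl ht (hS hc)).1.le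
    (prod_u_mem hl ht ((Finset.erase_subset _ _).trans hS)).2

omit hl in
lemma cocontr_subset (P : Finset (Vert n)) (e : Chord n) : cocontr l P e ⊆ chi l :=
  Finset.filter_subset _ _

omit hl in
lemma contr_subset (P : Finset (Vert n)) (e : Chord n) : contr l P e ⊆ chi l :=
  Finset.filter_subset _ _

lemma one_sub_u_le {t : Space l} (ht : t ∈ X l) {c d : Chord n} (hc : c ∈ chi l) (hd : d ∈ chi l)
    (h : Crosses c d) : 1 - u l d t ≤ u l c t := by
  rw [one_sub_u_eq hl ht hd]
  exact prod_u_le hl ht (cocontr_subset _ _) (mem_cocontr_of_crosses hl hc hd h)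

end

lemma u_forget {K l : List (Chord n)} (h : Good (K ++ l)) {t : Space l} (ht : t ∈ X l) {e : Chord n}
    (he : e ∈ chi (K ++ l)) :
    u (K ++ l) e (forget l K t) = ∏ d ∈ contr l (cellOf (K ++ l) (ends e)) e, u l d t := by
  have hp := proper_cellOf h he
  have hm := cellOf_ends_mem h he
  obtain ⟨h1, h2⟩ := cellOf_cell h hm
  rw [← crossRatio_eq_prod h.tail h1 h2 hp ht, u]
  exact (equi_forget h ht hm).crossRatio_eq hp.1 hp.2

/-! ### Polynomial functions of the dihedral coordinates -/

/-- The dihedral coordinates of all chords of `S`, on a stratum. -/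
def ubar (l : List (Chord n)) (t : Space l) (d : Chord n) : ℝ :=
  if d ∈ l then 0 else if d ∈ chi l then u l d t else 1

section
variable {l : List (Chord n)} (hl : Good l)
include hl

lemma ubar_mem {t : Space l} (ht : t ∈ X l) (d : Chord n) : 0 ≤ ubar l t d ∧ ubar l t d ≤ 1 := by
  unfold ubar
  split_ifs with h1 h2
  · simp
  · exact ⟨(u_mem hl ht h2).1.le, (u_mem hl ht h2).2.le⟩
  · simp

omit hl in
lemma ubar_of_mem {t : Space l} {d : Chord n} (hd : d ∈ chi l) : ubar l t d = u l d t := by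
  rw [ubar, if_neg (mem_chi.1 hd).1, if_pos hd]

lemma contr_self_erase {c e : Chord n} (hc : c ∈ chi l) (he : e ∈ chi (c :: l)) {d : Chord n}
    (hd : d ∈ (contr l (cellOf (c :: l) (ends e)) e).erase e) : d ∈ chi l ∧ Crosses c d := by
  have hgood : Good (c :: l) := ⟨hc, hl⟩
  rw [Finset.mem_erase, contr, Finset.mem_filter] at hd
  obtain ⟨hne, hd, hsub, hcon⟩ := hd
  refine ⟨hd, (contractsTo_cut hl hc he d).2 hcon fun h => hne ?_⟩
  have he' : e ∈ chi l := (mem_chi_cons.1 he).1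
  have hp := proper_cellOf hgood he
  have : cellOf l (ends e) = cellOf l (ends d) :=
    cellOf_of_proper hl (cellOf_ends_mem hl hd) (hp.mono hsub)
  exact contractsTo_cell_iff hl hd he' this.symm h

open MvPolynomial in
/-- Near the divisor of `c` the dihedral coordinates are those of the divisor, up to multiples of
`u_c`. -/
lemma exists_ubar_forget {c : Chord n} (hc : c ∈ chi l) : ∃ G : Chord n → MvPolynomial (Chord n) ℝ,
    ∀ t ∈ X l, ∀ d, ubar (c :: l) (forget l [c] t) d =
      ubar l t d - u l c t * eval (ubar l t) (G d) := by
  have hgood : Good (c :: l) := ⟨hc, hl⟩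
  -- If `d` crosses `c` its coordinate is 1 on the divisor, and 1 - u_d is a product of coordinates
  -- including u_c.
  have cross : ∀ d, d ∈ chi l → Crosses c d → ∃ g : MvPolynomial (Chord n) ℝ, ∀ t ∈ X l,
      ubar l t d = 1 - u l c t * eval (ubar l t) g := by
    intro d hd hcd
    have hmem := mem_cocontr_of_crosses hl hc hd hcd
    refine ⟨∏ e ∈ (cocontr l (cellOf l (ends d)) d).erase c, MvPolynomial.X e, fun t ht => ?_⟩
    have h1 := one_sub_u_eq hl ht hd
    rw [← Finset.mul_prod_erase _ _ hmem] at h1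
    rw [map_prod, ubar_of_mem hd]
    have : ∏ e ∈ (cocontr l (cellOf l (ends d)) d).erase c, eval (ubar l t) (MvPolynomial.X e) =
        ∏ e ∈ (cocontr l (cellOf l (ends d)) d).erase c, u l e t :=
      Finset.prod_congr rfl fun e he => by
        rw [eval_X, ubar_of_mem (cocontr_subset _ _ (Finset.mem_of_mem_erase he))]
    rw [this]
    linarith
  -- For chords of the divisor the pull-back of u_d is u_d times coordinates of chords crossing `c`,
  -- a product which is again 1 up to a multiple of u_c.
  have prods : ∀ S : Finset (Chord n), (∀ d ∈ S, d ∈ chi l ∧ Crosses c d) →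
      ∃ g : MvPolynomial (Chord n) ℝ, ∀ t ∈ X l,
        ∏ d ∈ S, u l d t = 1 - u l c t * eval (ubar l t) g := by
    intro S
    induction S using Finset.induction_on with
    | empty => exact fun _ => ⟨0, fun t _ => by simp⟩
    | insert d S hd ih =>
      intro hS
      obtain ⟨g, hg⟩ := ih fun d hd => hS d (Finset.mem_insert_of_mem hd)
      obtain ⟨h1, h2⟩ := hS d (Finset.mem_insert_self _ _)
      obtain ⟨g', hg'⟩ := cross d h1 h2
      refine ⟨g + g' - MvPolynomial.X c * g * g', fun t ht => ?_⟩
      rw [Finset.prod_insert hd, hg t ht, ← ubar_of_mem h1, hg' t ht]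
      simp only [map_add, map_sub, map_mul, eval_X, ubar_of_mem hc]
      ring
  have main : ∀ d, ∃ g : MvPolynomial (Chord n) ℝ, ∀ t ∈ X l,
      ubar (c :: l) (forget l [c] t) d = ubar l t d - u l c t * eval (ubar l t) g := by
    intro d
    by_cases hdc : d = c
    · subst hdc
      refine ⟨1, fun t _ => ?_⟩
      rw [ubar, if_pos (by simp), ubar_of_mem hc]
      simp
    by_cases hdl : d ∈ l
    · refine ⟨0, fun t _ => ?_⟩
      rw [ubar, if_pos (by simp [hdl]), ubar, if_pos hdl]
      simp
    have hdn : d ∉ c :: l := by simp [hdc, hdl]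
    by_cases hd : d ∈ chi (c :: l)
    · have hd' : d ∈ chi l := (mem_chi_cons.1 hd).1
      obtain ⟨g, hg⟩ := prods _ fun e he => contr_self_erase hl hc hd he
      refine ⟨MvPolynomial.X d * g, fun t ht => ?_⟩
      have hcell := cellOf_cell (K := [c]) hgood (cellOf_ends_mem hgood hd)
      have hs := self_mem_contr hl (proper_cellOf hgood hd) hcell.1 hcell.2
      have h1 := u_forget (K := [c]) hgood ht hd
      change u (c :: l) d (forget l [c] t) = ∏ e ∈ contr l (cellOf (c :: l) (ends d)) d, u l e t at h1
      rw [← Finset.mul_prod_erase _ _ hs, hg t ht] at h1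
      rw [ubar_of_mem hd, ubar_of_mem hd', h1, map_mul, eval_X, ubar_of_mem hd']
      ring
    · by_cases hd' : d ∈ chi l
      · have hcr : Crosses c d := by
          by_contra hcr
          exact hd (mem_chi_cons.2 ⟨hd', hdc, hcr⟩)
        obtain ⟨g, hg⟩ := cross d hd' hcr
        refine ⟨-g, fun t ht => ?_⟩
        rw [ubar, if_neg hdn, if_neg hd, hg t ht, map_neg]
        ring
      · refine ⟨0, fun t _ => ?_⟩
        rw [ubar, if_neg hdn, if_neg hd, ubar, if_neg hdl, if_neg hd']
        simp
  choose G hG using main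
  exact ⟨G, fun t ht d => hG d t ht⟩

end

/-! ### Bounds and substitutions for polynomials -/

section
open MvPolynomial
variable {σ : Type} [Fintype σ]

omit [Fintype σ] in
lemma exists_bound_eval (P : MvPolynomial σ ℝ) : ∃ C : ℝ, 0 ≤ C ∧
    ∀ a : σ → ℝ, (∀ i, 0 ≤ a i ∧ a i ≤ 1) → |eval a P| ≤ C := by
  induction P using MvPolynomial.induction_on with
  | C r => exact ⟨|r|, abs_nonneg r, fun a _ => by simp⟩
  | add p q hp hq =>
    obtain ⟨C, hC, h⟩ := hp
    obtain ⟨C', hC', h'⟩ := hq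
    refine ⟨C + C', by positivity, fun a ha => ?_⟩
    rw [map_add]
    exact (abs_add_le _ _).trans (add_le_add (h a ha) (h' a ha))
  | mul_X p i hp =>
    obtain ⟨C, hC, h⟩ := hp
    refine ⟨C, hC, fun a ha => ?_⟩
    rw [map_mul, eval_X, abs_mul, abs_of_nonneg (ha i).1]
    exact (mul_le_of_le_one_right (abs_nonneg _) (ha i).2).trans (h a ha)

omit [Fintype σ] in
lemma exists_lipschitz_eval (P : MvPolynomial σ ℝ) : ∃ C : ℝ, 0 ≤ C ∧
    ∀ a b : σ → ℝ, (∀ i, 0 ≤ a i ∧ a i ≤ 1) → (∀ i, 0 ≤ b i ∧ b i ≤ 1) →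
      ∀ M, (∀ i, |a i - b i| ≤ M) → |eval a P - eval b P| ≤ C * M := by
  induction P using MvPolynomial.induction_on with
  | C r => exact ⟨0, le_rfl, fun a b _ _ M _ => by simp⟩
  | add p q hp hq =>
    obtain ⟨C, hC, h⟩ := hp
    obtain ⟨C', hC', h'⟩ := hq
    refine ⟨C + C', by positivity, fun a b ha hb M hM => ?_⟩
    rw [map_add, map_add, add_mul, add_sub_add_comm]
    exact (abs_add_le _ _).trans (add_le_add (h a b ha hb M hM) (h' a b ha hb M hM))
  | mul_X p i hp =>
    obtain ⟨C, hC, h⟩ := hp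
    obtain ⟨C', hC', h'⟩ := exists_bound_eval p
    refine ⟨C + C', by positivity, fun a b ha hb M hM => ?_⟩
    rw [map_mul, map_mul, eval_X, eval_X]
    have e : eval a p * a i - eval b p * b i = (eval a p - eval b p) * a i + eval b p * (a i - b i) := by
      ring
    rw [e, add_mul]
    refine (abs_add_le _ _).trans (add_le_add ?_ ?_)
    · rw [abs_mul, abs_of_nonneg (ha i).1]
      exact (mul_le_of_le_one_right (abs_nonneg _) (ha i).2).trans (h a b ha hb M hM)
    · rw [abs_mul]
      exact mul_le_mul (h' b hb) (hM i) (abs_nonneg _) hC'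

omit [Fintype σ] in
-- Modulo X_c the substitution is the identity. This makes vanishing on the divisor imply
-- divisibility by u_c.
lemma exists_sub_bind (c : σ) (G : σ → MvPolynomial σ ℝ) (P : MvPolynomial σ ℝ) :
    ∃ P' : MvPolynomial σ ℝ, P - bind₁ (fun d => MvPolynomial.X d - MvPolynomial.X c * G d) P =
      MvPolynomial.X c * P' := by
  induction P using MvPolynomial.induction_on with
  | C r => exact ⟨0, by simp⟩
  | add p q hp hq =>
    obtain ⟨p', hp⟩ := hp
    obtain ⟨q', hq⟩ := hq
    exact ⟨p' + q', by rw [map_add, mul_add, ← hp, ← hq]; ring⟩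
  | mul_X p i hp =>
    obtain ⟨p', hp⟩ := hp
    refine ⟨p' * MvPolynomial.X i + bind₁ (fun d => MvPolynomial.X d - MvPolynomial.X c * G d) p * G i, ?_⟩
    rw [map_mul, bind₁_X_right]
    linear_combination MvPolynomial.X i * hp

end

/-! ### Residues of polynomial multiples of the canonical form -/

section
open MvPolynomial
variable {l : List (Chord n)} (hl : Good l) {c : Chord n} (hc : c ∈ chi l)
include hl hc

lemma abs_ubar_forget_sub : ∃ C : ℝ, 0 ≤ C ∧ ∀ t ∈ X l, ∀ d,
    |ubar (c :: l) (forget l [c] t) d - ubar l t d| ≤ C * u l c t := by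
  obtain ⟨G, hG⟩ := exists_ubar_forget hl hc
  choose C hC h using fun d => exists_bound_eval (G d)
  refine ⟨∑ d, C d, Finset.sum_nonneg fun d _ => hC d, fun t ht d => ?_⟩
  have hu := (u_mem hl ht hc).1
  rw [hG t ht d, sub_sub_cancel_left, abs_neg, abs_mul, abs_of_pos hu, mul_comm]
  exact mul_le_mul_of_nonneg_right ((h d _ (ubar_mem hl ht)).trans
    (Finset.single_le_sum (fun d _ => hC d) (Finset.mem_univ d))) hu.le

lemma abs_eval_forget_sub (P : MvPolynomial (Chord n) ℝ) : ∃ C : ℝ, 0 ≤ C ∧ ∀ t ∈ X l,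
    |eval (ubar (c :: l) (forget l [c] t)) P - eval (ubar l t) P| ≤ C * u l c t := by
  have hgood : Good ([c] ++ l) := ⟨hc, hl⟩
  obtain ⟨C, hC, h⟩ := abs_ubar_forget_sub hl hc
  obtain ⟨C', hC', h'⟩ := exists_lipschitz_eval P
  refine ⟨C' * C, by positivity, fun t ht => ?_⟩
  rw [mul_assoc]
  exact h' _ _ (ubar_mem hgood (forget_mem_X hgood ht)) (ubar_mem hl ht) _ (h t ht)

/-- A polynomial which vanishes on the divisor of `c` is a multiple of `u_c`. -/
lemma exists_eval_eq_mul {P : MvPolynomial (Chord n) ℝ}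
    (h : ∀ y ∈ X (c :: l), eval (ubar (c :: l) y) P = 0) :
    ∃ P' : MvPolynomial (Chord n) ℝ, ∀ t ∈ X l, eval (ubar l t) P = u l c t * eval (ubar l t) P' := by
  have hgood : Good ([c] ++ l) := ⟨hc, hl⟩
  obtain ⟨G, hG⟩ := exists_ubar_forget hl hc
  obtain ⟨P', hP'⟩ := exists_sub_bind c G P
  refine ⟨P', fun t ht => ?_⟩
  have h1 := congrArg (eval (ubar l t)) hP'
  rw [map_sub, map_mul, eval_X, ubar_of_mem hc] at h1
  have h2 : eval (ubar l t) (bind₁ (fun d => MvPolynomial.X d - MvPolynomial.X c * G d) P) =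
      eval (ubar (c :: l) (forget l [c] t)) P := by
    rw [← coe_aeval_eq_eval, ← coe_aeval_eq_eval]
    change aeval _ (bind₁ _ P) = aeval _ P
    rw [aeval_bind₁]
    congr 2
    funext d
    rw [hG t ht d]
    simp [ubar_of_mem hc]
  rw [h2, h _ (forget_mem_X hgood ht), sub_zero] at h1
  exact h1

/-- The filter which defines residues. -/
def resFilter (l : List (Chord n)) (c : Chord n) (y : Space (c :: l)) : Filter (Space l) :=
  comap (fun t => (u l c t, forget l [c] t)) (𝓝[>] (0 : ℝ) ×ˢ pure y) ⊓ 𝓟 (X l)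

omit hl hc in
lemma eventually_resFilter (y : Space (c :: l)) :
    ∀ᶠ t in resFilter l c y, t ∈ X l ∧ forget l [c] t = y := by
  have h1 : ∀ᶠ t in resFilter l c y, t ∈ X l := mem_inf_of_right (mem_principal_self _)
  have h2 : Tendsto (fun t => (u l c t, forget l [c] t)) (resFilter l c y)
      (𝓝[>] (0 : ℝ) ×ˢ pure y) := tendsto_comap.mono_left inf_le_left
  have h3 : ∀ᶠ q in 𝓝[>] (0 : ℝ) ×ˢ pure y, q.2 = y := by
    have : ∀ᶠ x in pure y, x = y := by simp
    exact this.prod_inr _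
  filter_upwards [h1, h2.eventually h3] with t a b using ⟨a, b⟩

omit hl hc in
lemma tendsto_resFilter (y : Space (c :: l)) : Tendsto (u l c) (resFilter l c y) (𝓝 0) := by
  have h2 : Tendsto (fun t => (u l c t, forget l [c] t)) (resFilter l c y)
      (𝓝[>] (0 : ℝ) ×ˢ pure y) := tendsto_comap.mono_left inf_le_left
  exact (tendsto_fst.comp h2).mono_right nhdsWithin_le_nhds

/-- Surjectivity of f_c: over each `y` there are points of the cell with u_c as small as desired.
Hence `limUnder` is a genuine limit. -/
lemma resFilter_neBot {y : Space (c :: l)} (hy : y ∈ X (c :: l)) : (resFilter l c y).NeBot := by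
  rw [resFilter, inf_principal_neBot_iff]
  intro p hp
  obtain ⟨s, hs, hsp⟩ := Filter.mem_comap.1 hp
  rw [mem_prod_iff] at hs
  obtain ⟨s1, h1, s2, h2, hss⟩ := hs
  obtain ⟨ε, hε, hsub⟩ := mem_nhdsGT_iff_exists_Ioo_subset.1 h1
  have hε' : (0 : ℝ) < ε := hε
  set x : ℝ := min (ε / 2) (1 / 2) with hx
  have hx0 : 0 < x := lt_min (by linarith) (by norm_num)
  have hx1 : x < 1 := (min_le_right _ _).trans_lt (by norm_num)
  have hxε : x < ε := (min_le_left _ _).trans_lt (by linarith)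
  obtain ⟨t, ht, htw⟩ := (step_bijOn hl hc).2.2
    (show Sum.elim (fun _ => x) y ∈ Box l [c] from ⟨fun _ => ⟨hx0, hx1⟩, hy⟩)
  have e1 : u l c t = x := by
    rw [← normalCoord_singleton]
    exact congrFun htw (Sum.inl ⟨c, by simp⟩)
  have e2 : forget l [c] t = y := funext fun q => congrFun htw (Sum.inr q)
  refine ⟨t, hsp (hss ⟨?_, ?_⟩), ht⟩
  · change u l c t ∈ s1
    rw [e1]; exact hsub ⟨hx0, hxε⟩
  · change forget l [c] t ∈ s2
    rw [e2]; exact mem_pure.1 h2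

lemma tendsto_eval_resFilter (P : MvPolynomial (Chord n) ℝ) (y : Space (c :: l)) :
    Tendsto (fun t => eval (ubar l t) P) (resFilter l c y) (𝓝 (eval (ubar (c :: l) y) P)) := by
  obtain ⟨C, hC, h⟩ := abs_eval_forget_sub hl hc P
  rw [tendsto_iff_norm_sub_tendsto_zero]
  have hlim : Tendsto (fun t => C * u l c t) (resFilter l c y) (𝓝 0) := by
    simpa using (tendsto_resFilter y).const_mul C
  refine squeeze_zero' (Eventually.of_forall fun t => norm_nonneg _) ?_ hlim
  filter_upwards [eventually_resFilter y] with t ht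
  have := h t ht.1
  rw [ht.2, abs_sub_comm] at this
  exact this

/-- Equality of polynomial functions restricts to the divisor of `c`. -/
lemma eval_eq_of_forall {P P' : MvPolynomial (Chord n) ℝ}
    (h : ∀ t ∈ X l, eval (ubar l t) P = eval (ubar l t) P') {y : Space (c :: l)}
    (hy : y ∈ X (c :: l)) : eval (ubar (c :: l) y) P = eval (ubar (c :: l) y) P' := by
  have := resFilter_neBot hl hc hy
  refine tendsto_nhds_unique (tendsto_eval_resFilter hl hc P y)
    ((tendsto_eval_resFilter hl hc P' y).congr' ?_)
  filter_upwards [eventually_resFilter y] with t ht using (h t ht.1).symm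

lemma jac_cut {t : Space l} (ht : t ∈ X l) : jac l [c] t =
    dens l t * (u l c t * (1 - u l c t)) / dens (c :: l) (forget l [c] t) :=
  jac_eq (hasJac_cut hl hc ht)

/-- By the Jacobian formula `dens l` is the pull-back of du_c / (u_c (1 - u_c)) times `dens (c ::
l)`; the factor 1 - u_c tends to 1 and P to its value on the divisor. -/
lemma res_eq {ω : Form l} {P : MvPolynomial (Chord n) ℝ}
    (h : ∀ t ∈ X l, ω t = eval (ubar l t) P * dens l t) {y : Space (c :: l)} (hy : y ∈ X (c :: l)) :
    res l c ω y = eval (ubar (c :: l) y) P * dens (c :: l) y := by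
  have := resFilter_neBot hl hc hy
  refine Tendsto.limUnder_eq (f := resFilter l c y) ?_
  have h1 : Tendsto (fun t => eval (ubar l t) P * dens (c :: l) y * (1 - u l c t)⁻¹)
      (resFilter l c y) (𝓝 (eval (ubar (c :: l) y) P * dens (c :: l) y * (1 - 0)⁻¹)) :=
    ((tendsto_eval_resFilter hl hc P y).mul_const _).mul
      (((tendsto_resFilter y).const_sub 1).inv₀ (by norm_num))
  rw [sub_zero, inv_one, mul_one] at h1
  refine h1.congr' ?_
  filter_upwards [eventually_resFilter y] with t ht
  have hu := u_mem hl ht.1 hc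
  have hd := (dens_pos hl ht.1).ne'
  have hu1 : 1 - u l c t ≠ 0 := by linarith
  have hu0 := hu.1.ne'
  have hd' := (dens_pos (l := c :: l) ⟨hc, hl⟩ hy).ne'
  rw [h t ht.1, jac_cut hl hc ht.1, ht.2]
  field_simp

end

lemma resIter_eq {ω : Form ([] : List (Chord n))} {P : MvPolynomial (Chord n) ℝ}
    (h : ∀ t ∈ X [], ω t = MvPolynomial.eval (ubar [] t) P * dens [] t) :
    ∀ l : List (Chord n), Good l → ∀ t ∈ X l,
      resIter l ω t = MvPolynomial.eval (ubar l t) P * dens l t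
  | [], _ => h
  | _ :: l, hl => fun _ hy => res_eq hl.2 hl.1 (resIter_eq h l hl.2) hy

/-! ### Logarithmic forms -/

section
open MvPolynomial

/-- The functions on `X` which are polynomials in the dihedral coordinates. -/
def polyFun (n : ℕ) : Subring (Space ([] : List (Chord n)) → ℝ) where
  carrier := {f | ∃ P : MvPolynomial (Chord n) ℝ, ∀ t ∈ X [], f t = eval (ubar [] t) P}
  mul_mem' := by
    rintro f g ⟨P, hP⟩ ⟨Q, hQ⟩
    exact ⟨P * Q, fun t ht => by rw [map_mul, ← hP t ht, ← hQ t ht]; rfl⟩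
  one_mem' := ⟨1, fun t _ => by simp⟩
  add_mem' := by
    rintro f g ⟨P, hP⟩ ⟨Q, hQ⟩
    exact ⟨P + Q, fun t ht => by rw [map_add, ← hP t ht, ← hQ t ht]; rfl⟩
  zero_mem' := ⟨0, fun t _ => by simp⟩
  neg_mem' := by
    rintro f ⟨P, hP⟩
    exact ⟨-P, fun t ht => by rw [map_neg, ← hP t ht]; rfl⟩

lemma polyFun_congr {f g : Space ([] : List (Chord n)) → ℝ} (hf : f ∈ polyFun n)
    (h : ∀ t ∈ X [], g t = f t) : g ∈ polyFun n := by
  obtain ⟨P, hP⟩ := hf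
  exact ⟨P, fun t ht => (h t ht).trans (hP t ht)⟩

lemma good_nil : Good ([] : List (Chord n)) := trivial

lemma cellOf_nil (A : Finset (Vert n)) : cellOf ([] : List (Chord n)) A = Finset.univ := by
  simp [cellOf, cells, Finset.filter_singleton]

lemma univ_mem_cells : (Finset.univ : Finset (Vert n)) ∈ cells ([] : List (Chord n)) := by
  simp [cells]

lemma lo_univ : lo (Finset.univ : Finset (Vert n)) = ⟨0, by omega⟩ :=
  lo_eq (Finset.mem_univ _) fun w _ => Nat.zero_le w.val

lemma hi_univ : hi (Finset.univ : Finset (Vert n)) = ⟨n + 2, by omega⟩ :=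
  hi_eq (Finset.mem_univ _) fun w _ => by rw [Fin.le_def]; simp only; omega

lemma pred_univ (v w : Vert n) (h : v.val + 1 = w.val) : pred (Finset.univ : Finset (Vert n)) w = v := by
  refine pred_eq (Finset.mem_univ _) ?_ fun x _ hx => ?_
  · rw [Fin.lt_def]; omega
  · rw [Fin.lt_def] at hx; rw [Fin.le_def]; omega

/-- The `v`-th marked point of `X`. -/
abbrev pt (t : Space ([] : List (Chord n))) (v : Vert n) : ℝ := pos [] t Finset.univ v

lemma pt_lt {t : Space ([] : List (Chord n))} (ht : t ∈ X []) {v w : Vert n} (h : v < w)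
    (hw : w.val ≤ n + 1) : pt t v < pt t w :=
  pos_lt good_nil ht univ_mem_cells (Finset.mem_univ _) (Finset.mem_univ _) h (by
    rw [hi_univ]; intro h'; rw [h'] at hw; simp at hw)

/-- Its complement (t_r - t_q) / (t_r - t_p) is the cross-ratio of p, q, r, ∞, a product of dihedral
coordinates by `prod_chords_rect`. -/
lemma ratio_mem {p q r : Vert n} (h1 : p ≤ q) (h2 : q ≤ r) (h3 : p < r) (hr : r.val ≤ n + 1) :
    (fun t => (pt t q - pt t p) / (pt t r - pt t p)) ∈ polyFun n := by
  have hne : ∀ v : Vert n, v.val ≤ n + 1 → v ≠ hi Finset.univ := by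
    intro v hv h
    rw [h, hi_univ] at hv
    simp at hv
  have hrp : ∀ t ∈ X ([] : List (Chord n)), pt t r - pt t p ≠ 0 := fun t ht =>
    (sub_pos.2 (pt_lt ht h3 hr)).ne'
  rcases h1.eq_or_lt with rfl | h1
  · exact polyFun_congr (zero_mem _) fun t _ => by simp
  rcases h2.eq_or_lt with rfl | h2
  · exact polyFun_congr (one_mem _) fun t ht => div_self (hrp t ht)
  have hqn : q.val ≤ n + 1 := by rw [Fin.lt_def] at h2; omega
  have hpn : p.val ≤ n + 1 := by rw [Fin.lt_def] at h1; omega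
  have hR : Rect Finset.univ p q r (hi (Finset.univ : Finset (Vert n))) := by
    refine ⟨Finset.mem_univ _, Finset.mem_univ _, Finset.mem_univ _, Finset.mem_univ _, h1.ne,
      hne r hr, fun a _ b _ => ?_⟩
    have := lt_of_le_of_ne (le_hi (Finset.mem_univ r)) (hne r hr)
    unfold Arc
    grind
  have key : (fun t => (pt t r - pt t q) / (pt t r - pt t p)) ∈ polyFun n := by
    refine ⟨∏ d ∈ (chi []).filter (fun d => cellOf [] (ends d) = Finset.univ ∧
      InRect p q r (hi (Finset.univ : Finset (Vert n))) d), MvPolynomial.X d, fun t ht => ?_⟩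
    have h := prod_chords_rect good_nil univ_mem_cells (pos_config good_nil ht univ_mem_cells).sep hR
    rw [map_prod]
    have e : ∀ d ∈ (chi []).filter (fun d => cellOf [] (ends d) = Finset.univ ∧
      InRect p q r (hi (Finset.univ : Finset (Vert n))) d), eval (ubar [] t) (MvPolynomial.X d) =
        crossRatio Finset.univ (config [] t Finset.univ) d := by
      intro d hd
      rw [eval_X, ubar_of_mem (Finset.mem_filter.1 hd).1, u, cellOf_nil]
    rw [Finset.prod_congr rfl e, h]
    unfold xr
    rw [bracket_config_hi (hne p hpn), bracket_config_hi (hne q hqn),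
      bracket_config (hne q hqn) (hne r hr), bracket_config (hne p hpn) (hne r hr)]
    have := hrp t ht
    have h' : pt t p - pt t r ≠ 0 := fun h => this (by linarith)
    change _ = -1 * (pt t q - pt t r) / ((pt t p - pt t r) * -1)
    rw [div_eq_div_iff this (mul_ne_zero h' (by norm_num))]
    ring
  refine polyFun_congr (sub_mem (one_mem _) key) fun t ht => ?_
  have := hrp t ht
  change _ = 1 - (pt t r - pt t q) / (pt t r - pt t p)
  field_simp
  ring

lemma coord_nil (k : Coord ([] : List (Chord n))) :
    k.1.1 = Finset.univ ∧ 1 ≤ k.1.2.val ∧ k.1.2.val ≤ n := by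
  obtain ⟨h1, h2, h3, h4, h5⟩ := k.2
  have h : k.1.1 = Finset.univ := by simpa [cells] using h1
  rw [h] at h3 h4 h5
  rw [lo_univ] at h3
  rw [hi_univ] at h4
  rw [hi_univ, pred_univ ⟨n + 1, by omega⟩ _ rfl] at h5
  have := k.1.2.isLt
  have g3 : k.1.2.val ≠ 0 := fun h => h3 (Fin.ext h)
  have g4 : k.1.2.val ≠ n + 2 := fun h => h4 (Fin.ext h)
  have g5 : k.1.2.val ≠ n + 1 := fun h => h5 (Fin.ext h)
  exact ⟨h, by omega, by omega⟩

lemma exists_coord_nil {v : Vert n} (h1 : 1 ≤ v.val) (h2 : v.val ≤ n) :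
    ∃ k : Coord ([] : List (Chord n)), k.1 = (Finset.univ, v) := by
  refine ⟨⟨(Finset.univ, v), univ_mem_cells, Finset.mem_univ _, ?_, ?_, ?_⟩, rfl⟩
  · rw [lo_univ]; intro h; simp only at h; rw [h] at h1; simp at h1
  · rw [hi_univ]; intro h; simp only at h; rw [h] at h2; simp at h2
  · rw [hi_univ, pred_univ ⟨n + 1, by omega⟩ _ rfl]; intro h; simp only at h; rw [h] at h2; simp at h2

/-- The vertex after the one of a simplicial coordinate. -/
def next (k : Coord ([] : List (Chord n))) : Vert n :=
  ⟨k.1.2.val + 1, by have := (coord_nil k).2.2; omega⟩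

lemma pt_coord (t : Space ([] : List (Chord n))) (k : Coord ([] : List (Chord n))) :
    pt t k.1.2 = t k := by
  rw [← pos_coord t k, (coord_nil k).1]

lemma pt_lo (t : Space ([] : List (Chord n))) : pt t ⟨0, by omega⟩ = 0 := by
  have := pos_lo (l := ([] : List (Chord n))) (t := t) ((cellSpec good_nil).card _ univ_mem_cells)
  rwa [lo_univ] at this

lemma pt_last (t : Space ([] : List (Chord n))) : pt t ⟨n + 1, by omega⟩ = 1 := by
  have := pos_pred_hi (l := ([] : List (Chord n))) (t := t) ((cellSpec good_nil).card _ univ_mem_cells)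
  rwa [hi_univ, pred_univ ⟨n + 1, by omega⟩ _ rfl] at this

/-- A vector field which rescales the first marked points. -/
def dil (k : Coord ([] : List (Chord n))) (t : Space ([] : List (Chord n))) :
    Space ([] : List (Chord n)) :=
  fun j => if j.1.2 ≤ k.1.2 then (1 - pt t k.1.2 / pt t (next k)) * t j else 0

lemma pt_add_dil (k : Coord ([] : List (Chord n))) (t : Space ([] : List (Chord n))) (τ : ℝ)
    {v : Vert n} (hv : v.val ≤ n + 1) : pt (t + τ • dil k t) v = pt t v +
      τ * (if v ≤ k.1.2 then (1 - pt t k.1.2 / pt t (next k)) * pt t v else 0) := by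
  by_cases h0 : v.val = 0
  · have : v = ⟨0, by omega⟩ := Fin.ext h0
    rw [this, pt_lo, pt_lo]
    simp
  by_cases h1 : v.val = n + 1
  · have : v = ⟨n + 1, by omega⟩ := Fin.ext h1
    have hk := (coord_nil k).2.2
    have hle : ¬ v ≤ k.1.2 := by rw [Fin.le_def]; omega
    rw [if_neg hle, this, pt_last, pt_last]
    simp
  obtain ⟨j, hj⟩ := exists_coord_nil (v := v) (by omega) (by omega)
  have hv' : v = j.1.2 := by rw [hj]
  rw [hv', pt_coord, pt_coord]
  simp only [dil, Pi.add_apply, Pi.smul_apply, smul_eq_mul]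

lemma dil_factor_mem (k : Coord ([] : List (Chord n))) :
    (fun t => 1 - pt t k.1.2 / pt t (next k)) ∈ polyFun n := by
  obtain ⟨-, h1, h2⟩ := coord_nil k
  have := ratio_mem (n := n) (p := ⟨0, by omega⟩) (q := k.1.2) (r := next k) (Nat.zero_le _)
    (by rw [Fin.le_def]; simp [next]) (by rw [Fin.lt_def]; simp [next]) (by simp [next]; omega)
  refine polyFun_congr (sub_mem (one_mem _) this) fun t _ => ?_
  simp only [Pi.sub_apply, Pi.one_apply, pt_lo, sub_zero]

/-- A difference of two points which both move is rescaled, and its logarithmic derivative is the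
factor 1 - t_k / t_{k+1}. If only t_a moves, the derivative is -(t_a / t_{k+1}) · ((t_{k+1} - t_k) /
(t_{k+1} - t_a)) · ((t_{k+1} - t_a) / (t_b - t_a)); that factor of `dil` is what makes the quotient
a product of ratios as in `ratio_mem`. -/
lemma logDeriv_bracket_mem (k : Coord ([] : List (Chord n))) {a b : Vert n} (hab : a ≠ b) :
    (fun t => logDeriv (fun τ : ℝ => bracket (config [] (t + τ • dil k t) Finset.univ a)
      (config [] (t + τ • dil k t) Finset.univ b)) 0) ∈ polyFun n := by
  wlog hlt : a < b generalizing a b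
  · have := this hab.symm (lt_of_le_of_ne (not_lt.1 hlt) hab.symm)
    refine polyFun_congr this fun t _ => ?_
    rw [show (fun τ : ℝ => bracket (config [] (t + τ • dil k t) Finset.univ a)
      (config [] (t + τ • dil k t) Finset.univ b)) = fun τ : ℝ =>
      -1 * bracket (config [] (t + τ • dil k t) Finset.univ b)
      (config [] (t + τ • dil k t) Finset.univ a) from funext fun τ => by rw [bracket_swap]; ring]
    exact logDeriv_const_mul _ _ (by norm_num)
  have hlt' := Fin.lt_def.1 hlt
  have hne : ∀ v : Vert n, v.val ≤ n + 1 → v ≠ hi Finset.univ := by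
    intro v hv h
    rw [h, hi_univ] at hv
    simp at hv
  by_cases hb : b = hi Finset.univ
  · have ha : a ≠ hi Finset.univ := fun h => hab (h.trans hb.symm)
    refine polyFun_congr (zero_mem _) fun t _ => ?_
    simp only [hb, bracket_config_hi ha]
    rw [logDeriv_const]
    rfl
  have hbn : b.val ≤ n + 1 := by
    by_contra h
    exact hb (by rw [hi_univ]; exact Fin.ext (by simp only; omega))
  have han : a.val ≤ n + 1 := by omega
  set w : Space ([] : List (Chord n)) → Vert n → ℝ := fun t v =>
    if v ≤ k.1.2 then (1 - pt t k.1.2 / pt t (next k)) * pt t v else 0 with hw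
  have key : ∀ t : Space ([] : List (Chord n)),
      logDeriv (fun τ : ℝ => bracket (config [] (t + τ • dil k t) Finset.univ a)
        (config [] (t + τ • dil k t) Finset.univ b)) 0 = (w t a - w t b) / (pt t a - pt t b) := by
    intro t
    have e : (fun τ : ℝ => bracket (config [] (t + τ • dil k t) Finset.univ a)
        (config [] (t + τ • dil k t) Finset.univ b)) =
        fun τ => (pt t a - pt t b) + τ * (w t a - w t b) := by
      funext τ
      rw [bracket_config (hne a han) (hne b hbn)]
      change pt _ a - pt _ b = _
      rw [pt_add_dil k t τ han, pt_add_dil k t τ hbn]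
      ring
    rw [e, logDeriv_apply]
    have : HasDerivAt (fun τ => (pt t a - pt t b) + τ * (w t a - w t b)) (w t a - w t b) 0 :=
      (((hasDerivAt_id' (0 : ℝ)).mul_const _).const_add _).congr_deriv (one_mul _)
    rw [this.deriv]
    simp
  have hd : ∀ t ∈ X ([] : List (Chord n)), pt t a - pt t b ≠ 0 := fun t ht =>
    (sub_neg.2 (pt_lt ht hlt hbn)).ne
  obtain ⟨-, hk1, hk2⟩ := coord_nil k
  have hknext : (next k).val = k.1.2.val + 1 := rfl
  by_cases hbk : b ≤ k.1.2
  · refine polyFun_congr (dil_factor_mem k) fun t ht => ?_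
    have := hd t ht
    rw [key t, hw]
    simp only [if_pos hbk, if_pos (hlt.le.trans hbk)]
    rw [← mul_sub, mul_div_assoc, div_self this, mul_one]
  by_cases hak : a ≤ k.1.2
  · rw [Fin.le_def] at hbk hak
    have r1 := ratio_mem (n := n) (p := ⟨0, by omega⟩) (q := a) (r := next k) (Nat.zero_le _)
      (by rw [Fin.le_def]; omega) (by rw [Fin.lt_def]; simp [next]) (by omega)
    have r2 := ratio_mem (n := n) (p := a) (q := k.1.2) (r := next k) (by rw [Fin.le_def]; omega)
      (by rw [Fin.le_def]; omega) (by rw [Fin.lt_def]; omega) (by omega)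
    have r3 := ratio_mem (n := n) (p := a) (q := next k) (r := b) (by rw [Fin.le_def]; omega)
      (by rw [Fin.le_def]; omega) hlt hbn
    refine polyFun_congr (neg_mem (mul_mem (mul_mem r1 (sub_mem (one_mem _) r2)) r3)) fun t ht => ?_
    have h1 := hd t ht
    have h2 : 0 < pt t (next k) := by
      have := pt_lt ht (v := ⟨0, by omega⟩) (w := next k) (by rw [Fin.lt_def]; simp [next]) (by omega)
      rwa [pt_lo] at this
    have h3 : 0 < pt t (next k) - pt t a := sub_pos.2 (pt_lt ht (by rw [Fin.lt_def]; omega) (by omega))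
    have h4 : pt t b - pt t a ≠ 0 := fun h => h1 (by linarith)
    rw [key t, hw]
    simp only [if_neg (show ¬ b ≤ k.1.2 by rw [Fin.le_def]; exact hbk),
      if_pos (show a ≤ k.1.2 by rw [Fin.le_def]; exact hak)]
    simp only [Pi.neg_apply, Pi.mul_apply, Pi.sub_apply, Pi.one_apply, pt_lo, sub_zero]
    have h5 := h2.ne'
    have h6 := h3.ne'
    generalize pt t (next k) = x at *
    generalize pt t a = y at *
    generalize pt t b = z at *
    generalize pt t k.1.2 = v at *
    have h7 : y - z = -(z - y) := by ring
    rw [h7]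
    field_simp
    ring
  · refine polyFun_congr (zero_mem _) fun t _ => ?_
    rw [key t, hw]
    simp only [if_neg hbk, if_neg hak, sub_zero, zero_div]
    rfl

lemma differentiableAt_u {l : List (Chord n)} (hl : Good l) {c : Chord n} (hc : c ∈ chi l)
    {t : Space l} (ht : t ∈ X l) : DifferentiableAt ℝ (u l c) t := by
  have hp := proper_cellOf hl hc
  have hz := (pos_config hl ht (cellOf_ends_mem hl hc)).sep
  have h1 := hp.pred_fst.1
  have h2 := hp.pred_fst_outside
  obtain ⟨a1, a2, a3, a4⟩ := hp.pred_snd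
  have hlt := chord_lt c
  exact differentiableAt_xr (hz _ h1 _ a1 (by grind)) (hz _ hp.1 _ hp.2 hlt.ne)

lemma mem_chi_nil (c : Chord n) : c ∈ chi ([] : List (Chord n)) := by simp [chi]

lemma logDeriv_cross_ratio {f g p q : ℝ → ℝ} {x : ℝ} (hf : DifferentiableAt ℝ f x)
    (hg : DifferentiableAt ℝ g x) (hp : DifferentiableAt ℝ p x) (hq : DifferentiableAt ℝ q x)
    (f0 : f x ≠ 0) (g0 : g x ≠ 0) (p0 : p x ≠ 0) (q0 : q x ≠ 0) :
    logDeriv (fun y => f y * g y / (p y * q y)) x =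
      logDeriv f x + logDeriv g x - (logDeriv p x + logDeriv q x) := by
  rw [logDeriv_div (f := fun y => f y * g y) (g := fun y => p y * q y) x (mul_ne_zero f0 g0)
    (mul_ne_zero p0 q0) (hf.mul hg) (hp.mul hq), logDeriv_mul x f0 g0 hf hg,
    logDeriv_mul x p0 q0 hp hq]

lemma fderiv_u_dil_mem (k : Coord ([] : List (Chord n))) (c : Chord n) :
    (fun t => fderiv ℝ (u [] c) t (dil k t) / u [] c t) ∈ polyFun n := by
  have hp := proper_univ c
  have h2 := hp.pred_fst_outside
  obtain ⟨a1, a2, a3, a4⟩ := hp.pred_snd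
  have hlt := chord_lt c
  have m1 := logDeriv_bracket_mem k (a := pred Finset.univ c.1.1) (b := c.1.2) (by grind)
  have m2 := logDeriv_bracket_mem k (a := c.1.1) (b := pred Finset.univ c.1.2) (by grind)
  have m3 := logDeriv_bracket_mem k (a := pred Finset.univ c.1.1) (b := pred Finset.univ c.1.2) (by grind)
  have m4 := logDeriv_bracket_mem k (a := c.1.1) (b := c.1.2) hlt.ne
  refine polyFun_congr (sub_mem (add_mem m1 m2) (add_mem m3 m4)) fun t ht => ?_
  have hz := (pos_config good_nil ht univ_mem_cells).sep
  have hu := (u_mem good_nil ht (mem_chi_nil c)).1.ne'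
  have hline : HasDerivAt (fun τ : ℝ => t + τ • dil k t) (dil k t) 0 :=
    (((hasDerivAt_id' (0 : ℝ)).smul_const (dil k t)).const_add t).congr_deriv (one_smul _ _)
  have hd : ∀ a b, DifferentiableAt ℝ (fun τ : ℝ => bracket (config [] (t + τ • dil k t) Finset.univ a)
      (config [] (t + τ • dil k t) Finset.univ b)) 0 := fun a b =>
    ((differentiable_bracket Finset.univ a b) _).comp (0 : ℝ) hline.differentiableAt
  have h0 : t + (0 : ℝ) • dil k t = t := by simp
  have hne : ∀ a b, a ≠ b → bracket (config [] (t + (0 : ℝ) • dil k t) Finset.univ a)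
      (config [] (t + (0 : ℝ) • dil k t) Finset.univ b) ≠ 0 := fun a b hab => by
    rw [h0]; exact hz _ (Finset.mem_univ _) _ (Finset.mem_univ _) hab
  have e : logDeriv (fun τ : ℝ => u [] c (t + τ • dil k t)) 0 =
      fderiv ℝ (u [] c) t (dil k t) / u [] c t := by
    rw [logDeriv_apply, h0]
    have h1 : HasFDerivAt (u [] c) (fderiv ℝ (u [] c) t) (t + (0 : ℝ) • dil k t) := by
      rw [h0]; exact (differentiableAt_u good_nil (mem_chi_nil c) ht).hasFDerivAt
    have h2 : HasDerivAt (fun τ : ℝ => u [] c (t + τ • dil k t)) (fderiv ℝ (u [] c) t (dil k t)) 0 := by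
      have h3 := h1.comp_hasDerivAt (0 : ℝ) hline
      exact h3
    rw [h2.deriv]
  rw [← e]
  have n1 : pred (Finset.univ : Finset (Vert n)) c.1.1 ≠ c.1.2 := by grind
  have n2 : c.1.1 ≠ pred (Finset.univ : Finset (Vert n)) c.1.2 := by grind
  have n3 : pred (Finset.univ : Finset (Vert n)) c.1.1 ≠ pred Finset.univ c.1.2 := by grind
  have e2 : (fun τ : ℝ => u [] c (t + τ • dil k t)) = fun τ : ℝ =>
      (bracket (config [] (t + τ • dil k t) Finset.univ (pred Finset.univ c.1.1))
        (config [] (t + τ • dil k t) Finset.univ c.1.2) *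
      bracket (config [] (t + τ • dil k t) Finset.univ c.1.1)
        (config [] (t + τ • dil k t) Finset.univ (pred Finset.univ c.1.2))) /
      (bracket (config [] (t + τ • dil k t) Finset.univ (pred Finset.univ c.1.1))
        (config [] (t + τ • dil k t) Finset.univ (pred Finset.univ c.1.2)) *
      bracket (config [] (t + τ • dil k t) Finset.univ c.1.1)
        (config [] (t + τ • dil k t) Finset.univ c.1.2)) := by
    funext τ
    rw [u, cellOf_nil]
    rfl
  rw [e2]
  exact logDeriv_cross_ratio (hd _ _) (hd _ _) (hd _ _) (hd _ _) (hne _ _ n1) (hne _ _ n2)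
    (hne _ _ n3) (hne _ _ hlt.ne)

/-- The matrix is triangular, with diagonal entries (t_{k+1} - t_k) · t_k / t_{k+1}. The quotients
telescope to t_1, and the product is that of all consecutive differences. -/
lemma det_dil {t : Space ([] : List (Chord n))} (ht : t ∈ X []) :
    (Matrix.of fun k j => dil k t j).det * dens [] t = 1 := by
  have hdens : dens [] t = (gap (config [] t Finset.univ) Finset.univ)⁻¹ := by
    simp [dens, cells]
  have hgap := gap_pos (pos_config good_nil ht univ_mem_cells)
  suffices h : (Matrix.of fun k j => dil k t j).det = gap (config [] t Finset.univ) Finset.univ by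
    rw [h, hdens, mul_inv_cancel₀ hgap.ne']
  rw [det_of_rank _ (fun k => k.1.2.val)]
  · set Z : ℕ → ℝ := fun i => if h : i < n + 3 then pt t ⟨i, h⟩ else 0 with hZ
    have hZv : ∀ v : Vert n, Z v.val = pt t v := fun v => by
      simp only [hZ, dif_pos v.isLt]
    have hZn : ∀ k : Coord ([] : List (Chord n)), Z (k.1.2.val + 1) = pt t (next k) := fun k => by
      rw [← hZv]; rfl
    have hpos : ∀ i, i ≤ n → 0 < Z (i + 1) := by
      intro i hi
      have := pt_lt ht (v := ⟨0, by omega⟩) (w := ⟨i + 1, by omega⟩) (by rw [Fin.lt_def]; simp)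
        (by simp only; omega)
      rw [pt_lo] at this
      simp only [hZ]
      rwa [dif_pos (by omega)]
    have e1 : ∏ k : Coord ([] : List (Chord n)), (Matrix.of fun k j => dil k t j) k k =
        ∏ i ∈ Finset.range n, (Z (i + 2) - Z (i + 1)) * (Z (i + 1) / Z (i + 2)) := by
      refine Finset.prod_bij (fun k _ => k.1.2.val - 1) ?_ ?_ ?_ ?_
      · intro k _
        have := coord_nil k
        rw [Finset.mem_range]; omega
      · intro k _ k' _ h
        have h1 := coord_nil k
        have h2 := coord_nil k'
        exact Subtype.ext (Prod.ext (h1.1.trans h2.1.symm) (Fin.ext (by omega)))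
      · intro i hi
        rw [Finset.mem_range] at hi
        obtain ⟨k, hk⟩ := exists_coord_nil (n := n) (v := ⟨i + 1, by omega⟩) (by simp) (by simp only; omega)
        exact ⟨k, Finset.mem_univ _, by rw [hk]; simp⟩
      · intro k _
        have h1 := coord_nil k
        have h2 := hpos k.1.2.val (by omega)
        simp only [Matrix.of_apply, dil, le_refl, if_true]
        rw [show k.1.2.val - 1 + 2 = k.1.2.val + 1 by omega, show k.1.2.val - 1 + 1 = k.1.2.val by omega,
          hZv, hZn, ← pt_coord t k]
        rw [hZn] at h2
        field_simp
    have e2 : gap (config [] t Finset.univ) Finset.univ =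
        ∏ i ∈ Finset.range (n + 1), (Z (i + 1) - Z i) := by
      have hmem : ∀ v : Vert n, v ∈ mid Finset.univ ↔ 1 ≤ v.val ∧ v.val ≤ n + 1 := by
        intro v
        rw [mem_mid, lo_univ, hi_univ, ne_eq, ne_eq, Fin.ext_iff, Fin.ext_iff]
        have := v.isLt
        simp only [Finset.mem_univ, true_and]
        omega
      refine Finset.prod_bij (fun v _ => v.val - 1) ?_ ?_ ?_ ?_
      · intro v hv
        rw [hmem] at hv
        rw [Finset.mem_range]; omega
      · intro v hv w hw h
        rw [hmem] at hv hw
        exact Fin.ext (by omega)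
      · intro i hi
        rw [Finset.mem_range] at hi
        exact ⟨⟨i + 1, by omega⟩, (hmem _).2 ⟨by simp, by simp only; omega⟩, by simp⟩
      · intro v hv
        rw [hmem] at hv
        have hv' := v.isLt
        have hpv : pred (Finset.univ : Finset (Vert n)) v = ⟨v.val - 1, by omega⟩ :=
          pred_univ _ _ (by simp only; omega)
        rw [hpv, bracket_config, show v.val - 1 + 1 = v.val by omega, hZv]
        · simp only [hZ]
          rw [dif_pos (by omega)]
        · rw [hi_univ, ne_eq, Fin.ext_iff]; simp only; omega
        · rw [hi_univ, ne_eq, Fin.ext_iff]; simp only; omega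
    have e3 : ∀ m, m ≤ n → ∏ i ∈ Finset.range m, Z (i + 1) / Z (i + 2) = Z 1 / Z (m + 1) := by
      intro m
      induction m with
      | zero => intro _; simp [div_self (hpos 0 (Nat.zero_le _)).ne']
      | succ m ih =>
        intro hm
        rw [Finset.prod_range_succ, ih (by omega)]
        have h1 := (hpos m (by omega)).ne'
        have h2 := (hpos (m + 1) (by omega)).ne'
        field_simp
    have z0 : Z 0 = 0 := by simp only [hZ]; rw [dif_pos (by omega)]; exact pt_lo t
    have z1 : Z (n + 1) = 1 := by simp only [hZ]; rw [dif_pos (by omega)]; exact pt_last t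
    rw [e1, e2, Finset.prod_mul_distrib, e3 n le_rfl, Finset.prod_range_succ', z0, z1, div_one, zero_add,
      sub_zero]
  · intro k j hkj hr
    have h1 := coord_nil k
    have h2 := coord_nil j
    have hne : k.1.2.val ≠ j.1.2.val := fun h =>
      hkj (Subtype.ext (Prod.ext (h1.1.trans h2.1.symm) (Fin.ext h)))
    simp only [Matrix.of_apply, dil]
    rw [if_neg]
    rw [Fin.le_def]
    omega

/-- Evaluated on the fields `dil`, the form is a determinant of functions which are polynomial in
the u_c; division by the determinant of the fields multiplies by `dens`. -/
lemma dlogWedge_eq (a : Coord ([] : List (Chord n)) → Chord n) : ∃ P : MvPolynomial (Chord n) ℝ,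
    ∀ t ∈ X [], dlogWedge a t = eval (ubar [] t) P * dens [] t := by
  have hmem : (fun t => (Matrix.of fun i k : Coord ([] : List (Chord n)) =>
      fderiv ℝ (u [] (a i)) t (dil k t) / u [] (a i) t).det) ∈ polyFun n := by
    refine polyFun_congr (f := ∑ σ : Equiv.Perm (Coord ([] : List (Chord n))), Equiv.Perm.sign σ •
      ∏ i, fun t => fderiv ℝ (u [] (a (σ i))) t (dil i t) / u [] (a (σ i)) t) ?_ fun t _ => ?_
    · refine sum_mem fun σ _ => ?_
      rw [Units.smul_def]
      exact zsmul_mem (prod_mem fun i _ => fderiv_u_dil_mem i _) _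
    · rw [Matrix.det_apply, Finset.sum_apply]
      refine Finset.sum_congr rfl fun σ _ => ?_
      rw [Pi.smul_apply, Finset.prod_apply]
      rfl
  obtain ⟨P, hP⟩ := hmem
  refine ⟨P, fun t ht => ?_⟩
  have hdet := det_dil ht
  rw [← hP t ht]
  have hmul : (Matrix.of fun i k : Coord ([] : List (Chord n)) =>
      fderiv ℝ (u [] (a i)) t (dil k t) / u [] (a i) t) =
      (Matrix.of fun i j => partialD (u [] (a i)) j t / u [] (a i) t) *
        (Matrix.of fun k j => dil k t j).transpose := by
    ext i k
    rw [Matrix.mul_apply, Matrix.of_apply]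
    simp only [Matrix.of_apply, Matrix.transpose_apply, partialD]
    have : dil k t = ∑ j, dil k t j • (Pi.single j 1 : Space ([] : List (Chord n))) := by
      ext j
      simp [Finset.sum_apply, Pi.single_apply]
    conv_lhs => rw [this]
    rw [map_sum, Finset.sum_div]
    refine Finset.sum_congr rfl fun j _ => ?_
    rw [map_smul, smul_eq_mul]
    ring
  beta_reduce
  rw [hmul, Matrix.det_mul, Matrix.det_transpose, mul_assoc, hdet, mul_one]
  rfl

lemma exists_eval_of_mem_logForms {ω : Form ([] : List (Chord n))} (hω : ω ∈ logForms n) :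
    ∃ P : MvPolynomial (Chord n) ℝ, ∀ t ∈ X [], ω t = eval (ubar [] t) P * dens [] t := by
  induction hω using Submodule.span_induction with
  | mem x h =>
    obtain ⟨a, rfl⟩ := h
    exact dlogWedge_eq a
  | zero => exact ⟨0, fun t _ => by simp⟩
  | add x y _ _ hx hy =>
    obtain ⟨P, hP⟩ := hx
    obtain ⟨Q, hQ⟩ := hy
    exact ⟨P + Q, fun t ht => by rw [Pi.add_apply, hP t ht, hQ t ht, map_add]; ring⟩
  | smul r x _ hx =>
    obtain ⟨P, hP⟩ := hx
    refine ⟨MvPolynomial.C (r : ℝ) * P, fun t ht => ?_⟩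
    rw [Pi.smul_apply, hP t ht, map_mul, eval_C, Rat.smul_def]
    ring

open Classical in
/-- The chords along which `ω` has no pole. -/
def regular (ω : Form ([] : List (Chord n))) : Finset (Chord n) :=
  Finset.univ.filter fun c => ¬ HasPole ω c

/-- A logarithmic form is the product of the canonical form and of a polynomial in the dihedral
coordinates, which is divisible by the coordinates of the divisors along which it has no pole. -/
theorem exists_numerator {ω : Form ([] : List (Chord n))} (hω : ω ∈ logForms n) :
    ∃ P : MvPolynomial (Chord n) ℝ, ∀ t ∈ X [],
      ω t = eval (ubar [] t) ((∏ c ∈ regular ω, MvPolynomial.X c) * P) * dens [] t := by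
  classical
  obtain ⟨P₀, hP₀⟩ := exists_eval_of_mem_logForms hω
  suffices H : ∀ A : Finset (Chord n), (∀ c ∈ A, ¬ HasPole ω c) → ∃ P : MvPolynomial (Chord n) ℝ,
      ∀ t ∈ X [], eval (ubar [] t) P₀ = eval (ubar [] t) ((∏ c ∈ A, MvPolynomial.X c) * P) by
    obtain ⟨P, hP⟩ := H (regular ω) fun c hc => (Finset.mem_filter.1 hc).2
    exact ⟨P, fun t ht => by rw [hP₀ t ht, hP t ht]⟩
  intro A
  induction A using Finset.induction_on with
  | empty => exact fun _ => ⟨P₀, fun t _ => by simp⟩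
  | insert c A hcA ih =>
    intro hA
    obtain ⟨P, hP⟩ := ih fun d hd => hA d (Finset.mem_insert_of_mem hd)
    have hc := mem_chi_nil c
    have hgood : Good [c] := ⟨hc, good_nil⟩
    -- The vanishing residue is the product of the u_d with d in `A`, of `P`, and of the density. As
    -- `c` is not in `A`, no factor other than `P` vanishes on the open stratum.
    have hzero : ∀ y ∈ X [c], eval (ubar [c] y) P = 0 := by
      intro y hy
      have h1 : res [] c ω y = eval (ubar [c] y) P₀ * dens [c] y := res_eq good_nil hc hP₀ hy
      have h2 : res [] c ω y = 0 := by
        by_contra h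
        exact hA c (Finset.mem_insert_self _ _) ⟨y, hy, h⟩
      have h3 := dens_pos hgood hy
      rw [h2, eval_eq_of_forall good_nil hc hP hy] at h1
      rcases mul_eq_zero.1 h1.symm with h | h
      · rw [map_mul, map_prod] at h
        rcases mul_eq_zero.1 h with h | h
        · rw [Finset.prod_eq_zero_iff] at h
          obtain ⟨d, hd, h⟩ := h
          rw [eval_X, ubar] at h
          have hdc : d ≠ c := fun h' => hcA (h' ▸ hd)
          rw [if_neg (by simpa using hdc)] at h
          split_ifs at h with h'
          · exact absurd h (u_mem hgood hy h').1.ne'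
          · exact absurd h one_ne_zero
        · exact h
      · exact absurd h h3.ne'
    obtain ⟨P', hP'⟩ := exists_eval_eq_mul good_nil hc hzero
    refine ⟨P', fun t ht => ?_⟩
    rw [hP t ht, Finset.prod_insert hcA, map_mul, map_mul, map_mul, hP' t ht, eval_X, ubar_of_mem hc]
    ring

end

open MvPolynomial (eval eval_X eval_C)

/-! ### Change of variables -/

lemma measurableSet_X (l : List (Chord n)) : MeasurableSet (X l) := (isOpen_X l).measurableSet

/-- The Jacobian of the trivialisation map. -/
def jacDens (l K : List (Chord n)) (t : Space l) : ℝ :=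
  dens l t * (∏ c : {c // c ∈ K}, normalCoord l K c.1 t * (1 - normalCoord l K c.1 t)) /
      dens (K ++ l) (forget l K t)

section
variable {l K : List (Chord n)} (h : Good (K ++ l))
include h

/-- The change of variables formula. Source and target have different index sets, so the target is
first transported to the coordinate space of the source. -/
lemma integral_triv (F : ({c // c ∈ K} ⊕ Coord (K ++ l) → ℝ) → ℂ) :
    (IntegrableOn F (Box l K) → IntegrableOn (fun t => jacDens l K t • F (triv l K t)) (X l)) ∧
      ∫ w in Box l K, F w = ∫ t in X l, jacDens l K t • F (triv l K t) := by
  have hl : Good l := h.tail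
  have hbij := triv_bijOn hl K h
  -- A bijection of the index sets is read off from the Jacobian at one point and then used at all
  -- points, which is legitimate by `abs_det_submatrix`.
  rcases (X l).eq_empty_or_nonempty with he | ⟨t₀, ht₀⟩
  · rw [← hbij.image_eq, he]
    simp
  obtain ⟨f₀, hf₀, e, he₀⟩ := hasJac_triv hl K h t₀ ht₀
  set Φ := MeasurableEquiv.piCongrLeft (fun _ : {c // c ∈ K} ⊕ Coord (K ++ l) => ℝ) e with hΦ
  have hmp : MeasurePreserving Φ volume volume := volume_measurePreserving_piCongrLeft _ e
  have hΦs : ∀ w k, Φ.symm w k = w (e k) := fun w k => rfl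
  set g : Space l → Space l := fun t => Φ.symm (triv l K t) with hg
  have key : ∀ t ∈ X l, ∃ g' : Space l →L[ℝ] Space l, HasFDerivAt g g' t ∧
      |g'.det| = jacDens l K t := by
    intro t ht
    obtain ⟨f', hf', e', he'⟩ := hasJac_triv hl K h t ht
    refine ⟨ContinuousLinearMap.pi fun k => (ContinuousLinearMap.proj (e k)).comp f', ?_, ?_⟩
    · rw [hasFDerivAt_pi]
      exact fun k => hasFDerivAt_pi'.1 hf' (e k)
    · rw [jacDens, ← he', abs_det_submatrix _ e' e, ContinuousLinearMap.det,
        ← LinearMap.det_toMatrix']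
      congr 2
  choose! g' hg' hdet using key
  have hinj : Set.InjOn g (X l) := fun t ht t' ht' hh => hbij.injOn ht ht' (Φ.symm.injective hh)
  have himg : g '' X l = Φ ⁻¹' Box l K := by
    rw [← hbij.image_eq, ← Φ.image_symm, Set.image_image]
  have hcong : ∀ t ∈ X l, |(g' t).det| • F (Φ (g t)) = jacDens l K t • F (triv l K t) := by
    intro t ht
    rw [hdet t ht, hg]
    simp only [MeasurableEquiv.apply_symm_apply]
  constructor
  · intro hF
    have h1 : IntegrableOn (F ∘ Φ) (g '' X l) := by
      rw [himg, hmp.integrableOn_comp_preimage Φ.measurableEmbedding]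
      exact hF
    rw [integrableOn_image_iff_integrableOn_abs_det_fderiv_smul volume (measurableSet_X l)
      (fun t ht => (hg' t ht).hasFDerivWithinAt) hinj] at h1
    exact h1.congr_fun hcong (measurableSet_X l)
  · rw [← hmp.setIntegral_preimage_emb Φ.measurableEmbedding, ← himg]
    rw [integral_image_eq_integral_abs_det_fderiv_smul volume (measurableSet_X l)
      (fun t ht => (hg' t ht).hasFDerivWithinAt) hinj (fun w => F (Φ w))]
    exact setIntegral_congr_fun (measurableSet_X l) hcong

/-- Fubini for the trivialisation map. -/
theorem integral_triv_prod (f : {c // c ∈ K} → ℝ → ℂ) (G : Space (K ++ l) → ℂ)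
    (hf : ∀ c, IntegrableOn (f c) (Set.Ioo 0 1)) (hG : IntegrableOn G (X (K ++ l))) :
    IntegrableOn (fun t => jacDens l K t • ((∏ c, f c (normalCoord l K c.1 t)) * G (forget l K t)))
      (X l) ∧
    ∫ t in X l, jacDens l K t • ((∏ c, f c (normalCoord l K c.1 t)) * G (forget l K t)) =
      (∏ c, ∫ x in Set.Ioo (0 : ℝ) 1, f c x) * ∫ y in X (K ++ l), G y := by
  set Φ := MeasurableEquiv.sumPiEquivProdPi (fun _ : {c // c ∈ K} ⊕ Coord (K ++ l) => ℝ) with hΦ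
  have hmp : MeasurePreserving Φ volume volume := volume_measurePreserving_sumPiEquivProdPi _
  set F : ({c // c ∈ K} ⊕ Coord (K ++ l) → ℝ) → ℂ := fun w =>
    (∏ c, f c (w (Sum.inl c))) * G (fun q => w (Sum.inr q)) with hF
  set F' : ({c // c ∈ K} → ℝ) × (Space (K ++ l)) → ℂ := fun z => (∏ c, f c (z.1 c)) * G z.2 with hF'
  have hbox : Box l K = Φ ⁻¹' ((Set.univ.pi fun _ => Set.Ioo 0 1) ×ˢ X (K ++ l)) := by
    ext w
    simp only [Box, Set.mem_ofPred_eq, Set.mem_preimage, Set.mem_prod, Set.mem_pi, Set.mem_univ,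
      true_implies, Set.mem_Ioo]
    rfl
  have hFF : F = F' ∘ Φ := rfl
  have hvol : (volume : Measure (({c // c ∈ K} → ℝ) × (Space (K ++ l)))).restrict
      ((Set.univ.pi fun _ => Set.Ioo 0 1) ×ˢ X (K ++ l)) =
      (Measure.pi fun _ : {c // c ∈ K} => (volume : Measure ℝ).restrict (Set.Ioo 0 1)).prod
        (volume.restrict (X (K ++ l))) := by
    rw [← Measure.restrict_pi_pi, Measure.prod_restrict]
    rfl
  have h1 : IntegrableOn F (Box l K) := by
    rw [hbox, hFF, hmp.integrableOn_comp_preimage Φ.measurableEmbedding, IntegrableOn, hvol]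
    exact (Integrable.fintype_prod hf).mul_prod hG
  have h2 : ∫ w in Box l K, F w = (∏ c, ∫ x in Set.Ioo (0 : ℝ) 1, f c x) *
      ∫ y in X (K ++ l), G y := by
    rw [hbox]
    change ∫ w in _, F' (Φ w) = _
    rw [hmp.setIntegral_preimage_emb Φ.measurableEmbedding, hvol, hF',
      integral_prod_mul (fun x : {c // c ∈ K} → ℝ => ∏ c, f c (x c)) G, integral_fintype_prod_eq_prod]
  have h3 := integral_triv h F
  exact ⟨h3.1 h1, by rw [← h2, h3.2]; rfl⟩

end

/-! ### Integrability of powers of the dihedral coordinates -/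

section
variable {l : List (Chord n)} (hl : Good l)
include hl

lemma continuousOn_u {c : Chord n} (hc : c ∈ chi l) : ContinuousOn (u l c) (X l) := fun _ ht =>
  (differentiableAt_u hl hc ht).continuousAt.continuousWithinAt

lemma continuousOn_dens : ContinuousOn (dens l) (X l) := by
  refine continuousOn_finsetProd _ fun P hP => ContinuousOn.inv₀ ?_ fun t ht =>
    (gap_pos (pos_config hl ht hP)).ne'
  refine (continuous_finsetProd _ fun v _ => ?_).continuousOn
  exact (differentiable_bracket P _ _).continuous

lemma continuousOn_eval (P : MvPolynomial (Chord n) ℝ) :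
    ContinuousOn (fun t => MvPolynomial.eval (ubar l t) P) (X l) := by
  refine (MvPolynomial.continuous_eval P).comp_continuousOn (continuousOn_pi.2 fun d => ?_)
  unfold ubar
  split_ifs with h1 h2
  · exact continuousOn_const
  · exact continuousOn_u hl h2
  · exact continuousOn_const

end

/-- The product of all dihedral coordinates. -/
def uprod (l : List (Chord n)) (t : Space l) : ℝ := ∏ d ∈ chi l, u l d t

lemma uprod_pos {l : List (Chord n)} (hl : Good l) {t : Space l} (ht : t ∈ X l) : 0 < uprod l t :=
  (prod_u_mem hl ht subset_rfl).1

lemma uprod_le_one {l : List (Chord n)} (hl : Good l) {t : Space l} (ht : t ∈ X l) :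
    uprod l t ≤ 1 := (prod_u_mem hl ht subset_rfl).2

section
variable {l : List (Chord n)} (hl : Good l)
include hl

lemma uprod_le_prod {t : Space l} (ht : t ∈ X l) {S : Finset (Chord n)} (hS : S ⊆ chi l) :
    uprod l t ≤ ∏ d ∈ S, u l d t := by
  rw [uprod, ← Finset.prod_sdiff hS]
  exact mul_le_of_le_one_left (prod_u_mem hl ht hS).1.le
    (prod_u_mem hl ht Finset.sdiff_subset).2

/-- The label of a coordinate and the last vertex of its cell span a chord of that cell. -/
lemma coord_isEmpty (h : chi l = ∅) : IsEmpty (Coord l) := by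
  refine ⟨fun q => ?_⟩
  obtain ⟨hq, hv, h1, h2, h3⟩ := q.2
  have hne : q.1.1.Nonempty := ⟨_, hv⟩
  have hlo : lo q.1.1 < q.1.2 := lt_of_le_of_ne (Finset.inf_le hv) (Ne.symm h1)
  have hhi : q.1.2 < hi q.1.1 := lt_of_le_of_ne (Finset.le_sup (f := id) hv) h2
  obtain ⟨p1, p2, p3⟩ := pred_spec ⟨q.1.2, hv, hhi⟩
  have hvp : q.1.2 < pred q.1.1 (hi q.1.1) := lt_of_le_of_ne (p3 _ hv hhi) h3
  have hc : q.1.2.val + 2 ≤ (hi q.1.1).val ∧ ¬ (q.1.2.val = 0 ∧ (hi q.1.1).val = n + 2) := by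
    rw [Fin.lt_def] at *
    omega
  have : (⟨(q.1.2, hi q.1.1), hc⟩ : Chord n) ∈ chi l :=
    mem_chi_of_proper hl hq ⟨hv, hi_mem hne, ⟨_, p1, hvp, p2⟩, ⟨_, lo_mem hne, Or.inl hlo⟩⟩
  rw [h] at this
  exact absurd this (Finset.notMem_empty _)

end

/-- The contribution to `f_K^*` of the dihedral coordinate `u_e`. -/
def val (l K : List (Chord n)) (e : Chord n) (t : Space l) : ℝ :=
  ∏ d ∈ contr l (cellOf (K.erase e ++ l) (ends e)) e, u l d t

section
variable {l K : List (Chord n)} (h : Good (K ++ l)) {t : Space l} (ht : t ∈ X l)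
include h ht

lemma normalCoord_eq {c : Chord n} (hc : c ∈ K) : normalCoord l K c t = val l K c t ∧
    1 - normalCoord l K c t = ∏ d ∈ cocontr l (cellOf (K.erase c ++ l) (ends c)) c, u l d t := by
  have hl := h.tail
  have h1 := good_erase h hc
  have hm := cellOf_ends_mem h1.2 h1.1
  have h2 := cellOf_cell (K := K.erase c) h1.2 hm
  rw [cellOf_cellOf_ends h1.2 h1.1] at h2
  have hp := proper_cellOf h1.2 h1.1
  exact ⟨crossRatio_eq_prod hl h2.1 h2.2 hp ht, one_sub_crossRatio_eq_prod hl h2.1 h2.2 hp ht⟩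

lemma u_forget_eq_val {e : Chord n} (he : e ∈ chi (K ++ l)) :
    u (K ++ l) e (forget l K t) = val l K e t := by
  rw [u_forget h ht he, val, List.erase_of_not_mem fun h' => (mem_chi.1 he).1 (by simp [h'])]

omit h in
lemma val_mem (hl : Good l) (K : List (Chord n)) (e : Chord n) : 0 < val l K e t ∧ val l K e t ≤ 1 :=
  prod_u_mem hl ht (contr_subset _ _)

lemma uprod_le_val (e : Chord n) : uprod l t ≤ val l K e t :=
  uprod_le_prod h.tail ht (contr_subset _ _)

lemma uprod_pow_le_forget :
    uprod l t ^ (chi (K ++ l)).card ≤ uprod (K ++ l) (forget l K t) := by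
  rw [← Finset.prod_const]
  refine Finset.prod_le_prod (fun _ _ => (uprod_pos h.tail ht).le) fun e he => ?_
  rw [u_forget_eq_val h ht he]
  exact uprod_le_val h ht e

end

lemma continuousOn_uprod_rpow {l : List (Chord n)} (hl : Good l) (δ : ℝ) :
    ContinuousOn (fun t => uprod l t ^ δ) (X l) :=
  ContinuousOn.rpow_const (continuousOn_finsetProd _ fun _ hd => continuousOn_u hl hd)
    fun _ ht => Or.inl (uprod_pos hl ht).ne'

/-- Induction on the number of chords. Under f_c the canonical form splits, and ∏ u_d is bounded by
u_c, by 1 - u_c, and by a root of the corresponding product on the divisor. So the integrand is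
dominated by a Beta integrand times an integrand of the same kind on X_{J ∪ {c}}. -/
theorem integrableOn_uprod {l : List (Chord n)} (hl : Good l) {δ : ℝ} (hδ : 0 < δ) :
    IntegrableOn (fun t => uprod l t ^ δ * dens l t) (X l) := by
  induction hN : (chi l).card using Nat.strong_induction_on generalizing l δ with
  | _ N ih =>
  rcases (chi l).eq_empty_or_nonempty with he | ⟨c, hc⟩
  -- Without chords the cell is a point.
  · have := coord_isEmpty hl he
    have : ∀ _ : Coord l, IsFiniteMeasure (volume : Measure ℝ) := isEmptyElim
    have : IsFiniteMeasure (volume : Measure (Space l)) :=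
      inferInstanceAs (IsFiniteMeasure (Measure.pi fun _ : Coord l => (volume : Measure ℝ)))
    exact (Integrable.of_finite (α := Space l)).integrableOn
  have hcl : Good (c :: l) := ⟨hc, hl⟩
  have hG : Good ([c] ++ l) := hcl
  -- Each coordinate of the divisor pulls back to at least ∏ u_d, so their product is at least its
  -- power with exponent the number of chords. Adding 1 keeps `M` positive.
  set M := (chi (c :: l)).card + 1 with hM
  have hM0 : (0 : ℝ) < M := by positivity
  -- One third each for u_c, 1 - u_c and the divisor.
  set δ' := δ / 3 with hδ'
  have hδ0 : 0 < δ' := by positivity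
  have hlt : (chi (c :: l)).card < N := by
    rw [← hN]
    exact Finset.card_lt_card ⟨fun d hd => (mem_chi_cons.1 hd).1,
      fun h => (mem_chi_cons.1 (h hc)).2.1 rfl⟩
  have h1 := ih _ hlt hcl (δ := δ' / M) (by positivity) rfl
  have h2 := (integral_triv_prod (l := l) (K := [c]) hG
    (fun _ x => (x : ℂ) ^ ((δ' : ℂ) - 1) * (1 - x : ℂ) ^ ((δ' : ℂ) - 1)) _
    (fun _ => by
      have := Complex.betaIntegral_convergent (u := δ') (v := δ') (by simpa) (by simpa)
      rw [intervalIntegrable_iff_integrableOn_Ioo_of_le zero_le_one] at this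
      exact this) (h1.ofReal (𝕜 := ℂ))).1
  refine Integrable.mono h2 (((continuousOn_uprod_rpow hl δ).mul
    (continuousOn_dens hl)).aestronglyMeasurable (measurableSet_X l)) ?_
  refine (ae_restrict_mem (measurableSet_X l)).mono fun t ht => ?_
  have hu := u_mem hl ht hc
  have hU := uprod_pos hl ht
  have hd := dens_pos hl ht
  have hy : forget l [c] t ∈ X (c :: l) := forget_mem_X (K := [c]) hG ht
  have hd' := dens_pos hcl hy
  have hU' := uprod_pos hcl hy
  have hx : ∏ i : {d // d ∈ [c]}, (((normalCoord l [c] i.1 t : ℝ) : ℂ) ^ ((δ' : ℂ) - 1) *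
      (1 - (normalCoord l [c] i.1 t : ℝ) : ℂ) ^ ((δ' : ℂ) - 1)) =
      ((u l c t : ℝ) : ℂ) ^ ((δ' : ℂ) - 1) * (1 - (u l c t : ℝ) : ℂ) ^ ((δ' : ℂ) - 1) := by
    rw [prod_mem_list [c] fun d => ((normalCoord l [c] d t : ℝ) : ℂ) ^ ((δ' : ℂ) - 1) *
      (1 - (normalCoord l [c] d t : ℝ) : ℂ) ^ ((δ' : ℂ) - 1)]
    simp [normalCoord_singleton]
  have hj : jacDens l [c] t = dens l t * (u l c t * (1 - u l c t)) / dens (c :: l) (forget l [c] t) := by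
    rw [jacDens, prod_mem_list [c] fun d => normalCoord l [c] d t * (1 - normalCoord l [c] d t)]
    simp [normalCoord_singleton]
  have e1 : ‖((u l c t : ℝ) : ℂ) ^ ((δ' : ℂ) - 1)‖ = u l c t ^ (δ' - 1) := by
    rw [Complex.norm_cpow_eq_rpow_re_of_pos hu.1]; simp
  have e2 : ‖(1 - (u l c t : ℝ) : ℂ) ^ ((δ' : ℂ) - 1)‖ = (1 - u l c t) ^ (δ' - 1) := by
    rw [← Complex.ofReal_one, ← Complex.ofReal_sub,
      Complex.norm_cpow_eq_rpow_re_of_pos (by linarith : 0 < 1 - u l c t)]; simp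
  have e3 : ‖((uprod (c :: l) (forget l [c] t) ^ (δ' / M) * dens (c :: l) (forget l [c] t) : ℝ) : ℂ)‖ =
      uprod (c :: l) (forget l [c] t) ^ (δ' / M) * dens (c :: l) (forget l [c] t) := by
    exact (Complex.norm_real _).trans (Real.norm_of_nonneg (mul_nonneg (Real.rpow_nonneg hU'.le _) hd'.le))
  have hx1 : 0 < 1 - u l c t := by linarith
  have e4 : 0 ≤ dens l t * (u l c t * (1 - u l c t)) / dens (c :: l) (forget l [c] t) :=
    div_nonneg (mul_nonneg hd.le (mul_nonneg hu.1.le hx1.le)) hd'.le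
  rw [Real.norm_of_nonneg (mul_nonneg (Real.rpow_nonneg hU.le δ) hd.le), hx, norm_smul, norm_mul,
    norm_mul, e1, e2, hj, Real.norm_of_nonneg e4]
  refine le_trans ?_ (le_of_eq (congrArg₂ (· * ·) rfl (congrArg₂ (· * ·) rfl e3.symm)))
  have b1 : uprod l t ≤ u l c t := prod_u_le hl ht subset_rfl hc
  have b2 : uprod l t ≤ 1 - u l c t := by
    rw [one_sub_u_eq hl ht hc]
    exact uprod_le_prod hl ht (cocontr_subset _ _)
  have b3 : uprod l t ^ M ≤ uprod (c :: l) (forget l [c] t) :=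
    le_trans (pow_le_pow_of_le_one hU.le (uprod_le_one hl ht) (Nat.le_succ _))
      (uprod_pow_le_forget (K := [c]) hG ht)
  have b4 : uprod l t ^ δ' ≤ uprod (c :: l) (forget l [c] t) ^ (δ' / M) := by
    calc uprod l t ^ δ' = (uprod l t ^ M) ^ (δ' / M) := by
          rw [← Real.rpow_natCast, ← Real.rpow_mul hU.le]; congr 1; field_simp
      _ ≤ _ := Real.rpow_le_rpow (pow_nonneg hU.le _) b3 (by positivity)
  have b5 : uprod l t ^ δ = uprod l t ^ δ' * uprod l t ^ δ' * uprod l t ^ δ' := by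
    rw [← Real.rpow_add hU, ← Real.rpow_add hU]; congr 1; rw [hδ']; ring
  have b6 : u l c t * u l c t ^ (δ' - 1) = u l c t ^ δ' := by
    rw [mul_comm, ← Real.rpow_add_one hu.1.ne']; congr 1; ring
  have b7 : (1 - u l c t) * (1 - u l c t) ^ (δ' - 1) = (1 - u l c t) ^ δ' := by
    rw [mul_comm, ← Real.rpow_add_one hx1.ne']; congr 1; ring
  generalize uprod (c :: l) (forget l [c] t) = U' at *
  generalize dens (c :: l) (forget l [c] t) = D' at *
  generalize dens l t = D at *
  generalize uprod l t = U at *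
  generalize u l c t = x at *
  calc U ^ δ * D
      ≤ x ^ δ' * (1 - x) ^ δ' * U' ^ (δ' / M) * D := by
        rw [b5]
        have := hu.1
        gcongr
    _ = _ := by
        rw [← b6, ← b7]
        field_simp

/-! ### The terms of the renormalised integrand -/

/-- The integrand `(∏_d u_d^{s_d}) P(u) α` on `X_J`, with `α` the canonical form. -/
def strat (P : MvPolynomial (Chord n) ℝ) (l : List (Chord n)) (s : Chord n → ℂ) (t : Space l) : ℂ :=
  (∏ d ∈ chi l, ((u l d t : ℝ) : ℂ) ^ s d) * ((eval (ubar l t) P * dens l t : ℝ) : ℂ)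

/-- The chords of the polygons cut out by `l`, other than those which cross an element of `K`. -/
def chords (l K : List (Chord n)) : Finset (Chord n) := K.toFinset ∪ chi (K ++ l)

/-- In f_K^* the product of the x_c (1 - x_c) in the Jacobian meets the denominator of d log x_c:
only 1 - x_c survives, and the densities of X_{J ∪ K} cancel. -/
def coef (P : MvPolynomial (Chord n) ℝ) (l K : List (Chord n)) (t : Space l) : ℝ :=
  eval (ubar (K ++ l) (forget l K t)) P * (∏ c ∈ K.toFinset, (1 - val l K c t)) * dens l t

/-- The pull-back of ∏ u_e^{s_e} is written as an exponential, linear in `s`, for differentiation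
and power series. -/
def expo (l K : List (Chord n)) (s : Chord n → ℂ) (t : Space l) : ℂ :=
  ∑ e ∈ chords l K, s e * (Real.log (val l K e t) : ℂ)

/-- The term of the renormalised integrand indexed by `K`, up to its sign. -/
def term (P : MvPolynomial (Chord n) ℝ) (l K : List (Chord n)) (s : Chord n → ℂ) (t : Space l) : ℂ :=
  Complex.exp (expo l K s t) * (coef P l K t : ℂ)

lemma cpow_eq_exp_log {x : ℝ} (hx : 0 < x) (z : ℂ) :
    (x : ℂ) ^ z = Complex.exp (z * (Real.log x : ℂ)) := by
  rw [Complex.cpow_def_of_ne_zero (by exact_mod_cast hx.ne'), Complex.ofReal_log hx.le, mul_comm]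

lemma disjoint_chords (l K : List (Chord n)) : Disjoint K.toFinset (chi (K ++ l)) :=
  Finset.disjoint_left.2 fun c hc h => (mem_chi.1 h).1 (by simp [List.mem_toFinset.1 hc])

lemma exp_expo {l : List (Chord n)} (hl : Good l) {K : List (Chord n)} (s : Chord n → ℂ) {t : Space l}
    (ht : t ∈ X l) : Complex.exp (expo l K s t) =
      (∏ c ∈ K.toFinset, (val l K c t : ℂ) ^ s c) * ∏ e ∈ chi (K ++ l), (val l K e t : ℂ) ^ s e := by
  rw [expo, chords, Complex.exp_sum, Finset.prod_union (disjoint_chords l K)]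
  congr 1 <;> exact Finset.prod_congr rfl fun e _ =>
    (cpow_eq_exp_log (val_mem ht hl K e).1 _).symm

/-- The term in product form, with x_c^{s_c - 1} for each normal direction and the integrand of X_{J
∪ K}, ready for Fubini. -/
theorem term_eq {l K : List (Chord n)} (h : Good (K ++ l)) (P : MvPolynomial (Chord n) ℝ)
    (s : Chord n → ℂ) {t : Space l} (ht : t ∈ X l) :
    term P l K s t = jacDens l K t • ((∏ c : {c // c ∈ K}, (normalCoord l K c.1 t : ℂ) ^ (s c.1 - 1)) *
      strat P (K ++ l) s (forget l K t)) := by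
  have hy := forget_mem_X h ht
  have hd : ((dens (K ++ l) (forget l K t) : ℝ) : ℂ) ≠ 0 := by exact_mod_cast (dens_pos h hy).ne'
  have e1 : ∏ d ∈ chi (K ++ l), ((u (K ++ l) d (forget l K t) : ℝ) : ℂ) ^ s d =
      ∏ e ∈ chi (K ++ l), (val l K e t : ℂ) ^ s e :=
    Finset.prod_congr rfl fun e he => by rw [u_forget_eq_val h ht he]
  have e2 : ∏ c : {c // c ∈ K}, (normalCoord l K c.1 t : ℂ) ^ (s c.1 - 1) =
      ∏ c ∈ K.toFinset, (val l K c t : ℂ) ^ (s c - 1) := by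
    rw [prod_mem_list K fun c => (normalCoord l K c t : ℂ) ^ (s c - 1)]
    exact Finset.prod_congr rfl fun c hc => by rw [(normalCoord_eq h ht (List.mem_toFinset.1 hc)).1]
  have e3 : ∏ c : {c // c ∈ K}, normalCoord l K c.1 t * (1 - normalCoord l K c.1 t) =
      (∏ c ∈ K.toFinset, val l K c t) * ∏ c ∈ K.toFinset, (1 - val l K c t) := by
    rw [prod_mem_list K fun c => normalCoord l K c t * (1 - normalCoord l K c t),
      ← Finset.prod_mul_distrib]
    exact Finset.prod_congr rfl fun c hc => by rw [(normalCoord_eq h ht (List.mem_toFinset.1 hc)).1]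
  have e4 : (∏ c ∈ K.toFinset, (val l K c t : ℂ)) * ∏ c ∈ K.toFinset, (val l K c t : ℂ) ^ (s c - 1) =
      ∏ c ∈ K.toFinset, (val l K c t : ℂ) ^ s c := by
    rw [← Finset.prod_mul_distrib]
    refine Finset.prod_congr rfl fun c _ => ?_
    have : (val l K c t : ℂ) ≠ 0 := by exact_mod_cast (val_mem ht h.tail K c).1.ne'
    rw [Complex.cpow_sub _ _ this, Complex.cpow_one]
    field_simp
  rw [term, exp_expo h.tail s ht, strat, jacDens, e1, e2, e3, ← e4, coef, Complex.real_smul]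
  push_cast
  field_simp

/-! ### From formal integrands to functions -/

/-- `realise`, as a homomorphism. -/
def realiseHom (l : List (Chord n)) (s : Chord n → ℂ) (t : Space l) : Integrand l →+ ℂ :=
  Finsupp.liftAddHom fun m =>
    { toFun := fun ω =>
        (∏ c ∈ chi l, ((u l c t : ℝ) : ℂ) ^ (∑ e, (m c e : ℂ) * s e)) * ((ω t : ℝ) : ℂ)
      map_zero' := by simp
      map_add' := fun ω ω' => by rw [Pi.add_apply]; push_cast; ring }

lemma realiseHom_apply (l : List (Chord n)) (s : Chord n → ℂ) (t : Space l) (Ω : Integrand l) :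
    realiseHom l s t Ω = realise l s Ω t := rfl

lemma realise_single (l : List (Chord n)) (s : Chord n → ℂ) (t : Space l) (m : Expo n) (ω : Form l) :
    realise l s (Finsupp.single m ω) t =
      (∏ c ∈ chi l, ((u l c t : ℝ) : ℂ) ^ (∑ e, (m c e : ℂ) * s e)) * ((ω t : ℝ) : ℂ) :=
  Finsupp.sum_single_index (by simp)

lemma fStar_single (l K : List (Chord n)) (m : Expo n) (ω : Form (K ++ l)) :
    fStar l K (Finsupp.single m ω) = Finsupp.single (pullExpo l K m) (pull l K ω) := by
  refine Finsupp.sum_single_index ?_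
  rw [show pull l K 0 = 0 from funext fun t => by simp [pull], Finsupp.single_zero]

/-- A single term stays a single term, and its polynomial stays the same under residues. -/
lemma R_single {l : List (Chord n)} {c : Chord n} (h : Good (c :: l)) {m : Expo n} {η : Form l}
    {P : MvPolynomial (Chord n) ℝ} (hη : ∀ t ∈ X l, η t = eval (ubar l t) P * dens l t) :
    ∃ η' : Form (c :: l), R l c (Finsupp.single m η) = Finsupp.single (evExpo c m) η' ∧
      ∀ y ∈ X (c :: l), η' y = eval (ubar (c :: l) y) P * dens (c :: l) y := by
  by_cases h0 : η = 0
  -- A zero coefficient is absent from the support, so `R` returns 0 and not `res l c 0`. The claim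
  -- then requires that a polynomial vanishing on the cell also vanishes on the divisor.
  · refine ⟨0, ?_, fun y hy => ?_⟩
    · rw [h0, Finsupp.single_zero, Finsupp.single_zero]
      exact Finsupp.sum_zero_index
    · have := eval_eq_of_forall (P := P) (P' := 0) h.2 h.1 (fun t ht => by
        have h3 := hη t ht
        rw [h0, Pi.zero_apply, eq_comm, mul_eq_zero] at h3
        rw [map_zero]
        exact h3.resolve_right (dens_pos h.2 ht).ne') hy
      rw [this, map_zero, zero_mul, Pi.zero_apply]
  · refine ⟨res l c η, ?_, fun y hy => res_eq h.2 h.1 hη hy⟩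
    rw [R, Finsupp.sum, Finsupp.support_single _ h0, Finset.sum_singleton,
      Finsupp.single_eq_same]

lemma RIter_single {l : List (Chord n)} {m : Expo n} {η : Form l} {P : MvPolynomial (Chord n) ℝ}
    (hη : ∀ t ∈ X l, η t = eval (ubar l t) P * dens l t) (K : List (Chord n)) (h : Good (K ++ l)) :
    ∃ η' : Form (K ++ l), RIter l K (Finsupp.single m η) =
        Finsupp.single (fun d => if ∃ c ∈ K, Crosses c d then 0 else m d) η' ∧
      ∀ y ∈ X (K ++ l), η' y = eval (ubar (K ++ l) y) P * dens (K ++ l) y := by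
  induction K with
  | nil => exact ⟨η, by simp [RIter], hη⟩
  | cons c K ih =>
    replace h : Good (c :: (K ++ l)) := h
    obtain ⟨η', h1, h2⟩ := ih h.2
    obtain ⟨η'', h3, h4⟩ := R_single (m := fun d => if ∃ c ∈ K, Crosses c d then 0 else m d) h h2
    refine ⟨η'', ?_, h4⟩
    rw [RIter, h1, h3]
    congr 1
    funext d
    rw [evExpo]
    by_cases hcd : Crosses c d
    · rw [if_pos hcd, if_pos ⟨c, by simp, hcd⟩]
    · rw [if_neg hcd]
      have : (∃ c' ∈ c :: K, Crosses c' d) ↔ ∃ c' ∈ K, Crosses c' d := by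
        rw [List.exists_mem_cons_iff]
        exact or_iff_right hcd
      simp only [this]

section
variable {l K : List (Chord n)} (h : Good (K ++ l))
include h

lemma Good.mem_chi_of_mem {c : Chord n} (hc : c ∈ K) :
    c ∈ chi l ∧ ∀ d ∈ K, ¬ Crosses d c := by
  have h1 := good_iff.1 h
  refine ⟨mem_chi.2 ⟨fun h2 => ?_, fun d hd => h1.2 d (by simp [hd]) c (by simp [hc])⟩,
    fun d hd => h1.2 d (by simp [hd]) c (by simp [hc])⟩
  exact (List.nodup_append.1 h1.1).2.2 c hc c h2 rfl

omit h in
lemma mem_chi_append {c : Chord n} (hc : c ∈ chi (K ++ l)) :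
    c ∈ chi l ∧ ∀ d ∈ K, ¬ Crosses d c := by
  obtain ⟨h1, h2⟩ := mem_chi.1 hc
  exact ⟨mem_chi.2 ⟨fun h => h1 (by simp [h]), fun d hd => h2 d (by simp [hd])⟩,
    fun d hd => h2 d (by simp [hd])⟩

lemma chords_mem {c : Chord n} (hc : c ∈ chords l K) : c ∈ chi l ∧ ∀ d ∈ K, ¬ Crosses d c := by
  rcases Finset.mem_union.1 hc with hc | hc
  · exact h.mem_chi_of_mem (List.mem_toFinset.1 hc)
  · exact mem_chi_append hc

/-- The two kinds of contributions take the same form: for a chord `e` of the stratum erasing `e`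
from `K` does nothing, and only the cell containing `e` contributes. -/
lemma pullExpo_eq {d : Chord n} (hd : d ∈ chi l) :
    pullExpo l K (fun d => if ∃ c ∈ K, Crosses c d then 0 else
      if d ∈ chi l then Pi.single d 1 else 0) d =
    ∑ e ∈ chords l K, if d ∈ contr l (cellOf (K.erase e ++ l) (ends e)) e then Pi.single e 1 else 0 := by
  have hm : ∀ e ∈ chords l K, (if ∃ c ∈ K, Crosses c e then (0 : Mon n) else
      if e ∈ chi l then Pi.single e 1 else 0) = Pi.single e 1 := by
    intro e he
    obtain ⟨h1, h2⟩ := chords_mem h he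
    rw [if_neg fun ⟨c, hc, hcr⟩ => h2 c hc hcr, if_pos h1]
  rw [pullExpo, if_neg (mem_chi.1 hd).1, if_pos hd, chords, Finset.sum_union (disjoint_chords l K)]
  congr 1
  · rw [Finset.sum_filter]
    refine Finset.sum_congr rfl fun c hc => ?_
    rw [hm c (Finset.mem_union_left _ hc)]
    simp only [contr, Finset.mem_filter, hd, true_and]
  · simp only [Finset.sum_filter]
    have : ∀ e ∈ chi (K ++ l), (if d ∈ contr l (cellOf (K.erase e ++ l) (ends e)) e then
        (Pi.single e 1 : Mon n) else 0) = ∑ P ∈ cells (K ++ l), if P ⊆ cellOf l (ends d) then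
          (if ContractsTo P d e then Pi.single e 1 else 0) else 0 := by
      intro e he
      rw [List.erase_of_not_mem fun h' => (mem_chi.1 he).1 (by simp [h']),
        Finset.sum_eq_single_of_mem _ (cellOf_ends_mem h he)]
      · simp only [contr, Finset.mem_filter, hd, true_and, ite_and]
      · intro P hP hne
        rw [← ite_and, if_neg]
        rintro ⟨_, h1, _⟩
        exact hne (eq_cellOf_ends h he hP h1)
    rw [Finset.sum_congr rfl this, Finset.sum_comm]
    refine Finset.sum_congr rfl fun P _ => ?_
    split_ifs with h1
    · exact Finset.sum_congr rfl fun e he => by rw [hm e (Finset.mem_union_right _ he)]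
    · simp

lemma prod_cpow_pullExpo (s : Chord n → ℂ) {t : Space l} (ht : t ∈ X l) :
    ∏ c ∈ chi l, ((u l c t : ℝ) : ℂ) ^ (∑ e, ((pullExpo l K (fun d => if ∃ c ∈ K, Crosses c d then 0
      else if d ∈ chi l then Pi.single d 1 else 0) c e : ℕ) : ℂ) * s e) =
    Complex.exp (expo l K s t) := by
  have hl := h.tail
  have h1 : ∀ c ∈ chi l, ∑ e, ((pullExpo l K (fun d => if ∃ c ∈ K, Crosses c d then 0
      else if d ∈ chi l then Pi.single d 1 else 0) c e : ℕ) : ℂ) * s e =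
      ∑ e ∈ chords l K, if c ∈ contr l (cellOf (K.erase e ++ l) (ends e)) e then s e else 0 := by
    intro c hc
    simp only [pullExpo_eq h hc, Finset.sum_apply, Nat.cast_sum, Finset.sum_mul]
    rw [Finset.sum_comm]
    refine Finset.sum_congr rfl fun e _ => ?_
    split_ifs
    · rw [Finset.sum_eq_single e] <;> simp +contextual
    · simp
  rw [Finset.prod_congr rfl fun c hc => by
    rw [h1 c hc, cpow_eq_exp_log (u_mem hl ht hc).1], ← Complex.exp_sum, expo]
  congr 1
  simp only [Finset.sum_mul]
  rw [Finset.sum_comm]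
  refine Finset.sum_congr rfl fun e _ => ?_
  have hsub : contr l (cellOf (K.erase e ++ l) (ends e)) e ⊆ chi l := contr_subset _ _
  rw [val, Real.log_prod fun d hd => (u_mem hl ht (hsub hd)).1.ne', Complex.ofReal_sum, Finset.mul_sum]
  rw [← Finset.sum_subset hsub fun c _ hc => by rw [if_neg hc, zero_mul]]
  exact Finset.sum_congr rfl fun c hc => by rw [if_pos hc]

lemma pull_eq {η' : Form (K ++ l)} {P : MvPolynomial (Chord n) ℝ}
    (hη : ∀ y ∈ X (K ++ l), η' y = eval (ubar (K ++ l) y) P * dens (K ++ l) y) {t : Space l}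
    (ht : t ∈ X l) : pull l K η' t = coef P l K t := by
  have hl := h.tail
  have hy := forget_mem_X h ht
  have hd := (dens_pos h hy).ne'
  have hv : ∏ c ∈ K.toFinset, val l K c t ≠ 0 :=
    Finset.prod_ne_zero_iff.2 fun c _ => (val_mem ht hl K c).1.ne'
  have hnd : K.Nodup := (List.nodup_append.1 (good_iff.1 h).1).1
  have e1 : (K.map fun c => normalCoord l K c t).prod = ∏ c ∈ K.toFinset, val l K c t := by
    rw [← List.prod_toFinset _ hnd]
    exact Finset.prod_congr rfl fun c hc => (normalCoord_eq h ht (List.mem_toFinset.1 hc)).1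
  have e3 : ∏ c : {c // c ∈ K}, normalCoord l K c.1 t * (1 - normalCoord l K c.1 t) =
      (∏ c ∈ K.toFinset, val l K c t) * ∏ c ∈ K.toFinset, (1 - val l K c t) := by
    rw [prod_mem_list K fun c => normalCoord l K c t * (1 - normalCoord l K c t),
      ← Finset.prod_mul_distrib]
    exact Finset.prod_congr rfl fun c hc => by rw [(normalCoord_eq h ht (List.mem_toFinset.1 hc)).1]
  rw [pull, hη _ hy, jac_eq (hasJac_triv hl K h t ht), e1, e3, coef]
  field_simp

end

lemma good_toList {l : List (Chord n)} (hl : Good l) {K : Finset (Chord n)}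
    (hK : K ∈ (chi l).powerset.filter fun K => NonCrossing K) : Good (K.toList ++ l) := by
  rw [Finset.mem_filter, Finset.mem_powerset] at hK
  exact good_append hl K.nodup_toList (fun c hc => hK.1 (Finset.mem_toList.1 hc))
    fun c hc d hd => hK.2 c (Finset.mem_toList.1 hc) d (Finset.mem_toList.1 hd)

/-- The formal operations only ever produce single terms, one for each K, so the realisation of
Ω^ren can be written explicitly. -/
theorem realise_ren {ω : Form ([] : List (Chord n))} {P : MvPolynomial (Chord n) ℝ}
    (hP : ∀ t ∈ X [], ω t = eval (ubar [] t) P * dens [] t) {l : List (Chord n)} (hl : Good l)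
    (s : Chord n → ℂ) {t : Space l} (ht : t ∈ X l) :
    realise l s (ren l (OmegaJ l ω)) t =
      ∑ K ∈ (chi l).powerset.filter fun K => NonCrossing K, (-1 : ℂ) ^ K.card * term P l K.toList s t := by
  rw [← realiseHom_apply, ren, map_sum]
  refine Finset.sum_congr rfl fun K hK => ?_
  have hG := good_toList hl hK
  obtain ⟨η', h1, h2⟩ := RIter_single (m := fun c => if c ∈ chi l then Pi.single c 1 else 0)
    (resIter_eq hP l hl) K.toList hG
  rw [map_zsmul, OmegaJ, h1, fStar_single, realiseHom_apply, realise_single,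
    prod_cpow_pullExpo hG s ht, pull_eq hG h2 ht, zsmul_eq_mul, term]
  push_cast
  ring

lemma realise_OmegaJ {ω : Form ([] : List (Chord n))} {P : MvPolynomial (Chord n) ℝ}
    (hP : ∀ t ∈ X [], ω t = eval (ubar [] t) P * dens [] t) {l : List (Chord n)} (hl : Good l)
    (s : Chord n → ℂ) {t : Space l} (ht : t ∈ X l) :
    realise l s (OmegaJ l ω) t = strat P l s t := by
  rw [OmegaJ, realise_single, resIter_eq hP l hl t ht, strat]
  congr 1
  refine Finset.prod_congr rfl fun c hc => ?_
  congr 1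
  simp only [if_pos hc]
  rw [Finset.sum_eq_single c] <;> simp +contextual

lemma openIntegrand_eq {ω : Form ([] : List (Chord n))} {P : MvPolynomial (Chord n) ℝ}
    (hP : ∀ t ∈ X [], ω t = eval (ubar [] t) P * dens [] t) (s : Chord n → ℂ)
    {t : Space ([] : List (Chord n))} (ht : t ∈ X []) : openIntegrand ω s t = strat P [] s t := by
  rw [openIntegrand, hP t ht, strat]
  congr 1
  exact Finset.prod_congr (by ext; simp [mem_chi_nil]) fun _ _ => rfl

/-! ### Integrals over the strata -/

/-- A polynomial which is divisible by the variables in `A`. -/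
def numer (A : Finset (Chord n)) (P : MvPolynomial (Chord n) ℝ) : MvPolynomial (Chord n) ℝ :=
  (∏ c ∈ A, MvPolynomial.X c) * P

lemma eval_numer (A : Finset (Chord n)) (P : MvPolynomial (Chord n) ℝ) (a : Chord n → ℝ) :
    eval a (numer A P) = (∏ c ∈ A, a c) * eval a P := by
  simp [numer]

lemma eval_numer_eq_zero {A : Finset (Chord n)} (P : MvPolynomial (Chord n) ℝ) {l : List (Chord n)}
    {c : Chord n} (hc : c ∈ A) (hcl : c ∈ l) (t : Space l) : eval (ubar l t) (numer A P) = 0 := by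
  rw [eval_numer, Finset.prod_eq_zero hc (by rw [ubar, if_pos hcl]), zero_mul]

lemma exists_numer_le (A : Finset (Chord n)) (P : MvPolynomial (Chord n) ℝ) :
    ∃ C : ℝ, 0 ≤ C ∧ ∀ l : List (Chord n), Good l → ∀ t ∈ X l,
      |eval (ubar l t) (numer A P)| ≤ C * ∏ d ∈ (chi l).filter (· ∈ A), u l d t := by
  obtain ⟨C, hC, h⟩ := exists_bound_eval P
  refine ⟨C, hC, fun l hl t ht => ?_⟩
  have h1 : 0 ≤ ∏ d ∈ A, ubar l t d := Finset.prod_nonneg fun d _ => (ubar_mem hl ht d).1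
  have h2 : ∏ d ∈ A, ubar l t d ≤ ∏ d ∈ (chi l).filter (· ∈ A), u l d t := by
    rw [← Finset.prod_filter_mul_prod_filter_not A (· ∈ chi l)]
    have e : ∏ d ∈ A.filter (· ∈ chi l), ubar l t d = ∏ d ∈ (chi l).filter (· ∈ A), u l d t :=
      Finset.prod_congr (by ext; simp [and_comm]) fun d hd =>
        ubar_of_mem (Finset.mem_filter.1 hd).1
    rw [e]
    exact mul_le_of_le_one_right (prod_u_mem hl ht (Finset.filter_subset _ _)).1.le
      (Finset.prod_le_one (fun d _ => (ubar_mem hl ht d).1) fun d _ => (ubar_mem hl ht d).2)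
  rw [eval_numer, abs_mul, abs_of_nonneg h1, mul_comm]
  exact mul_le_mul (h _ fun d => ubar_mem hl ht d) h2 h1 hC

lemma exists_pos_le {ι : Type*} (S : Finset ι) (a : ι → ℝ) (h : ∀ i ∈ S, 0 < a i) :
    ∃ δ : ℝ, 0 < δ ∧ ∀ i ∈ S, δ ≤ a i := by
  rcases S.eq_empty_or_nonempty with rfl | hS
  · exact ⟨1, one_pos, by simp⟩
  · obtain ⟨i, hi, hm⟩ := Finset.exists_min_image S a hS
    exact ⟨a i, h i hi, hm⟩

section
variable {l : List (Chord n)} (hl : Good l)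
include hl

lemma norm_prod_cpow {S : Finset (Chord n)} (hS : S ⊆ chi l) (s : Chord n → ℂ) {t : Space l}
    (ht : t ∈ X l) :
    ‖∏ d ∈ S, ((u l d t : ℝ) : ℂ) ^ s d‖ = ∏ d ∈ S, u l d t ^ (s d).re := by
  rw [norm_prod]
  exact Finset.prod_congr rfl fun d hd => Complex.norm_cpow_eq_rpow_re_of_pos (u_mem hl ht (hS hd)).1 _

lemma continuousOn_strat (P : MvPolynomial (Chord n) ℝ) (s : Chord n → ℂ) :
    ContinuousOn (strat P l s) (X l) := by
  refine ContinuousOn.mul (continuousOn_finsetProd _ fun d hd => ?_)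
    (Complex.continuous_ofReal.comp_continuousOn ((continuousOn_eval hl P).mul (continuousOn_dens hl)))
  exact ContinuousOn.cpow_const (Complex.continuous_ofReal.comp_continuousOn (continuousOn_u hl hd))
    fun t ht => Complex.ofReal_mem_slitPlane.2 (u_mem hl ht hd).1

/-- The divisibility of the numerator raises the exponents of the u_d with d in `A` by one. All
exponents are then at least some δ > 0, and `integrableOn_uprod` applies. -/
theorem integrableOn_strat (A : Finset (Chord n)) (P : MvPolynomial (Chord n) ℝ) {s : Chord n → ℂ}
    (hs : ∀ d ∈ chi l, 0 < (s d).re + if d ∈ A then 1 else 0) :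
    IntegrableOn (strat (numer A P) l s) (X l) := by
  obtain ⟨C, hC, hP⟩ := exists_numer_le A P
  obtain ⟨δ, hδ, hδs⟩ := exists_pos_le _ _ hs
  refine Integrable.mono' ((integrableOn_uprod hl hδ).const_mul C)
    ((continuousOn_strat hl _ s).aestronglyMeasurable (measurableSet_X l)) ?_
  refine (ae_restrict_mem (measurableSet_X l)).mono fun t ht => ?_
  have hd := dens_pos hl ht
  rw [strat, norm_mul, norm_prod_cpow hl subset_rfl s ht, Complex.norm_real, Real.norm_eq_abs, abs_mul,
    abs_of_pos hd]
  have h1 : ∏ d ∈ chi l, u l d t ^ (s d).re * (if d ∈ A then u l d t else 1) ≤ uprod l t ^ δ := by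
    rw [uprod, ← Real.finsetProd_rpow _ _ fun d hd => (u_mem hl ht hd).1.le]
    refine Finset.prod_le_prod (fun d hd => ?_) fun d hd => ?_
    · have := (u_mem hl ht hd).1
      split_ifs <;> positivity
    · have hu := u_mem hl ht hd
      have : u l d t ^ (s d).re * (if d ∈ A then u l d t else 1) =
          u l d t ^ ((s d).re + if d ∈ A then 1 else 0) := by
        rw [Real.rpow_add hu.1]
        split_ifs <;> simp
      rw [this]
      exact Real.rpow_le_rpow_of_exponent_ge hu.1 hu.2.le (hδs d hd)
  rw [Finset.prod_mul_distrib, ← Finset.prod_filter] at h1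
  have h2 : 0 ≤ ∏ d ∈ chi l, u l d t ^ (s d).re :=
    Finset.prod_nonneg fun d hd => Real.rpow_nonneg (u_mem hl ht hd).1.le _
  calc (∏ d ∈ chi l, u l d t ^ (s d).re) * (|eval (ubar l t) (numer A P)| * dens l t)
      ≤ (∏ d ∈ chi l, u l d t ^ (s d).re) *
          (C * (∏ d ∈ (chi l).filter (· ∈ A), u l d t) * dens l t) := by
        gcongr
        exact hP l hl t ht
    _ = C * (((∏ d ∈ chi l, u l d t ^ (s d).re) * ∏ d ∈ (chi l).filter (· ∈ A), u l d t) *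
          dens l t) := by ring
    _ ≤ C * (uprod l t ^ δ * dens l t) := by gcongr

end

lemma integral_Ioo_cpow {z : ℂ} (hz : 0 < z.re) :
    IntegrableOn (fun x : ℝ => (x : ℂ) ^ (z - 1)) (Set.Ioo 0 1) ∧
      ∫ x in Set.Ioo (0 : ℝ) 1, (x : ℂ) ^ (z - 1) = 1 / z := by
  have hz0 : z ≠ 0 := fun h => by simp [h] at hz
  have h1 : -1 < (z - 1).re := by simpa
  constructor
  · rw [← intervalIntegrable_iff_integrableOn_Ioo_of_le zero_le_one]
    exact intervalIntegral.intervalIntegrable_cpow' h1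
  · rw [← integral_Ioc_eq_integral_Ioo, ← intervalIntegral.integral_of_le zero_le_one,
      integral_cpow (Or.inl h1)]
    simp [hz0]

/-- The region of convergence of the integral over the stratum `X_J`, for a form with numerator
divisible by the variables in `A`. -/
def Region (A : Finset (Chord n)) (l : List (Chord n)) : Set (Chord n → ℂ) :=
  {s | ∀ d ∈ chi l, -1 < (s d).re ∧ (d ∉ A → 0 < (s d).re)}

/-- Fubini in the coordinates of f_K: each normal direction contributes ∫_0^1 x^{s_c - 1} dx =
1/s_c, the origin of the poles. -/
theorem integral_term {l K : List (Chord n)} (h : Good (K ++ l)) (A : Finset (Chord n))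
    (P : MvPolynomial (Chord n) ℝ) {s : Chord n → ℂ} (hs : s ∈ Region A l) :
    IntegrableOn (term (numer A P) l K s) (X l) ∧
    ∫ t in X l, term (numer A P) l K s t = (1 / ∏ c ∈ K.toFinset, s c) *
      ∫ y in X (K ++ l), strat (numer A P) (K ++ l) s y := by
  -- Here s_c need not have positive real part, and may be 0, but then both sides vanish: the
  -- numerator contains u_c and is restricted to u_c = 0.
  by_cases hA : ∃ c ∈ K, c ∈ A
  · obtain ⟨c, hc, hcA⟩ := hA
    have h1 : ∀ y, strat (numer A P) (K ++ l) s y = 0 := fun y => by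
      rw [strat, eval_numer_eq_zero P hcA (by simp [hc])]; simp
    have h2 : ∀ t, term (numer A P) l K s t = 0 := fun t => by
      rw [term, coef, eval_numer_eq_zero P hcA (by simp [hc])]; simp
    simp [funext h1, funext h2]
  · push Not at hA
    have h1 : ∀ c ∈ K, 0 < (s c).re := fun c hc => (hs c (h.mem_chi_of_mem hc).1).2 (hA c hc)
    have h2 := integral_triv_prod h (fun c x => (x : ℂ) ^ (s c.1 - 1)) _
      (fun c => (integral_Ioo_cpow (h1 c.1 c.2)).1)
      (integrableOn_strat h A P (s := s) fun d hd => by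
        have := hs d (mem_chi_append hd).1
        split_ifs with hdA
        · linarith
        · linarith [this.2 hdA])
    have h3 : Set.EqOn (term (numer A P) l K s) _ (X l) := fun t ht => term_eq h (numer A P) s ht
    refine ⟨h2.1.congr_fun h3.symm (measurableSet_X l), ?_⟩
    rw [setIntegral_congr_fun (measurableSet_X l) h3, h2.2]
    congr 1
    rw [Finset.prod_congr rfl fun c _ => (integral_Ioo_cpow (h1 c.1 c.2)).2,
      prod_mem_list K fun c => 1 / s c, Finset.prod_div_distrib, Finset.prod_const_one]

/-! ### Independence of the order of the chords -/

/-- The configuration of points with coordinates `t`, in terms of the set of cells. -/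
def configOf (C : Finset (Finset (Vert n)))
    (t : {q : Finset (Vert n) × Vert n // q.1 ∈ C ∧ q.2 ∈ q.1 ∧
      q.2 ≠ lo q.1 ∧ q.2 ≠ hi q.1 ∧ q.2 ≠ pred q.1 (hi q.1)} → ℝ)
    (P : Finset (Vert n)) (v : Vert n) : ℝ × ℝ :=
  if v = hi P then (1, 0)
  else if v = lo P then (0, 1)
  else if v = pred P (hi P) then (1, 1)
  else if h : P ∈ C ∧ v ∈ P ∧ v ≠ lo P ∧ v ≠ hi P ∧ v ≠ pred P (hi P) then (t ⟨(P, v), h⟩, 1)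
  else (0, 1)

def dihedralOf (C : Finset (Finset (Vert n)))
    (t : {q : Finset (Vert n) × Vert n // q.1 ∈ C ∧ q.2 ∈ q.1 ∧
      q.2 ≠ lo q.1 ∧ q.2 ≠ hi q.1 ∧ q.2 ≠ pred q.1 (hi q.1)} → ℝ) (c : Chord n) : ℝ :=
  crossRatio ((C.filter fun Q => ends c ⊆ Q).sup id)
    (configOf C t ((C.filter fun Q => ends c ⊆ Q).sup id)) c

/-- The integral over a stratum, in terms of the set of cells. -/
def stratOf (C : Finset (Finset (Vert n))) (χ Λ : Finset (Chord n)) (P : MvPolynomial (Chord n) ℝ)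
    (s : Chord n → ℂ) : ℂ :=
  ∫ t in {t : {q : Finset (Vert n) × Vert n // q.1 ∈ C ∧ q.2 ∈ q.1 ∧
      q.2 ≠ lo q.1 ∧ q.2 ≠ hi q.1 ∧ q.2 ≠ pred q.1 (hi q.1)} → ℝ |
      (∀ q, 0 < t q ∧ t q < 1) ∧ ∀ q q', q.1.1 = q'.1.1 → q.1.2 < q'.1.2 → t q < t q'},
    (∏ d ∈ χ, (dihedralOf C t d : ℂ) ^ s d) *
      ((eval (fun d => if d ∈ Λ then 0 else if d ∈ χ then dihedralOf C t d else 1) P *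
        ∏ Q ∈ C, (gap (configOf C t Q) Q)⁻¹ : ℝ) : ℂ)

/-- The coordinate space depends on the list `l` only through `cells l`. Once this set is a variable
of `stratOf`, equal sets of cells can be substituted inside the dependent types. -/
lemma integral_strat_eq (P : MvPolynomial (Chord n) ℝ) (l : List (Chord n)) (s : Chord n → ℂ) :
    ∫ t in X l, strat P l s t = stratOf (cells l) (chi l) l.toFinset P s := by
  simp only [stratOf, List.mem_toFinset]
  rfl

lemma integral_strat_congr (P : MvPolynomial (Chord n) ℝ) {l l' : List (Chord n)} (hl : Good l)
    (hl' : Good l') (h : ∀ c, c ∈ l ↔ c ∈ l') (s : Chord n → ℂ) :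
    ∫ t in X l, strat P l s t = ∫ t in X l', strat P l' s t := by
  rw [integral_strat_eq, integral_strat_eq, cells_congr hl hl' h, chi_congr h,
    show l.toFinset = l'.toFinset by ext; simp [h]]

/-! ### Subtraction of the divergences -/

lemma good_of_nonCrossing {J : Finset (Chord n)} (hJ : NonCrossing J) : Good J.toList :=
  good_iff.2 ⟨J.nodup_toList, fun c hc d hd => hJ c (Finset.mem_toList.1 hc) d (Finset.mem_toList.1 hd)⟩

lemma mem_dissections {J : Finset (Chord n)} : J ∈ dissections n ↔ NonCrossing J := by
  simp [dissections]

lemma mem_chi_toList {J : Finset (Chord n)} {d : Chord n} :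
    d ∈ chi J.toList ↔ d ∉ J ∧ ∀ c ∈ J, ¬ Crosses c d := by
  simp only [mem_chi, Finset.mem_toList]

lemma mem_subsets_chi {J K : Finset (Chord n)} (hJ : NonCrossing J) :
    (K ∈ (chi J.toList).powerset.filter fun K => NonCrossing K) ↔
      NonCrossing (J ∪ K) ∧ Disjoint J K := by
  rw [Finset.mem_filter, Finset.mem_powerset]
  constructor
  · rintro ⟨h1, h2⟩
    have h3 := fun c hc => mem_chi_toList.1 (h1 hc : c ∈ _)
    refine ⟨fun c hc d hd => ?_, Finset.disjoint_right.2 fun c hc => (h3 c hc).1⟩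
    rcases Finset.mem_union.1 hc with hc | hc <;> rcases Finset.mem_union.1 hd with hd | hd
    · exact hJ c hc d hd
    · exact (h3 d hd).2 c hc
    · exact fun h => (h3 c hc).2 d hd (crosses_comm.1 h)
    · exact h2 c hc d hd
  · rintro ⟨h1, h2⟩
    exact ⟨fun c hc => mem_chi_toList.2 ⟨fun h => Finset.disjoint_left.1 h2 h hc,
      fun d hd => h1 d (Finset.mem_union_left _ hd) c (Finset.mem_union_right _ hc)⟩,
      fun c hc d hd => h1 c (Finset.mem_union_right _ hc) d (Finset.mem_union_right _ hd)⟩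

/-- The hypothesis that `ω` has numerator `numer A P`. -/
def HasNumer (ω : Form ([] : List (Chord n))) (A : Finset (Chord n)) (P : MvPolynomial (Chord n) ℝ) :
    Prop := ∀ t ∈ X [], ω t = eval (ubar [] t) (numer A P) * dens [] t

section
variable {ω : Form ([] : List (Chord n))} {A : Finset (Chord n)} {P : MvPolynomial (Chord n) ℝ}
  (hω : HasNumer ω A P)
include hω

lemma renIntegral_eq_zero {J : Finset (Chord n)} (hJ : NonCrossing J) {c : Chord n} (hc : c ∈ J)
    (hcA : c ∈ A) (s : Chord n → ℂ) : renIntegral ω J s = 0 := by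
  refine setIntegral_eq_zero_of_forall_eq_zero fun t ht => ?_
  rw [renIntegrand, realise_ren hω (good_of_nonCrossing hJ) s ht]
  refine Finset.sum_eq_zero fun K _ => ?_
  rw [term, coef, eval_numer_eq_zero P hcA (by simp [hc])]
  simp

/-- Termwise application of `integral_term`; `integral_strat_congr` allows the stratum to be listed
by the finite set J ∪ K. -/
lemma integral_ren {J : Finset (Chord n)} (hJ : NonCrossing J) {s : Chord n → ℂ}
    (hs : s ∈ Region A J.toList) : IntegrableOn (renIntegrand ω J s) (X J.toList) ∧
    renIntegral ω J s = ∑ K ∈ (chi J.toList).powerset.filter fun K => NonCrossing K,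
      (-1 : ℂ) ^ K.card * ((1 / ∏ c ∈ K, s c) *
        ∫ t in X (J ∪ K).toList, strat (numer A P) (J ∪ K).toList s t) := by
  have hG := good_of_nonCrossing hJ
  have h1 : Set.EqOn (renIntegrand ω J s) _ (X J.toList) := fun t ht => realise_ren hω hG s ht
  have h2 := fun K hK => integral_term (good_toList (K := K) hG hK) A P hs
  have h3 : IntegrableOn (fun t => ∑ K ∈ (chi J.toList).powerset.filter fun K => NonCrossing K,
      (-1 : ℂ) ^ K.card * term (numer A P) J.toList K.toList s t) (X J.toList) :=
    integrable_finsetSum _ fun K hK => (h2 K hK).1.const_mul _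
  refine ⟨h3.congr_fun h1.symm (measurableSet_X _), ?_⟩
  rw [renIntegral, setIntegral_congr_fun (measurableSet_X _) h1,
    integral_finsetSum _ fun K hK => (h2 K hK).1.const_mul _]
  refine Finset.sum_congr rfl fun K hK => ?_
  rw [integral_const_mul, (h2 K hK).2, Finset.toList_toFinset]
  congr 2
  exact integral_strat_congr _ (good_toList hG hK)
    (good_of_nonCrossing ((mem_subsets_chi hJ).1 hK).1) (fun c => by simp [or_comm]) s

/-- The integral over a stratum is the sum of the renormalised integrals over the smaller strata. -/
theorem integral_strat_eq_sum {B : Finset (Chord n)} (hB : NonCrossing B) {s : Chord n → ℂ}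
    (hs : s ∈ Region A B.toList) : ∫ t in X B.toList, strat (numer A P) B.toList s t =
      ∑ J ∈ (dissections n).filter (B ⊆ ·), (1 / ∏ c ∈ J \ B, s c) * renIntegral ω J s := by
  set D : Finset (Chord n) → ℂ := fun M => ∫ t in X M.toList, strat (numer A P) M.toList s t with hD
  have hsJ : ∀ J, B ⊆ J → s ∈ Region A J.toList := fun J hJ d hd => hs d (mem_chi_toList.2
    ⟨fun h => (mem_chi_toList.1 hd).1 (hJ h), fun c hc => (mem_chi_toList.1 hd).2 c (hJ hc)⟩)
  have h1 : ∀ J ∈ (dissections n).filter (B ⊆ ·), (1 / ∏ c ∈ J \ B, s c) * renIntegral ω J s =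
      ∑ K ∈ (chi J.toList).powerset.filter fun K => NonCrossing K,
        (1 / ∏ c ∈ J \ B, s c) * ((-1 : ℂ) ^ K.card * ((1 / ∏ c ∈ K, s c) * D (J ∪ K))) := by
    intro J hJ
    rw [Finset.mem_filter, mem_dissections] at hJ
    rw [(integral_ren hω hJ.1 (hsJ J hJ.2)).2, Finset.mul_sum]
  -- Pairs (J, K) are regrouped as (M, K) with M = J ∪ K; J and K are disjoint, and K ranges over
  -- all subsets of M outside B.
  have h2 : ∑ J ∈ (dissections n).filter (B ⊆ ·),
      ∑ K ∈ (chi J.toList).powerset.filter fun K => NonCrossing K,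
        (1 / ∏ c ∈ J \ B, s c) * ((-1 : ℂ) ^ K.card * ((1 / ∏ c ∈ K, s c) * D (J ∪ K))) =
      ∑ M ∈ (dissections n).filter (B ⊆ ·), ∑ K ∈ (M \ B).powerset,
        (-1 : ℂ) ^ K.card * ((1 / ∏ c ∈ M \ B, s c) * D M) := by
    rw [Finset.sum_sigma', Finset.sum_sigma']
    refine Finset.sum_bij' (fun x _ => ⟨x.1 ∪ x.2, x.2⟩) (fun x _ => ⟨x.1 \ x.2, x.2⟩) ?_ ?_ ?_ ?_ ?_
    · rintro ⟨J, K⟩ h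
      rw [Finset.mem_sigma, Finset.mem_filter, mem_dissections] at h
      rw [mem_subsets_chi h.1.1] at h
      rw [Finset.mem_sigma, Finset.mem_filter, mem_dissections, Finset.mem_powerset]
      refine ⟨⟨h.2.1, h.1.2.trans Finset.subset_union_left⟩, fun c hc => Finset.mem_sdiff.2
        ⟨Finset.mem_union_right _ hc, fun hcB => Finset.disjoint_left.1 h.2.2 (h.1.2 hcB) hc⟩⟩
    · rintro ⟨M, K⟩ h
      rw [Finset.mem_sigma, Finset.mem_filter, mem_dissections, Finset.mem_powerset] at h
      obtain ⟨⟨h1, h2⟩, h3⟩ := h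
      have hKM : K ⊆ M := h3.trans Finset.sdiff_subset
      have hn : NonCrossing (M \ K) := fun c hc d hd =>
        h1 c (Finset.sdiff_subset hc) d (Finset.sdiff_subset hd)
      rw [Finset.mem_sigma, Finset.mem_filter, mem_dissections, mem_subsets_chi hn,
        Finset.sdiff_union_of_subset hKM]
      exact ⟨⟨hn, fun c hc => Finset.mem_sdiff.2 ⟨h2 hc, fun h => (Finset.mem_sdiff.1 (h3 h)).2 hc⟩⟩,
        h1, Finset.sdiff_disjoint⟩
    · rintro ⟨J, K⟩ h
      rw [Finset.mem_sigma, Finset.mem_filter, mem_dissections] at h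
      rw [mem_subsets_chi h.1.1] at h
      simp only [Sigma.mk.injEq, heq_eq_eq, and_true]
      exact Finset.union_sdiff_cancel_right h.2.2
    · rintro ⟨M, K⟩ h
      rw [Finset.mem_sigma, Finset.mem_powerset] at h
      simp only [Sigma.mk.injEq, heq_eq_eq, and_true]
      exact Finset.sdiff_union_of_subset (h.2.trans Finset.sdiff_subset)
    · rintro ⟨J, K⟩ h
      rw [Finset.mem_sigma, Finset.mem_filter, mem_dissections] at h
      rw [mem_subsets_chi h.1.1] at h
      have h3 : (J ∪ K) \ B = J \ B ∪ K := by
        rw [Finset.union_sdiff_distrib, Finset.sdiff_eq_self_of_disjoint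
          (Finset.disjoint_of_subset_right h.1.2 h.2.2.symm)]
      simp only [h3]
      rw [Finset.prod_union (h.2.2.mono_left Finset.sdiff_subset)]
      simp only [one_div, mul_inv]
      ring
  rw [Finset.sum_congr rfl h1, h2]
  -- The alternating sum over the subsets of M \ B is zero unless M = B.
  have h3 : ∀ M ∈ (dissections n).filter (B ⊆ ·), ∑ K ∈ (M \ B).powerset,
      (-1 : ℂ) ^ K.card * ((1 / ∏ c ∈ M \ B, s c) * D M) = if M = B then D B else 0 := by
    intro M hM
    have := congrArg (fun k : ℤ => (k : ℂ)) (Finset.sum_powerset_neg_one_pow_card (x := M \ B))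
    simp only [Int.cast_sum, Int.cast_pow, Int.cast_neg, Int.cast_one] at this
    rw [← Finset.sum_mul, this]
    have hiff : M \ B = ∅ ↔ M = B := by
      rw [Finset.sdiff_eq_empty_iff_subset]
      exact ⟨fun h => h.antisymm (Finset.mem_filter.1 hM).2, fun h => h.subset⟩
    by_cases hMB : M = B
    · subst hMB
      simp
    · rw [if_neg hMB, if_neg (mt hiff.1 hMB)]
      simp
  rw [Finset.sum_congr rfl h3, Finset.sum_ite_eq', if_pos]
  exact Finset.mem_filter.2 ⟨mem_dissections.2 hB, subset_rfl⟩

end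

/-! ### Estimates for the renormalised integrands -/

lemma Good.erase {K l : List (Chord n)} (h : Good (K ++ l)) (e : Chord n) : Good (K.erase e ++ l) := by
  by_cases he : e ∈ K
  · exact (good_erase h he).2
  · rwa [List.erase_of_not_mem he]

lemma Good.nodup {K l : List (Chord n)} (h : Good (K ++ l)) : K.Nodup :=
  (List.nodup_append.1 (good_iff.1 h).1).1

/-- The logarithm of the contribution of `u_e` to `f_K^*`. -/
def lval (l K : List (Chord n)) (e : Chord n) (t : Space l) : ℝ :=
  if e ∈ chords l K then Real.log (val l K e t) else 0

/-- The derivative of the term indexed by `K` in the directions `i`. -/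
def dterm (P : MvPolynomial (Chord n) ℝ) (l K : List (Chord n)) (s : Chord n → ℂ) {k : ℕ}
    (i : Fin k → Chord n) (t : Space l) : ℂ :=
  Complex.exp (∑ e, s e * (lval l K e t : ℂ)) * (∏ j, (lval l K (i j) t : ℂ)) * (coef P l K t : ℂ)

section
variable {l K K' : List (Chord n)} (h : Good (K ++ l))
include h

lemma ubar_forget_apply {t : Space l} (ht : t ∈ X l) (d : Chord n) :
    ubar (K ++ l) (forget l K t) d =
      if d ∈ K ++ l then 0 else if d ∈ chi (K ++ l) then val l K d t else 1 := by
  rw [ubar]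
  split_ifs with h1 h2
  · rfl
  · exact u_forget_eq_val h ht h2
  · rfl

lemma dterm_congr (h' : Good (K' ++ l)) (hm : ∀ c, c ∈ K ↔ c ∈ K') (P : MvPolynomial (Chord n) ℝ)
    (s : Chord n → ℂ) {k : ℕ} (i : Fin k → Chord n) {t : Space l} (ht : t ∈ X l) :
    dterm P l K s i t = dterm P l K' s i t := by
  have hv : ∀ e, val l K e t = val l K' e t := fun e => by
    have : cells (K.erase e ++ l) = cells (K'.erase e ++ l) :=
      cells_congr (h.erase e) (h'.erase e) fun c => by
        simp only [List.mem_append, h.nodup.mem_erase_iff, h'.nodup.mem_erase_iff, hm]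
    rw [val, val, cellOf, cellOf, this]
  have hmem : ∀ c, c ∈ K ++ l ↔ c ∈ K' ++ l := fun c => by simp [hm]
  have hchi := chi_congr hmem
  have hK : K.toFinset = K'.toFinset := by ext; simp [hm]
  have hch : chords l K = chords l K' := by rw [chords, chords, hchi, hK]
  have hl : ∀ e, lval l K e t = lval l K' e t := fun e => by
    rw [lval, lval, hv]
    exact if_congr (by rw [hch]) rfl rfl
  have hu : ubar (K ++ l) (forget l K t) = ubar (K' ++ l) (forget l K' t) := by
    funext d
    simp only [ubar_forget_apply h ht, ubar_forget_apply h' ht, hmem, hchi, hv]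
  simp only [dterm, hl, coef, hu, hv, hK]

omit h in
lemma dterm_zero (P : MvPolynomial (Chord n) ℝ) (s : Chord n → ℂ) (i : Fin 0 → Chord n) (t : Space l) :
    dterm P l K s i t = term P l K s t := by
  simp only [dterm, term, expo, lval, Finset.univ_eq_empty, Finset.prod_empty, mul_one]
  congr 2
  rw [← Finset.sum_subset (Finset.subset_univ (chords l K)) fun e _ he => by rw [if_neg he]; simp]
  exact Finset.sum_congr rfl fun e he => by rw [if_pos he]

lemma lval_bounds {t : Space l} (ht : t ∈ X l) (e : Chord n) :
    Real.log (uprod l t) ≤ lval l K e t ∧ lval l K e t ≤ 0 := by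
  have hU := uprod_pos h.tail ht
  have hU0 := Real.log_nonpos hU.le (uprod_le_one h.tail ht)
  rw [lval]
  split_ifs
  · have h1 := val_mem ht h.tail K e
    exact ⟨Real.log_le_log hU (uprod_le_val h ht e), Real.log_nonpos h1.1.le h1.2⟩
  · exact ⟨hU0, le_rfl⟩

end

/-- Near x = 1 the logarithm is small to first order, near x = 0 it is only logarithmically large;
both are captured in one inequality. -/
lemma neg_log_le {x : ℝ} (h0 : 0 < x) : -Real.log x ≤ (1 - x) * (1 - Real.log x) := by
  have h1 := Real.one_sub_inv_le_log_of_pos h0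
  have h2 : x * (1 - x⁻¹) ≤ x * Real.log x := mul_le_mul_of_nonneg_left h1 h0.le
  rw [mul_sub, mul_inv_cancel₀ h0.ne', mul_one] at h2
  nlinarith

lemma one_sub_prod_le {ι : Type*} (S : Finset ι) (a : ι → ℝ) {η : ℝ}
    (h : ∀ i ∈ S, 0 ≤ a i ∧ a i ≤ 1 ∧ 1 - a i ≤ η) : 1 - ∏ i ∈ S, a i ≤ S.card * η := by
  classical
  induction S using Finset.induction_on with
  | empty => simp
  | insert i S hi ih =>
    have h1 := ih fun j hj => h j (Finset.mem_insert_of_mem hj)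
    have h2 := h i (Finset.mem_insert_self _ _)
    have h3 : ∏ j ∈ S, a j ≤ 1 := Finset.prod_le_one
      (fun j hj => (h j (Finset.mem_insert_of_mem hj)).1)
      fun j hj => (h j (Finset.mem_insert_of_mem hj)).2.1
    have h4 : 0 ≤ ∏ j ∈ S, a j := Finset.prod_nonneg
      fun j hj => (h j (Finset.mem_insert_of_mem hj)).1
    rw [Finset.prod_insert hi, Finset.card_insert_of_notMem hi]
    push_cast
    nlinarith

/-- The number of chords, plus one. -/
def numChords (n : ℕ) : ℕ := Fintype.card (Chord n) + 1

lemma card_le_numChords (S : Finset (Chord n)) : (S.card : ℝ) ≤ numChords n := by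
  exact_mod_cast (Finset.card_le_univ S).trans (Nat.le_succ _)

lemma one_le_numChords : (1 : ℝ) ≤ numChords n := by
  simp [numChords]

/-- `contractsTo_cut` inside the polygon cut out by `m ++ l`, for chords of the larger cell of `l`.
-/
lemma contr_cut {l m : List (Chord n)} {c e : Chord n} (h : Good (c :: (m ++ l)))
    (he : e ∈ chi (c :: (m ++ l))) :
    contr l (cellOf (m ++ l) (ends e)) e ⊆ contr l (cellOf (c :: (m ++ l)) (ends e)) e ∧
    ∀ d ∈ contr l (cellOf (c :: (m ++ l)) (ends e)) e \ contr l (cellOf (m ++ l) (ends e)) e,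
      Crosses c d := by
  have he' := (mem_chi_cons.1 he).1
  have hsub : cellOf (c :: (m ++ l)) (ends e) ⊆ cellOf (m ++ l) (ends e) := by
    have h1 := (cellOf_cell (K := [c]) (l := m ++ l) h (cellOf_ends_mem h he)).2
    exact h1.trans (cellOf_cellOf_ends (K := [c]) (l := m ++ l) h he).le
  have hsub' : cellOf (m ++ l) (ends e) ⊆ cellOf l (ends e) := by
    have h1 := (cellOf_cell h.2 (cellOf_ends_mem h.2 he')).2
    rwa [cellOf_cellOf_ends h.2 he'] at h1
  have hends : ends e ⊆ cellOf (c :: (m ++ l)) (ends e) :=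
    ends_subset.2 ⟨(proper_cellOf h he).1, (proper_cellOf h he).2⟩
  constructor
  · intro d hd
    rw [contr, Finset.mem_filter] at hd ⊢
    exact ⟨hd.1, hsub.trans hd.2.1, (contractsTo_cut h.2 h.1 he d).1 hd.2.2⟩
  · intro d hd
    rw [Finset.mem_sdiff, contr, contr, Finset.mem_filter, Finset.mem_filter] at hd
    obtain ⟨⟨h1, h2, h3⟩, h4⟩ := hd
    refine (contractsTo_cut h.2 h.1 he d).2 h3 fun h5 => h4 ⟨h1, ?_, h5⟩
    rw [eq_cellOf_ends h.2.tail (mem_chi_append he').1 (cellOf_ends_mem h.2.tail h1) (hends.trans h2)]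
    exact hsub'

section
variable {l K : List (Chord n)} {c : Chord n} (h : Good (c :: (K ++ l))) {t : Space l} (ht : t ∈ X l)
include h ht

/-- Adding `c` to `K` multiplies the pull-back of u_e by coordinates of chords which cross `c`;
these are all at least 1 - u_c. -/
lemma exists_val_cons {e : Chord n} (he : e ∈ chords l K) (hec : e ≠ c) (hcr : ¬ Crosses c e) :
    ∃ r : ℝ, uprod l t ≤ r ∧ r ≤ 1 ∧ 1 - r ≤ numChords n * u l c t ∧
      val l (c :: K) e t = val l K e t * r := by
  have hl := h.2.tail
  have herase : (c :: K).erase e = c :: K.erase e :=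
    List.erase_cons_tail (by rw [beq_iff_eq]; exact hec.symm)
  have hgood : Good (c :: (K.erase e ++ l)) := by
    have := Good.erase (K := c :: K) h e
    rwa [herase] at this
  have hc : c ∈ chi l := (mem_chi_append h.1).1
  have hee : e ∈ chi (c :: (K.erase e ++ l)) := by
    obtain ⟨h1, h2⟩ := chords_mem h.2 he
    rw [mem_chi] at h1 ⊢
    refine ⟨?_, ?_⟩
    · simp only [List.mem_cons, List.mem_append, h.2.nodup.mem_erase_iff]
      have := h1.1
      tauto
    · simp only [List.mem_cons, List.mem_append, h.2.nodup.mem_erase_iff]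
      rintro d (rfl | hd | hd)
      · exact hcr
      · exact h2 d hd.2
      · exact h1.2 d hd
  obtain ⟨h1, h2⟩ := contr_cut hgood hee
  rw [val, val, herase, List.cons_append,
    ← Finset.prod_sdiff h1]
  have hsub : contr l (cellOf (c :: (K.erase e ++ l)) (ends e)) e \
      contr l (cellOf (K.erase e ++ l) (ends e)) e ⊆ chi l :=
    Finset.sdiff_subset.trans (contr_subset _ _)
  refine ⟨_, uprod_le_prod hl ht hsub, (prod_u_mem hl ht hsub).2, ?_, mul_comm _ _⟩
  refine (one_sub_prod_le _ _ (η := u l c t) fun d hd => ?_).trans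
    (mul_le_mul_of_nonneg_right (card_le_numChords _) (u_mem hl ht hc).1.le)
  have := u_mem hl ht (hsub hd)
  exact ⟨this.1.le, this.2.le, one_sub_u_le hl ht hc (hsub hd) (h2 d hd)⟩

omit ht in
lemma val_cons_self : val l (c :: K) c t = val l K c t := by
  rw [val, val, List.erase_cons_head, List.erase_of_not_mem fun h' => (mem_chi.1 h.1).1 (by simp [h'])]

lemma val_self_le : val l K c t ≤ u l c t := by
  have hl := h.2.tail
  have hm := cellOf_ends_mem h.2 h.1
  have h2 := cellOf_cell h.2 hm
  rw [val, List.erase_of_not_mem fun h' => (mem_chi.1 h.1).1 (by simp [h'])]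
  exact prod_u_le hl ht (contr_subset _ _)
    (self_mem_contr hl (proper_cellOf h.2 h.1) h2.1 h2.2)

lemma abs_val_cons_sub {e : Chord n} (he : e ∈ K) :
    |val l K e t - val l (c :: K) e t| ≤ numChords n * u l c t := by
  have hl := h.2.tail
  have hec : e ≠ c := fun h' => (mem_chi.1 h.1).1 (by simp [← h', he])
  have hcr : ¬ Crosses c e := fun h' => (mem_chi.1 h.1).2 e (by simp [he]) (crosses_comm.1 h')
  obtain ⟨r, -, h2, h3, h4⟩ := exists_val_cons h ht
    (Finset.mem_union_left _ (List.mem_toFinset.2 he)) hec hcr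
  have hv := val_mem ht hl K e
  rw [h4, abs_of_nonneg (by nlinarith)]
  nlinarith

/-- The two logarithms differ by log r for some r with 1 - r = O(u_c), or not at all. -/
lemma abs_lval_cons_sub (e : Chord n) : |lval l K e t - lval l (c :: K) e t| ≤
    numChords n * u l c t * (1 - Real.log (uprod l t)) := by
  have hl := h.2.tail
  have hc : c ∈ chi l := (mem_chi_append h.1).1
  have hu := u_mem hl ht hc
  have hU := uprod_pos hl ht
  have hL := Real.log_nonpos hU.le (uprod_le_one hl ht)
  have hN := one_le_numChords (n := n)
  have h0 : 0 ≤ numChords n * u l c t * (1 - Real.log (uprod l t)) := by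
    have := hu.1
    have : 0 ≤ 1 - Real.log (uprod l t) := by linarith
    positivity
  have key : ∀ r, uprod l t ≤ r → r ≤ 1 → 1 - r ≤ numChords n * u l c t →
      |Real.log r| ≤ numChords n * u l c t * (1 - Real.log (uprod l t)) := by
    intro r h1 h2 h3
    have hr := hU.trans_le h1
    rw [abs_of_nonpos (Real.log_nonpos hr.le h2)]
    refine (neg_log_le hr).trans (mul_le_mul h3 (by linarith [Real.log_le_log hU h1])
      (by linarith [Real.log_nonpos hr.le h2]) ?_)
    have := hu.1
    positivity
  have hmem : e ∈ chords l (c :: K) ↔ e ∈ chords l K ∧ (e = c ∨ ¬ Crosses c e) := by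
    have hcc : ¬ Crosses c c := by
      rintro (h | h) <;> exact lt_irrefl _ h.1
    have := h.1
    simp only [chords, Finset.mem_union, List.mem_toFinset, List.mem_cons, List.cons_append,
      mem_chi_cons]
    constructor
    · rintro ((rfl | he) | he)
      · exact ⟨Or.inr h.1, Or.inl rfl⟩
      · exact ⟨Or.inl he, Or.inr fun h' => (mem_chi.1 h.1).2 e (by simp [he]) (crosses_comm.1 h')⟩
      · exact ⟨Or.inr he.1, Or.inr he.2.2⟩
    · rintro ⟨he | he, rfl | hcr⟩
      · exact Or.inl (Or.inl rfl)
      · exact Or.inl (Or.inr he)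
      · exact Or.inl (Or.inl rfl)
      · by_cases hec : e = c
        · exact Or.inl (Or.inl hec)
        · exact Or.inr ⟨he, hec, hcr⟩
  rw [lval, lval]
  by_cases he : e ∈ chords l K
  · by_cases hec : e = c
    · subst hec
      rw [if_pos he, if_pos (hmem.2 ⟨he, Or.inl rfl⟩), val_cons_self h, sub_self, abs_zero]
      exact h0
    by_cases hcr : Crosses c e
    -- The symbol of `e` is set to 1 by R_c, so the second logarithm is 0. The first is small
    -- because 1 - u_e is bounded by u_c on the stratum of `K` as well.
    · rw [if_pos he, if_neg fun h' => (hmem.1 h').2.elim hec fun h'' => h'' hcr, sub_zero]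
      have he' : e ∈ chi (K ++ l) := by
        rcases Finset.mem_union.1 he with h' | h'
        · exact absurd (crosses_comm.1 hcr) ((mem_chi.1 h.1).2 e (by simp [List.mem_toFinset.1 h']))
        · exact h'
      have h3 := one_sub_u_le h.2 (forget_mem_X h.2 ht) h.1 he' hcr
      rw [u_forget_eq_val h.2 ht he', u_forget_eq_val h.2 ht h.1] at h3
      have h4 := val_self_le h ht
      exact key _ (uprod_le_val h.2 ht e) (val_mem ht hl K e).2
        (h3.trans (h4.trans (le_mul_of_one_le_left hu.1.le hN)))
    · obtain ⟨r, h1, h2, h3, h4⟩ := exists_val_cons h ht he hec hcr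
      rw [if_pos he, if_pos (hmem.2 ⟨he, Or.inr hcr⟩), h4,
        Real.log_mul (val_mem ht hl K e).1.ne' (hU.trans_le h1).ne', sub_add_cancel_left, abs_neg]
      exact key r h1 h2 h3
  · rw [if_neg he, if_neg fun h' => he (hmem.1 h').1, sub_self, abs_zero]
    exact h0

end

/-- If `c` crosses an element of `K`, it divides `1 - x_d` for some `d` in `K`. -/
lemma exists_mem_cocontr {l K : List (Chord n)} (h : Good (K ++ l)) {c : Chord n} (hc : c ∈ chi l)
    (hK : ∃ d ∈ K, Crosses c d) :
    ∃ d ∈ K, c ∈ cocontr l (cellOf (K.erase d ++ l) (ends d)) d := by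
  obtain ⟨d₀, hd₀, hcr₀⟩ := hK
  -- If `c` is not on the required arcs of `d`, an edge of the polygon around `d` is a chord of `K`
  -- which crosses `c`, shares one end with `d` and has its other end further on in the cyclic
  -- order. The term n + 3 is one full turn, added when an end precedes the first end of `c`; with
  -- it such a move increases the weight, so a maximal `d` has no obstruction.
  obtain ⟨d, hd, hmax⟩ := Finset.exists_max_image (K.toFinset.filter fun d => Crosses c d)
    (fun d => d.1.1.val + d.1.2.val + if d.1.1 < c.1.1 then n + 3 else 0)
    ⟨d₀, by simp [hd₀, hcr₀]⟩
  rw [Finset.mem_filter, List.mem_toFinset] at hd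
  obtain ⟨hdK, hcr⟩ := hd
  refine ⟨d, hdK, ?_⟩
  have hg := good_erase h hdK
  have hl := h.tail
  have hp := proper_cellOf hg.2 hg.1
  set Q := cellOf (K.erase d ++ l) (ends d) with hQ
  have hQm : Q ∈ cells (K.erase d ++ l) := cellOf_ends_mem hg.2 hg.1
  have hcell : Q ⊆ cellOf l (ends c) := by
    have h1 := (cellOf_cell hg.2 hQm).2
    rw [cellOf_cellOf_ends hg.2 hg.1] at h1
    rwa [mem_cellOf_of_crosses hl hc (h.mem_chi_of_mem hdK).1 hcr]
  have hno : ∀ a b : Vert n, (∃ d' ∈ K.erase d ++ l, d'.1 = (a, b)) →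
      ((c.1.1 < a ∧ a < c.1.2 ∧ c.1.2 < b) ∨ (a < c.1.1 ∧ c.1.1 < b ∧ b < c.1.2)) →
      a.val + b.val + (if a < c.1.1 then n + 3 else 0) ≤
        d.1.1.val + d.1.2.val + if d.1.1 < c.1.1 then n + 3 else 0 := by
    rintro a b ⟨d', hd', hab⟩ hcr'
    have hcr'' : Crosses c d' := by rw [Crosses, hab]; exact hcr'
    have hd'K : d' ∈ K := by
      rcases List.mem_append.1 hd' with h' | h'
      · exact List.mem_of_mem_erase h'
      · exact absurd (crosses_comm.1 hcr'') ((mem_chi.1 hc).2 d' h')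
    have := hmax d' (by simp [hd'K, hcr''])
    rwa [hab] at this
  obtain ⟨hedge, hedge'⟩ := edge_of_cell hg.2 hQm
  obtain ⟨a1, a2, a3, a4⟩ := hp.pred_snd
  obtain ⟨b1, b2⟩ := hp.pred_fst
  have e1 := hedge d.1.2 hp.2 (ne_of_gt ((lo_le hp.1).trans_lt (chord_lt d)))
  have f1 : (∃ d' ∈ K.erase d ++ l, d'.1 = (pred Q d.1.2, d.1.2)) → _ := hno _ _
  have f2 : (∃ d' ∈ K.erase d ++ l, d'.1 = (pred Q d.1.1, d.1.1)) → _ := hno _ _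
  have f3 : (∃ d' ∈ K.erase d ++ l, d'.1 = (lo Q, hi Q)) → _ := hno _ _
  have hlt := chord_lt c
  have hlt' := chord_lt d
  have hn1 := d.1.2.isLt
  have hn2 := c.1.2.isLt
  rw [cocontr, Finset.mem_filter]
  refine ⟨hc, hcell, ?_⟩
  unfold InRect Arc
  rcases b2 with ⟨b2, b3⟩ | ⟨b2, b3, b4⟩
  · have e2 := hedge d.1.1 hp.1 (fun h' => by
      have := lo_le b1
      rw [← h'] at this
      exact absurd b2 (not_lt.2 this))
    clear_value Q
    clear hedge hedge' f3 hmax hcell hno a4 b3 hQm hcr₀ hd₀ hp hg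
    generalize pred Q d.1.2 = p at *
    generalize pred Q d.1.1 = q at *
    simp only [Fin.lt_def, Fin.le_def, Crosses] at *
    rcases e1 with e1 | e1 <;> rcases e2 with e2 | e2 <;>
      (try replace f1 := f1 e1) <;> (try replace f2 := f2 e2) <;> split_ifs at * <;> omega
  · rw [← b2] at f3 hedge'
    clear_value Q
    clear hedge hmax hcell hno f2 a4 hQm hcr₀ hd₀ hp hg
    rw [b3]
    generalize pred Q d.1.2 = p at *
    generalize hi Q = q at *
    simp only [Fin.lt_def, Fin.le_def, Crosses] at *
    rcases e1 with e1 | e1 <;> rcases hedge' with e2 | e2 <;>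
      (try replace f1 := f1 e1) <;> (try replace f3 := f3 e2) <;> split_ifs at * <;> omega

/-- Two complex numbers of norm at most `B`, at distance at most `B * D`. -/
structure Near (B D : ℝ) (x y : ℂ) : Prop where
  left : ‖x‖ ≤ B
  right : ‖y‖ ≤ B
  sub : ‖x - y‖ ≤ B * D

lemma Near.mul {B D B' D' : ℝ} {x y x' y' : ℂ} (h : Near B D x y) (h' : Near B' D' x' y') :
    Near (B * B') (D + D') (x * x') (y * y') := by
  have hB := (norm_nonneg _).trans h.left
  refine ⟨?_, ?_, ?_⟩
  · rw [norm_mul]; exact mul_le_mul h.left h'.left (norm_nonneg _) hB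
  · rw [norm_mul]; exact mul_le_mul h.right h'.right (norm_nonneg _) hB
  · calc ‖x * x' - y * y'‖ = ‖(x - y) * x' + y * (x' - y')‖ := by congr 1; ring
      _ ≤ ‖x - y‖ * ‖x'‖ + ‖y‖ * ‖x' - y'‖ := by
        rw [← norm_mul, ← norm_mul]; exact norm_add_le _ _
      _ ≤ B * D * B' + B * (B' * D') := add_le_add
        (mul_le_mul h.sub h'.left (norm_nonneg _) ((norm_nonneg _).trans h.sub))
        (mul_le_mul h.right h'.sub (norm_nonneg _) hB)
      _ = _ := by ring

lemma Near.prod {ι : Type*} {S : Finset ι} {B D : ℝ} {x y : ι → ℂ}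
    (h : ∀ i ∈ S, Near B D (x i) (y i)) :
    Near (B ^ S.card) (S.card * D) (∏ i ∈ S, x i) (∏ i ∈ S, y i) := by
  classical
  induction S using Finset.induction_on with
  | empty => exact ⟨by simp, by simp, by simp⟩
  | insert i S hi ih =>
    rw [Finset.prod_insert hi, Finset.prod_insert hi, Finset.card_insert_of_notMem hi, pow_succ']
    have := (h i (Finset.mem_insert_self _ _)).mul
      (ih fun j hj => h j (Finset.mem_insert_of_mem hj))
    convert this using 1
    push_cast
    ring

lemma Near.mono {B D D' : ℝ} {x y : ℂ} (h : Near B D x y) (hD : D ≤ D') : Near B D' x y :=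
  ⟨h.left, h.right, h.sub.trans (mul_le_mul_of_nonneg_left hD ((norm_nonneg _).trans h.left))⟩

/-- The mean value inequality on a half-plane, where exp is bounded. -/
lemma near_exp {B D : ℝ} {z w : ℂ} (hz : z.re ≤ B) (hw : w.re ≤ B) (h : ‖z - w‖ ≤ D) :
    Near (Real.exp B) D (Complex.exp z) (Complex.exp w) := by
  refine ⟨?_, ?_, ?_⟩
  · rw [Complex.norm_exp]; exact Real.exp_le_exp.2 hz
  · rw [Complex.norm_exp]; exact Real.exp_le_exp.2 hw
  · refine ((convex_halfSpace_re_le B).norm_image_sub_le_of_norm_hasDerivWithin_le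
      (f' := Complex.exp) (fun x _ => (Complex.hasDerivAt_exp x).hasDerivWithinAt)
      (fun x hx => ?_) hw hz).trans (mul_le_mul_of_nonneg_left h (Real.exp_pos B).le)
    rw [Complex.norm_exp]
    exact Real.exp_le_exp.2 hx

lemma distance_le {S N x y k : ℝ} (hS : 0 ≤ S) (hN : 1 ≤ N) (hx : 0 ≤ x) (hy : 1 ≤ y) (hk : 0 ≤ k) :
    S * (N * x * y) + k * (N * x) + (x + (x + N * (N * x)) + 0) ≤
      (S * N + N + (1 + (1 + N * N))) * ((k + 1) * y) * x := by
  have a1 : y ≤ (k + 1) * y := by nlinarith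
  have a2 : k ≤ (k + 1) * y := by nlinarith
  have a3 : 1 ≤ (k + 1) * y := by nlinarith
  have b1 : S * N * y ≤ S * N * ((k + 1) * y) := by gcongr
  have b2 : N * k ≤ N * ((k + 1) * y) := by gcongr
  have b3 : (1 + (1 + N * N)) * 1 ≤ (1 + (1 + N * N)) * ((k + 1) * y) := by gcongr
  calc _ = (S * N * y + N * k + (1 + (1 + N * N)) * 1) * x := by ring
    _ ≤ (S * N * ((k + 1) * y) + N * ((k + 1) * y) + (1 + (1 + N * N)) * ((k + 1) * y)) * x := by
      gcongr
    _ = _ := by ring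

/-- The growth of the `k`-th derivatives of the terms. -/
def growth (ε : ℝ) (l : List (Chord n)) (k : ℕ) (t : Space l) : ℝ :=
  (k + 1) * (1 - Real.log (uprod l t)) ^ (k + 1) * uprod l t ^ (-(ε * numChords n))

section
variable {l K : List (Chord n)} {s : Chord n → ℂ} {ε : ℝ} (hε : 0 ≤ ε) (hs : ∀ e, -ε ≤ (s e).re)
include hε hs

/-- Each logarithm lies between log ∏ u_d and 0, so exponents slightly below zero cost at most the
power -ε N of ∏ u_d, with N = `numChords n`. -/
lemma re_sum_lval_le (h : Good (K ++ l)) {t : Space l} (ht : t ∈ X l) :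
    (∑ e, s e * (lval l K e t : ℂ)).re ≤ Real.log (uprod l t) * -(ε * numChords n) := by
  have hL := Real.log_nonpos (uprod_pos h.tail ht).le (uprod_le_one h.tail ht)
  rw [Complex.re_sum]
  calc ∑ e, (s e * (lval l K e t : ℂ)).re ≤ ∑ _e : Chord n, ε * -Real.log (uprod l t) := by
        refine Finset.sum_le_sum fun e _ => ?_
        have h1 := lval_bounds h ht e
        have h2 := hs e
        rw [Complex.re_mul_ofReal]
        nlinarith
    _ = (Finset.univ : Finset (Chord n)).card * (ε * -Real.log (uprod l t)) := by
        rw [Finset.sum_const, nsmul_eq_mul]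
    _ ≤ numChords n * (ε * -Real.log (uprod l t)) :=
        mul_le_mul_of_nonneg_right (card_le_numChords _) (mul_nonneg hε (by linarith))
    _ = _ := by ring

omit hε hs in
lemma norm_lval_le (h : Good (K ++ l)) {t : Space l} (ht : t ∈ X l) (e : Chord n) :
    ‖(lval l K e t : ℂ)‖ ≤ 1 - Real.log (uprod l t) := by
  have h1 := lval_bounds h ht e
  rw [Complex.norm_real, Real.norm_eq_abs, abs_of_nonpos h1.2]
  linarith

lemma norm_dterm_le (h : Good (K ++ l)) {t : Space l} (ht : t ∈ X l) (P : MvPolynomial (Chord n) ℝ)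
    {k : ℕ} (i : Fin k → Chord n) : ‖dterm P l K s i t‖ ≤
      uprod l t ^ (-(ε * numChords n)) * (1 - Real.log (uprod l t)) ^ k * |coef P l K t| := by
  have hU := uprod_pos h.tail ht
  have hL := Real.log_nonpos hU.le (uprod_le_one h.tail ht)
  rw [dterm, norm_mul, norm_mul, Complex.norm_exp, norm_prod, Complex.norm_real, Real.norm_eq_abs,
    Real.rpow_def_of_pos hU]
  have h1 : ∏ j, ‖(lval l K (i j) t : ℂ)‖ ≤ (1 - Real.log (uprod l t)) ^ k := by
    refine (Finset.prod_le_prod (fun _ _ => norm_nonneg _)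
      fun j _ => norm_lval_le h ht (i j)).trans ?_
    rw [Finset.prod_const, Finset.card_univ, Fintype.card_fin]
  have h2 := Real.exp_le_exp.2 (re_sum_lval_le hε hs h ht)
  gcongr

omit hε hs in
lemma one_sub_val_mem (h : Good (K ++ l)) {t : Space l} (ht : t ∈ X l) (e : Chord n) :
    0 ≤ 1 - val l K e t ∧ 1 - val l K e t ≤ 1 := by
  have := val_mem ht h.tail K e
  constructor <;> linarith

omit hε hs in
lemma exists_coef_le (h : Good (K ++ l)) (P : MvPolynomial (Chord n) ℝ) :
    ∃ C : ℝ, 0 ≤ C ∧ ∀ t ∈ X l, |coef P l K t| ≤ C * dens l t ∧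
      ∀ d ∈ K, |coef P l K t| ≤ C * (1 - val l K d t) * dens l t := by
  obtain ⟨C, hC, hP⟩ := exists_bound_eval P
  refine ⟨C, hC, fun t ht => ?_⟩
  have hd := dens_pos h.tail ht
  have h1 := one_sub_val_mem h ht
  have h2 := hP _ (fun d => ubar_mem h (forget_mem_X h ht) d)
  have h3 : ∀ S : Finset (Chord n), 0 ≤ ∏ c ∈ S, (1 - val l K c t) ∧
      ∏ c ∈ S, (1 - val l K c t) ≤ 1 := fun S =>
    ⟨Finset.prod_nonneg fun c _ => (h1 c).1, Finset.prod_le_one (fun c _ => (h1 c).1) fun c _ => (h1 c).2⟩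
  rw [coef, abs_mul, abs_mul, abs_of_pos hd, abs_of_nonneg (h3 _).1]
  constructor
  · exact mul_le_mul_of_nonneg_right (by nlinarith [h3 K.toFinset, abs_nonneg (eval
      (ubar (K ++ l) (forget l K t)) P)]) hd.le
  · intro d hdK
    have h4 : ∏ c ∈ K.toFinset, (1 - val l K c t) ≤ 1 - val l K d t := by
      rw [← Finset.mul_prod_erase _ _ (List.mem_toFinset.2 hdK)]
      exact mul_le_of_le_one_right (h1 d).1 (h3 _).2
    exact mul_le_mul_of_nonneg_right (mul_le_mul h2 h4 (h3 _).1 hC) hd.le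

/-- By `exists_mem_cocontr` some factor 1 - x_d of the coefficient is a multiple of u_c. Such terms
are small near D_c on their own. -/
lemma exists_dterm_crossing_le (h : Good (K ++ l)) (P : MvPolynomial (Chord n) ℝ) {c : Chord n}
    (hc : c ∈ chi l) (hK : ∃ d ∈ K, Crosses c d) : ∃ C : ℝ, 0 ≤ C ∧
    ∀ (k : ℕ) (i : Fin k → Chord n), ∀ t ∈ X l,
      ‖dterm P l K s i t‖ ≤ C * (growth ε l k t * u l c t * dens l t) := by
  obtain ⟨C, hC, hP⟩ := exists_coef_le h P
  obtain ⟨d, hd, hcd⟩ := exists_mem_cocontr h hc hK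
  refine ⟨C, hC, fun k i t ht => (norm_dterm_le hε hs h ht P i).trans ?_⟩
  have hl := h.tail
  have hU := uprod_pos hl ht
  have hL := Real.log_nonpos hU.le (uprod_le_one hl ht)
  have hD := dens_pos hl ht
  have hu := u_mem hl ht hc
  have h1 : 1 - val l K d t ≤ u l c t := by
    have h1 := normalCoord_eq h ht hd
    rw [← h1.1, h1.2]
    exact prod_u_le hl ht (cocontr_subset _ _) hcd
  have h2 := ((hP t ht).2 d hd).trans (mul_le_mul_of_nonneg_right (mul_le_mul_of_nonneg_left h1 hC) hD.le)
  have h3 : (1 - Real.log (uprod l t)) ^ k ≤ (k + 1) * (1 - Real.log (uprod l t)) ^ (k + 1) := by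
    have h4 : (1 - Real.log (uprod l t)) ^ k ≤ (1 - Real.log (uprod l t)) ^ (k + 1) :=
      pow_le_pow_right₀ (by linarith) (Nat.le_succ k)
    have h5 : 0 ≤ (1 - Real.log (uprod l t)) ^ (k + 1) := pow_nonneg (by linarith) _
    nlinarith [Nat.cast_nonneg (α := ℝ) k]
  have h0 : 0 ≤ (1 - Real.log (uprod l t)) ^ k := pow_nonneg (by linarith) _
  have h5 : 0 ≤ (k + 1) * (1 - Real.log (uprod l t)) ^ (k + 1) := h0.trans h3
  have hV : 0 < uprod l t ^ (-(ε * numChords n)) := Real.rpow_pos_of_pos hU _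
  calc _ ≤ uprod l t ^ (-(ε * numChords n)) * ((k + 1) * (1 - Real.log (uprod l t)) ^ (k + 1)) *
        (C * u l c t * dens l t) := by gcongr
    _ = _ := by rw [growth]; ring

/-- Both terms are products of corresponding factors: exponential, logarithms, numerator, the new
factor 1 - x_c against 1, the old factors 1 - x_d, density. Each pair is close up to O(u_c) and a
logarithm, and `Near.mul` adds the relative errors. The constant does not depend on the order k of
the derivative; that dependence is in `growth`. -/
lemma exists_dterm_sub_le {c : Chord n} (h : Good (c :: (K ++ l))) (P : MvPolynomial (Chord n) ℝ) :
    ∃ C : ℝ, 0 ≤ C ∧ ∀ (k : ℕ) (i : Fin k → Chord n), ∀ t ∈ X l,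
      ‖dterm P l K s i t - dterm P l (c :: K) s i t‖ ≤ C * (growth ε l k t * u l c t * dens l t) := by
  obtain ⟨C₁, hC₁, hP₁⟩ := exists_bound_eval P
  obtain ⟨C₂, hC₂, hP₂⟩ := abs_eval_forget_sub h.2 h.1 P
  set N : ℝ := (numChords n : ℝ) with hN
  set S : ℝ := ∑ e, ‖s e‖ with hS
  have hS0 : 0 ≤ S := Finset.sum_nonneg fun e _ => norm_nonneg _
  have hN1 : 1 ≤ N := one_le_numChords
  refine ⟨(C₁ + C₂) * (S * N + N + (1 + (1 + N * N))), by positivity, fun k i t ht => ?_⟩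
  have h' : Good ((c :: K) ++ l) := h
  have hl := h.2.tail
  have hc : c ∈ chi l := (mem_chi_append h.1).1
  have hU := uprod_pos hl ht
  have hL := Real.log_nonpos hU.le (uprod_le_one hl ht)
  have hD := dens_pos hl ht
  have hu := u_mem hl ht hc
  have hy := forget_mem_X h.2 ht
  set Λ := 1 - Real.log (uprod l t) with hΛ
  have hΛ1 : 1 ≤ Λ := by linarith
  have n1 : Near (uprod l t ^ (-(ε * N))) (S * (N * u l c t * Λ))
      (Complex.exp (∑ e, s e * (lval l K e t : ℂ)))
      (Complex.exp (∑ e, s e * (lval l (c :: K) e t : ℂ))) := by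
    rw [Real.rpow_def_of_pos hU]
    refine near_exp (re_sum_lval_le hε hs h.2 ht) (re_sum_lval_le hε hs h' ht) ?_
    rw [← Finset.sum_sub_distrib, hS, Finset.sum_mul]
    refine (norm_sum_le _ _).trans (Finset.sum_le_sum fun e _ => ?_)
    rw [← mul_sub, norm_mul, ← Complex.ofReal_sub, Complex.norm_real, Real.norm_eq_abs]
    exact mul_le_mul_of_nonneg_left (abs_lval_cons_sub h ht e) (norm_nonneg _)
  have n2 : Near (Λ ^ k) (k * (N * u l c t)) (∏ j, (lval l K (i j) t : ℂ))
      (∏ j, (lval l (c :: K) (i j) t : ℂ)) := by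
    have := Near.prod (S := (Finset.univ : Finset (Fin k))) (B := Λ) (D := N * u l c t)
      (x := fun j => (lval l K (i j) t : ℂ)) (y := fun j => (lval l (c :: K) (i j) t : ℂ)) fun j _ =>
      ⟨norm_lval_le h.2 ht _, norm_lval_le h' ht _, by
        rw [← Complex.ofReal_sub, Complex.norm_real, Real.norm_eq_abs, mul_comm Λ]
        exact abs_lval_cons_sub h ht _⟩
    rwa [Finset.card_univ, Fintype.card_fin] at this
  have n3 : Near (C₁ + C₂) (u l c t) (eval (ubar (K ++ l) (forget l K t)) P : ℂ)
      (eval (ubar (c :: (K ++ l)) (forget l (c :: K) t)) P : ℂ) := by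
    have hy' : forget l (c :: K) t ∈ X (c :: (K ++ l)) := forget_mem_X (K := c :: K) h' ht
    refine ⟨?_, ?_, ?_⟩
    · rw [Complex.norm_real]
      exact (hP₁ _ fun d => ubar_mem h.2 hy d).trans (by linarith)
    · rw [Complex.norm_real]
      exact (hP₁ _ fun d => ubar_mem h hy' d).trans (by linarith)
    · rw [← Complex.ofReal_sub, Complex.norm_real, Real.norm_eq_abs, abs_sub_comm,
        forget_cons (l := l) h ht]
      refine (hP₂ _ hy).trans ?_
      rw [u_forget_eq_val h.2 ht h.1]
      exact mul_le_mul (by linarith) (val_self_le h ht) (val_mem ht hl K c).1.le (by linarith)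
  have n4 : Near 1 (u l c t) 1 ((1 - val l (c :: K) c t : ℝ) : ℂ) := by
    have h1 := one_sub_val_mem h' ht c
    refine ⟨by simp, ?_, ?_⟩
    · rw [Complex.norm_real, Real.norm_of_nonneg h1.1]; exact h1.2
    · rw [Complex.ofReal_sub, Complex.ofReal_one, sub_sub_cancel, one_mul, Complex.norm_real,
        Real.norm_of_nonneg (val_mem ht hl _ c).1.le, val_cons_self h]
      exact val_self_le h ht
  have n5 : Near 1 (N * (N * u l c t)) (∏ d ∈ K.toFinset, ((1 - val l K d t : ℝ) : ℂ))
      (∏ d ∈ K.toFinset, ((1 - val l (c :: K) d t : ℝ) : ℂ)) := by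
    have := Near.prod (S := K.toFinset) (B := 1) (D := N * u l c t)
      (x := fun d => ((1 - val l K d t : ℝ) : ℂ)) (y := fun d => ((1 - val l (c :: K) d t : ℝ) : ℂ))
      fun d hd => by
        have h1 := one_sub_val_mem h.2 ht d
        have h2 := one_sub_val_mem h' ht d
        refine ⟨?_, ?_, ?_⟩
        · rw [Complex.norm_real, Real.norm_of_nonneg h1.1]; exact h1.2
        · rw [Complex.norm_real, Real.norm_of_nonneg h2.1]; exact h2.2
        · rw [← Complex.ofReal_sub, sub_sub_sub_cancel_left, Complex.norm_real, Real.norm_eq_abs,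
            abs_sub_comm, one_mul]
          exact abs_val_cons_sub h ht (List.mem_toFinset.1 hd)
    rw [one_pow] at this
    exact this.mono (mul_le_mul_of_nonneg_right (card_le_numChords _)
      (mul_nonneg (by linarith) hu.1.le))
  have n6 : Near (dens l t) 0 ((dens l t : ℝ) : ℂ) ((dens l t : ℝ) : ℂ) := by
    refine ⟨?_, ?_, by simp⟩ <;> rw [Complex.norm_real, Real.norm_of_nonneg hD.le]
  have e1 : dterm P l K s i t = Complex.exp (∑ e, s e * (lval l K e t : ℂ)) *
      (∏ j, (lval l K (i j) t : ℂ)) * (((eval (ubar (K ++ l) (forget l K t)) P : ℂ) *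
        (1 * ∏ d ∈ K.toFinset, ((1 - val l K d t : ℝ) : ℂ))) * ((dens l t : ℝ) : ℂ)) := by
    rw [dterm, coef]
    push_cast
    ring
  have e2 : dterm P l (c :: K) s i t = Complex.exp (∑ e, s e * (lval l (c :: K) e t : ℂ)) *
      (∏ j, (lval l (c :: K) (i j) t : ℂ)) *
      (((eval (ubar (c :: (K ++ l)) (forget l (c :: K) t)) P : ℂ) *
        (((1 - val l (c :: K) c t : ℝ) : ℂ) * ∏ d ∈ K.toFinset, ((1 - val l (c :: K) d t : ℝ) : ℂ))) *
          ((dens l t : ℝ) : ℂ)) := by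
    have hcK : c ∉ K.toFinset := fun h'' => (mem_chi.1 h.1).1 (by simp [List.mem_toFinset.1 h''])
    rw [dterm, coef, List.toFinset_cons, Finset.prod_insert hcK]
    push_cast
    rfl
  rw [e1, e2]
  refine ((n1.mul n2).mul ((n3.mul (n4.mul n5)).mul n6)).sub.trans ?_
  have hV : 0 < uprod l t ^ (-(ε * N)) := Real.rpow_pos_of_pos hU _
  have hB : 0 ≤ uprod l t ^ (-(ε * N)) * Λ ^ k * ((C₁ + C₂) * (1 * 1) * dens l t) :=
    mul_nonneg (mul_nonneg hV.le (pow_nonneg (by linarith) _))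
      (mul_nonneg (mul_nonneg (by linarith) (by norm_num)) hD.le)
  refine (mul_le_mul_of_nonneg_left
    (distance_le hS0 hN1 hu.1.le hΛ1 (Nat.cast_nonneg (α := ℝ) k)) hB).trans (le_of_eq ?_)
  rw [growth, ← hN, ← hΛ]
  ring

end

/-! ### Cancellation in the renormalised integrand -/

/-- The derivative of the renormalised integrand in the directions `i`. -/
def dren (P : MvPolynomial (Chord n) ℝ) (l : List (Chord n)) (s : Chord n → ℂ) {k : ℕ}
    (i : Fin k → Chord n) (t : Space l) : ℂ :=
  ∑ K ∈ (chi l).powerset.filter fun K => NonCrossing K, (-1 : ℂ) ^ K.card * dterm P l K.toList s i t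

lemma sum_pairs {α : Type*} [DecidableEq α] {𝒜 : Finset (Finset α)} (c : α)
    (h1 : ∀ K ∈ 𝒜, insert c K ∈ 𝒜) (h2 : ∀ K ∈ 𝒜, K.erase c ∈ 𝒜) (f : Finset α → ℂ) :
    ∑ K ∈ 𝒜, (-1 : ℂ) ^ K.card * f K =
      ∑ K ∈ 𝒜.filter (c ∉ ·), (-1 : ℂ) ^ K.card * (f K - f (insert c K)) := by
  have h3 : ∑ K ∈ 𝒜.filter (¬ c ∉ ·), (-1 : ℂ) ^ K.card * f K =
      ∑ K ∈ 𝒜.filter (c ∉ ·), -((-1 : ℂ) ^ K.card * f (insert c K)) := by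
    refine Finset.sum_bij' (fun K _ => K.erase c) (fun K _ => insert c K) ?_ ?_ ?_ ?_ ?_ <;>
      intro K hK <;> simp only [Finset.mem_filter, not_not] at hK ⊢
    · exact ⟨h2 K hK.1, Finset.notMem_erase _ _⟩
    · exact ⟨h1 K hK.1, Finset.mem_insert_self _ _⟩
    · exact Finset.insert_erase hK.2
    · exact Finset.erase_insert hK.2
    · rw [Finset.insert_erase hK.2, ← Finset.card_erase_add_one hK.2, pow_succ]
      ring
  rw [← Finset.sum_filter_add_sum_filter_not 𝒜 (c ∉ ·), h3, ← Finset.sum_add_distrib]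
  exact Finset.sum_congr rfl fun K _ => by ring

/-- Near D_c the sets K crossing `c` give small terms, and the others cancel in pairs K, K ∪ {c}.
Since `c` is arbitrary, the same sum is small near every divisor. -/
lemma exists_dren_le_u {l : List (Chord n)} (hl : Good l) {s : Chord n → ℂ} {ε : ℝ} (hε : 0 ≤ ε)
    (hs : ∀ e, -ε ≤ (s e).re) (P : MvPolynomial (Chord n) ℝ) {c : Chord n} (hc : c ∈ chi l) :
    ∃ C : ℝ, 0 ≤ C ∧ ∀ (k : ℕ) (i : Fin k → Chord n), ∀ t ∈ X l,
      ‖dren P l s i t‖ ≤ C * (growth ε l k t * u l c t * dens l t) := by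
  classical
  set 𝒦 := (chi l).powerset.filter fun K => NonCrossing K with h𝒦
  have hmem : ∀ K, K ∈ 𝒦 ↔ K ⊆ chi l ∧ NonCrossing K := fun K => by
    rw [h𝒦, Finset.mem_filter, Finset.mem_powerset]
  have hcc : ¬ Crosses c c := by rintro (h | h) <;> exact lt_irrefl _ h.1
  have hins : ∀ K ∈ 𝒦, (∀ d ∈ K, ¬ Crosses c d) → insert c K ∈ 𝒦 := by
    intro K hK hn
    rw [hmem] at hK ⊢
    refine ⟨Finset.insert_subset hc hK.1, fun a ha b hb => ?_⟩
    rcases Finset.mem_insert.1 ha with h1 | h1 <;> rcases Finset.mem_insert.1 hb with h2 | h2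
    · rw [h1, h2]; exact hcc
    · rw [h1]; exact hn b h2
    · rw [h2]; exact fun h => hn a h1 (crosses_comm.1 h)
    · exact hK.2 a h1 b h2
  have h1 : ∀ K : Finset (Chord n), ∃ C : ℝ, 0 ≤ C ∧ (K ∈ 𝒦 → (∃ d ∈ K, Crosses c d) →
      ∀ (k : ℕ) (i : Fin k → Chord n), ∀ t ∈ X l,
        ‖dterm P l K.toList s i t‖ ≤ C * (growth ε l k t * u l c t * dens l t)) := by
    intro K
    by_cases hK : K ∈ 𝒦 ∧ ∃ d ∈ K, Crosses c d
    · obtain ⟨C, hC, h⟩ := exists_dterm_crossing_le hε hs (good_toList hl hK.1) P hc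
        (by simpa using hK.2)
      exact ⟨C, hC, fun _ _ => h⟩
    · exact ⟨0, le_rfl, fun h1 h2 => absurd ⟨h1, h2⟩ hK⟩
  have h2 : ∀ K : Finset (Chord n), ∃ C : ℝ, 0 ≤ C ∧ (K ∈ 𝒦 → c ∉ K → (∀ d ∈ K, ¬ Crosses c d) →
      ∀ (k : ℕ) (i : Fin k → Chord n), ∀ t ∈ X l,
        ‖dterm P l K.toList s i t - dterm P l (insert c K).toList s i t‖ ≤
          C * (growth ε l k t * u l c t * dens l t)) := by
    intro K
    by_cases hK : K ∈ 𝒦 ∧ c ∉ K ∧ ∀ d ∈ K, ¬ Crosses c d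
    · have hG := good_toList hl hK.1
      have hG' := good_toList hl (hins K hK.1 hK.2.2)
      have hG'' : Good (c :: (K.toList ++ l)) := by
        refine ⟨mem_chi.2 ⟨?_, ?_⟩, hG⟩
        · simp only [List.mem_append, Finset.mem_toList]
          exact not_or.2 ⟨hK.2.1, (mem_chi.1 hc).1⟩
        · intro d hd
          rcases List.mem_append.1 hd with hd | hd
          · exact fun h => hK.2.2 d (Finset.mem_toList.1 hd) (crosses_comm.1 h)
          · exact (mem_chi.1 hc).2 d hd
      obtain ⟨C, hC, h⟩ := exists_dterm_sub_le hε hs hG'' P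
      refine ⟨C, hC, fun _ _ _ k i t ht => ?_⟩
      rw [dterm_congr (K' := c :: K.toList) hG' hG'' (fun d => by simp) P s i ht]
      exact h k i t ht
    · exact ⟨0, le_rfl, fun h1 h2 h3 => absurd ⟨h1, h2, h3⟩ hK⟩
  choose C₁ hC₁ hb₁ using h1
  choose C₂ hC₂ hb₂ using h2
  refine ⟨∑ K ∈ 𝒦, C₁ K + ∑ K ∈ 𝒦, C₂ K,
    add_nonneg (Finset.sum_nonneg fun K _ => hC₁ K) (Finset.sum_nonneg fun K _ => hC₂ K),
    fun k i t ht => ?_⟩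
  set G := growth ε l k t * u l c t * dens l t with hG
  have hG0 : 0 ≤ G := by
    have hU := uprod_pos hl ht
    have hL := Real.log_nonpos hU.le (uprod_le_one hl ht)
    have h3 : 0 ≤ growth ε l k t := mul_nonneg (mul_nonneg (by positivity)
      (pow_nonneg (by linarith) _)) (Real.rpow_nonneg hU.le _)
    exact mul_nonneg (mul_nonneg h3 (u_mem hl ht hc).1.le) (dens_pos hl ht).le
  -- Sets which cross `c` are kept as they are; among the rest insertion and removal of `c` stay
  -- inside the family, and `sum_pairs` applies.
  have e1 : dren P l s i t = ∑ K ∈ 𝒦.filter (fun K => ∃ d ∈ K, Crosses c d),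
        (-1 : ℂ) ^ K.card * dterm P l K.toList s i t +
      ∑ K ∈ (𝒦.filter (fun K => ¬ ∃ d ∈ K, Crosses c d)).filter (fun K => c ∉ K),
        (-1 : ℂ) ^ K.card * (dterm P l K.toList s i t - dterm P l (insert c K).toList s i t) := by
    rw [dren, ← Finset.sum_filter_add_sum_filter_not 𝒦 (fun K => ∃ d ∈ K, Crosses c d)]
    congr 1
    refine sum_pairs c (fun K hK => ?_) (fun K hK => ?_) _
    · simp only [Finset.mem_filter, not_exists, not_and] at hK ⊢
      refine ⟨hins K hK.1 hK.2, fun d hd => ?_⟩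
      rcases Finset.mem_insert.1 hd with h | h
      · rw [h]; exact hcc
      · exact hK.2 d h
    · simp only [Finset.mem_filter, not_exists, not_and, hmem] at hK ⊢
      exact ⟨⟨(Finset.erase_subset _ _).trans hK.1.1, fun a ha b hb =>
        hK.1.2 a (Finset.mem_of_mem_erase ha) b (Finset.mem_of_mem_erase hb)⟩,
        fun d hd => hK.2 d (Finset.mem_of_mem_erase hd)⟩
  have hsgn : ∀ (m : ℕ) (z : ℂ), ‖(-1 : ℂ) ^ m * z‖ = ‖z‖ := fun m z => by
    rw [norm_mul, norm_pow, norm_neg, norm_one, one_pow, one_mul]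
  rw [e1, add_mul]
  refine (norm_add_le _ _).trans (add_le_add ?_ ?_)
  · refine (norm_sum_le _ _).trans ((Finset.sum_le_sum fun K hK => ?_).trans
      ((Finset.sum_le_sum_of_subset_of_nonneg (Finset.filter_subset _ _) fun K _ _ =>
        mul_nonneg (hC₁ K) hG0).trans (Finset.sum_mul _ _ _).ge))
    rw [hsgn]
    exact hb₁ K (Finset.mem_filter.1 hK).1 (Finset.mem_filter.1 hK).2 k i t ht
  · refine (norm_sum_le _ _).trans ((Finset.sum_le_sum fun K hK => ?_).trans
      ((Finset.sum_le_sum_of_subset_of_nonneg ((Finset.filter_subset _ _).trans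
        (Finset.filter_subset _ _)) fun K _ _ =>
        mul_nonneg (hC₂ K) hG0).trans (Finset.sum_mul _ _ _).ge))
    rw [hsgn]
    simp only [Finset.mem_filter, not_exists, not_and] at hK
    exact hb₂ K hK.1.1 hK.2 hK.1.2 k i t ht

/-- With δ = 1/(4N) the powers of U combine to U^{1/N - 1/(2N)} = U^{2δ}. One factor U^δ is spent on
the logarithms through x^m / m! ≤ e^x, which also turns the factorial into geometric growth; the
other remains. -/
lemma growth_le {N U : ℝ} (hN : 1 ≤ N) (hU : 0 < U) (hU1 : U ≤ 1) (k : ℕ) :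
    (k + 1) * (1 - Real.log U) ^ (k + 1) * U ^ (-(1 / (2 * N ^ 2) * N)) * U ^ (1 / N) / k.factorial ≤
      Real.exp (1 / (4 * N)) * (4 * N) * (16 * N) ^ k * U ^ (1 / (4 * N)) := by
  have hN0 : N ≠ 0 := by positivity
  set δ := 1 / (4 * N) with hδ
  have hδ0 : 0 < δ := by positivity
  have hL := Real.log_nonpos hU.le hU1
  set Λ := 1 - Real.log U with hΛ
  have hΛ0 : 0 ≤ Λ := by linarith
  have h1 := Real.pow_div_factorial_le_exp (δ * Λ) (by positivity) (k + 1)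
  have h2 : Real.exp (δ * Λ) = Real.exp δ * U ^ (-δ) := by
    rw [Real.rpow_def_of_pos hU, ← Real.exp_add]
    congr 1
    rw [hΛ]; ring
  -- Used twice: for the factor k + 1 of `growth`, and for the one between k! and (k + 1)!.
  have h3 : ((k : ℝ) + 1) ≤ 2 ^ k := by exact_mod_cast Nat.lt_two_pow_self (n := k)
  have hfac : ((k + 1).factorial : ℝ) = (k + 1) * k.factorial := by
    rw [Nat.factorial_succ]; push_cast; ring
  have hk0 : (0 : ℝ) < k.factorial := by positivity
  have h4 : U ^ (-(1 / (2 * N ^ 2) * N)) * U ^ (1 / N) = U ^ δ * U ^ δ := by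
    rw [← Real.rpow_add hU, ← Real.rpow_add hU]
    congr 1
    rw [hδ]
    field_simp
    norm_num
  have h5 : (k + 1) * Λ ^ (k + 1) / k.factorial ≤ Real.exp δ * (4 * N) * (16 * N) ^ k * U ^ (-δ) := by
    have e1 : (k + 1) * Λ ^ (k + 1) / k.factorial =
        ((k : ℝ) + 1) * (k + 1) * (4 * N) ^ (k + 1) * ((δ * Λ) ^ (k + 1) / (k + 1).factorial) := by
      have : (4 * N) ^ (k + 1) * (δ * Λ) ^ (k + 1) = Λ ^ (k + 1) := by
        rw [← mul_pow, hδ]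
        congr 1
        field_simp
      rw [hfac, ← this]
      field_simp
    rw [e1]
    calc _ ≤ 2 ^ k * 2 ^ k * (4 * N) ^ (k + 1) * (Real.exp δ * U ^ (-δ)) := by
          rw [← h2]
          gcongr
      _ = _ := by
        have : (16 * N) ^ k = 2 ^ k * 2 ^ k * (4 * N) ^ k := by
          rw [← mul_pow, ← mul_pow]
          ring_nf
        rw [this, pow_succ]
        ring
  calc _ = (k + 1) * Λ ^ (k + 1) / k.factorial * (U ^ (-(1 / (2 * N ^ 2) * N)) * U ^ (1 / N)) := by ring
    _ ≤ Real.exp δ * (4 * N) * (16 * N) ^ k * U ^ (-δ) * (U ^ δ * U ^ δ) := by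
      rw [h4]
      gcongr
    _ = Real.exp δ * (4 * N) * (16 * N) ^ k * U ^ δ * (U ^ (-δ) * U ^ δ) := by ring
    _ = _ := by rw [← Real.rpow_add hU, neg_add_cancel, Real.rpow_zero, mul_one]

/-- The width of the strip on which the renormalised integrals converge. -/
def strip (n : ℕ) : ℝ := 1 / (2 * (numChords n : ℝ) ^ 2)

lemma strip_pos : 0 < strip n := by
  have := one_le_numChords (n := n)
  unfold strip
  positivity

/-- The smallest coordinate is at most (∏ u_d)^{1/N}, with N at least the number of chords. Applied
to this chord, `exists_dren_le_u` gains the power 1/N of ∏ u_d, while exponents above -1/(2N²) lose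
at most 1/(2N). -/
theorem exists_dren_le {l : List (Chord n)} (hl : Good l) {s : Chord n → ℂ}
    (hs : ∀ e, -strip n ≤ (s e).re) (P : MvPolynomial (Chord n) ℝ) :
    ∃ C R δ : ℝ, 0 ≤ C ∧ 0 ≤ R ∧ 0 < δ ∧ ∀ (k : ℕ) (i : Fin k → Chord n), ∀ t ∈ X l,
      ‖(k.factorial : ℂ)⁻¹ * dren P l s i t‖ ≤ C * R ^ k * (uprod l t ^ δ * dens l t) := by
  have hN := one_le_numChords (n := n)
  set N : ℝ := (numChords n : ℝ) with hNdef
  have hnorm : ∀ (k : ℕ) (z : ℂ), ‖(k.factorial : ℂ)⁻¹ * z‖ = ‖z‖ / k.factorial := fun k z => by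
    rw [norm_mul, norm_inv, Complex.norm_natCast, inv_mul_eq_div]
  rcases (chi l).eq_empty_or_nonempty with he | hne
  -- Without chords there is no c to gain from, but ∏ u_d = 1 and only the term K = ∅ is present.
  · have hG : Good ([] ++ l) := hl
    obtain ⟨C, hC, h⟩ := exists_coef_le (K := []) hG P
    refine ⟨C, 1, 1, hC, zero_le_one, one_pos, fun k i t ht => ?_⟩
    have hU : uprod l t = 1 := by rw [uprod, he, Finset.prod_empty]
    have h1 := norm_dterm_le strip_pos.le hs hG ht P i
    have h2 := (h t ht).1
    rw [hU, Real.one_rpow, Real.log_one, sub_zero, one_pow, one_mul, one_mul] at h1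
    have h3 : dren P l s i t = dterm P l [] s i t := by
      have : (∅ : Finset (Chord n)).powerset.filter (fun K => NonCrossing K) = {∅} := by
        ext K; simp +contextual [Finset.mem_filter]
      rw [dren, he, this, Finset.sum_singleton]
      simp
    rw [hnorm, h3, hU, Real.one_rpow, one_mul, one_pow, mul_one]
    have : (1 : ℝ) ≤ k.factorial := by exact_mod_cast Nat.factorial_pos k
    exact (div_le_self (norm_nonneg _) this).trans (h1.trans h2)
  · have h1 : ∀ c : Chord n, ∃ C : ℝ, 0 ≤ C ∧ (c ∈ chi l → ∀ (k : ℕ) (i : Fin k → Chord n), ∀ t ∈ X l,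
        ‖dren P l s i t‖ ≤ C * (growth (strip n) l k t * u l c t * dens l t)) := fun c => by
      by_cases hc : c ∈ chi l
      · obtain ⟨C, hC, h⟩ := exists_dren_le_u hl strip_pos.le hs P hc
        exact ⟨C, hC, fun _ => h⟩
      · exact ⟨0, le_rfl, fun h => absurd h hc⟩
    choose C hC hb using h1
    refine ⟨(∑ c, C c) * (Real.exp (1 / (4 * N)) * (4 * N)), 16 * N, 1 / (4 * N),
      mul_nonneg (Finset.sum_nonneg fun c _ => hC c) (by positivity), by positivity, by positivity,
      fun k i t ht => ?_⟩
    have hU := uprod_pos hl ht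
    have hU1 := uprod_le_one hl ht
    have hD := dens_pos hl ht
    have hL := Real.log_nonpos hU.le hU1
    -- The chord depends on the point `t`, so the constants of all chords are added in `C`.
    obtain ⟨c, hc, hmin⟩ := Finset.exists_min_image (chi l) (fun d => u l d t) hne
    have hu := u_mem hl ht hc
    have h2 : u l c t ≤ uprod l t ^ (1 / N) := by
      have h3 : u l c t ^ numChords n ≤ uprod l t := by
        refine (pow_le_pow_of_le_one hu.1.le hu.2.le ((Finset.card_le_univ (chi l)).trans
          (Nat.le_succ _))).trans ?_
        rw [← Finset.prod_const]
        exact Finset.prod_le_prod (fun _ _ => hu.1.le) hmin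
      calc u l c t = (u l c t ^ numChords n) ^ (1 / N) := by
            rw [← Real.rpow_natCast, ← Real.rpow_mul hu.1.le, hNdef, mul_one_div_cancel (by positivity),
              Real.rpow_one]
        _ ≤ _ := Real.rpow_le_rpow (pow_nonneg hu.1.le _) h3 (by positivity)
    have h4 := growth_le hN hU hU1 k
    have hg : 0 ≤ growth (strip n) l k t := mul_nonneg (mul_nonneg (by positivity)
      (pow_nonneg (by linarith) _)) (Real.rpow_nonneg hU.le _)
    have h5 : growth (strip n) l k t * u l c t / k.factorial ≤
        Real.exp (1 / (4 * N)) * (4 * N) * (16 * N) ^ k * uprod l t ^ (1 / (4 * N)) :=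
      (div_le_div_of_nonneg_right (mul_le_mul_of_nonneg_left h2 hg) (by positivity)).trans h4
    have h6 : C c ≤ ∑ c, C c := Finset.single_le_sum (fun c _ => hC c) (Finset.mem_univ c)
    rw [hnorm]
    calc ‖dren P l s i t‖ / k.factorial
        ≤ C c * (growth (strip n) l k t * u l c t * dens l t) / k.factorial :=
          div_le_div_of_nonneg_right (hb c hc k i t ht) (by positivity)
      _ = C c * (growth (strip n) l k t * u l c t / k.factorial) * dens l t := by ring
      _ ≤ (∑ c, C c) * (Real.exp (1 / (4 * N)) * (4 * N) * (16 * N) ^ k * uprod l t ^ (1 / (4 * N))) *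
          dens l t := mul_le_mul_of_nonneg_right (mul_le_mul h6 h5
            (div_nonneg (mul_nonneg hg hu.1.le) (by positivity)) ((hC c).trans h6)) hD.le
      _ = _ := by ring

/-! ### Power series expansion of the renormalised integrals -/

/-- The exponential series with each power of the sum expanded over words in the variables. Words,
instead of multi-indices, avoid multinomial coefficients. -/
lemma hasSum_exp_sum {ι : Type*} [Fintype ι] (h v : ι → ℂ) :
    HasSum (fun x : Σ k, Fin k → ι => (x.1.factorial : ℂ)⁻¹ * ∏ j, (h (x.2 j) * v (x.2 j)))
      (Complex.exp (∑ e, h e * v e)) := by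
  have hfib : ∀ (g : ι → ℝ) k, HasSum (fun i : Fin k → ι => (k.factorial : ℝ)⁻¹ * ∏ j, g (i j))
      ((∑ e, g e) ^ k / k.factorial) := fun g k => by
    have := hasSum_fintype (fun i : Fin k → ι => (k.factorial : ℝ)⁻¹ * ∏ j, g (i j))
    rwa [← Finset.mul_sum, ← Fintype.sum_pow, inv_mul_eq_div] at this
  refine HasSum.sigma_of_hasSum (g := fun k => (∑ e, h e * v e) ^ k / k.factorial) ?_
    (fun k => ?_) ?_
  · rw [Complex.exp_eq_exp_ℂ]
    exact NormedSpace.expSeries_div_hasSum_exp _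
  · have := hasSum_fintype (fun i : Fin k → ι => (k.factorial : ℂ)⁻¹ * ∏ j, (h (i j) * v (i j)))
    rwa [← Finset.mul_sum, ← Fintype.sum_pow (fun e => h e * v e), inv_mul_eq_div] at this
  · refine Summable.of_norm ?_
    have e : (fun x : Σ k, Fin k → ι => ‖(x.1.factorial : ℂ)⁻¹ * ∏ j, (h (x.2 j) * v (x.2 j))‖) =
        fun x => (x.1.factorial : ℝ)⁻¹ * ∏ j, ‖h (x.2 j) * v (x.2 j)‖ := by
      funext x
      rw [norm_mul, norm_inv, Complex.norm_natCast, norm_prod]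
    rw [e]
    refine (summable_sigma_of_nonneg fun x => by positivity).2
      ⟨fun k => (hfib (fun e => ‖h e * v e‖) k).summable, ?_⟩
    exact (Real.summable_pow_div_factorial (∑ e, ‖h e * v e‖)).congr fun k =>
      (hfib (fun e => ‖h e * v e‖) k).tsum_eq.symm

lemma summable_geometric_sigma {ι : Type*} [Fintype ι] {g : ι → ℝ} (hg : ∀ e, 0 ≤ g e) {R : ℝ}
    (hR : 0 ≤ R) (h : R * ∑ e, g e < 1) :
    Summable fun x : Σ k, Fin k → ι => R ^ x.1 * ∏ j, g (x.2 j) := by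
  have hfib : ∀ k, HasSum (fun i : Fin k → ι => R ^ k * ∏ j, g (i j)) ((R * ∑ e, g e) ^ k) :=
    fun k => by
      have := hasSum_fintype (fun i : Fin k → ι => R ^ k * ∏ j, g (i j))
      rwa [← Finset.mul_sum, ← Fintype.sum_pow, ← mul_pow] at this
  refine (summable_sigma_of_nonneg fun x =>
    mul_nonneg (pow_nonneg hR _) (Finset.prod_nonneg fun j _ => hg _)).2
    ⟨fun k => (hfib k).summable, ?_⟩
  exact (summable_geometric_of_lt_one (mul_nonneg hR (Finset.sum_nonneg fun e _ => hg e)) h).congr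
    fun k => (hfib k).tsum_eq.symm

section
variable {ι : Type*} [Fintype ι] {f : (ι → ℂ) → ℂ} {s₀ : ι → ℂ} {a : (Σ k, Fin k → ι) → ℂ} {C R : ℝ}

/-- The homogeneous parts of a power series in several variables. -/
def multiSeries (a : (Σ k, Fin k → ι) → ℂ) : FormalMultilinearSeries ℂ (ι → ℂ) ℂ := fun k =>
  ∑ i : Fin k → ι, a ⟨k, i⟩ • (ContinuousMultilinearMap.mkPiAlgebra ℂ (Fin k) ℂ).compContinuousLinearMap
    fun j => ContinuousLinearMap.proj (i j)

lemma multiSeries_apply (a : (Σ k, Fin k → ι) → ℂ) (k : ℕ) (y : Fin k → ι → ℂ) :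
    multiSeries a k y = ∑ i : Fin k → ι, a ⟨k, i⟩ * ∏ j, y j (i j) := by
  simp [multiSeries]

/-- The words of length k form a multilinear map of norm at most C (R m)^k, with m the number of
variables, so they constitute a convergent formal multilinear series. -/
theorem analyticAt_of_hasSum (hC : 0 ≤ C) (hR : 0 ≤ R) (ha : ∀ x, ‖a x‖ ≤ C * R ^ x.1)
    (hf : ∀ h : ι → ℂ, R * ∑ e, ‖h e‖ < 1 →
      HasSum (fun x : Σ k, Fin k → ι => a x * ∏ j, h (x.2 j)) (f (s₀ + h))) : AnalyticAt ℂ f s₀ := by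
  set m : ℝ := (Fintype.card ι : ℝ) with hm
  have hm0 : 0 ≤ m := Nat.cast_nonneg _
  have hnorm : ∀ k, ‖multiSeries a k‖ ≤ C * (R * m) ^ k := by
    intro k
    refine ContinuousMultilinearMap.opNorm_le_bound (by positivity) fun y => ?_
    rw [multiSeries_apply]
    calc ‖∑ i : Fin k → ι, a ⟨k, i⟩ * ∏ j, y j (i j)‖
        ≤ ∑ _i : Fin k → ι, C * R ^ k * ∏ j, ‖y j‖ := by
          refine (norm_sum_le _ _).trans (Finset.sum_le_sum fun i _ => ?_)
          rw [norm_mul, norm_prod]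
          exact mul_le_mul (ha ⟨k, i⟩) (Finset.prod_le_prod (fun _ _ => norm_nonneg _)
            fun j _ => norm_le_pi_norm (y j) (i j)) (Finset.prod_nonneg fun _ _ => norm_nonneg _)
            (by positivity)
      _ = C * (R * m) ^ k * ∏ j, ‖y j‖ := by
          rw [Finset.sum_const, Finset.card_univ, Fintype.card_fun, Fintype.card_fin, nsmul_eq_mul,
            mul_pow, hm]
          push_cast
          ring
  -- Any radius below 1/(R m) would do; adding 1 covers R m = 0.
  set r : NNReal := ⟨1 / (R * m + 1), by positivity⟩ with hr
  have hr1 : R * m * r < 1 := by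
    change R * m * (1 / (R * m + 1)) < 1
    rw [mul_one_div, div_lt_one (by positivity)]
    linarith
  have hr0 : 0 < r := by
    rw [← NNReal.coe_pos]
    change 0 < 1 / (R * m + 1)
    positivity
  refine HasFPowerSeriesAt.analyticAt (p := multiSeries a) ⟨r, ?_, by exact_mod_cast hr0, fun {y} hy => ?_⟩
  · refine FormalMultilinearSeries.le_radius_of_bound _ C fun k => ?_
    calc ‖multiSeries a k‖ * (r : ℝ) ^ k ≤ C * (R * m) ^ k * (r : ℝ) ^ k :=
          mul_le_mul_of_nonneg_right (hnorm k) (by positivity)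
      _ = C * (R * m * r) ^ k := by rw [mul_assoc, ← mul_pow]
      _ ≤ C * 1 := mul_le_mul_of_nonneg_left (pow_le_one₀ (by positivity) hr1.le) hC
      _ = C := mul_one C
  · have hy' : ‖y‖ < r := by
      rw [Metric.mem_eball, edist_zero_right] at hy
      exact_mod_cast hy
    have h1 : R * ∑ e, ‖y e‖ < 1 := by
      have h2 : ∑ e, ‖y e‖ ≤ m * r := by
        calc ∑ e, ‖y e‖ ≤ ∑ _e : ι, (r : ℝ) :=
              Finset.sum_le_sum fun e _ => (norm_le_pi_norm y e).trans hy'.le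
          _ = m * r := by rw [Finset.sum_const, nsmul_eq_mul, Finset.card_univ]
      calc _ ≤ R * (m * r) := mul_le_mul_of_nonneg_left h2 hR
        _ < 1 := by rwa [← mul_assoc]
    refine (hf y h1).sigma fun k => ?_
    rw [multiSeries_apply]
    exact hasSum_fintype _

end

section
variable {l : List (Chord n)} (hl : Good l)
include hl

lemma continuousOn_val (K : List (Chord n)) (e : Chord n) : ContinuousOn (val l K e) (X l) :=
  continuousOn_finsetProd _ fun _ hd => continuousOn_u hl (contr_subset _ _ hd)

lemma continuousOn_dterm {K : List (Chord n)} (h : Good (K ++ l)) (P : MvPolynomial (Chord n) ℝ)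
    (s : Chord n → ℂ) {k : ℕ} (i : Fin k → Chord n) : ContinuousOn (dterm P l K s i) (X l) := by
  have h1 : ∀ e, ContinuousOn (fun t => (lval l K e t : ℂ)) (X l) := fun e => by
    refine Complex.continuous_ofReal.comp_continuousOn ?_
    unfold lval
    split_ifs
    · exact (continuousOn_val hl K e).log fun t ht => (val_mem ht hl K e).1.ne'
    · exact continuousOn_const
  have h2 : ContinuousOn (fun t => ubar (K ++ l) (forget l K t)) (X l) := by
    refine continuousOn_pi.2 fun d => ?_
    refine ContinuousOn.congr ?_ fun t ht => ubar_forget_apply h ht d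
    split_ifs
    · exact continuousOn_const
    · exact continuousOn_val hl K d
    · exact continuousOn_const
  refine (ContinuousOn.mul ?_ (continuousOn_finsetProd _ fun j _ => h1 _)).mul
    (Complex.continuous_ofReal.comp_continuousOn ?_)
  · exact Complex.continuous_exp.comp_continuousOn
      (continuousOn_finsetSum _ fun e _ => continuousOn_const.mul (h1 e))
  · exact (((MvPolynomial.continuous_eval P).comp_continuousOn h2).mul
      (continuousOn_finsetProd _ fun c _ => continuousOn_const.sub (continuousOn_val hl K c))).mul
      (continuousOn_dens hl)

lemma continuousOn_dren (P : MvPolynomial (Chord n) ℝ) (s : Chord n → ℂ) {k : ℕ}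
    (i : Fin k → Chord n) : ContinuousOn (dren P l s i) (X l) :=
  continuousOn_finsetSum _ fun _ hK =>
    continuousOn_const.mul (continuousOn_dterm hl (good_toList hl hK) P s i)

omit hl in
-- The parameters enter only through one exponential, so Taylor expansion at s₀ inserts products of
-- logarithms, the factors of `dterm`.
lemma hasSum_dterm (K : List (Chord n)) (P : MvPolynomial (Chord n) ℝ)
    (s₀ y : Chord n → ℂ) (t : Space l) :
    HasSum (fun x : Σ k, Fin k → Chord n =>
      (x.1.factorial : ℂ)⁻¹ * dterm P l K s₀ x.2 t * ∏ j, y (x.2 j)) (term P l K (s₀ + y) t) := by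
  have h1 := (hasSum_exp_sum y fun e => (lval l K e t : ℂ)).mul_left
    (Complex.exp (∑ e, s₀ e * (lval l K e t : ℂ)) * (coef P l K t : ℂ))
  rw [mul_right_comm, ← Complex.exp_add, ← Finset.sum_add_distrib] at h1
  rw [← dterm_zero P (s₀ + y) Fin.elim0 t, dterm]
  simp only [← add_mul, Pi.add_apply, Finset.univ_eq_empty, Finset.prod_empty, mul_one] at h1 ⊢
  refine h1.congr_fun fun x => ?_
  rw [dterm, Finset.prod_mul_distrib]
  ring

/-- The renormalised integrals are given by power series. -/
theorem exists_hasSum_ren (P : MvPolynomial (Chord n) ℝ) {s₀ : Chord n → ℂ}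
    (hs : ∀ e, -strip n ≤ (s₀ e).re) :
    ∃ (a : (Σ k, Fin k → Chord n) → ℂ) (C R : ℝ), 0 ≤ C ∧ 0 ≤ R ∧ (∀ x, ‖a x‖ ≤ C * R ^ x.1) ∧
      ∀ y : Chord n → ℂ, R * ∑ e, ‖y e‖ < 1 →
        HasSum (fun x : Σ k, Fin k → Chord n => a x * ∏ j, y (x.2 j))
          (∫ t in X l, ∑ K ∈ (chi l).powerset.filter fun K => NonCrossing K,
            (-1 : ℂ) ^ K.card * term P l K.toList (s₀ + y) t) := by
  obtain ⟨C, R, δ, hC, hR, hδ, hb⟩ := exists_dren_le hl hs P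
  set M := ∫ t in X l, uprod l t ^ δ * dens l t with hM
  have hint := integrableOn_uprod hl hδ
  have hM0 : 0 ≤ M := setIntegral_nonneg (measurableSet_X l) fun t ht =>
    mul_nonneg (Real.rpow_nonneg (uprod_pos hl ht).le _) (dens_pos hl ht).le
  set F : (Σ k, Fin k → Chord n) → Space l → ℂ := fun x t => (x.1.factorial : ℂ)⁻¹ * dren P l s₀ x.2 t
    with hF
  have hFint : ∀ x, IntegrableOn (F x) (X l) := fun x => by
    refine Integrable.mono' (hint.const_mul (C * R ^ x.1)) ((continuousOn_const.mul
      (continuousOn_dren hl P s₀ x.2)).aestronglyMeasurable (measurableSet_X l)) ?_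
    exact (ae_restrict_mem (measurableSet_X l)).mono fun t ht => hb x.1 x.2 t ht
  have hFnorm : ∀ x, ∫ t in X l, ‖F x t‖ ≤ C * M * R ^ x.1 := fun x => by
    calc ∫ t in X l, ‖F x t‖ ≤ ∫ t in X l, C * R ^ x.1 * (uprod l t ^ δ * dens l t) :=
          setIntegral_mono_on (hFint x).norm (hint.const_mul _) (measurableSet_X l)
            fun t ht => hb x.1 x.2 t ht
      _ = C * R ^ x.1 * M := integral_const_mul _ _
      _ = _ := by ring
  refine ⟨fun x => ∫ t in X l, F x t, C * M, R, mul_nonneg hC hM0, hR,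
    fun x => (norm_integral_le_integral_norm _).trans (hFnorm x), fun y hy => ?_⟩
  have hsum : ∀ t, ∑' x, F x t * ∏ j, y (x.2 j) = ∑ K ∈ (chi l).powerset.filter fun K => NonCrossing K,
      (-1 : ℂ) ^ K.card * term P l K.toList (s₀ + y) t := fun t => by
    have := hasSum_sum (s := (chi l).powerset.filter fun K => NonCrossing K) fun K _ =>
      (hasSum_dterm K.toList P s₀ y t).mul_left ((-1 : ℂ) ^ K.card)
    refine (this.congr_fun fun x => ?_).tsum_eq
    simp only [hF, dren, Finset.mul_sum, Finset.sum_mul]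
    exact Finset.sum_congr rfl fun K _ => by ring
  -- Sum and integral are interchanged only after the sum over K has been formed: single terms need
  -- not be integrable on the strip, and the bounds of `exists_dren_le` hold for their alternating
  -- sum.
  have h1 := hasSum_integral_of_summable_integral_norm (μ := volume.restrict (X l))
    (F := fun (x : Σ k, Fin k → Chord n) t => F x t * ∏ j, y (x.2 j))
    (fun x => (hFint x).mul_const _) ?_
  · simp only [hsum, integral_mul_const] at h1
    exact h1
  · refine Summable.of_nonneg_of_le (fun x => integral_nonneg fun _ => norm_nonneg _) (fun x => ?_)
      ((summable_geometric_sigma (g := fun e => ‖y e‖) (fun e => norm_nonneg _) hR hy).mul_left (C * M))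
    simp only [norm_mul, integral_mul_const, norm_prod]
    rw [← mul_assoc]
    exact mul_le_mul_of_nonneg_right (hFnorm x) (Finset.prod_nonneg fun _ _ => norm_nonneg _)

lemma integrableOn_ren (P : MvPolynomial (Chord n) ℝ) {s : Chord n → ℂ}
    (hs : ∀ e, -strip n ≤ (s e).re) :
    IntegrableOn (fun t => ∑ K ∈ (chi l).powerset.filter fun K => NonCrossing K,
      (-1 : ℂ) ^ K.card * term P l K.toList s t) (X l) := by
  obtain ⟨C, R, δ, hC, hR, hδ, hb⟩ := exists_dren_le hl hs P
  have h1 : ∀ t, dren P l s Fin.elim0 t = ∑ K ∈ (chi l).powerset.filter fun K => NonCrossing K,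
      (-1 : ℂ) ^ K.card * term P l K.toList s t := fun t =>
    Finset.sum_congr rfl fun K _ => by rw [dterm_zero]
  simp only [← h1]
  refine Integrable.mono' ((integrableOn_uprod hl hδ).const_mul C)
    ((continuousOn_dren hl P s _).aestronglyMeasurable (measurableSet_X l)) ?_
  refine (ae_restrict_mem (measurableSet_X l)).mono fun t ht => ?_
  simpa using hb 0 Fin.elim0 t ht

end

/-! ### The renormalised integrals and the open string amplitude -/

section
variable {ω : Form ([] : List (Chord n))} {A : Finset (Chord n)} {P : MvPolynomial (Chord n) ℝ}
  (hω : HasNumer ω A P)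
include hω

lemma renIntegral_eq {J : Finset (Chord n)} (hJ : NonCrossing J) (s : Chord n → ℂ) :
    renIntegral ω J s = ∫ t in X J.toList, ∑ K ∈ (chi J.toList).powerset.filter fun K => NonCrossing K,
      (-1 : ℂ) ^ K.card * term (numer A P) J.toList K.toList s t :=
  setIntegral_congr_fun (measurableSet_X _) fun _ ht => realise_ren hω (good_of_nonCrossing hJ) s ht

lemma integrableOn_renIntegrand {J : Finset (Chord n)} (hJ : NonCrossing J) {s : Chord n → ℂ}
    (hs : ∀ e, -strip n ≤ (s e).re) : IntegrableOn (renIntegrand ω J s) (X J.toList) :=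
  (integrableOn_ren (good_of_nonCrossing hJ) (numer A P) hs).congr_fun
    (fun _ ht => (realise_ren hω (good_of_nonCrossing hJ) s ht).symm) (measurableSet_X _)

theorem exists_hasSum_renIntegral {J : Finset (Chord n)} (hJ : NonCrossing J) {s₀ : Chord n → ℂ}
    (hs : ∀ e, -strip n ≤ (s₀ e).re) :
    ∃ (a : (Σ k, Fin k → Chord n) → ℂ) (C R : ℝ), 0 ≤ C ∧ 0 ≤ R ∧ (∀ x, ‖a x‖ ≤ C * R ^ x.1) ∧
      ∀ y : Chord n → ℂ, R * ∑ e, ‖y e‖ < 1 →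
        HasSum (fun x : Σ k, Fin k → Chord n => a x * ∏ j, y (x.2 j)) (renIntegral ω J (s₀ + y)) := by
  simp only [renIntegral_eq hω hJ]
  exact exists_hasSum_ren (good_of_nonCrossing hJ) (numer A P) hs

lemma analyticAt_renIntegral {J : Finset (Chord n)} (hJ : NonCrossing J) {s₀ : Chord n → ℂ}
    (hs : ∀ e, -strip n ≤ (s₀ e).re) : AnalyticAt ℂ (renIntegral ω J) s₀ := by
  obtain ⟨a, C, R, hC, hR, ha, h⟩ := exists_hasSum_renIntegral hω hJ hs
  exact analyticAt_of_hasSum hC hR ha h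

/-- On X_J only the coordinates of chords in χ_J occur, so the integral does not depend on s_c for c
in J. -/
lemma renIntegral_update {J : Finset (Chord n)} (hJ : NonCrossing J) {c : Chord n} (hc : c ∈ J)
    (s : Chord n → ℂ) (z : ℂ) : renIntegral ω J (Function.update s c z) = renIntegral ω J s := by
  rw [renIntegral_eq hω hJ, renIntegral_eq hω hJ]
  refine integral_congr_ae (ae_of_all _ fun t => Finset.sum_congr rfl fun K hK => ?_)
  have h1 : expo J.toList K.toList (Function.update s c z) t = expo J.toList K.toList s t := by
    refine Finset.sum_congr rfl fun e he => ?_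
    have h1 := (chords_mem (good_toList (good_of_nonCrossing hJ) hK) he).1
    rw [Function.update_of_ne]
    rintro rfl
    exact (mem_chi_toList.1 h1).1 hc
  rw [term, term, h1]

/-- The amplitude is the integral over the open stratum, so this is `integral_strat_eq_sum` for B =
∅. -/
lemma openAmplitude_eq {s : Chord n → ℂ} (hs : s ∈ Region A []) :
    IntegrableOn (openIntegrand ω s) (X []) ∧
    openAmplitude ω s = ∑ J ∈ dissections n, (1 / ∏ c ∈ J, s c) * renIntegral ω J s := by
  have h0 : Set.EqOn (openIntegrand ω s) _ (X []) := fun t ht => openIntegrand_eq hω s ht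
  constructor
  · refine (integrableOn_strat good_nil A P (s := s) fun d hd => ?_).congr_fun h0.symm
      (measurableSet_X _)
    split_ifs with h
    · linarith [(hs d hd).1]
    · linarith [(hs d hd).2 h]
  · have h1 := integral_strat_eq_sum hω (B := ∅) (fun c hc => by simp at hc) (s := s) (by simpa using hs)
    rw [Finset.toList_empty] at h1
    rw [openAmplitude, setIntegral_congr_fun (measurableSet_X _) h0, h1]
    simp

/-- The residue of the open string amplitude along `s_c = 0`. -/
theorem exists_amplitude_residue {c : Chord n} {s : Chord n → ℂ}
    (hs : ∀ d, d ≠ c → -strip n < (s d).re ∧ (d ∉ A → 0 < (s d).re)) :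
    IntegrableOn (stratumIntegrand ω c s) (X [c]) ∧
    ∃ G : ℂ → ℂ, AnalyticAt ℂ G 0 ∧ ∀ᶠ z in 𝓝[{z : ℂ | 0 < z.re}] 0,
      openAmplitude ω (Function.update s c z) = (∫ t in X [c], stratumIntegrand ω c s t) / z + G z := by
  have hstrip : strip n ≤ 1 := by
    rw [strip]
    refine div_le_one_of_le₀ ?_ (by positivity)
    nlinarith [one_le_numChords (n := n)]
  have hnc : NonCrossing ({c} : Finset (Chord n)) := by
    intro a ha b hb
    rw [Finset.mem_singleton] at ha hb
    rw [ha, hb]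
    exact fun h => by rcases h with h | h <;> exact lt_irrefl _ h.1
  have hG : Good [c] := by simpa using good_of_nonCrossing hnc
  have hR : s ∈ Region A [c] := fun d hd => by
    have h1 : d ≠ c := by
      rintro rfl
      simp [mem_chi] at hd
    exact ⟨by linarith [(hs d h1).1], (hs d h1).2⟩
  have h0 : Set.EqOn (stratumIntegrand ω c s) _ (X [c]) := fun t ht => realise_OmegaJ hω hG s ht
  have hint := integrableOn_strat hG A P (s := s) fun d hd => by
    split_ifs with h
    · linarith [(hR d hd).1]
    · linarith [(hR d hd).2 h]
  -- G collects the J which do not contain c; in these, the only dependence on z is inside the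
  -- renormalised integrals.
  refine ⟨hint.congr_fun h0.symm (measurableSet_X _), fun z => ∑ J ∈ (dissections n).filter (c ∉ ·),
    (1 / ∏ d ∈ J, s d) * renIntegral ω J (Function.update s c z), ?_, ?_⟩
  · refine Finset.analyticAt_fun_sum _ fun J hJ => analyticAt_const.mul ?_
    rw [Finset.mem_filter, mem_dissections] at hJ
    have h1 : AnalyticAt ℂ (fun z => Function.update s c z) 0 := by
      refine Differentiable.analyticAt (differentiable_pi.2 fun d => ?_) 0
      by_cases h : d = c
      · subst h; simp [differentiable_fun_id]
      · simp [Function.update_of_ne h]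
    refine (analyticAt_renIntegral hω hJ.1 fun e => ?_).comp h1
    by_cases h : e = c
    · subst h; simp [strip_pos.le]
    · rw [Function.update_of_ne h]; exact (hs e h).1.le
  · refine eventually_mem_nhdsWithin.mono fun z hz => ?_
    have hz : 0 < z.re := hz
    have hreg : Function.update s c z ∈ Region A [] := fun d _ => by
      by_cases h : d = c
      · subst h; simp [hz]; linarith
      · rw [Function.update_of_ne h]
        exact ⟨by linarith [(hs d h).1], (hs d h).2⟩
    have h2 := integral_strat_eq_sum hω hnc (s := s) (by simpa using hR)
    rw [Finset.toList_singleton] at h2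
    -- The J containing c have the common factor 1/z, and their integrals do not involve z; their
    -- sum is the integral over the divisor, by `integral_strat_eq_sum` for B = {c}.
    rw [(openAmplitude_eq hω hreg).2, setIntegral_congr_fun (measurableSet_X _) h0, h2,
      ← Finset.sum_filter_add_sum_filter_not (dissections n) ({c} ⊆ ·), Finset.sum_div]
    simp only [Finset.singleton_subset_iff]
    congr 1 <;> refine Finset.sum_congr rfl fun J hJ => ?_ <;> rw [Finset.mem_filter, mem_dissections] at hJ
    · rw [renIntegral_update hω hJ.1 hJ.2, ← Finset.mul_prod_erase _ _ hJ.2, Function.update_self,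
        Finset.sdiff_singleton_eq_erase, Finset.prod_congr rfl fun d hd =>
          Function.update_of_ne (Finset.ne_of_mem_erase hd) z s, one_div, mul_inv, one_div]
      ring
    · rw [Finset.prod_congr rfl fun d hd => Function.update_of_ne
        (fun h => hJ.2 (h ▸ hd) : d ≠ c) z s]

end

/-! ### Laurent series in several variables -/

/-- Convergence at one positive x gives an analytic function on a disc, which vanishes at real
points accumulating at 0. -/
lemma coeff_eq_zero_of_hasSum {b : ℕ → ℂ} {r : ℝ} (hr : 0 < r)
    (h : ∀ x : ℝ, 0 < x → x < r → HasSum (fun k => (x : ℂ) ^ k * b k) 0) : b = 0 := by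
  have hx : ‖((r / 2 : ℝ) : ℂ)‖ = r / 2 := by
    rw [Complex.norm_real, Real.norm_of_nonneg (by positivity)]
  have hs := (h (r / 2) (by positivity) (by linarith)).summable.norm
  have hp : ∀ᶠ z : ℂ in 𝓝 0, HasSum
      (fun k => z ^ k • (FormalMultilinearSeries.ofScalars ℂ b).coeff k) ((∑' k, z ^ k * b k)) := by
    filter_upwards [Metric.ball_mem_nhds (0 : ℂ) (show 0 < r / 2 by positivity)] with z hz
    simp only [FormalMultilinearSeries.coeff_ofScalars, smul_eq_mul]
    refine (Summable.of_norm_bounded hs fun k => ?_).hasSum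
    rw [norm_mul, norm_mul, norm_pow, norm_pow, hx]
    have hz' : ‖z‖ ≤ r / 2 := (by simpa using hz : ‖z‖ < r / 2).le
    gcongr
  have hF : HasFPowerSeriesAt (fun z : ℂ => ∑' k, z ^ k * b k)
      (FormalMultilinearSeries.ofScalars ℂ b) 0 := hasFPowerSeriesAt_iff.2 (by simpa using hp)
  have hfr : ∃ᶠ z : ℂ in 𝓝[≠] 0, ∑' k, z ^ k * b k = 0 := by
    have h1 : Tendsto (fun x : ℝ => (x : ℂ)) (𝓝[>] 0) (𝓝[≠] 0) := by
      refine tendsto_nhdsWithin_iff.2 ⟨(Complex.continuous_ofReal.tendsto' 0 0 (by simp)).mono_left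
        nhdsWithin_le_nhds, eventually_mem_nhdsWithin.mono fun x hx => ?_⟩
      simpa using (Set.mem_Ioi.1 hx).ne'
    refine h1.frequently (Eventually.frequently ?_)
    filter_upwards [Ioo_mem_nhdsGT hr] with x hx
    exact (h x hx.1 hx.2).tsum_eq
  have h0 := hF.analyticAt.frequently_zero_iff_eventually_zero.1 hfr
  have h1 := (hF.congr h0).eq_zero
  funext k
  have h2 := FormalMultilinearSeries.coeff_ofScalars (𝕜 := ℂ) (p := b) (n := k)
  rw [← h2, h1]
  rfl

/-- Summing first over the remaining indices leaves a power series in x, whose coefficients must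
vanish. This peels off one variable at a time. -/
lemma coeff_eq_zero_of_hasSum_prod {β : Type*} {b : ℕ → β → ℂ} {r : ℝ} (hr : 0 < r)
    (h : ∀ x : ℝ, 0 < x → x < r → HasSum (fun p : ℕ × β => (x : ℂ) ^ p.1 * b p.1 p.2) 0) (k : ℕ) :
    HasSum (b k) 0 := by
  have h2 : ∀ k, Summable (b k) := fun k => by
    have h3 : Summable fun i => ((r / 2 : ℝ) : ℂ) ^ k * b k i :=
      (h (r / 2) (by positivity) (by linarith)).summable.prod_factor k
    have h4 : ((r / 2 : ℝ) : ℂ) ≠ 0 := Complex.ofReal_ne_zero.2 (by positivity)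
    exact (summable_mul_left_iff (pow_ne_zero k h4)).1 h3
  have h3 := coeff_eq_zero_of_hasSum hr (b := fun k => ∑' i, b k i) fun x h0 hx =>
    (h x h0 hx).prod_fiberwise fun k => (h2 k).hasSum.mul_left ((x : ℂ) ^ k)
  have h4 := (h2 k).hasSum
  rwa [show ∑' i, b k i = 0 from congrFun h3 k] at h4

lemma coeff_eq_zero_of_hasSum_fin {r : ℝ} (hr : 0 < r) (m : ℕ) : ∀ b : (Fin m → ℕ) → ℂ,
    (∀ x : Fin m → ℝ, (∀ i, 0 < x i ∧ x i < r) → HasSum (fun α => (∏ i, (x i : ℂ) ^ α i) * b α) 0) →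
      ∀ α, b α = 0 := by
  induction m with
  | zero =>
    intro b h α
    have h1 := h Fin.elim0 fun i => i.elim0
    have h2 := (hasSum_fintype fun α : Fin 0 → ℕ => (∏ i, ((Fin.elim0 i : ℝ) : ℂ) ^ α i) * b α).unique h1
    simp only [Fintype.sum_unique, Finset.univ_eq_empty, Finset.prod_empty, one_mul] at h2
    exact (congrArg b (Subsingleton.elim _ _)).trans h2
  | succ m ih =>
    intro b h α
    let e : ℕ × (Fin m → ℕ) ≃ (Fin (m + 1) → ℕ) :=
      { toFun := fun p => Fin.cons (α := fun _ => ℕ) p.1 p.2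
        invFun := fun α => (α 0, Fin.tail α)
        left_inv := fun p => by simp
        right_inv := fun α => by simp }
    have he : ∀ p, e p = Fin.cons (α := fun _ => ℕ) p.1 p.2 := fun _ => rfl
    have key := ih (fun β => b (e (α 0, β))) (fun y hy =>
      coeff_eq_zero_of_hasSum_prod (b := fun k β => (∏ i, (y i : ℂ) ^ β i) * b (e (k, β))) hr
        (fun x h0 hx => by
          have h2 := e.hasSum_iff.2 (h (Fin.cons (α := fun _ => ℝ) x y) fun i => by
            refine Fin.cases ⟨h0, hx⟩ (fun i => ?_) i
            simpa using hy i)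
          refine h2.congr_fun fun p => ?_
          simp only [Function.comp, Fin.prod_univ_succ, he, Fin.cons_zero, Fin.cons_succ, mul_assoc])
        (α 0)) (Fin.tail α)
    rwa [show e (α 0, Fin.tail α) = α from e.apply_symm_apply α] at key

section
variable {ι : Type*} [Fintype ι]

/-- Multiplication by the product of all variables turns the series into a power series, with
exponents raised by one. -/
lemma laurent_coeff_eq_zero {D : (ι → ℤ) → ℂ} (hD : ∀ k, D k ≠ 0 → ∀ c, -1 ≤ k c) {r : ℝ}
    (hr : 0 < r) (h : ∀ x : ι → ℝ, (∀ c, 0 < x c ∧ x c < r) →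
      HasSum (fun k : ι → ℤ => D k * ∏ c, (x c : ℂ) ^ k c) 0) : D = 0 := by
  let e := Fintype.equivFin ι
  have key := coeff_eq_zero_of_hasSum_fin hr (Fintype.card ι)
    (fun α => D fun c => (α (e c) : ℤ) - 1) (fun x hx => by
      have hx0 : ∀ c, ((x (e c) : ℝ) : ℂ) ≠ 0 := fun c => by exact_mod_cast (hx (e c)).1.ne'
      have h1 := (h (fun c => x (e c)) fun c => hx (e c)).mul_left (∏ c, ((x (e c) : ℝ) : ℂ))
      rw [mul_zero] at h1
      have hg : Function.Injective fun (α : Fin (Fintype.card ι) → ℕ) (c : ι) => (α (e c) : ℤ) - 1 :=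
        fun α β hαβ => by
          funext i
          have := congrFun hαβ (e.symm i)
          simpa using this
      refine ((hg.hasSum_iff fun k hk => ?_).2 h1).congr_fun fun α => ?_
      · by_cases hk0 : D k = 0
        · simp [hk0]
        · refine absurd ⟨fun i => (k (e.symm i) + 1).toNat, ?_⟩ hk
          funext c
          have := hD k hk0 c
          simp only [Equiv.symm_apply_apply]
          omega
      · simp only [Function.comp]
        rw [mul_left_comm, ← Finset.prod_mul_distrib, mul_comm, ← e.prod_comp]
        congr 1
        refine Finset.prod_congr rfl fun c _ => ?_
        rw [zpow_sub_one₀ (hx0 c), zpow_natCast]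
        field_simp [hx0 c])
  funext k
  by_contra hk
  have h1 := key fun i => (k (e.symm i) + 1).toNat
  refine hk ((congrArg D (funext fun c => ?_)).trans h1)
  have := hD k hk c
  simp only [Equiv.symm_apply_apply]
  omega

variable [DecidableEq ι]

/-- The exponents of the monomial `∏_j s_{x_j} / ∏_{c ∈ J} s_c`. -/
def laurentExp (J : Finset ι) (x : Σ k, Fin k → ι) (c : ι) : ℤ :=
  ((Finset.univ.filter fun j => x.2 j = c).card : ℤ) - if c ∈ J then 1 else 0

/-- The coefficients of the Laurent series `∑_x a_x ∏_j s_{x_j} / ∏_{c ∈ J} s_c`. -/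
def laurent (J : Finset ι) (a : (Σ k, Fin k → ι) → ℂ) (k : ι → ℤ) : ℂ :=
  ∑' x : {x // laurentExp J x = k}, a x

omit [Fintype ι] in
lemma laurent_ne_zero {J : Finset ι} {a : (Σ k, Fin k → ι) → ℂ} {k : ι → ℤ} (h : laurent J a k ≠ 0)
    (c : ι) : -1 ≤ k c ∧ (k c = -1 → c ∈ J) := by
  have h1 : ∃ x, laurentExp J x = k := by
    by_contra h1
    have : IsEmpty {x // laurentExp J x = k} := ⟨fun x => h1 ⟨x.1, x.2⟩⟩
    exact h tsum_empty
  obtain ⟨x, rfl⟩ := h1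
  unfold laurentExp
  split_ifs with hc
  · exact ⟨by omega, fun _ => hc⟩
  · exact ⟨by omega, fun _ => by omega⟩

lemma prod_laurentExp {J : Finset ι} {s : ι → ℂ} (hs : ∀ c ∈ J, s c ≠ 0) (x : Σ k, Fin k → ι) :
    ∏ c, s c ^ laurentExp J x c = (1 / ∏ c ∈ J, s c) * ∏ j, s (x.2 j) := by
  have h1 : ∏ j, s (x.2 j) = ∏ c, s c ^ (Finset.univ.filter fun j => x.2 j = c).card := by
    rw [← Finset.prod_fiberwise Finset.univ x.2 fun j => s (x.2 j)]
    refine Finset.prod_congr rfl fun c _ => ?_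
    rw [Finset.prod_congr rfl fun j hj => congrArg s (Finset.mem_filter.1 hj).2, Finset.prod_const]
  have h2 : ∏ c ∈ J, s c = ∏ c, if c ∈ J then s c else 1 := by simp
  rw [h1, h2, one_div, ← Finset.prod_inv_distrib, ← Finset.prod_mul_distrib]
  refine Finset.prod_congr rfl fun c _ => ?_
  unfold laurentExp
  split_ifs with hc
  · rw [zpow_sub_one₀ (hs c hc), zpow_natCast, mul_comm]
  · rw [sub_zero, zpow_natCast, inv_one, one_mul]

/-- Words with the same exponents after division by ∏_{c ∈ J} s_c are collected; absolute
convergence permits this regrouping. -/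
lemma hasSum_laurent {J : Finset ι} {a : (Σ k, Fin k → ι) → ℂ} {s : ι → ℂ} {z : ℂ}
    (hs : ∀ c ∈ J, s c ≠ 0) (h : HasSum (fun x => a x * ∏ j, s (x.2 j)) z) :
    HasSum (fun k => laurent J a k * ∏ c, s c ^ k c) ((1 / ∏ c ∈ J, s c) * z) := by
  have h1 := (Equiv.sigmaFiberEquiv (laurentExp J)).hasSum_iff.2 (h.mul_left (1 / ∏ c ∈ J, s c))
  refine h1.sigma fun k => ?_
  have h2 : Summable fun x : {x // laurentExp J x = k} =>
    (1 / ∏ c ∈ J, s c) * (a x * ∏ j, s (x.1.2 j)) := h1.summable.sigma_factor k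
  have h3 : ∀ x : {x // laurentExp J x = k}, (1 / ∏ c ∈ J, s c) * (a x * ∏ j, s (x.1.2 j)) =
      a x * ∏ c, s c ^ k c := by
    rintro ⟨x, rfl⟩
    rw [prod_laurentExp hs]
    ring
  change HasSum (fun x : {x // laurentExp J x = k} =>
    (1 / ∏ c ∈ J, s c) * (a x * ∏ j, s (x.1.2 j))) _
  simp only [h3] at h2 ⊢
  rw [laurent, ← tsum_mul_right]
  exact h2.hasSum

end

/-! ### The Laurent expansion of the open string amplitude -/

lemma convRegion_subset (ω : Form ([] : List (Chord n))) (l : List (Chord n)) :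
    convRegion ω ⊆ Region (regular ω) l := fun s hs d _ =>
  ⟨(hs d).1, fun h => (hs d).2 (by simpa [regular] using h)⟩

/-- The conditions on the support of the Laurent expansion of the open string amplitude. -/
def IsLaurentSupport (ω : Form ([] : List (Chord n))) (k : Chord n → ℤ) : Prop :=
  (∀ c, -1 ≤ k c) ∧ (∀ c, k c = -1 → HasPole ω c) ∧ NonCrossing (Finset.univ.filter fun c => k c = -1)

/-- `L` is the family of coefficients of a Laurent expansion of the open string amplitude. -/
def IsLaurent (ω : Form ([] : List (Chord n))) (L : (Chord n → ℤ) → ℂ) : Prop :=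
  (∀ k, L k ≠ 0 → IsLaurentSupport ω k) ∧ ∃ r : ℝ, 0 < r ∧ ∀ s ∈ convRegion ω, (∀ c, ‖s c‖ < r) →
    HasSum (fun k : Chord n → ℤ => L k * ∏ c, s c ^ k c) (openAmplitude ω s)

/-- Small positive real parameters always lie in the region of convergence, and they suffice to
determine the coefficients. -/
lemma IsLaurent.unique {ω : Form ([] : List (Chord n))} {L L' : (Chord n → ℤ) → ℂ}
    (h : IsLaurent ω L) (h' : IsLaurent ω L') : L = L' := by
  obtain ⟨hL, r, hr, hLr⟩ := h
  obtain ⟨hL', r', hr', hLr'⟩ := h'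
  refine sub_eq_zero.1 (laurent_coeff_eq_zero (fun k hk => ?_) (lt_min hr hr') fun x hx => ?_)
  · by_cases h0 : L k = 0
    · exact (hL' k fun h0' => hk (by simp [h0, h0'])).1
    · exact (hL k h0).1
  · have hs : (fun c => (x c : ℂ)) ∈ convRegion ω := fun c => by
      simp only [Complex.ofReal_re]
      exact ⟨by linarith [(hx c).1], fun _ => (hx c).1⟩
    have hn : ∀ c, ‖(x c : ℂ)‖ = x c := fun c => by
      rw [Complex.norm_real, Real.norm_of_nonneg (hx c).1.le]
    have h2 := (hLr _ hs fun c => (hn c).trans_lt ((hx c).2.trans_le (min_le_left _ _))).sub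
      (hLr' _ hs fun c => (hn c).trans_lt ((hx c).2.trans_le (min_le_right _ _)))
    rw [sub_self] at h2
    exact h2.congr_fun fun k => by rw [Pi.sub_apply, sub_mul]

theorem exists_isLaurent {ω : Form ([] : List (Chord n))} {P : MvPolynomial (Chord n) ℝ}
    (hω : HasNumer ω (regular ω) P) : ∃ L, IsLaurent ω L := by
  have hpole : ∀ c, c ∉ regular ω ↔ HasPole ω c := fun c => by simp [regular]
  have h1 : ∀ J : Finset (Chord n), ∃ (a : (Σ k, Fin k → Chord n) → ℂ) (R : ℝ), 0 ≤ R ∧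
      (NonCrossing J → ∀ y : Chord n → ℂ, R * ∑ e, ‖y e‖ < 1 →
        HasSum (fun x : Σ k, Fin k → Chord n => a x * ∏ j, y (x.2 j)) (renIntegral ω J y)) := by
    intro J
    by_cases hJ : NonCrossing J
    · obtain ⟨a, C, R, -, hR, -, h⟩ := exists_hasSum_renIntegral hω hJ (s₀ := 0) fun e => by
        simp [strip_pos.le]
      exact ⟨a, R, hR, fun _ y hy => by simpa using h y hy⟩
    · exact ⟨0, 0, le_rfl, fun h => absurd h hJ⟩
  choose a R hR ha using h1
  -- Only J all of whose chords are poles are kept. This gives the support condition, and the s_c in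
  -- the denominators are nonzero on the region of convergence; the omitted terms vanish.
  obtain ⟨S, hS⟩ : ∃ S, S = (dissections n).filter fun J => ∀ c ∈ J, c ∉ regular ω := ⟨_, rfl⟩
  have hSJ : ∀ {J}, J ∈ S → NonCrossing J ∧ ∀ c ∈ J, HasPole ω c := fun hJ => by
    rw [hS, Finset.mem_filter, mem_dissections] at hJ
    exact ⟨hJ.1, fun c hc => (hpole c).1 (hJ.2 c hc)⟩
  obtain ⟨M, hM0, hM⟩ : ∃ M, 0 ≤ M ∧ ∀ J ∈ S, R J ≤ M :=
    ⟨∑ J ∈ S, R J, Finset.sum_nonneg fun J _ => hR J,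
      fun J hJ => Finset.single_le_sum (fun J _ => hR J) hJ⟩
  -- For this radius, R_J ∑ |s_e| ≤ M N / (M N + 1) < 1 for all J in S, with N = `numChords n`.
  refine ⟨fun k => ∑ J ∈ S, laurent J (a J) k, fun k hk => ?_, 1 / (M * numChords n + 1),
    by positivity, fun s hs hr => ?_⟩
  · obtain ⟨J, hJ, hk⟩ := Finset.exists_ne_zero_of_sum_ne_zero hk
    have h2 := laurent_ne_zero hk
    refine ⟨fun c => (h2 c).1, fun c hc => (hSJ hJ).2 c ((h2 c).2 hc), fun c hc d hd => ?_⟩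
    exact (hSJ hJ).1 c ((h2 c).2 (Finset.mem_filter.1 hc).2) d ((h2 d).2 (Finset.mem_filter.1 hd).2)
  · have hsum : ∑ e, ‖s e‖ ≤ numChords n * (1 / (M * numChords n + 1)) := by
      calc ∑ e, ‖s e‖ ≤ ∑ _e : Chord n, 1 / (M * numChords n + 1) :=
            Finset.sum_le_sum fun e _ => (hr e).le
        _ = (Finset.univ : Finset (Chord n)).card * (1 / (M * numChords n + 1)) := by
            rw [Finset.sum_const, nsmul_eq_mul]
        _ ≤ _ := mul_le_mul_of_nonneg_right (card_le_numChords _) (by positivity)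
    have hlt : ∀ J ∈ S, R J * ∑ e, ‖s e‖ < 1 := fun J hJ => by
      calc R J * ∑ e, ‖s e‖ ≤ M * (numChords n * (1 / (M * numChords n + 1))) :=
            mul_le_mul (hM J hJ) hsum
              (Finset.sum_nonneg fun _ _ => norm_nonneg _) hM0
        _ = M * numChords n / (M * numChords n + 1) := by ring
        _ < 1 := by rw [div_lt_one (by positivity)]; linarith
    have hs0 : ∀ J ∈ S, ∀ c ∈ J, s c ≠ 0 := fun J hJ c hc h0 => by
      have := (hs c).2 ((hSJ hJ).2 c hc)
      rw [h0] at this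
      exact lt_irrefl _ this
    have h3 := hasSum_sum fun J hJ => hasSum_laurent (hs0 J hJ) (ha J (hSJ hJ).1 s (hlt J hJ))
    have h4 : openAmplitude ω s = ∑ J ∈ S, (1 / ∏ c ∈ J, s c) * renIntegral ω J s := by
      rw [(openAmplitude_eq hω (convRegion_subset ω _ hs)).2, hS]
      refine (Finset.sum_filter_of_ne fun J hJ h c hc hcA => h ?_).symm
      rw [renIntegral_eq_zero hω (mem_dissections.1 hJ) hc hcA, mul_zero]
    rw [h4]
    simp only [Finset.sum_mul]
    exact h3

end OpenString

end

/-! ### The theorem -/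

open OpenString

theorem mainTheorem5 (n : ℕ)
    (ω : Form ([] : List (Chord n))) (hω : ω ∈ logForms n) :
    (∀ s ∈ convRegion ω,
      IntegrableOn (openIntegrand ω s) (X []) ∧
      (∀ J ∈ dissections n, IntegrableOn (renIntegrand ω J s) (X J.toList)) ∧
      openAmplitude ω s = ∑ J ∈ dissections n, (1 / ∏ c ∈ J, s c) * renIntegral ω J s) ∧
    (∀ J ∈ dissections n, (∃ c ∈ J, ¬ HasPole ω c) → ∀ s, renIntegral ω J s = 0) ∧
    (∃ ε : ℝ, 0 < ε ∧
      (∀ J ∈ dissections n,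
        (∀ s : Chord n → ℂ, (∀ c, -ε < (s c).re) →
          IntegrableOn (renIntegrand ω J s) (X J.toList)) ∧
        AnalyticOnNhd ℂ (renIntegral ω J) {s | ∀ c, -ε < (s c).re}) ∧
      (∀ (c : Chord n) (s : Chord n → ℂ),
        (∀ d, d ≠ c → -ε < (s d).re ∧ (HasPole ω d → 0 < (s d).re)) →
        IntegrableOn (stratumIntegrand ω c s) (X [c]) ∧
        ∃ G : ℂ → ℂ, AnalyticAt ℂ G 0 ∧
          ∀ᶠ z in 𝓝[{z : ℂ | 0 < z.re}] 0,
            openAmplitude ω (Function.update s c z) =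
              (∫ t in X [c], stratumIntegrand ω c s t) / z + G z)) ∧
    (∃! L : (Chord n → ℤ) → ℂ,
      (∀ k, L k ≠ 0 → (∀ c, -1 ≤ k c) ∧ (∀ c, k c = -1 → HasPole ω c) ∧
        NonCrossing (Finset.univ.filter fun c => k c = -1)) ∧
      ∃ r : ℝ, 0 < r ∧ ∀ s ∈ convRegion ω, (∀ c, ‖s c‖ < r) →
        HasSum (fun k : Chord n → ℤ => L k * ∏ c, s c ^ k c) (openAmplitude ω s)) := by
  obtain ⟨P, hP⟩ := exists_numerator hω
  have hN : HasNumer ω (regular ω) P := hP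
  have hreg : ∀ c, c ∈ regular ω ↔ ¬ HasPole ω c := fun c => by simp [regular]
  obtain ⟨L, hL⟩ := exists_isLaurent hN
  refine ⟨fun s hs => ⟨(openAmplitude_eq hN (convRegion_subset ω _ hs)).1, fun J hJ =>
      (integral_ren hN (mem_dissections.1 hJ) (convRegion_subset ω _ hs)).1,
      (openAmplitude_eq hN (convRegion_subset ω _ hs)).2⟩,
    fun J hJ ⟨c, hc, hp⟩ s => renIntegral_eq_zero hN (mem_dissections.1 hJ) hc ((hreg c).2 hp) s,
    ⟨strip n, strip_pos, fun J hJ =>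
      ⟨fun s hs => integrableOn_renIntegrand hN (mem_dissections.1 hJ) fun c => (hs c).le,
        fun s hs => analyticAt_renIntegral hN (mem_dissections.1 hJ) fun c => (hs c).le⟩,
      fun c s hs => exists_amplitude_residue hN fun d hd => ⟨(hs d hd).1, fun h =>
        (hs d hd).2 (not_not.1 fun hp => h ((hreg d).2 hp))⟩⟩,
    ⟨L, hL, fun L' hL' => IsLaurent.unique hL' hL⟩⟩
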